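/- **Setting.** Let $\nu,\Omega\in\mathbb{R}$ and let $I\subset\mathbb{R}$ be a non-empty open interval. Let "$\cdot$" denote the bilinear dot product on $\mathbb{C}^3$ and $\mathbf{e}^3=(0,0,1)$. Let $\mathcal{H}$ be the set of vector fields $\mathbf{v}(\mathbf{x})=\sum_{\mathbf{n}\in S}\mathbf{v}_{\mathbf{n}}e^{i\mathbf{n}\cdot\mathbf{x}}$ on $\mathbb{R}^3$, where $S\subset\mathbb{R}^3\setminus\{\mathbf{0}\}$ is finite with $-S=S$, $\mathbf{v}_{\mathbf{n}}\in\mathbb{C}^3\setminus\{\mathbf{0}\}$, $\mathbf{v}_{-\mathbf{n}}=\overline{\mathbf{v}_{\mathbf{n}}}$ and $\mathbf{n}\cdot\mathbf{v}_{\mathbf{n}}=0$; $S$ is called the Fourier support of $\mathbf{v}$. Let $\mathcal{H}_I$ be the set of $\mathbf{u}(t,\mathbf{x})=\sum_{\mathbf{n}\in S}\mathbf{u}_{\mathbf{n}}(t)e^{i\mathbf{n}\cdot\mathbf{x}}$ on $I\times\mathbb{R}^3$, where $S\subset\mathbb{R}^3\setminus\{\mathbf{0}\}$ is finite with $-S=S$,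 $\mathbf{u}_{\mathbf{n}}:I\to\mathbb{C}^3$ is not identically zero, $\mathbf{u}_{-\mathbf{n}}=\overline{\mathbf{u}_{\mathbf{n}}}$ and $\mathbf{n}\cdot\mathbf{u}_{\mathbf{n}}=0$ on $I$; put $\mathbf{u}_{\mathbf{n}}=\mathbf{0}$ for $\mathbf{n}\notin S$. For $\mathbf{n}=(n^1,n^2,n^3)\neq\mathbf{0}$ let $\hat{\mathbb{P}}_{\mathbf{n}}$ be the orthogonal projection of $\mathbb{C}^3$ onto $\{\mathbf{v}:\mathbf{n}\cdot\mathbf{v}=0\}$ and let $J_{\mathbf{n}}$ be the matrix $J_{\mathbf{n}}\mathbf{v}=\frac{n^3}{|\mathbf{n}|^2}\,\mathbf{n}\times\mathbf{v}$. We say that $\mathbf{u}\in\mathcal{H}_I$ solves the projected Navier–Stokes–Coriolis system on $I$ if its coefficients are differentiable and $$\partial_t\mathbf{u}_{\mathbf{n}}+\nu|\mathbf{n}|^2\mathbf{u}_{\mathbf{n}}+\Omega J_{\mathbf{n}}\mathbf{u}_{\mathbf{n}}+\frac{i}{2}\hat{\mathbb{P}}_{\mathbf{n}}\sum_{\substack{\mathbf{n}_1,\mathbf{n}_2\in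 S\\ \mathbf{n}_1+\mathbf{n}_2=\mathbf{n}}}\big[(\mathbf{u}_{\mathbf{n}_1}\cdot\mathbf{n}_2)\mathbf{u}_{\mathbf{n}_2}+(\mathbf{u}_{\mathbf{n}_2}\cdot\mathbf{n}_1)\mathbf{u}_{\mathbf{n}_1}\big]=\mathbf{0},\qquad \mathbf{n}\cdot\mathbf{u}_{\mathbf{n}}=0,$$ for all $t\in I$ and all $\mathbf{n}\in S\cup\big[(S+S)\setminus\{\mathbf{0}\}\big]$. Let $P_3=\{\mathbf{n}\in\mathbb{R}^3:\mathbf{n}\cdot\mathbf{e}^3=0\}$. A field $\mathbf{b}\in\mathcal{H}$ is a Beltrami flow if $\nabla\times\mathbf{b}=\mu\mathbf{b}$ for some $\mu\in\mathbb{C}$. **Theorem 5.1.** A field $\mathbf{u}\in\mathcal{H}_I$ solves the projected Navier–Stokes–Coriolis system on $I$ if and only if its modes evolve by the linear equation $\partial_t\mathbf{u}_{\mathbf{n}}+\nu|\mathbf{n}|^2\mathbf{u}_{\mathbf{n}}+\Omega J_{\mathbf{n}}\mathbf{u}_{\mathbf{n}}=\mathbf{0}$ ($\mathbf{n}\in S$,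 $t\in I$) and, for some $t_*\in I$ (or, equivalently, for every $t_*\in I$), one of the following holds, where now $S$ denotes the Fourier support of $\mathbf{u}(t_*)\in\mathcal{H}$: (i) $S$ is a subset of a line through the origin. (ii) $S$ contains two linearly independent points and is a subset of a plane $P$ containing the origin, and (a) or (b) holds: - (a) $\Omega=0$ or $P=P_3$, and $\mathbf{u}(t_*)$ is perpendicular to $P$ everywhere. - (b) $\mathbf{u}(t_*)=\mathbf{u}^\parallel+u^\perp\mathbf{e}^\perp$, where $\mathbf{e}^\perp$ is a unit normal vector to $P$; $\mathbf{u}^\parallel\in\mathcal{H}$ is parallel to $P$ everywhere, and its Fourier support contains at least four points and is a subset of a circle on $P$ centered at the origin with radius $\lambda>0$; and $u^\perp(\mathbf{x})=Q(\omega(\mathbf{x}))-\langle Q(\omega)\rangle$, where $\omega$ is the scalar function defined by $\nabla\times\mathbf{u}^\parallel=\lambda\omega\mathbf{e}^\perp$, $\langle Q(\omega)\rangle$ is the zero mode (mean value) of $Q(\omega(\mathbf{x}))$, and $Q$ is a polynomial with real coefficients which is - arbitrary if ($\Omega=0$ or $P=P_3$) and $\nu=0$; - of the form $Q(\omega)=\kappa\omega$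 with $\kappa\in\mathbb{R}$ if ($\Omega=0$ or $P=P_3$) and $\nu\neq0$; - either $Q(\omega)=\omega$ or $Q(\omega)=-\omega$ if $\Omega\neq0$ and $P\neq P_3$. (iii) $S$ contains three linearly independent points and is a subset of a sphere centered at the origin, and $\mathbf{u}(t_*)$ is a Beltrami flow. -/

import Mathlib

open scoped Matrix

noncomputable section

namespace FiniteMode

/-- Real three-space, with dot product `⬝ᵥ`; the Euclidean length is given by `|n|² = n ⬝ᵥ n`. (The norm
that Lean puts on this type is used only to speak of derivatives.) -/
abbrev R3 := Fin 3 → ℝ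

/-- Complex three-space; `⬝ᵥ` is the bilinear dot product. -/
abbrev C3 := Fin 3 → ℂ

/-- A real vector regarded as a complex vector. -/
def toC (n : R3) : C3 := fun i => (n i : ℂ)

/-- The plane wave `exp (i n · x)`. -/
def wave (n x : R3) : ℂ := Complex.exp (Complex.I * ((n ⬝ᵥ x : ℝ) : ℂ))

/-- The vector field `v` on `ℝ³` is a real-valued, mean-zero, divergence-free field with finitely many
Fourier modes, and `c n` is its coefficient vector at the frequency `n`:
`v x = ∑_{n ∈ c.support} c n exp (i n · x)`. The Fourier support of `v` is `c.support`. -/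
structure IsField (v : R3 → R3) (c : R3 →₀ C3) : Prop where
  meanZero : c 0 = 0
  conj : ∀ n, c (-n) = star (c n)
  divFree : ∀ n, toC n ⬝ᵥ c n = 0
  expansion : ∀ x, toC (v x) = ∑ n ∈ c.support, wave n x • c n

/-- The time dependent vector field `u` on `I × ℝ³` is real-valued, mean-zero and divergence-free with
Fourier support the finite set `S`, and `c t n` is its coefficient vector at time `t` and frequency `n`:
every mode in `S` is not identically zero on `I`, and there are no modes outside `S`. -/
structure IsFieldOn (I : Set ℝ) (u : ℝ → R3 → R3) (S : Finset R3) (c : ℝ → R3 →₀ C3) : Prop where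
  field : ∀ t ∈ I, IsField (u t) (c t)
  support_subset : ∀ t ∈ I, (c t).support ⊆ S
  ne_zero : ∀ n ∈ S, ∃ t ∈ I, c t n ≠ 0

/-- The orthogonal projection of `ℂ³` onto `{v | n · v = 0}` (for real `n ≠ 0`):
`v ↦ v - (n · v / |n|²) n`. -/
def proj (n : R3) (v : C3) : C3 := v - ((toC n ⬝ᵥ v) / ((n ⬝ᵥ n : ℝ) : ℂ)) • toC n

/-- The matrix `J_n = (n³/|n|²) (n × ·)` of the projected Coriolis term. -/
def coriolis (n : R3) : Matrix (Fin 3) (Fin 3) ℂ :=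
  (!![0, -n 2, n 1;
      n 2, 0, -n 0;
      -n 1, n 0, 0].map fun a : ℝ => ((n 2 / (n ⬝ᵥ n) * a : ℝ) : ℂ))

/-- The sum over `n₁, n₂ ∈ S` with `n₁ + n₂ = n` of `(u_{n₁} · n₂) u_{n₂} + (u_{n₂} · n₁) u_{n₁}`. -/
def interaction (S : Finset R3) (a : R3 → C3) (n : R3) : C3 :=
  ∑ p ∈ (S ×ˢ S).filter (fun p => p.1 + p.2 = n),
    ((a p.1 ⬝ᵥ toC p.2) • a p.2 + (a p.2 ⬝ᵥ toC p.1) • a p.1)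

/-- The Fourier coefficients solve the projected Navier-Stokes-Coriolis system on `I`, at all
frequencies `n ∈ S ∪ (S + S) ∖ {0}`. -/
def Solves (ν Ω : ℝ) (I : Set ℝ) (S : Finset R3) (c : ℝ → R3 →₀ C3) : Prop :=
  ∀ n : R3, (n ∈ S ∨ (n ≠ 0 ∧ ∃ n₁ ∈ S, ∃ n₂ ∈ S, n₁ + n₂ = n)) → ∀ t ∈ I,
    toC n ⬝ᵥ c t n = 0 ∧
    DifferentiableAt ℝ (fun s => c s n) t ∧
    deriv (fun s => c s n) t + (ν * (n ⬝ᵥ n)) • c t n + Ω • (coriolis n *ᵥ c t n)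
      + (Complex.I / 2) • proj n (interaction S (c t) n) = 0

/-- The Fourier coefficients evolve by the linear flow on `I`. -/
def EvolvesLinearly (ν Ω : ℝ) (I : Set ℝ) (S : Finset R3) (c : ℝ → R3 →₀ C3) : Prop :=
  ∀ n ∈ S, ∀ t ∈ I,
    DifferentiableAt ℝ (fun s => c s n) t ∧
    deriv (fun s => c s n) t + (ν * (n ⬝ᵥ n)) • c t n + Ω • (coriolis n *ᵥ c t n) = 0

/-- The partial derivative `∂_j v^i` at `x`. -/
def partialDeriv (v : R3 → R3) (j i : Fin 3) (x : R3) : ℝ :=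
  fderiv ℝ v x (Pi.single j 1) i

/-- `∇ × v`. -/
def curl (v : R3 → R3) (x : R3) : R3 :=
  ![partialDeriv v 1 2 x - partialDeriv v 2 1 x,
    partialDeriv v 2 0 x - partialDeriv v 0 2 x,
    partialDeriv v 0 1 x - partialDeriv v 1 0 x]

/-- The eigenfield condition in the definition of a Beltrami flow. -/
def IsCurlEigenfield (v : R3 → R3) : Prop :=
  ∃ μ : ℂ, ∀ x, toC (curl v x) = μ • toC (v x)

/-- `f` is a real-valued function with finitely many Fourier modes, and `m` is its zero mode
(mean value). -/
def HasZeroMode (f : R3 → ℝ) (m : ℝ) : Prop :=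
  ∃ a : R3 →₀ ℂ, (∀ x, (f x : ℂ) = ∑ n ∈ a.support, a n * wave n x) ∧ a 0 = (m : ℂ)

/-- The horizontal plane `{n | n · e³ = 0}`. -/
def horizontalPlane : Submodule ℝ R3 := LinearMap.ker (LinearMap.proj 2 : R3 →ₗ[ℝ] ℝ)

/-- Type (i): the Fourier support lies on a line through the origin. -/
def TypeI (c : R3 →₀ C3) : Prop :=
  ∃ L : Submodule ℝ R3, Module.finrank ℝ L = 1 ∧ ∀ n ∈ c.support, n ∈ L

/-- Type (ii)(a): `v` is perpendicular to `P`, which is allowed only if `Ω = 0` or `P` is horizontal. -/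
def TypeIIa (Ω : ℝ) (P : Submodule ℝ R3) (v : R3 → R3) : Prop :=
  (Ω = 0 ∨ P = horizontalPlane) ∧ ∀ x, ∀ p ∈ P, v x ⬝ᵥ p = 0

/-- Type (ii)(b): `v = v^∥ + v^⊥ e` with `e` a unit normal to `P`, with `v^∥` parallel to `P` and of Fourier
support of at least four points on a circle of radius `r` about the origin, and
`v^⊥ = Q(ω) - ⟨Q(ω)⟩` where `∇ × v^∥ = r ω e`. -/
def TypeIIb (ν Ω : ℝ) (P : Submodule ℝ R3) (v : R3 → R3) : Prop :=
  ∃ (e : R3) (vpar : R3 → R3) (vperp : R3 → ℝ),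
    (e ⬝ᵥ e = 1 ∧ ∀ p ∈ P, e ⬝ᵥ p = 0) ∧
    (∀ x, v x = vpar x + vperp x • e) ∧
    (∀ x, vpar x ∈ P) ∧
    ∃ (b : R3 →₀ C3) (r : ℝ) (ω : R3 → ℝ) (Q : Polynomial ℝ) (m : ℝ),
      IsField vpar b ∧
      0 < r ∧ (∀ n ∈ b.support, n ∈ P ∧ n ⬝ᵥ n = r ^ 2) ∧ 4 ≤ b.support.card ∧
      (∀ x, curl vpar x = (r * ω x) • e) ∧
      HasZeroMode (fun x => Q.eval (ω x)) m ∧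
      (∀ x, vperp x = Q.eval (ω x) - m) ∧
      ((Ω = 0 ∨ P = horizontalPlane) → ν ≠ 0 → ∃ κ : ℝ, Q = Polynomial.C κ * Polynomial.X) ∧
      (Ω ≠ 0 → P ≠ horizontalPlane → Q = Polynomial.X ∨ Q = -Polynomial.X)

/-- Type (ii): the Fourier support spans a plane `P`, and (a) or (b) holds. -/
def TypeII (ν Ω : ℝ) (v : R3 → R3) (c : R3 →₀ C3) : Prop :=
  (∃ n₁ ∈ c.support, ∃ n₂ ∈ c.support, LinearIndependent ℝ ![n₁, n₂]) ∧
  ∃ P : Submodule ℝ R3, Module.finrank ℝ P = 2 ∧ (∀ n ∈ c.support, n ∈ P) ∧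
    (TypeIIa Ω P v ∨ TypeIIb ν Ω P v)

/-- Type (iii): the Fourier support has three linearly independent points and lies on a sphere centred at
the origin, and `v` is a Beltrami flow. -/
def TypeIII (v : R3 → R3) (c : R3 →₀ C3) : Prop :=
  (∃ n₁ ∈ c.support, ∃ n₂ ∈ c.support, ∃ n₃ ∈ c.support, LinearIndependent ℝ ![n₁, n₂, n₃]) ∧
  (∃ r : ℝ, 0 < r ∧ ∀ n ∈ c.support, n ⬝ᵥ n = r ^ 2) ∧
  IsCurlEigenfield v

/-- The field `v` with Fourier coefficients `c` is of one of the types (i), (ii), (iii). -/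
def IsAdmissible (ν Ω : ℝ) (v : R3 → R3) (c : R3 →₀ C3) : Prop :=
  TypeI c ∨ TypeII ν Ω v c ∨ TypeIII v c

end FiniteMode

end

/-! The linear part of the system acts mode by mode and creates no frequencies. The theorem
therefore says that for a solution the quadratic interaction is a gradient at every frequency and
time, and that this happens only for the listed fields. The listed types are first described by
Fourier coefficients (`CoeffAdmissible`). Any open time interval can be shrunk until finitely many
coefficients are each either identically zero or never zero; at a frequency where the field stays
zero the equation becomes an algebraic closure condition. From these conditions, and in the planar
case also from the evolution of the surviving modes, `exists_coeffAdmissible` finds an admissible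
time in every nonempty open set of times. An admissible field has gradient interaction
(`CoeffAdmissible.nl_parallel`). So the projected interaction, which is continuous in time, vanishes
identically (`Solves.evolvesLinearly`), and the types persist under the linear flow
(`EvolvesLinearly.coeffAdmissible`). This is why one time and all times give the same statement.

Support spanning space (`helical_of_closed`). Take an edge of the convex hull of the support. Sums
of two points of the edge lie outside the support and have no other decompositions, so closure
reduces to convolution equations on a line (`edge_modes`). They say that the polarizations at the
ends agree, up to a complex factor, after parallel transport along the great circle (`EdgeRel`).
Suppose that no mode on the edge is isotropic (circularly polarized). By central symmetry one of the
two faces at the edge is seen from the origin within a quarter lune, of area π. Transport around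
that face rotates the ratio of the two helical amplitudes by twice the solid angle, which lies
strictly between 0 and 2π, so the ratio cannot return to itself (`no_polarized_face`). Hence some
mode on the edge is isotropic; then the edge has just two modes, helical with a common eigenvalue μ.
In Lamb form, the interaction is the cross product of the field with the defect `curl u - μ u`;
comparing extreme frequencies of field and defect shows that the defect is zero (`helical_of_edge`).

Support spanning a plane with normal e (`PlanarEvolution.admissible`). The field becomes a normal
component α and a stream function β, and the interaction becomes the Poisson brackets of β with α
and with its Laplacian. Along an edge of the support of β the top part of a bracket is a first order
recursion; finite support forces integral levels and makes commuting top parts multiples of powers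
of β. This gives that the support of β lies on a circle (`exists_circle`) and that the centralizer
of β consists of polynomials in β (`REdge.exists_aeval`). For ν = 0 without Coriolis effect, β is
constant in time and all iterated brackets of β with α keep their support in a fixed finite set, so
α commutes with β. Viscosity instead makes the second coefficient of α grow strictly from edge to
edge around the circle unless α has level at most one, whence α = κβ. An effective Coriolis term
gives α = κβ too, and the evolution of this ratio fixes κ² = -R, where R is the squared radius.

Evaluation of trigonometric polynomials, an injective algebra homomorphism into functions,
translates between coefficients and fields (`IsField.isAdmissible`, `IsField.coeffAdmissible`). -/

noncomputable section
namespace FiniteMode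

/-! ### Walks along the hull of a finite planar set -/

/-- Walking up the boundary of a finite planar set along its upper-right hull edges. -/
theorem hull_walk {ι : Type*} (T : Finset ι) (x z : ι → ℝ) (n : ι) (hn : n ∈ T)
    (hz : ∀ u ∈ T, z n ≤ z u) (hbot : ∀ u ∈ T, z u = z n → x u ≤ x n) (Q : ι → Prop) (hQ : Q n)
    (hstep : ∀ u ∈ T, ∀ v ∈ T, ∀ s : ℝ, z u < z v →
      (∀ i ∈ T, x i - s * z i ≤ x u - s * z u) → x v - s * z v = x u - s * z u →
      Q u → Q v) :
    ∃ v ∈ T, Q v ∧ (∀ i ∈ T, z i ≤ z v) ∧ ∀ i ∈ T, z i = z v → x i ≤ x v := by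
  classical
  -- Induction on the number of points strictly above the current point `w`. The slope `s'` belongs
  -- to the edge just traversed: no point lies to the right of the line through `w` with this slope,
  -- and the points above `w` lie strictly to its left.
  have key : ∀ (k : ℕ) (w : ι), w ∈ T → Q w → (T.filter fun u => z w < z u).card = k →
      (∃ s' : ℝ, ∀ u ∈ T, (z u ≤ z w → x u - x w ≤ s' * (z u - z w)) ∧
        (z w < z u → x u - x w < s' * (z u - z w))) →
      ∃ v ∈ T, Q v ∧ (∀ i ∈ T, z i ≤ z v) ∧ ∀ i ∈ T, z i = z v → x i ≤ x v := by
    intro k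
    induction k using Nat.strong_induction_on with
    | _ k ih =>
    intro w hw hQw hk ⟨s', hs'⟩
    by_cases hne : (T.filter fun u => z w < z u).Nonempty
    -- Gift wrapping: the next edge has the largest quotient of x by z increments among the points
    -- above `w`.
    · obtain ⟨m, hm, hmax⟩ := Finset.exists_max_image _ (fun u => (x u - x w) / (z u - z w)) hne
      set s := (x m - x w) / (z m - z w) with hs
      have hne2 : ((T.filter fun u => z w < z u).filter
          fun u => (x u - x w) / (z u - z w) = s).Nonempty := ⟨m, by simp [hm, ← hs]⟩
      -- The highest point on the new edge is taken, so that points above `v` are strictly off its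
      -- line, which restores the invariant.
      obtain ⟨v, hv, hvmax⟩ := Finset.exists_max_image _ z hne2
      simp only [Finset.mem_filter] at hm hv hmax hvmax
      obtain ⟨⟨hvT, hwv⟩, hvs⟩ := hv
      have hle : ∀ i ∈ T, z w < z i → x i - x w ≤ s * (z i - z w) := by
        intro i hi hwi
        have := hmax i ⟨hi, hwi⟩
        rwa [div_le_iff₀ (by linarith)] at this
      have hveq : x v - x w = s * (z v - z w) := by
        rw [← hvs]; field_simp [(sub_pos.2 hwv).ne']
      have hss' : s < s' := by
        have h1 := (hs' v hvT).2 hwv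
        rw [hveq] at h1
        exact lt_of_mul_lt_mul_right h1 (by linarith)
      have hle2 : ∀ i ∈ T, z i ≤ z w → x i - x w ≤ s * (z i - z w) := by
        intro i hi hwi
        have := (hs' i hi).1 hwi
        nlinarith
      have hall : ∀ i ∈ T, x i - x w ≤ s * (z i - z w) := fun i hi =>
        (le_or_gt (z i) (z w)).elim (hle2 i hi) (hle i hi)
      have htie : ∀ i ∈ T, z v < z i → x i - x w < s * (z i - z w) := by
        intro i hi hvi
        refine lt_of_le_of_ne (hall i hi) fun h => ?_
        have := hvmax i ⟨⟨hi, hwv.trans hvi⟩, by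
          rw [h, mul_div_assoc, div_self (by linarith), mul_one]⟩
        linarith
      have hQv : Q v :=
        hstep w hw v hvT s hwv (fun i hi => by nlinarith [hall i hi]) (by linarith) hQw
      refine ih _ ?_ v hvT hQv rfl ⟨s, fun i hi => ⟨fun h => ?_, fun h => ?_⟩⟩
      · rw [← hk]
        refine Finset.card_lt_card (Finset.ssubset_iff_of_subset ?_ |>.2 ⟨v, ?_, ?_⟩)
        · intro u hu
          simp only [Finset.mem_filter] at hu ⊢
          exact ⟨hu.1, hwv.trans hu.2⟩
        · simp [hvT, hwv]
        · simp
      · have := hall i hi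
        linarith
      · have := htie i hi h
        linarith
    · have hno : ∀ i ∈ T, z i ≤ z w := fun i hi => by
        by_contra h
        exact hne ⟨i, by simp [hi, not_le.1 h]⟩
      exact ⟨w, hw, hQw, hno, fun i hi h => by simpa [h] using (hs' i hi).1 h.le⟩
  -- At the start any slope beyond all slopes seen from `n` will do.
  refine key _ n hn hQ rfl ⟨1 + ∑ u ∈ T, |(x u - x n) / (z u - z n)|, fun u hu => ⟨fun h => ?_,
    fun h => ?_⟩⟩
  · have : z u = z n := le_antisymm h (hz u hu)
    simpa [this] using hbot u hu this
  · have h1 : |(x u - x n) / (z u - z n)| ≤ ∑ u ∈ T, |(x u - x n) / (z u - z n)| :=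
      Finset.single_le_sum (f := fun u => |(x u - x n) / (z u - z n)|)
        (fun _ _ => abs_nonneg _) hu
    have h2 := le_abs_self ((x u - x n) / (z u - z n))
    rw [← div_lt_iff₀ (by linarith)]
    linarith

/-! ### Spinors, helical amplitudes and the holonomy of a face -/

theorem im_mul_mul_conj (A C D : ℂ) :
    (A * C * (starRingEnd ℂ) D).im = ‖A‖ * ‖C‖ * ‖D‖ * Real.sin (A.arg + C.arg - D.arg) := by
  conv_lhs => rw [← Complex.norm_mul_exp_arg_mul_I A, ← Complex.norm_mul_exp_arg_mul_I C,
    ← Complex.norm_mul_exp_arg_mul_I D]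
  simp only [map_mul, Complex.conj_ofReal, ← Complex.exp_conj, Complex.conj_I]
  have : (‖A‖ : ℂ) * Complex.exp (A.arg * Complex.I) * (‖C‖ * Complex.exp (C.arg * Complex.I)) *
      (‖D‖ * Complex.exp (D.arg * -Complex.I)) =
      ((‖A‖ * ‖C‖ * ‖D‖ : ℝ) : ℂ) * Complex.exp (((A.arg + C.arg - D.arg : ℝ) : ℂ) * Complex.I) := by
    push_cast
    rw [show ((A.arg : ℂ) + C.arg - D.arg) * Complex.I =
      A.arg * Complex.I + C.arg * Complex.I + D.arg * -Complex.I by ring, Complex.exp_add,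
      Complex.exp_add]
    ring
  rw [this, Complex.im_ofReal_mul, Complex.exp_ofReal_mul_I_im]

theorem norm_pos3 {A C D : ℂ} (hA : A ≠ 0) (hC : C ≠ 0) (hD : D ≠ 0) : 0 < ‖A‖ * ‖C‖ * ‖D‖ := by
  positivity

theorem arg_add_lt_of_im_neg {A C D : ℂ} (h : (A * C * (starRingEnd ℂ) D).im < 0)
    (h1 : A.arg + C.arg - D.arg < Real.pi) :
    A.arg + C.arg < D.arg := by
  rw [im_mul_mul_conj] at h
  by_contra hlt
  push Not at hlt
  have := Real.sin_nonneg_of_nonneg_of_le_pi (sub_nonneg.2 hlt) h1.le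
  have := mul_nonneg (by positivity : 0 ≤ ‖A‖ * ‖C‖ * ‖D‖) this
  linarith

theorem lt_arg_add_of_im_pos {A C D : ℂ} (h : 0 < (A * C * (starRingEnd ℂ) D).im)
    (h0 : -Real.pi < A.arg + C.arg - D.arg) :
    D.arg < A.arg + C.arg := by
  rw [im_mul_mul_conj] at h
  by_contra hlt
  push Not at hlt
  have := Real.sin_nonpos_of_nonpos_of_neg_pi_le (sub_nonpos.2 hlt) h0.le
  have := mul_nonpos_of_nonneg_of_nonpos (by positivity : 0 ≤ ‖A‖ * ‖C‖ * ‖D‖) this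
  linarith

theorem le_arg_add_of_im_nonneg {A C D : ℂ} (hA : A ≠ 0) (hC : C ≠ 0) (hD : D ≠ 0)
    (h : 0 ≤ (A * C * (starRingEnd ℂ) D).im)
    (h0 : -Real.pi < A.arg + C.arg - D.arg) :
    D.arg ≤ A.arg + C.arg := by
  rw [im_mul_mul_conj] at h
  by_contra hlt
  push Not at hlt
  have := Real.sin_neg_of_neg_of_neg_pi_lt (sub_neg.2 hlt) h0
  have := mul_neg_of_pos_of_neg (norm_pos3 hA hC hD) this
  linarith

theorem arg_add_le_of_im_nonpos {A C D : ℂ} (hA : A ≠ 0) (hC : C ≠ 0) (hD : D ≠ 0)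
    (h : (A * C * (starRingEnd ℂ) D).im ≤ 0)
    (h1 : A.arg + C.arg - D.arg < Real.pi) :
    A.arg + C.arg ≤ D.arg := by
  rw [im_mul_mul_conj] at h
  by_contra hlt
  push Not at hlt
  have := Real.sin_pos_of_pos_of_lt_pi (sub_pos.2 hlt) h1
  have := mul_pos (norm_pos3 hA hC hD) this
  linarith

/-- Euclidean length. -/
def len (w : R3) : ℝ := √(w ⬝ᵥ w)

theorem len_sq (w : R3) : len w ^ 2 = w ⬝ᵥ w := by
  refine Real.sq_sqrt ?_
  simp only [dotProduct, Fin.sum_univ_three]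
  nlinarith [mul_self_nonneg (w 0), mul_self_nonneg (w 1), mul_self_nonneg (w 2)]

/-- Stereographic denominator of the point `w`. -/
def spinP (w : R3) : ℝ := len w - w 0

/-- Stereographic numerator of the point `w`. -/
def spinQ (w : R3) : ℂ := ⟨w 1, w 2⟩

/-- The inner product of the spinors attached to two points. -/
def spinK (w z : R3) : ℂ := spinP w * spinP z + (starRingEnd ℂ) (spinQ w) * spinQ z

theorem spinP_mul (w : R3) : spinP w * (len w + w 0) = w 1 ^ 2 + w 2 ^ 2 := by
  have := len_sq w
  simp only [dotProduct, Fin.sum_univ_three] at this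
  simp only [spinP]
  linear_combination this

theorem spinP_pos {w : R3} (h1 : 0 ≤ w 1) (h2 : 0 ≤ w 2) (h : w 1 ≠ 0 ∨ w 2 ≠ 0) : 0 < spinP w := by
  have hp : 0 < w 1 ^ 2 + w 2 ^ 2 := by
    rcases h with h | h <;> positivity
  have hl : 0 ≤ len w := Real.sqrt_nonneg _
  have h3 := len_sq w
  simp only [dotProduct, Fin.sum_univ_three] at h3
  have : |w 0| < len w := abs_lt_of_sq_lt_sq (by nlinarith) hl
  have := le_abs_self (w 0)
  simp only [spinP]
  linarith

/-- The two complex amplitudes of `c` in the helical basis at `w`. -/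
def ampP (w : R3) (c : C3) : ℂ :=
  c 0 * (2 * spinP w * spinQ w) + c 1 * (spinP w ^ 2 - spinQ w ^ 2) +
    c 2 * (Complex.I * (spinP w ^ 2 + spinQ w ^ 2))

/-- See `ampP`. -/
def ampM (w : R3) (c : C3) : ℂ :=
  c 0 * (2 * spinP w * (starRingEnd ℂ) (spinQ w)) + c 1 * (spinP w ^ 2 - (starRingEnd ℂ) (spinQ w) ^ 2) -
    c 2 * (Complex.I * (spinP w ^ 2 + (starRingEnd ℂ) (spinQ w) ^ 2))

/-- The relation between the polarizations at the two endpoints of an edge. -/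
def EdgeRel (w z : R3) (a b : C3) : Prop :=
  (a ⬝ᵥ toC (crossProduct w z)) * (b ⬝ᵥ toC w) * len z +
    (b ⬝ᵥ toC (crossProduct w z)) * (a ⬝ᵥ toC z) * len w = 0

/-- Null coordinates of a point w: P and Q are |w| ∓ w₀, and s, t are w₁ ± i w₂, so `e1` is the
formula for |w|². For a vector c, the letters a, u, v are c₀, c₁ - i c₂ and c₁ + i c₂, so `e3` is
twice c · w = 0. The identity expands c · w' in the two helical amplitudes of c at w. -/
theorem amp_identity (P Q s t P' Q' s' t' a u v : ℂ) (e1 : s * t = P * Q) (e2 : s' * t' = P' * Q')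
    (e3 : a * (Q - P) + s * u + t * v = 0) :
    P ^ 2 * (P + Q) ^ 2 * P' * (a * (Q' - P') + s' * u + t' * v) =
      (2 * P * s * a + P ^ 2 * v - s ^ 2 * u) * ((P * t' - t * P') * (P * P' + t * s')) +
      (2 * P * t * a + P ^ 2 * u - t ^ 2 * v) * ((P * s' - s * P') * (P * P' + s * t')) := by
  grind

/-- The companion expansion of c · (w × w'): the same two helical terms, with one sign reversed. -/
theorem amp_identity_cross (P Q s t P' Q' s' t' a u v : ℂ) (e1 : s * t = P * Q)
    (e2 : s' * t' = P' * Q') :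
    P ^ 2 * (P + Q) * P' * (2 * a * (t * s' - s * t') + (Q' - P') * (u * s - v * t) -
        (Q - P) * (u * s' - v * t')) * (P + Q) =
      (-((2 * P * s * a + P ^ 2 * v - s ^ 2 * u) * ((P * t' - t * P') * (P * P' + t * s'))) +
      (2 * P * t * a + P ^ 2 * u - t ^ 2 * v) * ((P * s' - s * P') * (P * P' + s * t'))) * (P + Q) := by
  grind

/-- By the two expansions, the relation `h` equates a difference times a sum of helical terms with
the same expression after exchanging the two points. Only the mixed products survive, and `h1`, `h2`
allow the common factors to be cancelled. -/
theorem transport_aux (P Q s t P' Q' s' t' a u v a' u' v' : ℂ) (e1 : s * t = P * Q)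
    (e2 : s' * t' = P' * Q') (e3 : a * (Q - P) + s * u + t * v = 0)
    (e4 : a' * (Q' - P') + s' * u' + t' * v' = 0) (hR : P + Q ≠ 0)
    (hR' : P' + Q' ≠ 0) (h1 : P * s' - s * P' ≠ 0) (h2 : P * t' - t * P' ≠ 0)
    (h : (2 * a * (t * s' - s * t') + (Q' - P') * (u * s - v * t) - (Q - P) * (u * s' - v * t')) *
        (a' * (Q - P) + s * u' + t * v') * (P' + Q') =
      (2 * a' * (t' * s - s' * t) + (Q - P) * (u' * s' - v' * t') - (Q' - P') * (u' * s - v' * t)) *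
        (a * (Q' - P') + s' * u + t' * v) * (P + Q)) :
    (2 * P * t * a + P ^ 2 * u - t ^ 2 * v) * (2 * P' * s' * a' + P' ^ 2 * v' - s' ^ 2 * u') *
        (P * P' + s * t') ^ 2 =
      (2 * P * s * a + P ^ 2 * v - s ^ 2 * u) * (2 * P' * t' * a' + P' ^ 2 * u' - t' ^ 2 * v') *
        (P * P' + t * s') ^ 2 := by
  have i1 := amp_identity P Q s t P' Q' s' t' a u v e1 e2 e3
  have i2 := mul_right_cancel₀ hR (amp_identity_cross P Q s t P' Q' s' t' a u v e1 e2)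
  have i3 := amp_identity P' Q' s' t' P Q s t a' u' v' e2 e1 e4
  have i4 := mul_right_cancel₀ hR' (amp_identity_cross P' Q' s' t' P Q s t a' u' v' e2 e1)
  generalize 2 * a * (t * s' - s * t') + (Q' - P') * (u * s - v * t) -
    (Q - P) * (u * s' - v * t') = X at *
  generalize 2 * a' * (t' * s - s' * t) + (Q - P) * (u' * s' - v' * t') -
    (Q' - P') * (u' * s - v' * t) = X' at *
  generalize a * (Q' - P') + s' * u + t' * v = Y at *
  generalize a' * (Q - P) + s * u' + t * v' = Y' at *
  generalize 2 * P * s * a + P ^ 2 * v - s ^ 2 * u = A at *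
  generalize 2 * P * t * a + P ^ 2 * u - t ^ 2 * v = B at *
  generalize 2 * P' * s' * a' + P' ^ 2 * v' - s' ^ 2 * u' = A' at *
  generalize 2 * P' * t' * a' + P' ^ 2 * u' - t' ^ 2 * v' = B' at *
  have h3 : (P ^ 2 * (P + Q) * P' * X) * (P' ^ 2 * (P' + Q') ^ 2 * P * Y') =
      (P' ^ 2 * (P' + Q') * P * X') * (P ^ 2 * (P + Q) ^ 2 * P' * Y) := by
    linear_combination (P ^ 3 * P' ^ 3 * (P + Q) * (P' + Q')) * h
  rw [i1, i2, i3, i4] at h3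
  refine mul_left_cancel₀ (mul_ne_zero (mul_ne_zero (two_ne_zero) h1) h2) ?_
  linear_combination (-1 : ℂ) * h3

theorem amp_prod_aux (P Q s t a u v : ℂ) (e1 : s * t = P * Q)
    (e3 : a * (Q - P) + s * u + t * v = 0) :
    (2 * P * s * a + P ^ 2 * v - s ^ 2 * u) * (2 * P * t * a + P ^ 2 * u - t ^ 2 * v) =
      P ^ 2 * (P + Q) ^ 2 * (a ^ 2 + u * v) := by
  grind

theorem amp_inv_aux (P Q s t a u v : ℂ) (e1 : s * t = P * Q)
    (e3 : a * (Q - P) + s * u + t * v = 0)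
    (h1 : 2 * P * s * a + P ^ 2 * v - s ^ 2 * u = 0) (h2 : 2 * P * t * a + P ^ 2 * u - t ^ 2 * v = 0) :
    P ^ 2 * (P + Q) ^ 2 * a = 0 ∧ P ^ 2 * (P + Q) ^ 2 * u = 0 ∧ P ^ 2 * (P + Q) ^ 2 * v = 0 := by
  refine ⟨?_, ?_, ?_⟩ <;> grind

theorem spinQ_eq (w : R3) : spinQ w = w 1 + Complex.I * w 2 := by
  rw [mul_comm]; exact Complex.mk_eq_add_mul_I _ _

theorem conj_spinQ (w : R3) : (starRingEnd ℂ) (spinQ w) = w 1 - Complex.I * w 2 := by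
  rw [spinQ_eq]; simp; ring

theorem spinQ_mul_conj (w : R3) :
    spinQ w * (starRingEnd ℂ) (spinQ w) = spinP w * ((len w + w 0 : ℝ) : ℂ) := by
  rw [conj_spinQ, spinQ_eq, ← Complex.ofReal_mul, spinP_mul]
  push_cast
  linear_combination (-(w 2 : ℂ) ^ 2) * Complex.I_sq

theorem coord0_eq (w : R3) : ((len w + w 0 : ℝ) : ℂ) - spinP w = 2 * w 0 := by
  simp [spinP]; ring

theorem len2_eq (w : R3) : (spinP w : ℂ) + ((len w + w 0 : ℝ) : ℂ) = 2 * len w := by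
  simp [spinP]; ring

theorem dot_toC (c : C3) (w : R3) : c ⬝ᵥ toC w = c 0 * w 0 + c 1 * w 1 + c 2 * w 2 := by
  simp [dotProduct, Fin.sum_univ_three, toC]

theorem two_dot_toC (c : C3) (w : R3) : 2 * (c ⬝ᵥ toC w) =
    c 0 * (((len w + w 0 : ℝ) : ℂ) - spinP w) + spinQ w * (c 1 - Complex.I * c 2) +
      (starRingEnd ℂ) (spinQ w) * (c 1 + Complex.I * c 2) := by
  rw [coord0_eq, dot_toC, conj_spinQ, spinQ_eq]
  linear_combination (2 * c 2 * w 2) * Complex.I_sq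

theorem ampP_eq (w : R3) (c : C3) : ampP w c = 2 * spinP w * spinQ w * c 0 +
    (spinP w : ℂ) ^ 2 * (c 1 + Complex.I * c 2) - spinQ w ^ 2 * (c 1 - Complex.I * c 2) := by
  unfold ampP; ring

theorem ampM_eq (w : R3) (c : C3) : ampM w c = 2 * spinP w * (starRingEnd ℂ) (spinQ w) * c 0 +
    (spinP w : ℂ) ^ 2 * (c 1 - Complex.I * c 2) -
      (starRingEnd ℂ) (spinQ w) ^ 2 * (c 1 + Complex.I * c 2) := by
  unfold ampM; ring

theorem four_dot_cross (c : C3) (w z : R3) :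
    4 * Complex.I * (c ⬝ᵥ toC (crossProduct w z)) =
      2 * c 0 * ((starRingEnd ℂ) (spinQ w) * spinQ z - spinQ w * (starRingEnd ℂ) (spinQ z)) +
      (((len z + z 0 : ℝ) : ℂ) - spinP z) *
        ((c 1 - Complex.I * c 2) * spinQ w - (c 1 + Complex.I * c 2) * (starRingEnd ℂ) (spinQ w)) -
      (((len w + w 0 : ℝ) : ℂ) - spinP w) *
        ((c 1 - Complex.I * c 2) * spinQ z - (c 1 + Complex.I * c 2) * (starRingEnd ℂ) (spinQ z)) := by
  rw [coord0_eq, coord0_eq, dot_toC]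
  simp only [spinQ_eq, cross_apply]
  simp
  ring

/-- `EdgeRel` compares polarizations by parallel transport along the great circle through the two
directions, up to a complex factor. In the gauge given by the spinors, the two helical amplitudes
then turn by opposite phases, both governed by the spinor product `spinK`. -/
theorem spin_transport {w z : R3} {a b : C3}
    (hne : spinP w * spinQ z ≠ spinP z * spinQ w) (ha : a ⬝ᵥ toC w = 0) (hb : b ⬝ᵥ toC z = 0)
    (hlw : 0 < len w) (hlz : 0 < len z) (h : EdgeRel w z a b) :
    ampM w a * ampP z b * (starRingEnd ℂ) (spinK w z) ^ 2 =
      ampP w a * ampM z b * spinK w z ^ 2 := by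
  have e1 := spinQ_mul_conj w
  have e2 := spinQ_mul_conj z
  have e3 := two_dot_toC a w
  have e4 := two_dot_toC b z
  rw [ha, mul_zero] at e3
  rw [hb, mul_zero] at e4
  have h1 : (spinP w : ℂ) * spinQ z - spinQ w * spinP z ≠ 0 := by
    rw [sub_ne_zero]; rwa [mul_comm (spinQ w)]
  have h2 : (spinP w : ℂ) * (starRingEnd ℂ) (spinQ z) - (starRingEnd ℂ) (spinQ w) * spinP z ≠ 0 := by
    intro h
    apply h1
    have := congrArg (starRingEnd ℂ) h
    simpa using this
  have := transport_aux (spinP w) ((len w + w 0 : ℝ) : ℂ) (spinQ w) ((starRingEnd ℂ) (spinQ w))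
    (spinP z) ((len z + z 0 : ℝ) : ℂ) (spinQ z) ((starRingEnd ℂ) (spinQ z)) (a 0)
    (a 1 - Complex.I * a 2) (a 1 + Complex.I * a 2) (b 0) (b 1 - Complex.I * b 2)
    (b 1 + Complex.I * b 2) e1 e2 e3.symm e4.symm 
    (by rw [len2_eq]; simpa using hlw.ne') (by rw [len2_eq]; simpa using hlz.ne') h1 h2 ?_
  · rw [ampM_eq, ampP_eq, ampM_eq, ampP_eq]
    simp only [spinK, map_add, map_mul, Complex.conj_ofReal, Complex.conj_conj]
    exact this
  · rw [← four_dot_cross, ← two_dot_toC, ← two_dot_toC, len2_eq, len2_eq, ← four_dot_cross]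
    have hx : b ⬝ᵥ toC (crossProduct z w) = -(b ⬝ᵥ toC (crossProduct w z)) := by
      simp only [dot_toC, cross_apply]; simp; ring
    rw [hx]
    unfold EdgeRel at h
    linear_combination (16 * Complex.I) * h

theorem dot_self_eq (c : C3) :
    c ⬝ᵥ c = c 0 ^ 2 + (c 1 - Complex.I * c 2) * (c 1 + Complex.I * c 2) := by
  simp only [dotProduct, Fin.sum_univ_three]
  linear_combination (c 2) ^ 2 * Complex.I_sq

/-- Hence a polarization is isotropic exactly when one of its helical amplitudes vanishes (at a
point with `spinP` and `len` nonzero). -/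
theorem amp_prod {w : R3} {a : C3} (ha : a ⬝ᵥ toC w = 0) :
    ampP w a * ampM w a = (spinP w : ℂ) ^ 2 * (2 * len w) ^ 2 * (a ⬝ᵥ a) := by
  have e3 := two_dot_toC a w
  rw [ha, mul_zero] at e3
  rw [ampP_eq, ampM_eq, dot_self_eq, ← len2_eq]
  exact amp_prod_aux _ _ _ _ _ _ _ (spinQ_mul_conj w) e3.symm

theorem amp_ne_zero {w : R3} {a : C3} (hw : 0 < spinP w) (hl : 0 < len w) (ha : a ⬝ᵥ toC w = 0)
    (h0 : a ≠ 0) : ampP w a ≠ 0 ∨ ampM w a ≠ 0 := by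
  by_contra! h
  have e3 := two_dot_toC a w
  rw [ha, mul_zero] at e3
  have h1 := h.1
  have h2 := h.2
  rw [ampP_eq] at h1
  rw [ampM_eq] at h2
  obtain ⟨k1, k2, k3⟩ := amp_inv_aux _ _ _ _ _ _ _ (spinQ_mul_conj w) e3.symm h1 h2
  have hn : (spinP w : ℂ) ^ 2 * (spinP w + ((len w + w 0 : ℝ) : ℂ)) ^ 2 ≠ 0 := by
    rw [len2_eq]
    have : (spinP w : ℂ) ≠ 0 := by exact_mod_cast hw.ne'
    have h' : (len w : ℂ) ≠ 0 := by exact_mod_cast hl.ne'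
    exact mul_ne_zero (pow_ne_zero _ this) (pow_ne_zero _ (mul_ne_zero two_ne_zero h'))
  have k1 := (mul_eq_zero.1 k1).resolve_left hn
  have k2 := (mul_eq_zero.1 k2).resolve_left hn
  have k3 := (mul_eq_zero.1 k3).resolve_left hn
  apply h0
  ext i
  fin_cases i
  · exact k1
  · simp; linear_combination (k2 + k3) / 2
  · simp; linear_combination (-Complex.I / 2) * (k3 - k2) + a 2 * Complex.I_sq

/-- The Bargmann invariant of three spinors. Its phase measures half the solid angle of the triangle
up to sign, and the sign of its imaginary part records the orientation. -/
theorem im_spinK_triple (u v w : R3) :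
    (spinK u v * spinK v w * (starRingEnd ℂ) (spinK u w)).im =
      -(2 * spinP u * spinP v * spinP w) * (u ⬝ᵥ crossProduct v w) := by
  have h1 := spinP_mul u
  have h2 := spinP_mul v
  have h3 := spinP_mul w
  have k1 : len u = spinP u + u 0 := by simp [spinP]
  have k2 : len v = spinP v + v 0 := by simp [spinP]
  have k3 : len w = spinP w + w 0 := by simp [spinP]
  rw [k1] at h1
  rw [k2] at h2
  rw [k3] at h3
  simp only [spinK, spinQ, dotProduct, Fin.sum_univ_three, cross_apply]
  simp
  generalize spinP u = p at *
  generalize spinP v = q at *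
  generalize spinP w = r at *
  generalize u 0 = u0 at *
  generalize u 1 = u1 at *
  generalize u 2 = u2 at *
  generalize v 0 = v0 at *
  generalize v 1 = v1 at *
  generalize v 2 = v2 at *
  generalize w 0 = w0 at *
  generalize w 1 = w1 at *
  generalize w 2 = w2 at *
  grind

/-- The point `w` lies in the closed quarter lune `y, z ≥ 0`, off the `x`-axis. -/
def InLune (w : R3) : Prop := 0 ≤ w 1 ∧ 0 ≤ w 2 ∧ (w 1 ≠ 0 ∨ w 2 ≠ 0)

namespace InLune

variable {u v w : R3}

theorem spinP_pos (h : InLune w) : 0 < spinP w := FiniteMode.spinP_pos h.1 h.2.1 h.2.2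

theorem len_pos (h : InLune w) : 0 < len w := by
  have h1 := h.spinP_pos
  have h2 := spinP_mul w
  have h3 : 0 < len w + w 0 := by
    have : 0 < w 1 ^ 2 + w 2 ^ 2 := by
      rcases h.2.2 with h | h <;> positivity
    rw [← h2] at this
    exact pos_of_mul_pos_right this h1.le
  unfold spinP at h1
  linarith

theorem arg_nonneg (h : InLune w) : 0 ≤ (spinQ w).arg := Complex.arg_nonneg_iff.2 h.2.1

theorem arg_le (h : InLune w) : (spinQ w).arg ≤ Real.pi / 2 :=
  Complex.arg_le_pi_div_two_iff.2 (Or.inl h.1)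

theorem re_spinK (hu : InLune u) (hv : InLune v) : 0 < (spinK u v).re := by
  have := mul_pos hu.spinP_pos hv.spinP_pos
  have h1 := mul_nonneg hu.1 hv.1
  have h2 := mul_nonneg hu.2.1 hv.2.1
  simp [spinK, spinQ]
  linarith

theorem spinK_ne (hu : InLune u) (hv : InLune v) : spinK u v ≠ 0 := fun h => by
  have := hu.re_spinK hv
  simp [h] at this

theorem abs_arg_spinK (hu : InLune u) (hv : InLune v) :
    -(Real.pi / 2) < (spinK u v).arg ∧ (spinK u v).arg < Real.pi / 2 :=
  abs_lt.1 (Complex.abs_arg_lt_pi_div_two_iff.2 (Or.inl (hu.re_spinK hv)))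

theorem arg_spinK_nonneg (h : 0 ≤ u 1 * v 2 - u 2 * v 1) : 0 ≤ (spinK u v).arg := by
  rw [Complex.arg_nonneg_iff]
  simp [spinK, spinQ]
  linarith

/-- The orientation test with a pole of the x-axis as third point, where `spinQ` takes the role of
`spinK`. It telescopes along a chain and bounds the accumulated phase by the argument of `spinQ` at
the end. -/
theorem arg_spinK_add_lt (hu : InLune u) (hv : InLune v) (h : 0 < u 1 * v 2 - u 2 * v 1) :
    (spinK u v).arg + (spinQ u).arg < (spinQ v).arg := by
  have h1 := hu.abs_arg_spinK hv
  have h2 := hu.arg_le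
  have h3 := hu.arg_nonneg
  have h4 := hv.arg_le
  have h5 := hv.arg_nonneg
  refine arg_add_lt_of_im_neg ?_ (by linarith [Real.pi_pos])
  have : (spinK u v * spinQ u * (starRingEnd ℂ) (spinQ v)).im =
      -(spinP u * spinP v * (u 1 * v 2 - u 2 * v 1)) := by
    simp [spinK, spinQ]; ring
  rw [this]
  have := mul_pos (mul_pos hu.spinP_pos hv.spinP_pos) h
  linarith

end InLune

theorem conj_sq_div {K : ℂ} (hK : K ≠ 0) :
    (starRingEnd ℂ) K ^ 2 / K ^ 2 = Complex.exp (-(4 * (K.arg : ℂ)) * Complex.I) := by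
  have hn : (‖K‖ : ℂ) ≠ 0 := by simpa using hK
  have h2 : (starRingEnd ℂ) K = ‖K‖ * Complex.exp (-(K.arg * Complex.I)) := by
    conv_lhs => rw [← Complex.norm_mul_exp_arg_mul_I K]
    simp only [map_mul, Complex.conj_ofReal, ← Complex.exp_conj, Complex.conj_I, mul_neg]
  have h3 : K ^ 2 = (‖K‖ * Complex.exp (K.arg * Complex.I)) ^ 2 := by
    rw [Complex.norm_mul_exp_arg_mul_I]
  rw [h2, h3]
  rw [mul_pow, mul_pow, mul_div_mul_left _ _ (pow_ne_zero 2 hn), ← Complex.exp_nat_mul,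
    ← Complex.exp_nat_mul, ← Complex.exp_sub]
  congr 1
  push_cast
  ring

/-- Ratio of the helical amplitudes. -/
def ampRatio (w : R3) (c : C3) : ℂ := ampM w c / ampP w c

/-- Nonvanishing of both amplitudes propagates along the edge, and the amplitude ratio changes only
by a phase, four times the argument of `spinK`. -/
theorem ampRatio_step {u v : R3} {a b : C3} (hu : InLune u) (hv : InLune v)
    (hne : spinP u * spinQ v ≠ spinP v * spinQ u) (ha : a ⬝ᵥ toC u = 0) (hb : b ⬝ᵥ toC v = 0)
    (h : EdgeRel u v a b) (hP : ampP u a ≠ 0) (hM : ampM u a ≠ 0) (hb0 : b ≠ 0) :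
    ampP v b ≠ 0 ∧ ampM v b ≠ 0 ∧
      ampRatio v b = ampRatio u a * Complex.exp (-(4 * ((spinK u v).arg : ℂ)) * Complex.I) := by
  have ht := spin_transport hne ha hb hu.len_pos hv.len_pos h
  have hK := hu.spinK_ne hv
  have hK' : (starRingEnd ℂ) (spinK u v) ≠ 0 := by simpa using hK
  have hor := amp_ne_zero hv.spinP_pos hv.len_pos hb hb0
  have hPv : ampP v b ≠ 0 := by
    rintro h0
    rw [h0, mul_zero, zero_mul] at ht
    have := hor.resolve_left (not_not.2 h0)
    exact (mul_ne_zero (mul_ne_zero hP this) (pow_ne_zero 2 hK)) ht.symm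
  have hMv : ampM v b ≠ 0 := by
    rintro h0
    rw [h0, mul_zero, zero_mul] at ht
    exact (mul_ne_zero (mul_ne_zero hM hPv) (pow_ne_zero 2 hK')) ht
  refine ⟨hPv, hMv, ?_⟩
  rw [← conj_sq_div hK, ampRatio, ampRatio]
  field_simp
  linear_combination -ht

/-- Two distinct points of a face plane off the origin are not parallel. -/
theorem spin_ne_of_plane {u v : R3} (hu : InLune u) (hv : InLune v) {y0 t : ℝ} (hy0 : 0 < y0)
    (hpu : u 1 = y0 * (1 - t * u 2)) (hpv : v 1 = y0 * (1 - t * v 2))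
    (hne : u 0 ≠ v 0 ∨ u 2 ≠ v 2) : spinP u * spinQ v ≠ spinP v * spinQ u := by
  intro h
  have h1 := congrArg Complex.re h
  have h2 := congrArg Complex.im h
  simp [spinQ] at h1 h2
  have hp := hu.spinP_pos
  have hq := hv.spinP_pos
  have e : spinP u * y0 = spinP v * y0 := by
    linear_combination h1 - spinP u * hpv + spinP v * hpu + y0 * t * h2
  have e' : spinP u = spinP v := mul_right_cancel₀ hy0.ne' e
  have k1 : v 1 = u 1 := by
    rw [e'] at h1; exact mul_left_cancel₀ hq.ne' h1
  have k2 : v 2 = u 2 := by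
    rw [e'] at h2; exact mul_left_cancel₀ hq.ne' h2
  have s1 := spinP_mul u
  have s2 := spinP_mul v
  rw [e', ← k1, ← k2, ← s2] at s1
  have s3 := mul_left_cancel₀ hq.ne' s1
  have s4 : len u - u 0 = len v - v 0 := e'
  rcases hne with h | h
  · apply h; linarith
  · exact h k2.symm

theorem arg_eq_zero_of_pos {K : ℂ} (h : 0 < K.re) (h' : K.im = 0) : K.arg = 0 :=
  Complex.arg_eq_zero_iff.2 ⟨h.le, h'⟩

theorem spinP_anti {a b : R3} (ha : InLune a) (hb : InLune b) (e1 : a 1 = b 1) (e2 : a 2 = b 2)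
    (e0 : a 0 ≤ b 0) : spinP b ≤ spinP a ∧ (a 0 < b 0 → spinP b < spinP a) := by
  have s1 := spinP_mul a
  have s2 := spinP_mul b
  have pa := ha.spinP_pos
  have pb := hb.spinP_pos
  have ka : len a = spinP a + a 0 := by simp [spinP]
  have kb : len b = spinP b + b 0 := by simp [spinP]
  have h0 : 0 < b 1 ^ 2 + b 2 ^ 2 := by
    rcases hb.2.2 with h | h <;> positivity
  rw [ka, e1, e2] at s1
  have h1 : 0 < spinP a + a 0 + a 0 := pos_of_mul_pos_right (s1 ▸ h0) pa.le
  rw [← s2, kb] at s1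
  refine ⟨?_, fun h => ?_⟩ <;> by_contra! hlt
  · nlinarith [mul_nonneg (sub_nonneg.2 hlt.le) h1.le, mul_nonneg pb.le (sub_nonneg.2 e0)]
  · nlinarith [mul_nonneg (sub_nonneg.2 hlt) h1.le, mul_pos pb (sub_pos.2 h)]

theorem exp_mul_I_ne_one {θ : ℝ} (h0 : 0 < θ) (h1 : θ < 2 * Real.pi) :
    Complex.exp ((θ : ℂ) * Complex.I) ≠ 1 := by
  intro hexp
  rw [Complex.exp_eq_one_iff] at hexp
  obtain ⟨n, hn⟩ := hexp
  have hn' : θ = n * (2 * Real.pi) := by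
    have := congrArg Complex.im hn
    simpa using this
  have hpi := Real.pi_pos
  have hn1' : (0 : ℝ) < n := by
    by_contra! h
    nlinarith
  have hn2' : (n : ℝ) < 1 := by
    by_contra! h
    nlinarith
  have : (0 : ℤ) < n := by exact_mod_cast hn1'
  have : n < (1 : ℤ) := by exact_mod_cast hn2'
  omega

set_option maxHeartbeats 1000000 in
/-- A planar face contained in a quarter lune cannot carry polarizations, one of which is
non-isotropic, related along all its edges: the holonomy around its boundary is not trivial. -/
theorem no_polarized_face {ι : Type*} (T : Finset ι) (w : ι → R3) (c : ι → C3) {n0 n1 : ι}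
    (hn0 : n0 ∈ T) (hn1 : n1 ∈ T) {y0 t : ℝ} (hy0 : 0 < y0)
    (hplane : ∀ u ∈ T, w u 1 = y0 * (1 - t * w u 2)) (hy : ∀ u ∈ T, 0 ≤ w u 1)
    (hz : ∀ u ∈ T, 0 ≤ w u 2) (hz0 : w n0 2 = 0) (hz1 : w n1 2 = 0) (h01 : w n0 0 < w n1 0)
    (hbot : ∀ u ∈ T, w u 2 = 0 → w n0 0 ≤ w u 0 ∧ w u 0 ≤ w n1 0) (htop : ∃ u ∈ T, 0 < w u 2)
    (hc : ∀ u ∈ T, c u ≠ 0) (hperp : ∀ u ∈ T, c u ⬝ᵥ toC (w u) = 0) (hniso : c n0 ⬝ᵥ c n0 ≠ 0)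
    (hedge : ∀ p q : ℝ, ∀ u ∈ T, ∀ v ∈ T, (p ≠ 0 ∨ q ≠ 0) → (w u 0 ≠ w v 0 ∨ w u 2 ≠ w v 2) →
      (∀ i ∈ T, p * w i 0 + q * w i 2 ≤ p * w u 0 + q * w u 2) →
      p * w v 0 + q * w v 2 = p * w u 0 + q * w u 2 →
      EdgeRel (w u) (w v) (c u) (c v))
    (hinj : ∀ u ∈ T, ∀ v ∈ T, w u = w v → u = v) : False := by
  have hL : ∀ u ∈ T, InLune (w u) := by
    intro u hu
    refine ⟨hy u hu, hz u hu, ?_⟩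
    by_cases h : w u 2 = 0
    · left; rw [hplane u hu, h]; simpa using hy0.ne'
    · exact Or.inr h
  have hplane0 : w n0 1 = y0 := by rw [hplane n0 hn0, hz0]; ring
  have hplane1 : w n1 1 = y0 := by rw [hplane n1 hn1, hz1]; ring
  have hcross : ∀ u ∈ T, ∀ v ∈ T, w u 1 * w v 2 - w u 2 * w v 1 = y0 * (w v 2 - w u 2) := by
    intro u hu v hv
    rw [hplane u hu, hplane v hv]; ring
  have hstep : ∀ u ∈ T, ∀ v ∈ T, (w u 0 ≠ w v 0 ∨ w u 2 ≠ w v 2) →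
      EdgeRel (w u) (w v) (c u) (c v) → ampP (w u) (c u) ≠ 0 → ampM (w u) (c u) ≠ 0 →
      ampP (w v) (c v) ≠ 0 ∧ ampM (w v) (c v) ≠ 0 ∧ ampRatio (w v) (c v) =
        ampRatio (w u) (c u) * Complex.exp (-(4 * ((spinK (w u) (w v)).arg : ℂ)) * Complex.I) :=
    fun u hu v hv hne h hP hM => ampRatio_step (hL u hu) (hL v hv)
      (spin_ne_of_plane (hL u hu) (hL v hv) hy0 (hplane u hu) (hplane v hv) hne)
      (hperp u hu) (hperp v hv) h hP hM (hc v hv)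
  -- the bottom edge
  have hA0 : ampP (w n0) (c n0) ≠ 0 ∧ ampM (w n0) (c n0) ≠ 0 := by
    have h1 := amp_prod (hperp n0 hn0)
    have h2 : (spinP (w n0) : ℂ) ≠ 0 := by exact_mod_cast (hL n0 hn0).spinP_pos.ne'
    have h3 : (len (w n0) : ℂ) ≠ 0 := by exact_mod_cast (hL n0 hn0).len_pos.ne'
    have h4 : ampP (w n0) (c n0) * ampM (w n0) (c n0) ≠ 0 := by
      rw [h1]
      exact mul_ne_zero (mul_ne_zero (pow_ne_zero _ h2)
        (pow_ne_zero _ (mul_ne_zero two_ne_zero h3))) hniso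
    exact ⟨left_ne_zero_of_mul h4, right_ne_zero_of_mul h4⟩
  have hE01 : EdgeRel (w n0) (w n1) (c n0) (c n1) := by
    refine hedge 0 (-1) n0 hn0 n1 hn1 (by simp) (Or.inl h01.ne) (fun i hi => ?_) (by simp [hz0, hz1])
    have := hz i hi
    rw [hz0]; linarith
  obtain ⟨hP1, hM1, hr01⟩ := hstep n0 hn0 n1 hn1 (Or.inl h01.ne) hE01 hA0.1 hA0.2
  -- Both bottom points have the same last two coordinates, hence the same `spinQ`, so `spinK` is a
  -- positive real and the bottom edge contributes no phase. The same holds for the top edge.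
  have hK01 : (spinK (w n0) (w n1)).arg = 0 := by
    refine arg_eq_zero_of_pos ((hL _ hn0).re_spinK (hL _ hn1)) ?_
    simp [spinK, spinQ, hz0, hz1]
  rw [hK01] at hr01
  simp only [Complex.ofReal_zero, mul_zero, neg_zero, zero_mul, Complex.exp_zero, mul_one] at hr01
  have hself : ∀ u ∈ T, (spinK (w u) (w u)).arg = 0 := by
    intro u hu
    refine arg_eq_zero_of_pos ((hL _ hu).re_spinK (hL _ hu)) ?_
    simp [spinK, spinQ]; ring
  have hQ0 : ∀ n ∈ T, w n 2 = 0 → (spinQ (w n)).arg = 0 := by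
    intro n hn h
    refine arg_eq_zero_of_pos ?_ (by simpa [spinQ] using h)
    simp only [spinQ, hplane n hn, h]
    simpa using hy0
  have hmono : ∀ a ∈ T, ∀ u ∈ T, ∀ v ∈ T, w a 2 = 0 → w u 2 < w v 2 →
      0 ≤ (spinK (w u) (w v)).arg ∧ 0 ≤ (spinK (w a) (w u)).arg ∧
      0 ≤ (spinK (w a) (w v)).arg := by
    intro a ha u hu v hv ha2 huv
    refine ⟨InLune.arg_spinK_nonneg ?_, InLune.arg_spinK_nonneg ?_, InLune.arg_spinK_nonneg ?_⟩
    · rw [hcross u hu v hv]; exact mul_nonneg hy0.le (by linarith)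
    · rw [hcross a ha u hu, ha2]; exact mul_nonneg hy0.le (by linarith [hz u hu])
    · rw [hcross a ha v hv, ha2]; exact mul_nonneg hy0.le (by linarith [hz v hv])
  have hdet : ∀ a ∈ T, ∀ u ∈ T, ∀ v ∈ T, ∀ s : ℝ, w a 2 = 0 → 
      w v 0 - s * w v 2 = w u 0 - s * w u 2 →
      (w a ⬝ᵥ crossProduct (w u) (w v)) =
        y0 * ((w a 0 - (w u 0 - s * w u 2)) * (w v 2 - w u 2)) := by
    intro a ha u hu v hv s ha2 h
    simp only [dotProduct, Fin.sum_univ_three, cross_apply]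
    simp only [hplane a ha, hplane u hu, hplane v hv, ha2]
    simp
    linear_combination (y0 * w u 2) * h
  -- the right chain
  obtain ⟨r, hr, ⟨hPr, hMr, Br, hratr, hBr1, hBr2⟩, hrtop, hrmax⟩ :=
    hull_walk T (fun i => w i 0) (fun i => w i 2) n1 hn1 (fun u hu => by rw [hz1]; exact hz u hu)
    (fun u hu h => (hbot u hu (h.trans hz1)).2)
    -- `B` is the phase accumulated from `n1`. It is at least the phase of the direct transport,
    -- because the triangles `n1, u, v` cut off by the hull edges have a constant orientation; it
    -- stays below the argument of `spinQ` once the chain has left the bottom.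
    (fun v => ampP (w v) (c v) ≠ 0 ∧ ampM (w v) (c v) ≠ 0 ∧ ∃ B : ℝ,
      ampRatio (w v) (c v) = ampRatio (w n1) (c n1) * Complex.exp (-(4 * (B : ℂ)) * Complex.I) ∧
      (spinK (w n1) (w v)).arg ≤ B ∧ ((0 < w v 2 → B < (spinQ (w v)).arg) ∧ (w v 2 = 0 → B = 0)))
    ⟨hP1, hM1, 0, by simp, (hself n1 hn1).le, fun h => absurd h (by rw [hz1]; exact lt_irrefl 0),
      fun _ => rfl⟩
    (by
      intro u hu v hv s huv hle heq ⟨hPu, hMu, B, hrat, hB1, hB2, hB3⟩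
      have hER := hedge 1 (-s) u hu v hv (by simp) (Or.inr huv.ne)
        (fun i hi => by linarith [hle i hi]) (by linarith)
      obtain ⟨hPv, hMv, hrv⟩ := hstep u hu v hv (Or.inr huv.ne) hER hPu hMu
      obtain ⟨m1, m2, m3⟩ := hmono n1 hn1 u hu v hv hz1 huv
      refine ⟨hPv, hMv, B + (spinK (w u) (w v)).arg, ?_, ?_, ?_, ?_⟩
      · rw [hrv, hrat, mul_assoc, ← Complex.exp_add]
        congr 2
        push_cast
        ring
      · have h3 := ((hL _ hn1).abs_arg_spinK (hL _ hv)).2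
        refine (le_arg_add_of_im_nonneg ((hL _ hn1).spinK_ne (hL _ hu)) ((hL _ hu).spinK_ne (hL _ hv))
          ((hL _ hn1).spinK_ne (hL _ hv)) ?_ (by linarith [Real.pi_pos])).trans (by linarith)
        rw [im_spinK_triple, hdet n1 hn1 u hu v hv s hz1 heq]
        have h4 := hle n1 hn1
        rw [hz1] at h4
        have h5 := mul_pos (mul_pos (hL _ hn1).spinP_pos (hL _ hu).spinP_pos) (hL _ hv).spinP_pos
        have h6 : 0 ≤ y0 * ((w u 0 - s * w u 2 - w n1 0) * (w v 2 - w u 2)) :=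
          mul_nonneg hy0.le (mul_nonneg (by linarith) (by linarith))
        nlinarith [mul_nonneg h5.le h6]
      · intro hv0
        have h3 := (hL _ hu).arg_spinK_add_lt (hL _ hv) (by
          rw [hcross u hu v hv]; exact mul_pos hy0 (by linarith))
        rcases (hz u hu).eq_or_lt with h | h
        · rw [hB3 h.symm]
          rw [hQ0 u hu h.symm] at h3
          linarith
        · linarith [hB2 h]
      · intro h
        linarith [hz u hu])
  -- the left chain
  obtain ⟨l, hl, ⟨hPl, hMl, Bl, hratl, hBl1, hBl2⟩, hltop, hlmax⟩ :=
    hull_walk T (fun i => -w i 0) (fun i => w i 2) n0 hn0 (fun u hu => by rw [hz0]; exact hz u hu)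
    (fun u hu h => neg_le_neg (hbot u hu (h.trans hz0)).1)
    -- On the left chain the triangles have the opposite orientation, so direct transport from `n0`
    -- bounds the accumulated phase from above.
    (fun v => ampP (w v) (c v) ≠ 0 ∧ ampM (w v) (c v) ≠ 0 ∧ ∃ B : ℝ,
      ampRatio (w v) (c v) = ampRatio (w n0) (c n0) * Complex.exp (-(4 * (B : ℂ)) * Complex.I) ∧
      0 ≤ B ∧ B ≤ (spinK (w n0) (w v)).arg)
    ⟨hA0.1, hA0.2, 0, by simp, le_rfl, (hself n0 hn0).ge⟩
    (by
      intro u hu v hv s huv hle heq ⟨hPu, hMu, B, hrat, hB1, hB2⟩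
      have hER := hedge (-1) (-s) u hu v hv (by simp) (Or.inr huv.ne)
        (fun i hi => by linarith [hle i hi]) (by linarith)
      obtain ⟨hPv, hMv, hrv⟩ := hstep u hu v hv (Or.inr huv.ne) hER hPu hMu
      obtain ⟨m1, m2, m3⟩ := hmono n0 hn0 u hu v hv hz0 huv
      refine ⟨hPv, hMv, B + (spinK (w u) (w v)).arg, ?_, by linarith, ?_⟩
      · rw [hrv, hrat, mul_assoc, ← Complex.exp_add]
        congr 2
        push_cast
        ring
      · have h3 := ((hL _ hn0).abs_arg_spinK (hL _ hu)).2
        have h3' := ((hL _ hu).abs_arg_spinK (hL _ hv)).2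
        refine le_trans (by linarith) (arg_add_le_of_im_nonpos ((hL _ hn0).spinK_ne (hL _ hu))
          ((hL _ hu).spinK_ne (hL _ hv)) ((hL _ hn0).spinK_ne (hL _ hv)) ?_
          (by linarith [Real.pi_pos]))
        rw [im_spinK_triple, hdet n0 hn0 u hu v hv (-s) hz0 (by linarith)]
        have h4 := hle n0 hn0
        rw [hz0] at h4
        have h5 := mul_pos (mul_pos (hL _ hn0).spinP_pos (hL _ hu).spinP_pos) (hL _ hv).spinP_pos
        have h6 : 0 ≤ y0 * ((w n0 0 - (w u 0 - -s * w u 2)) * (w v 2 - w u 2)) :=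
          mul_nonneg hy0.le (mul_nonneg (by linarith) (by linarith))
        nlinarith [mul_nonneg h5.le h6])
  -- the top edge
  have hzlr : w l 2 = w r 2 := le_antisymm (hrtop l hl) (hltop r hr)
  have hylr : w l 1 = w r 1 := by rw [hplane l hl, hplane r hr, hzlr]
  have hr0 : 0 < w r 2 := by
    obtain ⟨u, hu, h⟩ := htop
    exact h.trans_le (hrtop u hu)
  have hxlr : w l 0 ≤ w r 0 := hrmax l hl hzlr
  have hrat : ampRatio (w r) (c r) = ampRatio (w l) (c l) := by
    rcases hxlr.eq_or_lt with h | h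
    · have : l = r := hinj l hl r hr (by ext i; fin_cases i <;> assumption)
      rw [this]
    · have hER := hedge 0 1 l hl r hr (by simp) (Or.inl h.ne)
        (fun i hi => by linarith [hltop i hi]) (by rw [hzlr]; ring)
      obtain ⟨-, -, hrr⟩ := hstep l hl r hr (Or.inl h.ne) hER hPl hMl
      have hK : (spinK (w l) (w r)).arg = 0 := by
        refine arg_eq_zero_of_pos ((hL _ hl).re_spinK (hL _ hr)) ?_
        simp [spinK, spinQ, hzlr, hylr]; ring
      simpa [hK] using hrr
  -- The two ways from `n0` to the top must give the same amplitude ratio, so the total holonomy is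
  -- trivial.
  have hexp : Complex.exp (((4 * (Br - Bl) : ℝ) : ℂ) * Complex.I) = 1 := by
    rw [hratr, hratl, hr01] at hrat
    have h0 : ampRatio (w n0) (c n0) ≠ 0 := div_ne_zero hA0.2 hA0.1
    have h1 := mul_left_cancel₀ h0 hrat
    have : ((4 * (Br - Bl) : ℝ) : ℂ) * Complex.I =
        -(4 * (Bl : ℂ)) * Complex.I - -(4 * (Br : ℂ)) * Complex.I := by push_cast; ring
    rw [this, Complex.exp_sub, h1, div_self (Complex.exp_ne_zero _)]
  -- The direct phases compare strictly: moving in the positive x direction with the other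
  -- coordinates fixed decreases `spinP`, which increases the argument of `spinK` from bottom to
  -- top.
  have hlt : Bl < Br := by
    refine hBl2.trans_lt (lt_of_lt_of_le ?_ hBr1)
    have hargs0 := (hL _ hn0).abs_arg_spinK (hL _ hl)
    have hargs1 := (hL _ hn1).abs_arg_spinK (hL _ hr)
    have hp0 := (hL _ hn0).spinP_pos
    have hp1 := (hL _ hn1).spinP_pos
    have hpl := (hL _ hl).spinP_pos
    have hpr := (hL _ hr).spinP_pos
    have d1 := (spinP_anti (hL _ hn0) (hL _ hn1) (hplane0.trans hplane1.symm) (hz0.trans hz1.symm)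
      h01.le).2 h01
    have d2 := (spinP_anti (hL _ hl) (hL _ hr) hylr hzlr hxlr).1
    have h1 : ((1 : ℂ)).arg = 0 := Complex.arg_one
    have := lt_arg_add_of_im_pos (A := spinK (w n1) (w r)) (C := 1) (D := spinK (w n0) (w l)) ?_
      (by rw [h1]; linarith)
    · rwa [h1, add_zero] at this
    · simp [spinK, spinQ, hz0, hz1, hplane0, hplane1, hzlr, hylr]
      have hprod : spinP (w n1) * spinP (w r) < spinP (w n0) * spinP (w l) :=
        mul_lt_mul d1 d2 hpr hp0.le
      nlinarith [mul_pos (mul_pos hy0 hr0) (sub_pos.2 hprod)]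
  -- The total phase 4 (Br - Bl) thus lies strictly between 0 and 2π, contradicting the trivial
  -- holonomy.
  have hub : Br - Bl < Real.pi / 2 := by
    have := hBr2.1 hr0
    linarith [(hL _ hr).arg_le]
  exact exp_mul_I_ne_one (by linarith) (by linarith) hexp

/-! ### Convolution equations for modes on a line -/

section Line

variable {A B : ℝ → ℂ} {Θ : Finset ℝ} {n₀ n₁ n₂ : ℝ}

/-- Two points of the support of `B` whose sum is attained by no other pair have equal length. -/
theorem line_pair_eq
    (hBB : ∀ s, ∑ θ ∈ Θ, B θ * B (s - θ) * ((s - 2 * θ : ℝ) : ℂ) *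
      ((2 * n₀ + (s + 2 * (s - θ)) * n₁ + (s - θ) * s * n₂ : ℝ) : ℂ) = 0)
    (hBΘ : ∀ θ, B θ ≠ 0 → θ ∈ Θ) {t₁ t₂ : ℝ} (h12 : t₁ < t₂) (h1 : B t₁ ≠ 0) (h2 : B t₂ ≠ 0)
    (huniq : ∀ θ, B θ ≠ 0 → B (t₁ + t₂ - θ) ≠ 0 → θ = t₁ ∨ θ = t₂) :
    2 * n₁ + (t₁ + t₂) * n₂ = 0 := by
  have h := hBB (t₁ + t₂)
  rw [Finset.sum_eq_add_of_mem t₁ t₂ (hBΘ _ h1) (hBΘ _ h2) h12.ne] at h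
  · rw [show t₁ + t₂ - t₁ = t₂ by ring, show t₁ + t₂ - t₂ = t₁ by ring] at h
    have h3 : B t₁ * B t₂ * (((t₂ - t₁) ^ 2 * (2 * n₁ + (t₁ + t₂) * n₂) : ℝ) : ℂ) = 0 := by
      rw [← h]; push_cast; ring
    have h4 := (mul_eq_zero.1 h3).resolve_left (mul_ne_zero h1 h2)
    rw [Complex.ofReal_eq_zero] at h4
    exact (mul_eq_zero.1 h4).resolve_left (pow_ne_zero 2 (sub_ne_zero.2 h12.ne'))
  · intro θ _ hθ
    by_cases ha : B θ = 0
    · simp [ha]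
    by_cases hb : B (t₁ + t₂ - θ) = 0
    · simp [hb]
    rcases huniq θ ha hb with h | h
    · exact absurd h hθ.1
    · exact absurd h hθ.2

/-- If only the pair `x, u` reaches the frequency `x + u`, the convolution there has a single term.
-/
theorem line_cross_eq
    (hBA : ∀ s, ∑ θ ∈ Θ, B θ * A (s - θ) * ((s - 2 * θ : ℝ) : ℂ) = 0)
    {x u : ℝ} (hx : x ∈ Θ) (hxu : x ≠ u) (hBx : B x ≠ 0)
    (huniq : ∀ θ ∈ Θ, θ ≠ x → B θ ≠ 0 → A (x + u - θ) = 0) : A u = 0 := by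
  have h := hBA (x + u)
  rw [Finset.sum_eq_single_of_mem x hx] at h
  · rw [show x + u - x = u by ring] at h
    rcases mul_eq_zero.1 h with h | h
    · exact (mul_eq_zero.1 h).resolve_left hBx
    · rw [Complex.ofReal_eq_zero] at h
      exact absurd (by linarith) hxu
  · intro θ hθ hne
    by_cases hb : B θ = 0
    · simp [hb]
    · simp [huniq θ hθ hne hb]

/-- The one-dimensional analysis of the modes along an edge. -/
theorem line_dichotomy (hn₂ : 0 < n₂)
    (hBA : ∀ s, ∑ θ ∈ Θ, B θ * A (s - θ) * ((s - 2 * θ : ℝ) : ℂ) = 0)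
    (hBB : ∀ s, ∑ θ ∈ Θ, B θ * B (s - θ) * ((s - 2 * θ : ℝ) : ℂ) *
      ((2 * n₀ + (s + 2 * (s - θ)) * n₁ + (s - θ) * s * n₂ : ℝ) : ℂ) = 0)
    (hΘ : ∀ θ, θ ∈ Θ ↔ A θ ≠ 0 ∨ B θ ≠ 0) (h0 : (0 : ℝ) ∈ Θ) (h1 : (1 : ℝ) ∈ Θ) :
    (∀ θ, B θ = 0) ∨ ((∀ θ ∈ Θ, θ = 0 ∨ θ = 1) ∧ B 0 ≠ 0 ∧ B 1 ≠ 0 ∧ 2 * n₁ + n₂ = 0 ∧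
      A 0 * B 1 = A 1 * B 0) := by
  classical
  by_cases hB : ∀ θ, B θ = 0
  · exact Or.inl hB
  right
  push Not at hB
  have hBΘ : ∀ θ, B θ ≠ 0 → θ ∈ Θ := fun θ h => (hΘ θ).2 (Or.inr h)
  have hAΘ : ∀ θ, A θ ≠ 0 → θ ∈ Θ := fun θ h => (hΘ θ).2 (Or.inl h)
  set Q := Θ.filter fun θ => B θ ≠ 0 with hQ
  have memQ : ∀ θ, θ ∈ Q ↔ B θ ≠ 0 := fun θ => by
    simp only [hQ, Finset.mem_filter]; exact ⟨fun h => h.2, fun h => ⟨hBΘ _ h, h⟩⟩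
  have hQne : Q.Nonempty := hB.imp fun θ h => (memQ θ).2 h
  -- lowest and highest points
  obtain ⟨x, hx, hxmin⟩ := Finset.exists_min_image Q id hQne
  obtain ⟨y, hy, hymax⟩ := Finset.exists_max_image Q id hQne
  simp only [id] at hxmin hymax
  have hBx := (memQ x).1 hx
  have hBy := (memQ y).1 hy
  -- If `x` were the only point carrying `B`, any other mode `u` would meet `x` in an isolated sum,
  -- so `A u` would vanish as well.
  have hxy : x < y := by
    refine lt_of_le_of_ne (hxmin y hy) fun hxy => ?_
    have hsingle : ∀ θ, B θ ≠ 0 → θ = x := fun θ h =>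
      le_antisymm ((hymax θ ((memQ θ).2 h)).trans hxy.ge) (hxmin θ ((memQ θ).2 h))
    obtain ⟨u, hu, hux⟩ : ∃ u ∈ Θ, u ≠ x := by
      by_cases h : x = 0
      · exact ⟨1, h1, by rw [h]; exact one_ne_zero⟩
      · exact ⟨0, h0, Ne.symm h⟩
    have hAu : A u = 0 := line_cross_eq hBA (hBΘ x hBx) hux.symm hBx
      fun θ _ hne hb => absurd (hsingle θ hb) hne
    rcases (hΘ u).1 hu with h | h
    · exact h hAu
    · exact hux (hsingle u h)
  have hlow : ∃ t, x < t ∧ t ∈ Q ∧ (∀ θ ∈ Q, θ ≠ x → t ≤ θ) := by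
    obtain ⟨t, ht, htmin⟩ := Finset.exists_min_image (Q.erase x) id
      ⟨y, Finset.mem_erase.2 ⟨hxy.ne', hy⟩⟩
    rw [Finset.mem_erase] at ht
    exact ⟨t, lt_of_le_of_ne (hxmin t ht.2) ht.1.symm, ht.2,
      fun θ h hne => htmin θ (Finset.mem_erase.2 ⟨hne, h⟩)⟩
  have hhigh : ∃ t, t < y ∧ t ∈ Q ∧ (∀ θ ∈ Q, θ ≠ y → θ ≤ t) := by
    obtain ⟨t, ht, htmax⟩ := Finset.exists_max_image (Q.erase y) id
      ⟨x, Finset.mem_erase.2 ⟨hxy.ne, hx⟩⟩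
    rw [Finset.mem_erase] at ht
    exact ⟨t, lt_of_le_of_ne (hymax t ht.2) ht.1, ht.2,
      fun θ h hne => htmax θ (Finset.mem_erase.2 ⟨hne, h⟩)⟩
  obtain ⟨t, hxt, htQ, htmin⟩ := hlow
  obtain ⟨t', hty, htQ', htmax⟩ := hhigh
  have e1 : 2 * n₁ + (x + t) * n₂ = 0 := by
    refine line_pair_eq hBB hBΘ hxt hBx ((memQ t).1 htQ) fun θ ha hb => ?_
    by_contra! hne
    have := hxmin _ ((memQ _).2 hb)
    have := htmin θ ((memQ _).2 ha) hne.1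
    exact hne.2 (by linarith)
  have e2 : 2 * n₁ + (t' + y) * n₂ = 0 := by
    refine line_pair_eq hBB hBΘ hty ((memQ t').1 htQ') hBy fun θ ha hb => ?_
    by_contra! hne
    have := hymax _ ((memQ _).2 hb)
    have := htmax θ ((memQ _).2 ha) hne.2
    exact hne.1 (by linarith)
  -- Two points of the line with equal length have a fixed midpoint, the foot of the perpendicular.
  -- The lowest pair and the highest pair share it, so they coincide and `B` lives on exactly two
  -- points.
  have e3 : x + t = t' + y := by
    have : (x + t - (t' + y)) * n₂ = 0 := by linarith
    have := (mul_eq_zero.1 this).resolve_right hn₂.ne'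
    linarith
  have hty' : t ≤ y := htmin y hy hxy.ne'
  have hxt' : x ≤ t' := hxmin t' htQ'
  have hteq : t = y := by linarith
  have htwo : ∀ θ, B θ ≠ 0 → θ = x ∨ θ = y := by
    intro θ h
    by_contra! hne
    have := htmin θ ((memQ _).2 h) hne.1
    exact hne.2 (le_antisymm (hymax θ ((memQ _).2 h)) (hteq ▸ this))
  rw [hteq] at e1
  -- no further points
  have hall : ∀ θ ∈ Θ, θ = x ∨ θ = y := by
    by_contra! hcon
    obtain ⟨u₀, hu₀, hu₀x, hu₀y⟩ := hcon
    set U := (Θ.erase x).erase y with hU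
    have memU : ∀ θ, θ ∈ U ↔ θ ≠ y ∧ θ ≠ x ∧ θ ∈ Θ := by simp [hU]
    have hAU : ∀ u ∈ U, A u ≠ 0 := by
      intro u hu hA
      obtain ⟨k1, k2, k3⟩ := (memU u).1 hu
      rcases (hΘ u).1 k3 with h | h
      · exact h hA
      · rcases htwo u h with h | h
        · exact k2 h
        · exact k1 h
    have hUne : U.Nonempty := ⟨u₀, (memU u₀).2 ⟨hu₀y, hu₀x, hu₀⟩⟩
    -- An extreme further mode `u` is paired with `x` or `y`. The one competing pair involves a
    -- point beyond all of `U` and different from `x` and `y`, hence outside the support, so `A u`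
    -- would vanish.
    by_cases hlow : ∃ u ∈ U, u < y
    · obtain ⟨u', hu', hu'y⟩ := hlow
      obtain ⟨u, hu, humin⟩ := Finset.exists_min_image U id hUne
      have huy : u < y := (humin u' hu').trans_lt hu'y
      refine hAU u hu (line_cross_eq hBA (hBΘ x hBx) ((memU u).1 hu).2.1.symm hBx
        fun θ _ hne hb => ?_)
      rw [(htwo θ hb).resolve_left hne]
      by_contra hA
      have hv := hAΘ _ hA
      by_cases hvU : x + u - y ∈ U
      · have := humin _ hvU
        simp only [id] at this
        linarith
      · rw [memU] at hvU
        have : x + u - y ≠ y := by linarith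
        have : x + u - y ≠ x := by intro h; linarith
        tauto
    · push Not at hlow
      obtain ⟨u, hu, humax⟩ := Finset.exists_max_image U id hUne
      have huy := hlow u hu
      refine hAU u hu (line_cross_eq hBA (hBΘ y hBy) ((memU u).1 hu).1.symm hBy
        fun θ _ hne hb => ?_)
      rw [(htwo θ hb).resolve_right hne]
      by_contra hA
      have hv := hAΘ _ hA
      by_cases hvU : y + u - x ∈ U
      · have := humax _ hvU
        simp only [id] at this
        linarith
      · rw [memU] at hvU
        have : y + u - x ≠ y := by intro h; linarith
        have : y + u - x ≠ x := by intro h; linarith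
        tauto
  have hx0 : x = 0 ∧ y = 1 := by
    rcases hall 0 h0 with h | h <;> rcases hall 1 h1 with h' | h'
    · linarith
    · exact ⟨h.symm, h'.symm⟩
    · linarith
    · linarith
  obtain ⟨rfl, rfl⟩ := hx0
  refine ⟨hall, hBx, hBy, by linarith, ?_⟩
  have h := hBA 1
  rw [Finset.sum_eq_add_of_mem 0 1 h0 h1 zero_ne_one
    (fun θ hθ hne => absurd (hall θ hθ) (by tauto))] at h
  norm_num at h
  linear_combination -h

end Line

/-! ### The nonlinearity in a plane, and modes on an exposed edge -/

/-- The Fourier coefficient at `n` of `-i (v · ∇) v`. -/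
def nl (c : R3 →₀ C3) (n : R3) : C3 := ∑ a ∈ c.support, (c a ⬝ᵥ toC n) • c (n - a)

/-- No energy is transferred to frequencies outside of the Fourier support. -/
def ClosedModes (c : R3 →₀ C3) : Prop := ∀ p, p ≠ 0 → p ∉ c.support → ∃ γ : ℂ, nl c p = γ • toC p

theorem toC_add (a b : R3) : toC (a + b) = toC a + toC b := by ext; simp [toC]

theorem toC_sub (a b : R3) : toC (a - b) = toC a - toC b := by ext; simp [toC]

theorem toC_neg (a : R3) : toC (-a) = -toC a := by ext; simp [toC]

theorem toC_smul (r : ℝ) (a : R3) : toC (r • a) = (r : ℂ) • toC a := by ext; simp [toC]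

theorem toC_zero : toC 0 = 0 := by ext; simp [toC]

theorem toC_injective : Function.Injective toC := fun a b h => by
  ext i; simpa [toC] using congrFun h i

theorem toC_dot (a b : R3) : toC a ⬝ᵥ toC b = ((a ⬝ᵥ b : ℝ) : ℂ) := by
  simp [toC, dotProduct]

theorem toC_cross (a b : R3) : toC (crossProduct a b) = crossProduct (toC a) (toC b) := by
  simp only [cross_apply]
  ext i; fin_cases i <;> simp [toC]

theorem dot_self_pos {a : R3} (h : a ≠ 0) : 0 < a ⬝ᵥ a := by
  have h1 : 0 ≤ a ⬝ᵥ a := by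
    simp only [dotProduct, Fin.sum_univ_three]
    nlinarith [mul_self_nonneg (a 0), mul_self_nonneg (a 1), mul_self_nonneg (a 2)]
  exact lt_of_le_of_ne h1 fun h0 => h (dotProduct_self_eq_zero.1 h0.symm)

/-- Signed area in the plane with normal `e`. -/
def det (e a b : R3) : ℝ := e ⬝ᵥ crossProduct a b

theorem det_add_left (e a b c : R3) : det e (a + b) c = det e a c + det e b c := by
  simp [det]

theorem det_add_right (e a b c : R3) : det e a (b + c) = det e a b + det e a c := by
  simp [det]

theorem det_sub_right (e a b c : R3) : det e a (b - c) = det e a b - det e a c := by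
  simp [det]

theorem det_smul_left (e a b : R3) (r : ℝ) : det e (r • a) b = r * det e a b := by
  simp [det]

theorem det_smul_right (e a b : R3) (r : ℝ) : det e a (r • b) = r * det e a b := by
  simp [det]

theorem det_self (e a : R3) : det e a a = 0 := by simp [det]

theorem det_neg_left (e a b : R3) : det e (-a) b = -det e a b := by
  simp only [det, map_neg, LinearMap.neg_apply, dotProduct_neg]

theorem det_neg_right (e a b : R3) : det e a (-b) = -det e a b := by
  simp only [det, map_neg, dotProduct_neg]

theorem det_swap (e a b : R3) : det e a b = -det e b a := by
  simp only [det]; rw [← cross_anticomm, dotProduct_neg]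

/-- Component of the mode `c a` along `e`. -/
def perpCoeff (e : R3) (c : R3 →₀ C3) (a : R3) : ℂ := c a ⬝ᵥ toC e

/-- Component of the mode `c a` along `e × a`. -/
def parCoeff (e : R3) (c : R3 →₀ C3) (a : R3) : ℂ :=
  (c a ⬝ᵥ toC (crossProduct e a)) / ((a ⬝ᵥ a : ℝ) : ℂ)

theorem mode_expand_aux (e0 e1 e2 a0 a1 a2 v0 v1 v2 : ℂ) (he : e0 * e0 + e1 * e1 + e2 * e2 = 1)
    (hea : e0 * a0 + e1 * a1 + e2 * a2 = 0) (hv : v0 * a0 + v1 * a1 + v2 * a2 = 0) :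
    (a0 * a0 + a1 * a1 + a2 * a2) * v0 =
      (a0 * a0 + a1 * a1 + a2 * a2) * (v0 * e0 + v1 * e1 + v2 * e2) * e0 +
      (v0 * (e1 * a2 - e2 * a1) + v1 * (e2 * a0 - e0 * a2) + v2 * (e0 * a1 - e1 * a0)) *
        (e1 * a2 - e2 * a1) := by
  grind

theorem mode_expand {e a : R3} {v : C3} (he : e ⬝ᵥ e = 1) (hea : e ⬝ᵥ a = 0) (ha : a ≠ 0)
    (hv : v ⬝ᵥ toC a = 0) :
    v = (v ⬝ᵥ toC e) • toC e +
      ((v ⬝ᵥ toC (crossProduct e a)) / ((a ⬝ᵥ a : ℝ) : ℂ)) • toC (crossProduct e a) := by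
  have h0 : ((a ⬝ᵥ a : ℝ) : ℂ) ≠ 0 := by exact_mod_cast (dot_self_pos ha).ne'
  have key : ((a ⬝ᵥ a : ℝ) : ℂ) • v = ((a ⬝ᵥ a : ℝ) : ℂ) • ((v ⬝ᵥ toC e) • toC e) +
      (v ⬝ᵥ toC (crossProduct e a)) • toC (crossProduct e a) := by
    have k1 : toC e ⬝ᵥ toC e = 1 := by rw [toC_dot, he]; simp
    have k2 : toC e ⬝ᵥ toC a = 0 := by rw [toC_dot, hea]; simp
    rw [← toC_dot, toC_cross]
    generalize toC e = E at *
    generalize toC a = A at *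
    simp only [dotProduct, Fin.sum_univ_three, cross_apply] at *
    ext i
    fin_cases i
    · simpa [mul_assoc] using mode_expand_aux (E 0) (E 1) (E 2) (A 0) (A 1) (A 2) (v 0) (v 1) (v 2) k1 k2 hv
    · have := mode_expand_aux (E 1) (E 2) (E 0) (A 1) (A 2) (A 0) (v 1) (v 2) (v 0)
        (by linear_combination k1) (by linear_combination k2) (by linear_combination hv)
      simp; linear_combination this
    · have := mode_expand_aux (E 2) (E 0) (E 1) (A 2) (A 0) (A 1) (v 2) (v 0) (v 1)
        (by linear_combination k1) (by linear_combination k2) (by linear_combination hv)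
      simp; linear_combination this
  have := congrArg (fun x => ((a ⬝ᵥ a : ℝ) : ℂ)⁻¹ • x) key
  simp only [smul_add, smul_smul, inv_mul_cancel₀ h0, one_smul, inv_mul_cancel_left₀ h0] at this
  rwa [← div_eq_inv_mul] at this

theorem cross_dot_toC (e a p : R3) : toC (crossProduct e a) ⬝ᵥ toC p = (det e a p : ℂ) := by
  rw [toC_dot, dotProduct_comm, triple_product_permutation, det]

theorem cross_dot_cross_unit {e a b : R3} (he : e ⬝ᵥ e = 1) (ha : e ⬝ᵥ a = 0) :
    crossProduct e a ⬝ᵥ crossProduct e b = a ⬝ᵥ b := by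
  rw [cross_dot_cross, he, dotProduct_comm a e, ha]; ring

theorem dot_toC_of_expand {e a p : R3} {v : C3} (he : e ⬝ᵥ e = 1) (hea : e ⬝ᵥ a = 0)
    (hep : e ⬝ᵥ p = 0) (hv : v ⬝ᵥ toC a = 0) (h0 : a = 0 → v = 0) :
    v ⬝ᵥ toC p = (v ⬝ᵥ toC (crossProduct e a)) / ((a ⬝ᵥ a : ℝ) : ℂ) * det e a p ∧
    v ⬝ᵥ toC (crossProduct e p) =
      (v ⬝ᵥ toC (crossProduct e a)) / ((a ⬝ᵥ a : ℝ) : ℂ) * ((a ⬝ᵥ p : ℝ) : ℂ) := by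
  by_cases ha : a = 0
  · simp [h0 ha]
  constructor
  · conv_lhs => rw [mode_expand he hea ha hv]
    rw [add_dotProduct, smul_dotProduct, smul_dotProduct, cross_dot_toC, toC_dot, hep]
    simp
  · conv_lhs => rw [mode_expand he hea ha hv]
    rw [add_dotProduct, smul_dotProduct, smul_dotProduct, toC_dot, toC_dot,
      cross_dot_cross_unit he hea, dot_self_cross]
    simp

/-- Components of the nonlinearity at a frequency whose decompositions all lie in one plane. -/
theorem nl_planar {e p : R3} {c : R3 →₀ C3} (he : e ⬝ᵥ e = 1) (hep : e ⬝ᵥ p = 0) (hc0 : c 0 = 0)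
    (hdiv : ∀ n, c n ⬝ᵥ toC n = 0)
    (hpl : ∀ a ∈ c.support, p - a ∈ c.support → e ⬝ᵥ a = 0) :
    nl c p ⬝ᵥ toC e =
        ∑ a ∈ c.support, parCoeff e c a * perpCoeff e c (p - a) * (det e a p : ℂ) ∧
      nl c p ⬝ᵥ toC (crossProduct e p) = ∑ a ∈ c.support,
        parCoeff e c a * parCoeff e c (p - a) * (det e a p : ℂ) * (((p - a) ⬝ᵥ p : ℝ) : ℂ) := by
  rw [nl, sum_dotProduct, sum_dotProduct]
  constructor
  all_goals
    refine Finset.sum_congr rfl fun a ha => ?_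
    by_cases hb : p - a ∈ c.support
    · have hea := hpl a ha hb
      have heb : e ⬝ᵥ (p - a) = 0 := by rw [dotProduct_sub, hep, hea, sub_zero]
      have h1 := dot_toC_of_expand he hea hep (hdiv a) (fun h => h ▸ hc0)
      have h2 := dot_toC_of_expand he heb hep (hdiv (p - a)) (fun h => h ▸ hc0)
      rw [smul_dotProduct, h1.1, smul_eq_mul]
      first
        | (simp only [parCoeff, perpCoeff]; ring1)
        | (rw [h2.2]; simp only [parCoeff]; ring1)
    · simp [parCoeff, perpCoeff, Finsupp.notMem_support_iff.1 hb]

theorem smul_toC_dot_zero {v : C3} {e p : R3} (hep : e ⬝ᵥ p = 0) (h : ∃ γ : ℂ, v = γ • toC p) :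
    v ⬝ᵥ toC e = 0 ∧ v ⬝ᵥ toC (crossProduct e p) = 0 := by
  obtain ⟨γ, rfl⟩ := h
  rw [smul_dotProduct, smul_dotProduct, toC_dot, toC_dot, dotProduct_comm p e, hep, dot_cross_self]
  simp

theorem exists_unit_normal {w z : R3} (h : crossProduct w z ≠ 0) :
    ∃ e : R3, e ⬝ᵥ e = 1 ∧ e ⬝ᵥ w = 0 ∧ e ⬝ᵥ z = 0 ∧
      crossProduct w z = det e w z • e ∧ 0 < det e w z := by
  set m := crossProduct w z with hm
  have hpos := dot_self_pos h
  have hs : 0 < √(m ⬝ᵥ m) := Real.sqrt_pos.2 hpos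
  have hss : √(m ⬝ᵥ m) * √(m ⬝ᵥ m) = m ⬝ᵥ m := Real.mul_self_sqrt hpos.le
  have hd : det ((√(m ⬝ᵥ m))⁻¹ • m) w z = √(m ⬝ᵥ m) := by
    rw [det, smul_dotProduct, ← hm]
    nth_rw 2 [← hss]
    simp [hs.ne']
  have hw : m ⬝ᵥ w = 0 := by rw [hm, dotProduct_comm, dot_self_cross]
  have hz : m ⬝ᵥ z = 0 := by rw [hm, dotProduct_comm, dot_cross_self]
  generalize √(m ⬝ᵥ m) = s at *
  refine ⟨s⁻¹ • m, ?_, ?_, ?_, ?_, ?_⟩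
  · rw [smul_dotProduct, dotProduct_smul, ← hss]
    simp only [smul_eq_mul]
    field_simp
  · rw [smul_dotProduct, hw, smul_zero]
  · rw [smul_dotProduct, hz, smul_zero]
  · rw [hd, smul_smul, mul_inv_cancel₀ hs.ne', one_smul]
  · rw [hd]; exact hs

theorem parallel_of_cross_eq_zero {w z : R3} (h : crossProduct w z = 0) :
    (w ⬝ᵥ w) • z = (w ⬝ᵥ z) • w := by
  have h0 := congrFun h 0
  have h1 := congrFun h 1
  have h2 := congrFun h 2
  simp only [cross_apply] at h0 h1 h2
  simp at h0 h1 h2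
  ext i
  simp only [dotProduct, Fin.sum_univ_three, Pi.smul_apply, smul_eq_mul]
  fin_cases i
  · simp; linear_combination w 2 * h1 - w 1 * h2
  · simp; linear_combination w 0 * h2 - w 2 * h0
  · simp; linear_combination w 1 * h0 - w 0 * h1

theorem cross_ne_zero_of_level {ν w z : R3} {s : ℝ} (hs : s ≠ 0) (hw : ν ⬝ᵥ w = s) (hz : ν ⬝ᵥ z = s)
    (hne : w ≠ z) : crossProduct w z ≠ 0 := by
  intro h
  have h1 := parallel_of_cross_eq_zero h
  have hw0 : w ≠ 0 := by rintro rfl; simp at hw; exact hs hw.symm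
  have h2 := congrArg (fun x => ν ⬝ᵥ x) h1
  simp only [dotProduct_smul, hw, hz, smul_eq_mul] at h2
  have h3 := mul_right_cancel₀ hs h2
  rw [← h3] at h1
  exact hne (smul_right_injective _ (dot_self_pos hw0).ne' h1).symm

/-- The segment from `w` to `z` is cut out from the finite set `S` by the functional `ν ≤ 1`
and then by `α ≤ M` on the face `ν = 1`. -/
structure ExposedEdge (S : Finset R3) (ν α : R3) (M : ℝ) (w z : R3) : Prop where
  le : ∀ x ∈ S, ν ⬝ᵥ x ≤ 1
  le' : ∀ x ∈ S, ν ⬝ᵥ x = 1 → α ⬝ᵥ x ≤ M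
  left_mem : w ∈ S
  right_mem : z ∈ S
  left : ν ⬝ᵥ w = 1
  left' : α ⬝ᵥ w = M
  right : ν ⬝ᵥ z = 1
  right' : α ⬝ᵥ z = M
  ne : w ≠ z
  segment : ∀ x ∈ S, ν ⬝ᵥ x = 1 → α ⬝ᵥ x = M → ∃ θ : ℝ, x = w + θ • (z - w)

namespace ExposedEdge

variable {S : Finset R3} {ν α : R3} {M : ℝ} {w z : R3} (E : ExposedEdge S ν α M w z)
include E

theorem cross_ne_zero : crossProduct w z ≠ 0 :=
  cross_ne_zero_of_level one_ne_zero E.left E.right E.ne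

/-- Two points of `S` adding up to twice a point of the edge line lie on the edge. -/
theorem mem_of_add {a b : R3} (ha : a ∈ S) (hb : b ∈ S) (h1 : ν ⬝ᵥ (a + b) = 2)
    (h2 : α ⬝ᵥ (a + b) = 2 * M) : ∃ θ : ℝ, a = w + θ • (z - w) := by
  rw [dotProduct_add] at h1 h2
  have e1 := E.le a ha
  have e2 := E.le b hb
  have f1 : ν ⬝ᵥ a = 1 := by linarith
  have f2 : ν ⬝ᵥ b = 1 := by linarith
  have g1 := E.le' a ha f1
  have g2 := E.le' b hb f2
  exact E.segment a ha f1 (by linarith)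

end ExposedEdge

/-- Sums of two points of the edge line have level 2 under `ν`, so they lie outside the support, and
by exposedness all their decompositions stay on the edge. Closure at these frequencies yields the
equations of `line_dichotomy`, with `A` the component along the normal of the plane of `w, z` and
`B` the component in that plane. -/
theorem edge_modes {c : R3 →₀ C3} {ν α : R3} {M : ℝ} {w z : R3}
    (E : ExposedEdge c.support ν α M w z) (hc0 : c 0 = 0) (hdiv : ∀ n, c n ⬝ᵥ toC n = 0)
    (hcl : ClosedModes c) :
    ∃ e : R3, e ⬝ᵥ e = 1 ∧ e ⬝ᵥ w = 0 ∧ e ⬝ᵥ z = 0 ∧ crossProduct w z = det e w z • e ∧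
      ((parCoeff e c w = 0 ∧ parCoeff e c z = 0) ∨
        ((∀ x ∈ c.support, ν ⬝ᵥ x = 1 → α ⬝ᵥ x = M → x = w ∨ x = z) ∧
          parCoeff e c w ≠ 0 ∧ parCoeff e c z ≠ 0 ∧ w ⬝ᵥ w = z ⬝ᵥ z ∧
          perpCoeff e c w * parCoeff e c z = perpCoeff e c z * parCoeff e c w)) := by
  obtain ⟨e, he, hew, hez, hcr, hD⟩ := exists_unit_normal E.cross_ne_zero
  refine ⟨e, he, hew, hez, hcr, ?_⟩
  set d := z - w with hd
  have hed : e ⬝ᵥ d = 0 := by rw [hd, dotProduct_sub, hew, hez, sub_zero]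
  have hd0 : d ≠ 0 := sub_ne_zero.2 E.ne.symm
  have hνd : ν ⬝ᵥ d = 0 := by rw [hd, dotProduct_sub, E.left, E.right, sub_self]
  have hαd : α ⬝ᵥ d = 0 := by rw [hd, dotProduct_sub, E.left', E.right', sub_self]
  have hwd : det e w d = det e w z := by rw [hd, det_sub_right, det_self, sub_zero]
  set f : ℝ → R3 := fun θ => w + θ • d with hf
  have hfinj : Function.Injective f := fun a b h => by
    have : a • d = b • d := by simpa [hf] using h
    exact smul_left_injective ℝ hd0 this
  set Θ := c.support.preimage f hfinj.injOn with hΘ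
  have hne0 : ∀ θ, f θ ≠ 0 := fun θ h => by
    have := congrArg (fun x => ν ⬝ᵥ x) h
    simp [hf, dotProduct_add, E.left, hνd] at this
  have hef : ∀ θ, e ⬝ᵥ f θ = 0 := fun θ => by simp [hf, dotProduct_add, hew, hed]
  have hp0 : ∀ s : ℝ, w + f s ≠ 0 := fun s h => by
    have := congrArg (fun x => ν ⬝ᵥ x) h
    simp [hf, dotProduct_add, E.left, hνd] at this
  have hνp : ∀ s, ν ⬝ᵥ (w + f s) = 2 := fun s => by
    simp [hf, dotProduct_add, E.left, hνd]; norm_num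
  have hαp : ∀ s, α ⬝ᵥ (w + f s) = 2 * M := fun s => by
    simp [hf, dotProduct_add, E.left', hαd, two_mul]
  have hpS : ∀ s, w + f s ∉ c.support := fun s h => by
    have := E.le _ h
    rw [hνp] at this; norm_num at this
  have hmem : ∀ s, ∀ a ∈ c.support, w + f s - a ∈ c.support → ∃ θ, a = f θ := fun s a ha hb =>
    E.mem_of_add ha hb (by rw [add_sub_cancel]; exact hνp s) (by rw [add_sub_cancel]; exact hαp s)
  have hsub : ∀ s θ, w + f s - f θ = f (s - θ) := fun s θ => by
    simp only [hf, sub_smul]; abel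
  -- Source of the factor `s - 2 * θ` in the line equations; the positive area `det e w z` is
  -- divided out.
  have hdet : ∀ s θ, det e (f θ) (w + f s) = (s - 2 * θ) * det e w z := fun s θ => by
    simp only [hf, det_add_left, det_add_right, det_smul_left, det_smul_right, det_self,
      det_swap e d w, hwd]
    ring
  have hDc : (det e w z : ℂ) ≠ 0 := by exact_mod_cast hD.ne'
  have hmain : ∀ s, (∑ θ ∈ Θ, parCoeff e c (f θ) * perpCoeff e c (f (s - θ)) *
        ((s - 2 * θ : ℝ) : ℂ) = 0) ∧
      ∑ θ ∈ Θ, parCoeff e c (f θ) * parCoeff e c (f (s - θ)) * ((s - 2 * θ : ℝ) : ℂ) *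
        ((2 * (w ⬝ᵥ w) + (s + 2 * (s - θ)) * (w ⬝ᵥ d) + (s - θ) * s * (d ⬝ᵥ d) : ℝ) : ℂ) = 0 := by
    intro s
    have hep : e ⬝ᵥ (w + f s) = 0 := by rw [dotProduct_add, hew, hef, add_zero]
    have hnl := nl_planar he hep hc0 hdiv (fun a ha hb => by
      obtain ⟨θ, rfl⟩ := hmem s a ha hb
      exact hef θ)
    have hz := smul_toC_dot_zero hep (hcl _ (hp0 s) (hpS s))
    rw [hnl.1, hnl.2] at hz
    have hconv : ∀ F : R3 → ℂ, (∀ a, w + f s - a ∉ c.support → F a = 0) →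
        ∑ θ ∈ Θ, F (f θ) = ∑ a ∈ c.support, F a := by
      intro F hF
      refine Finset.sum_preimage f c.support hfinj.injOn F fun a ha hr => hF a fun hb => hr ?_
      obtain ⟨θ, hθ⟩ := hmem s a ha hb
      exact ⟨θ, hθ.symm⟩
    constructor
    · have h := hz.1
      rw [← hconv _ (fun a ha => by simp [perpCoeff, Finsupp.notMem_support_iff.1 ha])] at h
      refine mul_right_cancel₀ hDc ?_
      rw [zero_mul, Finset.sum_mul, ← h]
      refine Finset.sum_congr rfl fun θ _ => ?_
      rw [hsub, hdet]; push_cast; ring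
    · have h := hz.2
      rw [← hconv _ (fun a ha => by simp [parCoeff, Finsupp.notMem_support_iff.1 ha])] at h
      refine mul_right_cancel₀ hDc ?_
      rw [zero_mul, Finset.sum_mul, ← h]
      refine Finset.sum_congr rfl fun θ _ => ?_
      have : f (s - θ) ⬝ᵥ (w + f s) =
          2 * (w ⬝ᵥ w) + (s + 2 * (s - θ)) * (w ⬝ᵥ d) + (s - θ) * s * (d ⬝ᵥ d) := by
        simp only [hf, add_dotProduct, dotProduct_add, smul_dotProduct, dotProduct_smul,
          smul_eq_mul, dotProduct_comm d w]
        ring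
      rw [hsub, hdet, this]; push_cast; ring
  have hΘiff : ∀ θ, θ ∈ Θ ↔ perpCoeff e c (f θ) ≠ 0 ∨ parCoeff e c (f θ) ≠ 0 := by
    intro θ
    rw [hΘ, Finset.mem_preimage, Finsupp.mem_support_iff]
    constructor
    · intro h
      by_contra! hcon
      have := mode_expand he (hef θ) (hne0 θ) (hdiv (f θ))
      apply h
      rw [this]
      change perpCoeff e c (f θ) • _ + parCoeff e c (f θ) • _ = 0
      rw [hcon.1, hcon.2]; simp
    · rintro h h0
      rcases h with h | h
      · exact h (by simp [perpCoeff, h0])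
      · exact h (by simp [parCoeff, h0])
  have hf0 : f 0 = w := by simp [hf]
  have hf1 : f 1 = z := by simp [hf, hd]
  have h0 : (0 : ℝ) ∈ Θ := by rw [hΘ, Finset.mem_preimage, hf0]; exact E.left_mem
  have h1 : (1 : ℝ) ∈ Θ := by rw [hΘ, Finset.mem_preimage, hf1]; exact E.right_mem
  rcases line_dichotomy (A := fun θ => perpCoeff e c (f θ)) (B := fun θ => parCoeff e c (f θ))
    (dot_self_pos hd0) (fun s => (hmain s).1) (fun s => (hmain s).2) hΘiff h0 h1 with h | h
  · left
    have k0 := h 0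
    have k1 := h 1
    simp only [hf0, hf1] at k0 k1
    exact ⟨k0, k1⟩
  · right
    simp only [hf0, hf1] at h
    obtain ⟨k1, k2, k3, k4, k5⟩ := h
    refine ⟨fun x hx hν hα => ?_, k2, k3, ?_, k5⟩
    · obtain ⟨θ, hθ⟩ := E.segment x hx hν hα
      have hθ' : x = f θ := hθ
      rcases k1 θ (by rw [hΘ, Finset.mem_preimage, ← hθ']; exact hx) with h | h
      · left; rw [hθ', h, hf0]
      · right; rw [hθ', h, hf1]
    · have : z = w + d := by simp [hd]
      rw [this]
      simp only [add_dotProduct, dotProduct_add, dotProduct_comm d w]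
      linarith

/-- If the in-plane components vanish, both products in the relation are zero. Otherwise the ends
have equal length and proportional components, and the two products cancel. -/
theorem edgeRel_of_exposed {c : R3 →₀ C3} {ν α : R3} {M : ℝ} {w z : R3}
    (E : ExposedEdge c.support ν α M w z) (hc0 : c 0 = 0) (hdiv : ∀ n, c n ⬝ᵥ toC n = 0)
    (hcl : ClosedModes c) : EdgeRel w z (c w) (c z) := by
  obtain ⟨e, he, hew, hez, hcr, h⟩ := edge_modes E hc0 hdiv hcl
  have k1 := dot_toC_of_expand he hew hez (hdiv w) (fun h => h ▸ hc0)
  have k2 := dot_toC_of_expand he hez hew (hdiv z) (fun h => h ▸ hc0)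
  have k1' : c w ⬝ᵥ toC z = parCoeff e c w * det e w z := k1.1
  have k2' : c z ⬝ᵥ toC w = parCoeff e c z * det e z w := k2.1
  rw [EdgeRel, hcr, toC_smul, dotProduct_smul, dotProduct_smul, k1', k2', det_swap e z w]
  change (_ • perpCoeff e c w) * _ * _ + (_ • perpCoeff e c z) * _ * _ = 0
  rcases h with h | ⟨-, -, -, h1, h2⟩
  · rw [h.1, h.2]; simp
  · have : len w = len z := by rw [len, len, h1]
    rw [this]
    push_cast
    simp only [smul_eq_mul]
    linear_combination (-(det e w z : ℂ) ^ 2 * len z) * h2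

/-- The field `c` is an eigenvector of the curl at the frequency `n`, with eigenvalue `μ`. -/
def HelicalAt (μ : ℝ) (c : R3 →₀ C3) (n : R3) : Prop :=
  Complex.I • crossProduct (toC n) (c n) = (μ : ℂ) • c n

theorem helical_of_coeff {e n : R3} {c : R3 →₀ C3} {μ : ℝ} (he : e ⬝ᵥ e = 1) (hen : e ⬝ᵥ n = 0)
    (hn : n ≠ 0) (hdiv : c n ⬝ᵥ toC n = 0)
    (h1 : (μ : ℂ) * parCoeff e c n = -(Complex.I * perpCoeff e c n))
    (h2 : (μ : ℂ) * perpCoeff e c n = Complex.I * parCoeff e c n * ((n ⬝ᵥ n : ℝ) : ℂ)) :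
    HelicalAt μ c n := by
  have hx : c n = perpCoeff e c n • toC e + parCoeff e c n • toC (crossProduct e n) :=
    mode_expand he hen hn hdiv
  have c1 : crossProduct (toC n) (toC e) = -toC (crossProduct e n) := by
    rw [toC_cross, cross_anticomm]
  have c2 : crossProduct (toC n) (toC (crossProduct e n)) = ((n ⬝ᵥ n : ℝ) : ℂ) • toC e := by
    rw [← toC_cross, cross_cross_eq_smul_sub_smul', hen, zero_smul, sub_zero,
      toC_smul]
  rw [HelicalAt, hx, map_add, map_smul, map_smul, c1, c2, smul_add, smul_smul, smul_neg, smul_smul,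
    smul_add, smul_smul, smul_smul, h2, smul_smul, h1, neg_smul, add_comm]

/-- If one end of an edge is isotropic then the edge consists of its two ends, and both are
helical with the same eigenvalue. -/
theorem helical_edge {c : R3 →₀ C3} {ν α : R3} {M : ℝ} {w z : R3}
    (E : ExposedEdge c.support ν α M w z) (hc0 : c 0 = 0) (hdiv : ∀ n, c n ⬝ᵥ toC n = 0)
    (hcl : ClosedModes c) (hiso : c w ⬝ᵥ c w = 0) :
    (∀ x ∈ c.support, ν ⬝ᵥ x = 1 → α ⬝ᵥ x = M → x = w ∨ x = z) ∧ c z ⬝ᵥ c z = 0 ∧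
      ∃ μ : ℝ, μ ≠ 0 ∧ HelicalAt μ c w ∧ HelicalAt μ c z := by
  obtain ⟨e, he, hew, hez, hcr, h⟩ := edge_modes E hc0 hdiv hcl
  have hw0 : w ≠ 0 := by rintro rfl; have := E.left; simp at this
  have hz0 : z ≠ 0 := by rintro rfl; have := E.right; simp at this
  have hsq : ∀ n : R3, n ≠ 0 → e ⬝ᵥ n = 0 → c n ⬝ᵥ c n =
      perpCoeff e c n ^ 2 + parCoeff e c n ^ 2 * ((n ⬝ᵥ n : ℝ) : ℂ) := by
    intro n hn hen
    have hx : c n = perpCoeff e c n • toC e + parCoeff e c n • toC (crossProduct e n) :=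
      mode_expand he hen hn (hdiv n)
    have k1 : toC e ⬝ᵥ toC (crossProduct e n) = 0 := by rw [toC_dot, dot_self_cross]; simp
    rw [hx]
    simp only [add_dotProduct, dotProduct_add, smul_dotProduct, dotProduct_smul, k1,
      dotProduct_comm (toC (crossProduct e n)) (toC e)]
    rw [toC_dot, toC_dot, cross_dot_cross_unit he hen, he]
    simp; ring
  have hi := hsq w hw0 hew
  rw [hiso] at hi
  -- Without in-plane components isotropy would annihilate the normal one too, so the edge has just
  -- two modes. Both have the same ratio τ of normal to in-plane component; isotropy gives τ² =
  -- -|w|², and -iτ = ±|w| is the eigenvalue.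
  rcases h with h | ⟨h1, h2, h3, h4, h5⟩
  · exfalso
    rw [h.1] at hi
    have hα : perpCoeff e c w = 0 := by
      have : perpCoeff e c w ^ 2 = 0 := by linear_combination -hi
      exact pow_eq_zero_iff two_ne_zero |>.1 this
    have hx : c w = perpCoeff e c w • toC e + parCoeff e c w • toC (crossProduct e w) :=
      mode_expand he hew hw0 (hdiv w)
    rw [hα, h.1] at hx
    have := Finsupp.mem_support_iff.1 E.left_mem
    simp at hx
    exact this hx
  · have hR : 0 < w ⬝ᵥ w := dot_self_pos hw0
    set τ := perpCoeff e c w / parCoeff e c w with hτ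
    have e1 : perpCoeff e c w = τ * parCoeff e c w := by rw [hτ]; field_simp
    have e2 : perpCoeff e c z = τ * parCoeff e c z := by
      rw [hτ]; field_simp; linear_combination -h5
    have hτ2 : τ ^ 2 = -((w ⬝ᵥ w : ℝ) : ℂ) := by
      rw [e1] at hi
      have : parCoeff e c w ^ 2 * (τ ^ 2 + ((w ⬝ᵥ w : ℝ) : ℂ)) = 0 := by linear_combination -hi
      have := (mul_eq_zero.1 this).resolve_left (pow_ne_zero 2 h2)
      linear_combination this
    have hlen : (len w : ℂ) ^ 2 = ((w ⬝ᵥ w : ℝ) : ℂ) := by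
      rw [← len_sq]; push_cast; rfl
    have hl0 : 0 < len w := Real.sqrt_pos.2 hR
    obtain ⟨μ, hμ0, hμ⟩ : ∃ μ : ℝ, μ ≠ 0 ∧ (μ : ℂ) = -(Complex.I * τ) := by
      have : (-(Complex.I * τ) - len w) * (-(Complex.I * τ) + len w) = 0 := by
        linear_combination -hτ2 + τ ^ 2 * Complex.I_sq - hlen
      rcases mul_eq_zero.1 this with h | h
      · exact ⟨len w, hl0.ne', by linear_combination -h⟩
      · exact ⟨-len w, by linarith, by push_cast; linear_combination -h⟩
    refine ⟨h1, ?_, μ, hμ0, ?_, ?_⟩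
    · rw [hsq z hz0 hez, e2, ← h4]
      linear_combination (parCoeff e c z ^ 2) * hτ2
    · refine helical_of_coeff he hew hw0 (hdiv w) ?_ ?_
      · rw [hμ, e1]; ring
      · rw [hμ, e1]; linear_combination (-Complex.I * parCoeff e c w) * hτ2
    · refine helical_of_coeff he hez hz0 (hdiv z) ?_ ?_
      · rw [hμ, e2]; ring
      · rw [hμ, e2, ← h4]; linear_combination (-Complex.I * parCoeff e c z) * hτ2

/-! ### Supporting planes and exposed edges -/

theorem exists_rotate {S : Finset R3} {ν q : R3} (h : ∀ x ∈ S, ν ⬝ᵥ x ≤ 1)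
    (hle : ∀ x ∈ S, ν ⬝ᵥ x = 1 → q ⬝ᵥ x ≤ 0) (hex : ∃ x ∈ S, 0 < q ⬝ᵥ x) :
    ∃ τ : ℝ, 0 < τ ∧ (∀ x ∈ S, (ν + τ • q) ⬝ᵥ x ≤ 1) ∧
      ∃ x ∈ S, 0 < q ⬝ᵥ x ∧ (ν + τ • q) ⬝ᵥ x = 1 := by
  classical
  obtain ⟨x₀, hx₀, hq₀⟩ := hex
  -- The smallest tilt at which the supporting plane meets a point on the positive side of `q`.
  obtain ⟨m, hm, hmin⟩ := Finset.exists_min_image (S.filter fun x => 0 < q ⬝ᵥ x)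
    (fun x => (1 - ν ⬝ᵥ x) / (q ⬝ᵥ x)) ⟨x₀, by simp [hx₀, hq₀]⟩
  simp only [Finset.mem_filter] at hm hmin
  have hνm : ν ⬝ᵥ m < 1 := lt_of_le_of_ne (h m hm.1) fun he => by
    linarith [hle m hm.1 he, hm.2]
  have hτ : 0 < (1 - ν ⬝ᵥ m) / (q ⬝ᵥ m) := div_pos (by linarith) hm.2
  refine ⟨_, hτ, fun x hx => ?_, m, hm.1, hm.2, ?_⟩
  · rw [add_dotProduct, smul_dotProduct, smul_eq_mul]
    rcases le_or_gt (q ⬝ᵥ x) 0 with hq | hq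
    · nlinarith [h x hx]
    · have := hmin x ⟨hx, hq⟩
      rw [le_div_iff₀ hq] at this
      linarith
  · rw [add_dotProduct, smul_dotProduct, smul_eq_mul, div_mul_cancel₀ _ hm.2.ne']
    ring

/-- Stopping halfway to the first new contact leaves in contact only those points of the face where
`q` vanishes. This merges a two-stage exposure into one functional. -/
theorem exists_refine {S : Finset R3} {ν q : R3} (h : ∀ x ∈ S, ν ⬝ᵥ x ≤ 1)
    (hle : ∀ x ∈ S, ν ⬝ᵥ x = 1 → q ⬝ᵥ x ≤ 0) :
    ∃ ε : ℝ, 0 < ε ∧ ∀ x ∈ S, (ν + ε • q) ⬝ᵥ x ≤ 1 ∧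
      ((ν + ε • q) ⬝ᵥ x = 1 → ν ⬝ᵥ x = 1 ∧ q ⬝ᵥ x = 0) := by
  by_cases hex : ∃ x ∈ S, 0 < q ⬝ᵥ x
  · obtain ⟨τ, hτ, hall, -⟩ := exists_rotate h hle hex
    refine ⟨τ / 2, by linarith, fun x hx => ?_⟩
    have h1 := hall x hx
    have h2 := h x hx
    rw [add_dotProduct, smul_dotProduct, smul_eq_mul] at h1 ⊢
    refine ⟨by linarith, fun h3 => ?_⟩
    have h4 : ν ⬝ᵥ x = 1 := by linarith
    refine ⟨h4, ?_⟩
    have : τ / 2 * (q ⬝ᵥ x) = 0 := by linarith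
    exact (mul_eq_zero.1 this).resolve_left (by linarith)
  · push Not at hex
    refine ⟨1, one_pos, fun x hx => ?_⟩
    have h1 := hex x hx
    have h2 := h x hx
    rw [add_dotProduct, smul_dotProduct, smul_eq_mul]
    exact ⟨by linarith, fun h3 => ⟨by linarith, by linarith⟩⟩

theorem dot_le_of_norm_le {a b : R3} (h : b ⬝ᵥ b ≤ a ⬝ᵥ a) :
    a ⬝ᵥ b ≤ a ⬝ᵥ a ∧ (a ⬝ᵥ b = a ⬝ᵥ a → b = a) := by
  have h1 : (b - a) ⬝ᵥ (b - a) = b ⬝ᵥ b - 2 * (a ⬝ᵥ b) + a ⬝ᵥ a := by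
    simp only [sub_dotProduct, dotProduct_sub, dotProduct_comm b a]; ring
  have h2 : 0 ≤ (b - a) ⬝ᵥ (b - a) := by
    by_cases h : b - a = 0
    · simp [h]
    · exact (dot_self_pos h).le
  refine ⟨by linarith, fun h3 => ?_⟩
  by_contra hne
  have := dot_self_pos (sub_ne_zero.2 hne)
  linarith

theorem line_of_two_levels {ν α w z x : R3} (hk : crossProduct ν α ≠ 0) (hwz : w ≠ z)
    (h1 : ν ⬝ᵥ z = ν ⬝ᵥ w) (h2 : α ⬝ᵥ z = α ⬝ᵥ w) (h3 : ν ⬝ᵥ x = ν ⬝ᵥ w) (h4 : α ⬝ᵥ x = α ⬝ᵥ w) :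
    ∃ θ : ℝ, x = w + θ • (z - w) := by
  set k := crossProduct ν α with hkdef
  have key : ∀ u : R3, ν ⬝ᵥ u = 0 → α ⬝ᵥ u = 0 → (k ⬝ᵥ k) • u = (k ⬝ᵥ u) • k := by
    intro u hu1 hu2
    refine parallel_of_cross_eq_zero ?_
    rw [hkdef, cross_cross_eq_smul_sub_smul, hu1, hu2, zero_smul, zero_smul,
      sub_zero]
  have kz := key (z - w) (by rw [dotProduct_sub, h1, sub_self]) (by rw [dotProduct_sub, h2, sub_self])
  have kx := key (x - w) (by rw [dotProduct_sub, h3, sub_self]) (by rw [dotProduct_sub, h4, sub_self])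
  have hkk := (dot_self_pos hk).ne'
  have hkz : k ⬝ᵥ (z - w) ≠ 0 := by
    intro h0
    rw [h0, zero_smul] at kz
    exact sub_ne_zero.2 hwz.symm ((smul_eq_zero.1 kz).resolve_left hkk)
  refine ⟨(k ⬝ᵥ (x - w)) / (k ⬝ᵥ (z - w)), ?_⟩
  rw [← sub_eq_iff_eq_add']
  refine smul_right_injective _ hkk ?_
  simp only [kx, smul_comm (k ⬝ᵥ k), kz, smul_smul]
  rw [div_mul_cancel₀ _ hkz]

/-- A symmetric spanning finite set has an edge cut out by a single functional. -/
theorem exists_exposed_edge {S : Finset R3} (h0 : (0 : R3) ∉ S)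
    (hspan : ∃ a ∈ S, ∃ b ∈ S, crossProduct a b ≠ 0) :
    ∃ ν w z, ExposedEdge S ν 0 0 w z := by
  classical
  obtain ⟨a, ha, b, hb, hab⟩ := hspan
  -- A longest point is a vertex: the functional n / |n|² attains 1 on the set at `n` only. Tilting
  -- it about `n` produces a second contact point.
  obtain ⟨n, hn, hnmax⟩ := Finset.exists_max_image S (fun x => x ⬝ᵥ x) ⟨a, ha⟩
  have hn0 : n ≠ 0 := fun h => h0 (h ▸ hn)
  have hnn := dot_self_pos hn0
  -- a point not parallel to `n`
  obtain ⟨x, hx, hxn⟩ : ∃ x ∈ S, crossProduct n x ≠ 0 := by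
    by_contra! hcon
    have h1 := parallel_of_cross_eq_zero (hcon a ha)
    have h2 := parallel_of_cross_eq_zero (hcon b hb)
    apply hab
    have : (n ⬝ᵥ n) • ((n ⬝ᵥ n) • crossProduct a b) = 0 := by
      rw [← LinearMap.map_smul, ← LinearMap.map_smul₂, h1, h2]
      simp
    simpa [hnn.ne'] using this
  have hlev : ∀ y ∈ S, ((n ⬝ᵥ n)⁻¹ • n) ⬝ᵥ y ≤ 1 ∧ (((n ⬝ᵥ n)⁻¹ • n) ⬝ᵥ y = 1 → y = n) := by
    intro y hy
    have h1 := dot_le_of_norm_le (hnmax y hy)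
    rw [smul_dotProduct, smul_eq_mul, ← div_eq_inv_mul, div_le_one hnn, div_eq_one_iff_eq hnn.ne']
    exact h1
  set q := x - ((n ⬝ᵥ x) / (n ⬝ᵥ n)) • n with hq
  have hqn : q ⬝ᵥ n = 0 := by
    rw [hq, sub_dotProduct, smul_dotProduct, smul_eq_mul, div_mul_cancel₀ _ hnn.ne',
      dotProduct_comm, sub_self]
  have hq0 : q ≠ 0 := by
    intro h
    apply hxn
    rw [hq, sub_eq_zero] at h
    rw [h]; simp
  have hqx : 0 < q ⬝ᵥ x := by
    have : x = q + ((n ⬝ᵥ x) / (n ⬝ᵥ n)) • n := by rw [hq]; simp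
    rw [this, dotProduct_add, dotProduct_smul, hqn, smul_zero, add_zero]
    exact dot_self_pos hq0
  obtain ⟨τ, hτ, hν, x₁, hx₁, hqx₁, hx₁ν⟩ := exists_rotate (fun y hy => (hlev y hy).1)
    (fun y hy h => by rw [(hlev y hy).2 h, hqn]) ⟨x, hx, hqx⟩
  set ν := (n ⬝ᵥ n)⁻¹ • n + τ • q with hνdef
  have hνn : ν ⬝ᵥ n = 1 := by
    rw [hνdef, add_dotProduct, smul_dotProduct, smul_dotProduct, hqn, smul_eq_mul,
      inv_mul_cancel₀ hnn.ne']; simp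
  have hne : n ≠ x₁ := by rintro rfl; exact hqx₁.ne' hqn
  by_cases hline : ∀ y ∈ S, ν ⬝ᵥ y = 1 → ∃ θ : ℝ, y = n + θ • (x₁ - n)
  · exact ⟨ν, n, x₁, hν, fun _ _ _ => by simp, hn, hx₁, hνn, by simp, hx₁ν, by simp, hne,
      fun y hy h _ => hline y hy h⟩
  push Not at hline
  obtain ⟨x₂, hx₂, hx₂ν, hx₂l⟩ := hline
  set d := x₁ - n with hd
  have hd0 : d ≠ 0 := sub_ne_zero.2 hne.symm
  have hdd := dot_self_pos hd0
  set r := x₂ - n - ((d ⬝ᵥ (x₂ - n)) / (d ⬝ᵥ d)) • d with hr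
  have hrd : r ⬝ᵥ d = 0 := by
    rw [hr, sub_dotProduct, smul_dotProduct, smul_eq_mul, div_mul_cancel₀ _ hdd.ne',
      dotProduct_comm, sub_self]
  have hr0 : r ≠ 0 := by
    intro h
    apply hx₂l ((d ⬝ᵥ (x₂ - n)) / (d ⬝ᵥ d))
    rw [hr, sub_eq_zero, sub_eq_iff_eq_add'] at h
    exact h
  have hrx : 0 < r ⬝ᵥ (x₂ - n) := by
    have : x₂ - n = r + ((d ⬝ᵥ (x₂ - n)) / (d ⬝ᵥ d)) • d := by rw [hr]; simp
    rw [this, dotProduct_add, dotProduct_smul, hrd, smul_zero, add_zero]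
    exact dot_self_pos hr0
  -- on the face, `r - (r ⬝ n) ν` takes the value `r ⬝ (y - n)`
  have hval : ∀ y, ν ⬝ᵥ y = 1 → (r - (r ⬝ᵥ n) • ν) ⬝ᵥ y = r ⬝ᵥ (y - n) := by
    intro y hy
    rw [sub_dotProduct, smul_dotProduct, hy, dotProduct_sub]; simp
  -- Here the contact set is a whole face. A functional exposing `n` is tilted inside the face, away
  -- from the line through `n` and `x₁`, until it meets `x₃`. As `r` is orthogonal to `x₁ - n`, the
  -- value at `x₁` never becomes 1, which keeps `ν` and `β` independent.
  obtain ⟨σ, hσ, hσle, x₃, hx₃, hrx₃, hx₃σ⟩ := exists_rotate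
    (S := S.filter fun y => ν ⬝ᵥ y = 1) (ν := (n ⬝ᵥ n)⁻¹ • n) (q := r - (r ⬝ᵥ n) • ν)
    (fun y hy => (hlev y (Finset.mem_filter.1 hy).1).1)
    (fun y hy h => by
      obtain ⟨h1, h2⟩ := Finset.mem_filter.1 hy
      rw [hval y h2, (hlev y h1).2 h]; simp)
    ⟨x₂, Finset.mem_filter.2 ⟨hx₂, hx₂ν⟩, by rw [hval _ hx₂ν]; exact hrx⟩
  obtain ⟨hx₃S, hx₃ν⟩ := Finset.mem_filter.1 hx₃
  set β := (n ⬝ᵥ n)⁻¹ • n + σ • (r - (r ⬝ᵥ n) • ν) with hβ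
  have hβn : β ⬝ᵥ n = 1 := by
    rw [hβ, add_dotProduct, smul_dotProduct, smul_dotProduct, hval n hνn, smul_eq_mul,
      inv_mul_cancel₀ hnn.ne']; simp
  have hβx₁ : β ⬝ᵥ x₁ ≠ 1 := by
    intro h
    rw [hβ, add_dotProduct, smul_dotProduct σ, hval x₁ hx₁ν, hrd, smul_zero, add_zero] at h
    exact hne ((hlev x₁ hx₁).2 h).symm
  have hne₃ : n ≠ x₃ := by
    rintro rfl
    rw [hval _ hx₃ν] at hrx₃
    simp at hrx₃
  have hcr : crossProduct ν β ≠ 0 := by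
    intro h
    have h1 := parallel_of_cross_eq_zero h
    have h2 := congrArg (fun y => y ⬝ᵥ n) h1
    have h3 := congrArg (fun y => y ⬝ᵥ x₁) h1
    simp only [smul_dotProduct, hβn, hνn, hx₁ν, smul_eq_mul] at h2 h3
    have hν0 : ν ≠ 0 := by intro h; rw [h] at hνn; simp at hνn
    rw [← h2] at h3
    exact hβx₁ (mul_left_cancel₀ (dot_self_pos hν0).ne' h3)
  obtain ⟨ε, hε, hεS⟩ := exists_refine (S := S) (ν := ν) (q := β - ν) hν fun y hy h => by
    rw [sub_dotProduct, h]
    linarith [hσle y (Finset.mem_filter.2 ⟨hy, h⟩)]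
  have hfin : ∀ y, ν ⬝ᵥ y = 1 → β ⬝ᵥ y = 1 → (ν + ε • (β - ν)) ⬝ᵥ y = 1 := by
    intro y h1 h2
    rw [add_dotProduct, smul_dotProduct, sub_dotProduct, h1, h2]; simp
  refine ⟨ν + ε • (β - ν), n, x₃, fun y hy => (hεS y hy).1, fun _ _ _ => by simp, hn, hx₃S,
    hfin n hνn hβn, by simp, hfin x₃ hx₃ν hx₃σ, by simp, hne₃, fun y hy h _ => ?_⟩
  obtain ⟨h1, h2⟩ := (hεS y hy).2 h
  rw [sub_dotProduct, h1, sub_eq_zero] at h2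
  exact line_of_two_levels hcr hne₃ (hx₃ν.trans hνn.symm) (hx₃σ.trans hβn.symm)
    (h1.trans hνn.symm) (h2.trans hβn.symm)

/-! ### Orthonormal frames and the two faces at an edge -/

section Frame

variable {X e : R3}

theorem frame_expand (hX : X ⬝ᵥ X = 1) (he : e ⬝ᵥ e = 1) (heX : e ⬝ᵥ X = 0) (u : R3) :
    u = (X ⬝ᵥ u) • X + (crossProduct e X ⬝ᵥ u) • crossProduct e X + (e ⬝ᵥ u) • e := by
  have h0 : X ≠ 0 := by rintro rfl; simp at hX
  have hv : toC (u - (X ⬝ᵥ u) • X) ⬝ᵥ toC X = 0 := by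
    rw [toC_dot, sub_dotProduct, smul_dotProduct, hX, dotProduct_comm u X]; simp
  have h1 := mode_expand he heX h0 hv
  rw [hX, toC_dot, toC_dot, Complex.ofReal_one, div_one, ← toC_smul, ← toC_smul, ← toC_add] at h1
  have h2 := toC_injective h1
  rw [sub_dotProduct, smul_dotProduct, sub_dotProduct, smul_dotProduct, dotProduct_comm X e, heX,
    dot_cross_self, smul_zero, sub_zero, sub_zero, sub_eq_iff_eq_add] at h2
  rw [dotProduct_comm (crossProduct e X) u, dotProduct_comm e u]
  refine h2.trans ?_
  abel

/-- Coordinates in the right-handed orthonormal frame `X, e × X, e`. -/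
def frame (X e u : R3) : R3 := ![X ⬝ᵥ u, crossProduct e X ⬝ᵥ u, e ⬝ᵥ u]

/-- Complex coordinates in the frame `X, e × X, e`. -/
def frameC (X e : R3) (v : C3) : C3 := ![v ⬝ᵥ toC X, v ⬝ᵥ toC (crossProduct e X), v ⬝ᵥ toC e]

theorem frameC_dot (hX : X ⬝ᵥ X = 1) (he : e ⬝ᵥ e = 1) (heX : e ⬝ᵥ X = 0) (v : C3) (u : R3) :
    frameC X e v ⬝ᵥ toC (frame X e u) = v ⬝ᵥ toC u := by
  conv_rhs => rw [frame_expand hX he heX u]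
  simp only [toC_add, toC_smul, dotProduct_add, dotProduct_smul]
  simp [frameC, frame, toC, dotProduct, Fin.sum_univ_three]
  ring

theorem frame_injective (hX : X ⬝ᵥ X = 1) (he : e ⬝ᵥ e = 1) (heX : e ⬝ᵥ X = 0) {u v : R3}
    (h : frame X e u = frame X e v) : u = v := by
  rw [frame_expand hX he heX u, frame_expand hX he heX v]
  have h0 := congrFun h 0
  have h1 := congrFun h 1
  have h2 := congrFun h 2
  simp only [frame] at h0 h1 h2
  simp at h0 h1 h2
  rw [h0, h1, h2]

theorem frame_dot (hX : X ⬝ᵥ X = 1) (he : e ⬝ᵥ e = 1) (heX : e ⬝ᵥ X = 0) (u v : R3) :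
    frame X e u ⬝ᵥ frame X e v = u ⬝ᵥ v := by
  conv_rhs => rw [frame_expand hX he heX v]
  simp only [dotProduct_add, dotProduct_smul]
  simp only [frame, dotProduct_comm u]
  simp
  ring

theorem frameC_ne_zero (hX : X ⬝ᵥ X = 1) (he : e ⬝ᵥ e = 1) (heX : e ⬝ᵥ X = 0) {v : C3}
    (h : v ≠ 0) : frameC X e v ≠ 0 := by
  intro h0
  apply h
  ext i
  have := frameC_dot hX he heX v (Pi.single i 1)
  rw [h0, zero_dotProduct] at this
  have h1 : toC (Pi.single i 1) = Pi.single i 1 := by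
    ext j; by_cases h : j = i
    · subst h; simp [toC]
    · simp [toC, h]
  rw [h1, dotProduct_single_one] at this
  exact this.symm

theorem frameC_dot_self (hX : X ⬝ᵥ X = 1) (he : e ⬝ᵥ e = 1) (heX : e ⬝ᵥ X = 0) (v : C3) :
    frameC X e v ⬝ᵥ frameC X e v = v ⬝ᵥ v := by
  have hre : v = toC (fun i => (v i).re) + Complex.I • toC (fun i => (v i).im) := by
    ext i; simp [toC, mul_comm Complex.I, Complex.re_add_im]
  have hlin : ∀ a b : R3, frameC X e (toC a + Complex.I • toC b) =
      toC (frame X e a) + Complex.I • toC (frame X e b) := by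
    intro a b
    ext i
    fin_cases i <;> simp [frameC, frame, toC_dot, add_dotProduct, smul_dotProduct, toC,
      dotProduct_comm a, dotProduct_comm b]
  rw [hre, hlin]
  simp only [add_dotProduct, dotProduct_add, smul_dotProduct, dotProduct_smul, toC_dot,
    frame_dot hX he heX]

theorem frame_cross (hX : X ⬝ᵥ X = 1) (he : e ⬝ᵥ e = 1) (heX : e ⬝ᵥ X = 0) (u v : R3) :
    crossProduct (frame X e u) (frame X e v) = frame X e (crossProduct u v) := by
  have h1 : crossProduct (crossProduct e X) e = X := by
    rw [cross_cross_eq_smul_sub_smul, he, dotProduct_comm X, heX]; simp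
  have h2 : crossProduct X (crossProduct e X) = e := by
    rw [cross_cross_eq_smul_sub_smul', hX, heX]; simp
  have g0 : X ⬝ᵥ crossProduct u v = crossProduct (crossProduct e X) e ⬝ᵥ crossProduct u v := by
    rw [h1]
  have g2 : e ⬝ᵥ crossProduct u v = crossProduct X (crossProduct e X) ⬝ᵥ crossProduct u v := by
    rw [h2]
  rw [cross_apply]
  ext i
  fin_cases i
  · simp [frame, g0, cross_dot_cross]; ring
  · simp [frame, cross_dot_cross]; ring
  · simp [frame, g2, cross_dot_cross]; ring

theorem edgeRel_frame (hX : X ⬝ᵥ X = 1) (he : e ⬝ᵥ e = 1) (heX : e ⬝ᵥ X = 0) {w z : R3} {a b : C3}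
    (h : EdgeRel w z a b) : EdgeRel (frame X e w) (frame X e z) (frameC X e a) (frameC X e b) := by
  unfold EdgeRel len at *
  simpa only [frame_cross hX he heX, frameC_dot hX he heX, frame_dot hX he heX] using h

end Frame

theorem exposedEdge_face {S : Finset R3} {ν α w z : R3} (hk : crossProduct ν α ≠ 0)
    (hν : ∀ x ∈ S, ν ⬝ᵥ x ≤ 1) (hw : w ∈ S) (hz : z ∈ S) (hw1 : ν ⬝ᵥ w = 1) (hz1 : ν ⬝ᵥ z = 1)
    (hα : ∀ x ∈ S, ν ⬝ᵥ x = 1 → α ⬝ᵥ x ≤ α ⬝ᵥ w) (hαz : α ⬝ᵥ z = α ⬝ᵥ w) (hne : w ≠ z) :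
    ExposedEdge S ν α (α ⬝ᵥ w) w z :=
  ⟨hν, hα, hw, hz, hw1, rfl, hz1, hαz, hne, fun _ _ h1 h2 =>
    line_of_two_levels hk hne (hz1.trans hw1.symm) hαz (h1.trans hw1.symm) h2⟩

/-- An edge with non-isotropic modes contradicts the holonomy around one of its two faces: here
the face on the side of `e`, which is seen under less than a right angle. -/
theorem false_of_face {c : R3 →₀ C3} (hc0 : c 0 = 0) (hdiv : ∀ n, c n ⬝ᵥ toC n = 0)
    (hcl : ClosedModes c) (hsym : ∀ x ∈ c.support, -x ∈ c.support) {ν w z e : R3} {τ σ : ℝ}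
    (hw : w ∈ c.support) (hz : z ∈ c.support) (hne : w ≠ z) (hνw : ν ⬝ᵥ w = 1) (hνz : ν ⬝ᵥ z = 1)
    (hniso : ∀ x ∈ c.support, ν ⬝ᵥ x = 1 → c x ⬝ᵥ c x ≠ 0)
    (he : e ⬝ᵥ e = 1) (hew : e ⬝ᵥ w = 0) (hez : e ⬝ᵥ z = 0) (hτ : 0 < τ) (hσ : 0 < σ)
    (hup : ∀ x ∈ c.support, (ν + τ • e) ⬝ᵥ x ≤ 1)
    (hlow : ∀ x ∈ c.support, (ν - σ • e) ⬝ᵥ x ≤ 1)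
    (hex : ∃ x ∈ c.support, 0 < e ⬝ᵥ x ∧ (ν + τ • e) ⬝ᵥ x = 1)
    (hsum : 2 * (ν ⬝ᵥ e) + τ - σ ≤ 0) : False := by
  classical
  have hcr := cross_ne_zero_of_level one_ne_zero hνw hνz hne
  set d := z - w with hd
  have hd0 : d ≠ 0 := sub_ne_zero.2 hne.symm
  have hed : e ⬝ᵥ d = 0 := by rw [hd, dotProduct_sub, hew, hez, sub_zero]
  -- the frame
  obtain ⟨X, k, hX, hdX, hYw⟩ : ∃ (X : R3) (k : ℝ), X ⬝ᵥ X = 1 ∧ d = k • X ∧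
      0 < crossProduct e X ⬝ᵥ w := by
    have hdd := dot_self_pos hd0
    have hs : 0 < √(d ⬝ᵥ d) := Real.sqrt_pos.2 hdd
    have hss : √(d ⬝ᵥ d) * √(d ⬝ᵥ d) = d ⬝ᵥ d := Real.mul_self_sqrt hdd.le
    have h1 : crossProduct e d ⬝ᵥ w ≠ 0 := by
      intro h0
      apply hcr
      have h2 : crossProduct w z = crossProduct w d := by rw [hd]; simp
      have h3 : e ⬝ᵥ crossProduct w d = 0 := by
        have h4 := triple_product_permutation w e d
        rw [dotProduct_comm, h0] at h4
        rw [← cross_anticomm, dotProduct_neg, ← h4, neg_zero]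
      have h5 := mode_expand (v := toC (crossProduct w d)) he hed hd0
        (by rw [toC_dot, dotProduct_comm, dot_cross_self]; simp)
      have h6 : crossProduct w d ⬝ᵥ crossProduct e d = 0 := by
        rw [cross_dot_cross, dotProduct_comm w e, hew, dotProduct_comm d e, hed]; ring
      rw [toC_dot, toC_dot, dotProduct_comm, h3, h6] at h5
      rw [h2]
      refine toC_injective ?_
      rw [h5, toC_zero]; simp
    generalize √(d ⬝ᵥ d) = s at *
    -- The sign of `X` is chosen so that the edge has positive coordinate along `e × X`.
    rcases lt_or_gt_of_ne h1 with h | h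
    · refine ⟨-(s⁻¹ • d), -s, ?_, ?_, ?_⟩
      · simp only [neg_dotProduct, dotProduct_neg, smul_dotProduct, dotProduct_smul, ← hss,
          smul_eq_mul]
        field_simp
      · rw [smul_neg, neg_smul, neg_neg, smul_smul, mul_inv_cancel₀ hs.ne', one_smul]
      · rw [map_neg, map_smul, neg_dotProduct, smul_dotProduct, smul_eq_mul]
        have := mul_pos (inv_pos.2 hs) (neg_pos.2 h)
        linarith
    · refine ⟨s⁻¹ • d, s, ?_, ?_, ?_⟩
      · simp only [smul_dotProduct, dotProduct_smul, ← hss, smul_eq_mul]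
        field_simp
      · rw [smul_smul, mul_inv_cancel₀ hs.ne', one_smul]
      · rw [map_smul, smul_dotProduct, smul_eq_mul]
        exact mul_pos (inv_pos.2 hs) h
  have hk0 : k ≠ 0 := by rintro rfl; rw [zero_smul] at hdX; exact hd0 hdX
  have heX : e ⬝ᵥ X = 0 := by
    have : k * (e ⬝ᵥ X) = 0 := by rw [← smul_eq_mul, ← dotProduct_smul, ← hdX, hed]
    exact (mul_eq_zero.1 this).resolve_left hk0
  have hνX : ν ⬝ᵥ X = 0 := by
    have : k * (ν ⬝ᵥ X) = 0 := by
      rw [← smul_eq_mul, ← dotProduct_smul, ← hdX, hd, dotProduct_sub, hνw, hνz, sub_self]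
    exact (mul_eq_zero.1 this).resolve_left hk0
  set Y := crossProduct e X with hY
  set y0 := Y ⬝ᵥ w with hy0
  have hexp : ∀ u, ν ⬝ᵥ u = (Y ⬝ᵥ u) * (ν ⬝ᵥ Y) + (e ⬝ᵥ u) * (ν ⬝ᵥ e) := by
    intro u
    conv_lhs => rw [frame_expand hX he heX u]
    simp only [dotProduct_add, dotProduct_smul, hνX, smul_eq_mul]
    ring
  have hνY : y0 * (ν ⬝ᵥ Y) = 1 := by
    have := hexp w
    rw [hνw, hew, zero_mul, add_zero] at this
    exact this.symm
  have hνu : ∀ u, y0 * (ν ⬝ᵥ u) = (Y ⬝ᵥ u) + y0 * ((e ⬝ᵥ u) * (ν ⬝ᵥ e)) := by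
    intro u
    rw [hexp u]
    linear_combination (Y ⬝ᵥ u) * hνY
  set T := c.support.filter fun u => (ν + τ • e) ⬝ᵥ u = 1 with hT
  have memT : ∀ u, u ∈ T ↔ u ∈ c.support ∧ ν ⬝ᵥ u + τ * (e ⬝ᵥ u) = 1 := fun u => by
    rw [hT, Finset.mem_filter, add_dotProduct, smul_dotProduct, smul_eq_mul]
  have hwT : w ∈ T := (memT w).2 ⟨hw, by rw [hνw, hew]; ring⟩
  have hzT : z ∈ T := (memT z).2 ⟨hz, by rw [hνz, hez]; ring⟩
  have hplane : ∀ u ∈ T, Y ⬝ᵥ u = y0 * (1 - ((ν ⬝ᵥ e) + τ) * (e ⬝ᵥ u)) := by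
    intro u hu
    linear_combination y0 * ((memT u).1 hu).2 - hνu u
  have hz0 : ∀ u ∈ T, 0 ≤ e ⬝ᵥ u := by
    intro u hu
    have h1 := hlow u ((memT u).1 hu).1
    rw [sub_dotProduct, smul_dotProduct, smul_eq_mul] at h1
    have h2 := ((memT u).1 hu).2
    have : 0 ≤ (τ + σ) * (e ⬝ᵥ u) := by linarith
    exact nonneg_of_mul_nonneg_right this (by linarith)
  -- Central symmetry enters here: the lower face functional at `-u` gives (τ + σ) (e · u) ≤ 2,
  -- while `hsum` says 2 (ν · e + τ) ≤ τ + σ. So the face stays in the half space where `Y` is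
  -- nonnegative.
  have hyn : ∀ u ∈ T, 0 ≤ Y ⬝ᵥ u := by
    intro u hu
    have h1 := hlow _ (hsym u ((memT u).1 hu).1)
    rw [dotProduct_neg, sub_dotProduct, smul_dotProduct, smul_eq_mul] at h1
    have h2 := ((memT u).1 hu).2
    rw [hplane u hu]
    refine mul_nonneg hYw.le ?_
    nlinarith [hz0 u hu]
  -- the endpoints of the edge
  have hbne : (T.filter fun u => e ⬝ᵥ u = 0).Nonempty := ⟨w, by simp [hwT, hew]⟩
  obtain ⟨n0, hn0, hmin⟩ := Finset.exists_min_image _ (fun u => X ⬝ᵥ u) hbne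
  obtain ⟨n1, hn1, hmax⟩ := Finset.exists_max_image _ (fun u => X ⬝ᵥ u) hbne
  simp only [Finset.mem_filter] at hn0 hn1 hmin hmax
  have h01 : X ⬝ᵥ n0 < X ⬝ᵥ n1 := by
    have e1 := hmin w ⟨hwT, hew⟩
    have e2 := hmin z ⟨hzT, hez⟩
    have e3 := hmax w ⟨hwT, hew⟩
    have e4 := hmax z ⟨hzT, hez⟩
    refine lt_of_le_of_ne (e1.trans e3) fun h => hk0 ?_
    have h5 : X ⬝ᵥ d = 0 := by rw [hd, dotProduct_sub]; linarith
    rw [hdX, dotProduct_smul, hX] at h5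
    simpa using h5
  have hνe : ν + τ • e ≠ 0 := by
    intro h
    have := ((memT w).1 hwT).2
    rw [← smul_eq_mul, ← smul_dotProduct, ← add_dotProduct, h] at this
    simp at this
  have heY : e ⬝ᵥ Y = 0 := by rw [hY, dot_self_cross]
  have hXY : X ⬝ᵥ Y = 0 := by rw [hY, dot_cross_self]
  refine no_polarized_face T (frame X e) (fun u => frameC X e (c u)) (n0 := n0) (n1 := n1) hn0.1 hn1.1
    (y0 := y0) (t := ν ⬝ᵥ e + τ) hYw hplane hyn hz0 hn0.2 hn1.2 h01
    (fun u hu h => ⟨hmin u ⟨hu, h⟩, hmax u ⟨hu, h⟩⟩) ?_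
    (fun u hu => frameC_ne_zero hX he heX (Finsupp.mem_support_iff.1 ((memT u).1 hu).1))
    (fun u _ => by rw [frameC_dot hX he heX, hdiv]) ?_ ?_
    (fun u _ v _ h => frame_injective hX he heX h)
  · obtain ⟨x, hx, hex, hx1⟩ := hex
    exact ⟨x, by rw [hT, Finset.mem_filter]; exact ⟨hx, hx1⟩, hex⟩
  · rw [frameC_dot_self hX he heX]
    refine hniso n0 ((memT n0).1 hn0.1).1 ?_
    have := ((memT n0).1 hn0.1).2
    rwa [hn0.2, mul_zero, add_zero] at this
  · intro p q u hu v hv hpq huv hle heq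
    have hval : ∀ i, (p • X + q • e) ⬝ᵥ i = p * frame X e i 0 + q * frame X e i 2 := fun i => by
      simp [frame, add_dotProduct, smul_dotProduct]
    refine edgeRel_frame hX he heX (edgeRel_of_exposed
      (exposedEdge_face (ν := ν + τ • e) (α := p • X + q • e) ?_ hup ((memT u).1 hu).1
        ((memT v).1 hv).1 ?_ ?_ ?_ ?_ ?_) hc0 hdiv hcl)
    · intro h
      have h1 := parallel_of_cross_eq_zero h
      have h2 := congrArg (fun x => x ⬝ᵥ Y) h1
      simp only [smul_dotProduct, add_dotProduct, hXY, heY, smul_eq_mul, mul_zero, add_zero] at h2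
      have hνY0 : ν ⬝ᵥ Y ≠ 0 := right_ne_zero_of_mul (hνY ▸ one_ne_zero)
      have h3 := (mul_eq_zero.1 h2.symm).resolve_right hνY0
      have h4 : p • X + q • e = 0 := by
        rw [add_dotProduct ν _ (p • X + q • e), smul_dotProduct, smul_eq_mul, h3, zero_smul] at h1
        exact (smul_eq_zero.1 h1).resolve_left (dot_self_pos hνe).ne'
      have h5 := congrArg (fun x => x ⬝ᵥ X) h4
      have h6 := congrArg (fun x => x ⬝ᵥ e) h4
      simp [add_dotProduct, smul_dotProduct, hX, he, heX, dotProduct_comm X e] at h5 h6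
      rcases hpq with h | h
      · exact h h5
      · exact h h6
    · exact (Finset.mem_filter.1 hu).2
    · exact (Finset.mem_filter.1 hv).2
    · intro x hx hx1
      rw [hval, hval]
      exact hle x (Finset.mem_filter.2 ⟨hx, hx1⟩)
    · rw [hval, hval]; exact heq
    · rintro rfl
      rcases huv with h | h <;> exact h rfl

/-- Tilting the supporting plane to either side produces the two faces at the edge. Seen from the
axis through the origin parallel to the edge, central symmetry allows one of them at most a right
angle; the sign of 2 (ν · e) + τ - σ tells which. -/
theorem false_of_edge {c : R3 →₀ C3} (hc0 : c 0 = 0) (hdiv : ∀ n, c n ⬝ᵥ toC n = 0)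
    (hcl : ClosedModes c) (hsym : ∀ x ∈ c.support, -x ∈ c.support) {ν w z : R3}
    (E : ExposedEdge c.support ν 0 0 w z)
    (hniso : ∀ x ∈ c.support, ν ⬝ᵥ x = 1 → c x ⬝ᵥ c x ≠ 0)
    (hspan : ∃ x ∈ c.support, x ⬝ᵥ crossProduct w z ≠ 0) : False := by
  obtain ⟨e, he, hew, hez, hcr, hD⟩ := exists_unit_normal E.cross_ne_zero
  have hline : ∀ x ∈ c.support, ν ⬝ᵥ x = 1 → e ⬝ᵥ x = 0 := by
    intro x hx h
    obtain ⟨θ, rfl⟩ := E.segment x hx h (by simp)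
    simp [dotProduct_add, dotProduct_sub, hew, hez]
  have hpos : ∃ x ∈ c.support, 0 < e ⬝ᵥ x := by
    obtain ⟨x, hx, h⟩ := hspan
    rw [hcr, dotProduct_smul, dotProduct_comm, smul_eq_mul] at h
    have h' := right_ne_zero_of_mul h
    rcases lt_or_gt_of_ne h' with h | h
    · exact ⟨-x, hsym x hx, by rw [dotProduct_neg]; linarith⟩
    · exact ⟨x, hx, h⟩
  have hneg : ∃ x ∈ c.support, 0 < (-e) ⬝ᵥ x := by
    obtain ⟨x, hx, h⟩ := hpos
    exact ⟨-x, hsym x hx, by simpa using h⟩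
  obtain ⟨τ, hτ, hup, x, hx, hx0, hx1⟩ := exists_rotate E.le (fun x hx h => (hline x hx h).le) hpos
  obtain ⟨σ, hσ, hlow, y, hy, hy0, hy1⟩ := exists_rotate E.le
    (fun x hx h => by rw [neg_dotProduct, hline x hx h, neg_zero]) hneg
  rcases le_total (2 * (ν ⬝ᵥ e) + τ - σ) 0 with hs | hs
  · exact false_of_face hc0 hdiv hcl hsym E.left_mem E.right_mem E.ne E.left E.right hniso he hew hez
      hτ hσ hup (fun x hx => by simpa [sub_eq_add_neg] using hlow x hx) ⟨x, hx, hx0, hx1⟩ hs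
  · exact false_of_face (e := -e) hc0 hdiv hcl hsym E.left_mem E.right_mem E.ne E.left E.right hniso
      (by simpa using he) (by simpa using hew) (by simpa using hez)
      hσ hτ hlow (fun x hx => by simpa [sub_eq_add_neg] using hup x hx) ⟨y, hy, hy0, hy1⟩
      (by rw [dotProduct_neg]; linarith)

/-! ### The Lamb form and fields with vanishing curl defect -/

theorem sum_reflect {V M : Type*} [AddCommMonoid V] [AddCommMonoid M] (c : R3 →₀ V) (p : R3)
    (G : R3 → R3 → M)
    (h1 : ∀ a b, c a = 0 → G a b = 0) (h2 : ∀ a b, c b = 0 → G a b = 0) :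
    ∑ a ∈ c.support, G a (p - a) = ∑ a ∈ c.support, G (p - a) a := by
  classical
  have key : ∀ F : R3 → M, (∀ a, c (p - a) = 0 → F a = 0) →
      ∑ a ∈ c.support, F a = ∑ a ∈ c.support.filter (fun a => p - a ∈ c.support), F a := by
    intro F hF
    rw [Finset.sum_filter]
    refine Finset.sum_congr rfl fun a _ => ?_
    split_ifs with h
    · rfl
    · exact hF a (Finsupp.notMem_support_iff.1 h)
  rw [key _ (fun a h => h2 a _ h), key _ (fun a h => h1 _ a h)]
  refine Finset.sum_nbij' (fun a => p - a) (fun a => p - a) ?_ ?_ ?_ ?_ ?_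
  · intro a ha; simp only [Finset.mem_filter, sub_sub_cancel] at ha ⊢; exact ⟨ha.2, ha.1⟩
  · intro a ha; simp only [Finset.mem_filter, sub_sub_cancel] at ha ⊢; exact ⟨ha.2, ha.1⟩
  · intro a _; simp
  · intro a _; simp
  · intro a _; simp

/-- The defect of the curl eigenvector equation. -/
def helDefect (μ : ℝ) (c : R3 →₀ C3) (n : R3) : C3 :=
  Complex.I • crossProduct (toC n) (c n) - (μ : ℂ) • c n

theorem helDefect_eq_zero {μ : ℝ} {c : R3 →₀ C3} {n : R3} : helDefect μ c n = 0 ↔ HelicalAt μ c n :=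
  sub_eq_zero

theorem helDefect_of_zero {μ : ℝ} {c : R3 →₀ C3} {n : R3} (h : c n = 0) : helDefect μ c n = 0 := by
  simp [helDefect, h]

theorem helDefect_dot {μ : ℝ} {c : R3 →₀ C3} {n : R3} (h : c n ⬝ᵥ toC n = 0) :
    helDefect μ c n ⬝ᵥ toC n = 0 := by
  rw [helDefect, sub_dotProduct, smul_dotProduct, smul_dotProduct, h, dotProduct_comm,
    dot_self_cross]
  simp

theorem star_cross (a b : C3) : star (crossProduct a b) = crossProduct (star a) (star b) := by
  simp only [cross_apply]
  ext i; fin_cases i <;> simp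

theorem star_toC (a : R3) : star (toC a) = toC a := by ext i; simp [toC]

theorem helDefect_neg {μ : ℝ} {c : R3 →₀ C3} (hconj : ∀ n, c (-n) = star (c n)) (n : R3) :
    helDefect μ c (-n) = star (helDefect μ c n) := by
  simp only [helDefect, hconj, toC_neg, star_sub, star_smul, star_cross, star_toC, map_neg,
    LinearMap.neg_apply]
  simp
  rw [← cross_anticomm, smul_neg]

/-- The Lamb form of the nonlinearity. -/
theorem sum_cross_helDefect_eq {μ : ℝ} {c : R3 →₀ C3} (hdiv : ∀ n, c n ⬝ᵥ toC n = 0) (p : R3) :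
    ∑ a ∈ c.support, crossProduct (c a) (helDefect μ c (p - a)) =
      Complex.I • (((1 / 2 : ℂ) * ∑ a ∈ c.support, c a ⬝ᵥ c (p - a)) • toC p - nl c p) := by
  -- Antisymmetry under `a ↔ p - a` removes the contribution of μ, so the formula holds for every μ.
  have s1 : ∑ a ∈ c.support, crossProduct (c a) (c (p - a)) = 0 := by
    have h1 := sum_reflect c p (fun a b => crossProduct (c a) (c b)) (fun a b h => by simp [h])
      (fun a b h => by simp [h])
    have h2 : ∑ a ∈ c.support, crossProduct (c (p - a)) (c a) =
        -∑ a ∈ c.support, crossProduct (c a) (c (p - a)) := by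
      rw [← Finset.sum_neg_distrib]
      exact Finset.sum_congr rfl fun a _ => (cross_anticomm _ _).symm
    rw [h2] at h1
    exact self_eq_neg.1 h1
  have s2 : ∑ a ∈ c.support, (c a ⬝ᵥ c (p - a)) • toC (p - a) =
      ((1 / 2 : ℂ) * ∑ a ∈ c.support, c a ⬝ᵥ c (p - a)) • toC p := by
    have h1 := sum_reflect c p (fun a b => (c a ⬝ᵥ c b) • toC b) (fun a b h => by simp [h])
      (fun a b h => by simp [h])
    have h2 : ∑ a ∈ c.support, (c a ⬝ᵥ c (p - a)) • toC (p - a) +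
        ∑ a ∈ c.support, (c (p - a) ⬝ᵥ c a) • toC a = (∑ a ∈ c.support, c a ⬝ᵥ c (p - a)) • toC p := by
      rw [← Finset.sum_add_distrib, Finset.sum_smul]
      refine Finset.sum_congr rfl fun a _ => ?_
      rw [dotProduct_comm (c (p - a)), ← smul_add, ← toC_add, sub_add_cancel]
    rw [← h1, ← two_smul ℂ] at h2
    rw [mul_smul, ← h2, smul_smul]
    norm_num
  have s3 : ∀ a, crossProduct (c a) (helDefect μ c (p - a)) =
      Complex.I • ((c a ⬝ᵥ c (p - a)) • toC (p - a) - (c a ⬝ᵥ toC p) • c (p - a)) -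
        (μ : ℂ) • crossProduct (c a) (c (p - a)) := by
    intro a
    rw [helDefect, map_sub, map_smul, map_smul, cross_cross_eq_smul_sub_smul', toC_sub,
      dotProduct_comm (toC p - toC a), dotProduct_sub, hdiv, sub_zero]
  rw [Finset.sum_congr rfl fun a _ => s3 a, Finset.sum_sub_distrib, ← Finset.smul_sum,
    ← Finset.smul_sum, Finset.sum_sub_distrib, s1, s2, smul_zero, sub_zero]
  rfl

theorem sum_cross_helDefect {μ : ℝ} {c : R3 →₀ C3} (hdiv : ∀ n, c n ⬝ᵥ toC n = 0) {p : R3}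
    (h : ∃ γ : ℂ, nl c p = γ • toC p) :
    ∃ γ : ℂ, ∑ a ∈ c.support, crossProduct (c a) (helDefect μ c (p - a)) = γ • toC p := by
  obtain ⟨γ, hγ⟩ := h
  exact ⟨_, by rw [sum_cross_helDefect_eq hdiv, hγ, ← sub_smul, smul_smul]⟩

/-- With no defect, the Lamb form leaves only the gradient term. -/
theorem nl_of_helical {μ : ℝ} {c : R3 →₀ C3} (hdiv : ∀ n, c n ⬝ᵥ toC n = 0)
    (h : ∀ n, HelicalAt μ c n) (p : R3) : ∃ γ : ℂ, nl c p = γ • toC p := by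
  have h1 := sum_cross_helDefect_eq (μ := μ) hdiv p
  rw [Finset.sum_eq_zero fun a _ => by rw [helDefect_eq_zero.2 (h _), map_zero]] at h1
  exact ⟨_, (sub_eq_zero.1 ((smul_eq_zero.1 h1.symm).resolve_left Complex.I_ne_zero)).symm⟩

theorem parallelC_of_cross_eq_zero {w z : C3} (h : crossProduct w z = 0) :
    (w ⬝ᵥ w) • z = (w ⬝ᵥ z) • w := by
  have h1 := cross_cross_eq_smul_sub_smul' w w z
  rw [h, map_zero] at h1
  exact (sub_eq_zero.1 h1.symm).symm

/-- In either case, γ zero or not, `c n` is orthogonal to `m` as well as to `n`. Were `n` and `m`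
independent, `c n` would be a complex multiple of the real vector `n × m`, and such a vector is not
isotropic unless zero. -/
theorem cross_eq_zero_of_helical {c : R3 →₀ C3} {n m : R3} {v : C3}
    (hdiv : c n ⬝ᵥ toC n = 0) (hn : c n ≠ 0) (hiso : c n ⬝ᵥ c n = 0)
    (hvm : v ⬝ᵥ toC m = 0) (hv : v ≠ 0)
    (h : ∃ γ : ℂ, crossProduct (c n) v = γ • toC (n + m)) : crossProduct n m = 0 := by
  obtain ⟨γ, hγ⟩ := h
  have hmc : toC m ⬝ᵥ c n = 0 := by
    by_cases hg : γ = 0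
    · rw [hg, zero_smul] at hγ
      have h1 := cross_cross_eq_smul_sub_smul' (toC m) (c n) v
      rw [hγ, map_zero, dotProduct_comm (toC m) v, hvm, zero_smul, zero_sub] at h1
      have h2 := neg_eq_zero.1 h1.symm
      exact dotProduct_comm (c n) (toC m) ▸ (smul_eq_zero.1 h2).resolve_right hv
    · have h1 := congrArg (fun x => c n ⬝ᵥ x) hγ
      simp only [dot_self_cross, dotProduct_smul, toC_add, dotProduct_add, hdiv, zero_add] at h1
      rw [dotProduct_comm]
      exact (smul_eq_zero.1 h1.symm).resolve_left hg
  by_contra hd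
  have h1 : crossProduct (toC (crossProduct n m)) (c n) = 0 := by
    rw [toC_cross, cross_cross_eq_smul_sub_smul, dotProduct_comm (toC n), hdiv, hmc]; simp
  have h2 := parallelC_of_cross_eq_zero h1
  have hdd : toC (crossProduct n m) ⬝ᵥ toC (crossProduct n m) ≠ 0 := by
    rw [toC_dot]; exact_mod_cast (dot_self_pos hd).ne'
  have h3 := congrArg (fun x => x ⬝ᵥ c n) h2
  simp only [smul_dotProduct, hiso, smul_zero] at h3
  have h4 : toC (crossProduct n m) ⬝ᵥ c n = 0 := by
    rw [smul_eq_mul] at h3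
    exact mul_self_eq_zero.1 h3.symm
  rw [h4, zero_smul] at h2
  exact hn ((smul_eq_zero.1 h2).resolve_left hdd)

/-- An isolated sum `n + m` of a mode and a defect frequency leaves one cross product in the Lamb
form. -/
theorem helDefect_parallel {μ : ℝ} {c : R3 →₀ C3} (hdiv : ∀ n, c n ⬝ᵥ toC n = 0)
    (hcl : ClosedModes c) {n m : R3} (hn : n ∈ c.support) (hiso : c n ⬝ᵥ c n = 0)
    (hm : helDefect μ c m ≠ 0) (hp0 : n + m ≠ 0) (hp : n + m ∉ c.support)
    (huniq : ∀ a ∈ c.support, helDefect μ c (n + m - a) ≠ 0 → a = n) : crossProduct n m = 0 := by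
  have h := sum_cross_helDefect (μ := μ) hdiv (hcl _ hp0 hp)
  rw [Finset.sum_eq_single_of_mem n hn (fun a ha hne => by
    by_cases h0 : helDefect μ c (n + m - a) = 0
    · simp [h0]
    · exact absurd (huniq a ha h0) hne), add_sub_cancel_left] at h
  exact cross_eq_zero_of_helical (hdiv n) (Finsupp.mem_support_iff.1 hn) hiso
    (helDefect_dot (hdiv m)) hm h

theorem eq_smul_of_cross_eq_zero {ν n m : R3} {s : ℝ} (h : crossProduct n m = 0) (hn : ν ⬝ᵥ n = 1)
    (hm : ν ⬝ᵥ m = s) : m = s • n := by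
  have h1 := parallel_of_cross_eq_zero h
  have hn0 : n ≠ 0 := by rintro rfl; simp at hn
  have h2 := congrArg (fun x => ν ⬝ᵥ x) h1
  simp only [dotProduct_smul, hn, hm, smul_eq_mul, mul_one] at h2
  rw [← h2, mul_smul] at h1
  exact smul_right_injective _ (dot_self_pos hn0).ne' h1

/-- A two-point edge with isotropic modes forces the field to be helical. -/
theorem helical_of_edge {μ : ℝ} {c : R3 →₀ C3} (hc0 : c 0 = 0) (hconj : ∀ n, c (-n) = star (c n))
    (hdiv : ∀ n, c n ⬝ᵥ toC n = 0) (hcl : ClosedModes c) {ν w z : R3}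
    (hw : w ∈ c.support) (hz : z ∈ c.support) (hne : w ≠ z) (hνw : ν ⬝ᵥ w = 1) (hνz : ν ⬝ᵥ z = 1)
    (hle : ∀ x ∈ c.support, ν ⬝ᵥ x ≤ 1) (htwo : ∀ x ∈ c.support, ν ⬝ᵥ x = 1 → x = w ∨ x = z)
    (hiw : c w ⬝ᵥ c w = 0) (hiz : c z ⬝ᵥ c z = 0) (hhw : HelicalAt μ c w) :
    ∀ n, HelicalAt μ c n := by
  classical
  by_contra hcon
  push Not at hcon
  obtain ⟨n₀, hn₀⟩ := hcon
  rw [← helDefect_eq_zero] at hn₀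
  have hsupp : ∀ n, helDefect μ c n ≠ 0 → n ∈ c.support := fun n h => by
    rw [Finsupp.mem_support_iff]; exact fun h0 => h (helDefect_of_zero h0)
  have hD0 : helDefect μ c 0 = 0 := helDefect_of_zero hc0
  have hDneg : ∀ n, helDefect μ c n ≠ 0 → helDefect μ c (-n) ≠ 0 := fun n h => by
    rw [helDefect_neg hconj]; exact star_ne_zero.2 h
  set V := c.support.filter fun n => helDefect μ c n ≠ 0 with hV
  have memV : ∀ n, n ∈ V ↔ helDefect μ c n ≠ 0 := fun n => by
    rw [hV, Finset.mem_filter]; exact ⟨fun h => h.2, fun h => ⟨hsupp n h, h⟩⟩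
  obtain ⟨m₀, hm₀, hmax⟩ := Finset.exists_max_image V (fun x => ν ⬝ᵥ x) ⟨n₀, (memV _).2 hn₀⟩
  set s := ν ⬝ᵥ m₀ with hs
  have hmax' : ∀ n, helDefect μ c n ≠ 0 → ν ⬝ᵥ n ≤ s := fun n h => hmax n ((memV n).2 h)
  have hs0 : 0 ≤ s := by
    have := hmax' _ (hDneg _ ((memV _).1 hm₀))
    rw [dotProduct_neg] at this
    linarith
  -- On the top level `s` of the defect, the point extreme in direction `x - y` forms an isolated
  -- sum with the end `x` of the edge. It is therefore parallel to `x`, that is, equal to `s • x`.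
  have top : ∀ x y : R3, x ∈ c.support → c x ⬝ᵥ c x = 0 → ν ⬝ᵥ x = 1 → ν ⬝ᵥ y = 1 → x ≠ y →
      (∀ a ∈ c.support, ν ⬝ᵥ a = 1 → a = x ∨ a = y) →
      helDefect μ c (s • x) ≠ 0 ∧
        ∀ b, helDefect μ c b ≠ 0 → ν ⬝ᵥ b = s → (x - y) ⬝ᵥ b ≤ (x - y) ⬝ᵥ (s • x) := by
    intro x y hx hix hνx hνy hxy h2
    obtain ⟨m, hm, hmm⟩ := Finset.exists_max_image (V.filter fun n => ν ⬝ᵥ n = s)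
      (fun n => (x - y) ⬝ᵥ n) ⟨m₀, by rw [Finset.mem_filter]; exact ⟨hm₀, rfl⟩⟩
    rw [Finset.mem_filter, memV] at hm
    have hmm' : ∀ b, helDefect μ c b ≠ 0 → ν ⬝ᵥ b = s → (x - y) ⬝ᵥ b ≤ (x - y) ⬝ᵥ m :=
      fun b hb hb' => hmm b (by rw [Finset.mem_filter, memV]; exact ⟨hb, hb'⟩)
    have hd := dot_self_pos (sub_ne_zero.2 hxy)
    have hm0 : m ≠ 0 := by rintro rfl; exact hm.1 hD0
    have hνp : ν ⬝ᵥ (x + m) = 1 + s := by rw [dotProduct_add, hνx, hm.2]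
    have hpar : crossProduct x m = 0 := by
      refine helDefect_parallel hdiv hcl hx hix hm.1 ?_ ?_ ?_
      · intro h
        rw [h, dotProduct_zero] at hνp
        linarith
      -- The sum has level 1 + s, so it can lie in the support only for s = 0, and then `m = y - x`.
      -- But the defect is symmetric, and `-m` would be more extreme than `m`.
      · intro hp
        have h3 := hle _ hp
        have hs' : s = 0 := by linarith
        rcases h2 _ hp (by linarith) with h | h
        · exact hm0 (by simpa using h)
        · have hm' : m = -(x - y) := by rw [← h]; abel
          have h4 := hmm' _ (hDneg _ hm.1) (by rw [dotProduct_neg, hm.2, hs', neg_zero])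
          rw [hm', neg_neg, dotProduct_neg] at h4
          linarith
      · intro a ha hb
        have h3 := hle a ha
        have h4 := hmax' _ hb
        rw [dotProduct_sub, hνp] at h4
        rcases h2 a ha (by linarith) with h | h
        · exact h
        · exfalso
          have h5 := hmm' _ hb (by rw [dotProduct_sub, hνp, h, hνy]; ring)
          rw [h, show x + m - y = x - y + m by abel, dotProduct_add] at h5
          linarith
    have hmx : m = s • x := eq_smul_of_cross_eq_zero hpar hνx hm.2
    rw [← hmx]
    exact ⟨hm.1, hmm'⟩
  obtain ⟨hw1, -⟩ := top w z hw hiw hνw hνz hne htwo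
  obtain ⟨-, hz2⟩ := top z w hz hiz hνz hνw hne.symm (fun a ha h => (htwo a ha h).symm)
  have hs_pos : 0 < s := lt_of_le_of_ne hs0 fun h => hw1 (by rw [← h, zero_smul]; exact hD0)
  -- The defect frequency `s • w` belongs to the support, so s ≤ 1; and there is no defect at `w`
  -- itself.
  have hs1 : s < 1 := by
    have h1 := hle _ (hsupp _ hw1)
    rw [dotProduct_smul, hνw] at h1
    refine lt_of_le_of_ne (by simpa using h1) fun h => hw1 ?_
    rw [h, one_smul]
    exact helDefect_eq_zero.2 hhw
  have hd := dot_self_pos (sub_ne_zero.2 hne.symm)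
  have hνp : ν ⬝ᵥ (z + s • w) = 1 + s := by
    rw [dotProduct_add, dotProduct_smul, hνz, hνw]; simp
  -- The same argument crosswise: replacing `z` by `w` in the sum `z + s • w` would require a defect
  -- at `s • z + (1 - s) • (z - w)`, beyond the extreme point `s • z`. So `z` and `w` would be
  -- parallel.
  have hpar : crossProduct z (s • w) = 0 := by
    refine helDefect_parallel hdiv hcl hz hiz hw1 ?_ ?_ ?_
    · intro h
      rw [h, dotProduct_zero] at hνp
      linarith
    · intro hp
      have := hle _ hp
      linarith
    · intro a ha hb
      have h3 := hle a ha
      have h4 := hmax' _ hb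
      rw [dotProduct_sub, hνp] at h4
      rcases htwo a ha (by linarith) with h | h
      · exfalso
        have h5 := hz2 _ hb (by rw [dotProduct_sub, hνp, h, hνw]; ring)
        rw [h, show z + s • w - w = s • z + (1 - s) • (z - w) by
          simp only [sub_smul, smul_sub, one_smul]; abel, dotProduct_add, dotProduct_smul _ (z - w) (z - w)] at h5
        have := mul_pos (sub_pos.2 hs1) hd
        simp only [smul_eq_mul] at h5
        linarith
      · exact h
  rw [map_smul] at hpar
  exact cross_ne_zero_of_level one_ne_zero hνz hνw hne.symm
    ((smul_eq_zero.1 hpar).resolve_left hs_pos.ne')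

/-- A closed family of modes which spans space belongs to a Beltrami flow. -/
theorem helical_of_closed {c : R3 →₀ C3} (hc0 : c 0 = 0) (hconj : ∀ n, c (-n) = star (c n))
    (hdiv : ∀ n, c n ⬝ᵥ toC n = 0) (hcl : ClosedModes c)
    (hspan : ∃ a ∈ c.support, ∃ b ∈ c.support, crossProduct a b ≠ 0)
    (hspan3 : ∀ e : R3, e ≠ 0 → ∃ x ∈ c.support, x ⬝ᵥ e ≠ 0) :
    ∃ μ : ℝ, μ ≠ 0 ∧ ∀ n, HelicalAt μ c n := by
  have hsym : ∀ x ∈ c.support, -x ∈ c.support := fun x hx => by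
    rw [Finsupp.mem_support_iff] at hx ⊢
    rw [hconj]; exact star_ne_zero.2 hx
  obtain ⟨ν, w, z, E⟩ := exists_exposed_edge (S := c.support) (by simp [hc0]) hspan
  by_cases hiso : ∀ x ∈ c.support, ν ⬝ᵥ x = 1 → c x ⬝ᵥ c x ≠ 0
  · exact (false_of_edge hc0 hdiv hcl hsym E hiso (hspan3 _ E.cross_ne_zero)).elim
  push Not at hiso
  obtain ⟨x, hx, hx1, hxi⟩ := hiso
  obtain ⟨y, hy, hy1, hxy⟩ : ∃ y ∈ c.support, ν ⬝ᵥ y = 1 ∧ x ≠ y := by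
    by_cases h : x = w
    · exact ⟨z, E.right_mem, E.right, by rw [h]; exact E.ne⟩
    · exact ⟨w, E.left_mem, E.left, h⟩
  have hk : crossProduct x y ≠ 0 := cross_ne_zero_of_level one_ne_zero hx1 hy1 hxy
  have E' : ExposedEdge c.support ν 0 0 x y := by
    refine ⟨E.le, E.le', hx, hy, hx1, by simp, hy1, by simp, hxy, fun v hv hv1 _ => ?_⟩
    obtain ⟨a, ha⟩ := E.segment x hx hx1 (by simp)
    obtain ⟨b, hb⟩ := E.segment y hy hy1 (by simp)
    obtain ⟨t, ht⟩ := E.segment v hv hv1 (by simp)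
    have hab : b - a ≠ 0 := fun h => hxy (by rw [ha, hb, sub_eq_zero.1 h])
    refine ⟨(t - a) / (b - a), ?_⟩
    have h1 : y - x = (b - a) • (z - w) := by rw [ha, hb, sub_smul]; abel
    rw [h1, smul_smul, div_mul_cancel₀ _ hab, sub_smul, ht]
    rw [ha]
    abel
  obtain ⟨htwo, hyi, μ, hμ, hhx, -⟩ := helical_edge E' hc0 hdiv hcl hxi
  exact ⟨μ, hμ, helical_of_edge hc0 hconj hdiv hcl hx hy hxy hx1 hy1 E.le
    (fun v hv h => htwo v hv h (by simp)) hxi hyi hhx⟩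

/-! ### Trigonometric polynomials and their bracket -/

/-- Trigonometric polynomials on space, given by their coefficients. -/
abbrev Trig := AddMonoidAlgebra ℂ R3

namespace Trig

theorem coeff_mul_of_subset (f g : Trig) {s : Finset R3} (hs : f.coeff.support ⊆ s) (p : R3) :
    (f * g).coeff p = ∑ a ∈ s, f.coeff a * g.coeff (p - a) := by
  classical
  rw [AddMonoidAlgebra.coeff_mul, Finsupp.sum,
    ← Finset.sum_subset hs (fun a _ ha => by rw [Finsupp.notMem_support_iff.1 ha, zero_mul])]
  refine Finset.sum_congr rfl fun a _ => ?_
  rw [Finsupp.sum, Finset.sum_eq_single (p - a)]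
  · simp
  · intro b _ hb
    rw [if_neg]
    rintro rfl
    simp at hb
  · intro h
    simp [Finsupp.notMem_support_iff.1 h]

/-- The linear map multiplying the coefficient at `a` by `χ a`. -/
def weight (χ : R3 → ℂ) : Trig →ₗ[ℂ] Trig where
  toFun f := .ofCoeff (Finsupp.onFinset f.coeff.support (fun a => χ a * f.coeff a) fun a h => by
    rw [Finsupp.mem_support_iff]; exact right_ne_zero_of_mul h)
  map_add' f g := by
    ext a; simp [mul_add]
  map_smul' r f := by
    ext a; simp; ring

theorem weight_coeff (χ : R3 → ℂ) (f : Trig) (a : R3) : (weight χ f).coeff a = χ a * f.coeff a := rfl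

theorem weight_support (χ : R3 → ℂ) (f : Trig) : (weight χ f).coeff.support ⊆ f.coeff.support := by
  intro a h
  rw [Finsupp.mem_support_iff, weight_coeff] at h
  rw [Finsupp.mem_support_iff]
  exact right_ne_zero_of_mul h

/-- The negative Laplacian. -/
abbrev lap : Trig →ₗ[ℂ] Trig := weight fun n => ((n ⬝ᵥ n : ℝ) : ℂ)

/-- `weight χ` as a derivation. -/
def wder (χ : R3 →+ ℂ) : Derivation ℂ Trig Trig :=
  Derivation.mk' (weight χ) fun f g => by
    ext p
    simp only [smul_eq_mul, AddMonoidAlgebra.coeff_add, Finsupp.add_apply, weight_coeff]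
    rw [mul_comm g, coeff_mul_of_subset f g subset_rfl,
      coeff_mul_of_subset f (weight χ g) subset_rfl, coeff_mul_of_subset _ g (weight_support χ f),
      Finset.mul_sum, ← Finset.sum_add_distrib]
    refine Finset.sum_congr rfl fun a _ => ?_
    rw [weight_coeff, weight_coeff, map_sub χ]
    ring

theorem wder_coeff (χ : R3 →+ ℂ) (f : Trig) (a : R3) : (wder χ f).coeff a = χ a * f.coeff a := rfl

/-- The coordinate weights. -/
def coord (i : Fin 3) : R3 →+ ℂ where
  toFun a := (a i : ℂ)
  map_zero' := by simp
  map_add' a b := by simp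

/-- Derivative (up to the factor `i`) in the direction of the `i`-th coordinate. -/
abbrev pd (i : Fin 3) : Derivation ℂ Trig Trig := wder (coord i)

/-- The bracket `e · (∇f × ∇g)` (up to sign). -/
def br (e : R3) (f : Trig) : Derivation ℂ Trig Trig :=
  ((e 1 : ℂ) • pd 2 f - (e 2 : ℂ) • pd 1 f) • pd 0 + ((e 2 : ℂ) • pd 0 f - (e 0 : ℂ) • pd 2 f) • pd 1 +
    ((e 0 : ℂ) • pd 1 f - (e 1 : ℂ) • pd 0 f) • pd 2

theorem br_apply (e : R3) (f g : Trig) : br e f g =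
    ((e 1 : ℂ) • pd 2 f - (e 2 : ℂ) • pd 1 f) * pd 0 g +
    ((e 2 : ℂ) • pd 0 f - (e 0 : ℂ) • pd 2 f) * pd 1 g +
    ((e 0 : ℂ) • pd 1 f - (e 1 : ℂ) • pd 0 f) * pd 2 g := by
  simp [br]

theorem br_coeff (e : R3) (f g : Trig) (p : R3) : (br e f g).coeff p =
    ∑ a ∈ f.coeff.support, f.coeff a * g.coeff (p - a) * (det e a p : ℂ) := by
  have hsub : ∀ (i j : Fin 3) (x y : ℂ), (x • pd i f - y • pd j f).coeff.support ⊆ f.coeff.support := by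
    intro i j x y a h
    rw [Finsupp.mem_support_iff] at h ⊢
    intro h0
    apply h
    simp [wder_coeff, h0]
  rw [br_apply]
  simp only [AddMonoidAlgebra.coeff_add, Finsupp.add_apply]
  rw [coeff_mul_of_subset _ _ (hsub _ _ _ _), coeff_mul_of_subset _ _ (hsub _ _ _ _),
    coeff_mul_of_subset _ _ (hsub _ _ _ _), ← Finset.sum_add_distrib, ← Finset.sum_add_distrib]
  refine Finset.sum_congr rfl fun a _ => ?_
  have : det e a p = det e a (p - a) := by rw [det_sub_right, det_self, sub_zero]
  rw [this]
  simp [wder_coeff, coord, det, dotProduct, Fin.sum_univ_three, cross_apply]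
  ring

theorem br_coeff_of_subset (e : R3) {f : Trig} (g : Trig) {s : Finset R3} (hs : f.coeff.support ⊆ s)
    (p : R3) : (br e f g).coeff p = ∑ a ∈ s, f.coeff a * g.coeff (p - a) * (det e a p : ℂ) := by
  rw [br_coeff]
  refine Finset.sum_subset hs fun a _ ha => ?_
  rw [Finsupp.notMem_support_iff.1 ha, zero_mul, zero_mul]

theorem br_swap (e : R3) (f g : Trig) : br e f g = -br e g f := by
  rw [br_apply, br_apply]
  simp only [sub_mul, smul_mul_assoc]
  rw [mul_comm (pd 2 f) (pd 0 g), mul_comm (pd 1 f) (pd 0 g), mul_comm (pd 2 f) (pd 1 g),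
    mul_comm (pd 0 f) (pd 1 g), mul_comm (pd 0 f) (pd 2 g), mul_comm (pd 1 f) (pd 2 g)]
  abel

theorem br_self (e : R3) (f : Trig) : br e f f = 0 := by
  rw [br_apply]
  simp only [sub_mul, smul_mul_assoc]
  rw [mul_comm (pd 2 f) (pd 0 f), mul_comm (pd 1 f) (pd 0 f), mul_comm (pd 2 f) (pd 1 f)]
  abel

theorem br_pow_self (e : R3) (f : Trig) (k : ℕ) : br e f (f ^ k) = 0 := by
  rw [Derivation.leibniz_pow, br_self, smul_zero, smul_zero]

theorem br_aeval (e : R3) (f : Trig) (q : Polynomial ℂ) : br e f (Polynomial.aeval f q) = 0 := by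
  rw [Derivation.map_aeval, br_self, smul_zero]

/-- The frequencies of `f` lie in the half space `ℓ ≤ s`. -/
def LevelLE (ℓ : R3) (f : Trig) (s : ℝ) : Prop := ∀ m, f.coeff m ≠ 0 → ℓ ⬝ᵥ m ≤ s

/-- The frequencies of `f` are orthogonal to `e`. -/
def Planar (e : R3) (f : Trig) : Prop := ∀ m, f.coeff m ≠ 0 → e ⬝ᵥ m = 0

theorem exists_of_mul_coeff_ne {f g : Trig} {p : R3} (h : (f * g).coeff p ≠ 0) :
    ∃ a b, a + b = p ∧ f.coeff a ≠ 0 ∧ g.coeff b ≠ 0 := by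
  rw [coeff_mul_of_subset f g subset_rfl] at h
  obtain ⟨a, -, ha⟩ := Finset.exists_ne_zero_of_sum_ne_zero h
  exact ⟨a, p - a, by abel, left_ne_zero_of_mul ha, right_ne_zero_of_mul ha⟩

theorem exists_of_br_coeff_ne {e : R3} {f g : Trig} {p : R3} (h : (br e f g).coeff p ≠ 0) :
    ∃ a b, a + b = p ∧ f.coeff a ≠ 0 ∧ g.coeff b ≠ 0 := by
  rw [br_coeff] at h
  obtain ⟨a, -, ha⟩ := Finset.exists_ne_zero_of_sum_ne_zero h
  have := left_ne_zero_of_mul ha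
  exact ⟨a, p - a, by abel, left_ne_zero_of_mul this, right_ne_zero_of_mul this⟩

theorem LevelLE.mul {ℓ : R3} {f g : Trig} {s t : ℝ} (hf : LevelLE ℓ f s) (hg : LevelLE ℓ g t) :
    LevelLE ℓ (f * g) (s + t) := by
  intro m h
  obtain ⟨a, b, rfl, ha, hb⟩ := exists_of_mul_coeff_ne h
  rw [dotProduct_add]
  exact add_le_add (hf a ha) (hg b hb)

theorem LevelLE.br {ℓ e : R3} {f g : Trig} {s t : ℝ} (hf : LevelLE ℓ f s) (hg : LevelLE ℓ g t) :
    LevelLE ℓ (br e f g) (s + t) := by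
  intro m h
  obtain ⟨a, b, rfl, ha, hb⟩ := exists_of_br_coeff_ne h
  rw [dotProduct_add]
  exact add_le_add (hf a ha) (hg b hb)

theorem Planar.mul {e : R3} {f g : Trig} (hf : Planar e f) (hg : Planar e g) : Planar e (f * g) := by
  intro m h
  obtain ⟨a, b, rfl, ha, hb⟩ := exists_of_mul_coeff_ne h
  rw [dotProduct_add, hf a ha, hg b hb, add_zero]

theorem Planar.br {e e' : R3} {f g : Trig} (hf : Planar e f) (hg : Planar e g) :
    Planar e (br e' f g) := by
  intro m h
  obtain ⟨a, b, rfl, ha, hb⟩ := exists_of_br_coeff_ne h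
  rw [dotProduct_add, hf a ha, hg b hb, add_zero]

theorem one_coeff_ne {m : R3} (h : (1 : Trig).coeff m ≠ 0) : m = 0 := by
  classical
  rw [AddMonoidAlgebra.one_def, AddMonoidAlgebra.coeff_single, Finsupp.single_apply] at h
  by_contra hm
  exact h (if_neg (Ne.symm hm))

theorem LevelLE.pow {ℓ : R3} {f : Trig} (hf : LevelLE ℓ f 1) (k : ℕ) : LevelLE ℓ (f ^ k) k := by
  induction k with
  | zero =>
    intro m h
    rw [pow_zero] at h
    simp [one_coeff_ne h]
  | succ k ih =>
    rw [pow_succ, Nat.cast_succ]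
    exact ih.mul hf

theorem Planar.pow {e : R3} {f : Trig} (hf : Planar e f) (k : ℕ) : Planar e (f ^ k) := by
  induction k with
  | zero =>
    intro m h
    rw [pow_zero] at h
    simp [one_coeff_ne h]
  | succ k ih =>
    rw [pow_succ]
    exact ih.mul hf

theorem Planar.sub {e : R3} {f g : Trig} (hf : Planar e f) (hg : Planar e g) : Planar e (f - g) := by
  intro m h
  by_cases h1 : f.coeff m = 0
  · by_cases h2 : g.coeff m = 0
    · exact absurd (by simp [h1, h2]) h
    · exact hg m h2
  · exact hf m h1

theorem Planar.smul {e : R3} {f : Trig} (hf : Planar e f) (r : ℂ) : Planar e (r • f) := by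
  intro m h
  refine hf m fun h0 => h ?_
  simp [h0]

theorem LevelLE.sub {ℓ : R3} {f g : Trig} {s : ℝ} (hf : LevelLE ℓ f s) (hg : LevelLE ℓ g s) :
    LevelLE ℓ (f - g) s := by
  intro m h
  by_cases h1 : f.coeff m = 0
  · by_cases h2 : g.coeff m = 0
    · exact absurd (by simp [h1, h2]) h
    · exact hg m h2
  · exact hf m h1

theorem LevelLE.smul {ℓ : R3} {f : Trig} {s : ℝ} (hf : LevelLE ℓ f s) (r : ℂ) :
    LevelLE ℓ (r • f) s := by
  intro m h
  refine hf m fun h0 => h ?_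
  simp [h0]

theorem exists_top {ℓ : R3} {f : Trig} (hf : f ≠ 0) :
    ∃ m, f.coeff m ≠ 0 ∧ LevelLE ℓ f (ℓ ⬝ᵥ m) := by
  have hne : f.coeff.support.Nonempty := by
    rw [Finsupp.support_nonempty_iff]
    exact fun h => hf (AddMonoidAlgebra.coeff_eq_zero.1 h)
  obtain ⟨m, hm, hmax⟩ := Finset.exists_max_image f.coeff.support (fun x => ℓ ⬝ᵥ x) hne
  exact ⟨m, Finsupp.mem_support_iff.1 hm, fun x hx => hmax x (Finsupp.mem_support_iff.2 hx)⟩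

end Trig

/-! ### Edges of a planar support and the centralizer of a stream function -/

theorem planar_expand {e a b m : R3} (he : e ⬝ᵥ e = 1) (ha : e ⬝ᵥ a = 0) (hb : e ⬝ᵥ b = 0)
    (hm : e ⬝ᵥ m = 0) : det e a b • m = det e m b • a + det e a m • b := by
  have h1 : det m a b • e = (e ⬝ᵥ m) • crossProduct a b + (e ⬝ᵥ a) • crossProduct b m +
      (e ⬝ᵥ b) • crossProduct m a := by
    simp only [cross_apply]
    ext i; fin_cases i <;> simp [det, dotProduct, Fin.sum_univ_three, cross_apply] <;> ring
  have h2 : det m a b = 0 := by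
    have := congrArg (e ⬝ᵥ ·) h1
    simpa [ha, hb, hm, he] using this
  have h3 : det e a b • m = det m a b • e + det e m b • a + det e a m • b := by
    ext i; fin_cases i <;> simp [det, dotProduct, Fin.sum_univ_three, cross_apply] <;> ring
  rw [h3, h2, zero_smul, zero_add]

theorem eq_zero_of_step_up {F : ℝ → ℂ} (hF : {θ | F θ ≠ 0}.Finite) {θ : ℝ}
    (h : ∀ x, θ ≤ x → F x ≠ 0 → F (x + 1) ≠ 0) : F θ = 0 := by
  by_contra h0
  have hall : ∀ k : ℕ, F (θ + k) ≠ 0 := by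
    intro k
    induction k with
    | zero => simpa using h0
    | succ k ih =>
      have := h _ (by simp) ih
      rwa [Nat.cast_succ, ← add_assoc]
  refine Set.infinite_of_injective_forall_mem (f := fun k : ℕ => θ + (k : ℝ)) (fun a b hab => ?_) hall hF
  simpa using hab

theorem eq_zero_of_step_down {F : ℝ → ℂ} (hF : {θ | F θ ≠ 0}.Finite) {θ : ℝ}
    (h : ∀ x, x ≤ θ → F x ≠ 0 → F (x - 1) ≠ 0) : F θ = 0 := by
  have hG : {x | F (-x) ≠ 0}.Finite := hF.preimage neg_injective.injOn
  have := eq_zero_of_step_up (F := fun x => F (-x)) hG (θ := -θ) fun x hx hFx => by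
    have := h (-x) (by linarith) hFx
    rwa [neg_add, ← sub_eq_add_neg]
  simpa using this

/-- `F` solves the first order recursion on the line with right hand side `r`. -/
def Recur (b₁ b₂ : ℂ) (s : ℝ) (F r : ℝ → ℂ) : Prop :=
  ∀ θ : ℝ, b₁ * θ * F θ - b₂ * (s + 1 - θ) * F (θ - 1) = r θ

section
variable {b₁ b₂ : ℂ} {s : ℝ} {F r : ℝ → ℂ}

/-- The coefficient of the earlier term vanishes only at the upper end θ = s, and the coefficient of
the later term only at θ = 0. Off these ends a nonzero value propagates by unit steps, which finite
support forbids to go on forever. -/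
theorem Recur.step_up (h : Recur b₁ b₂ s F r) (hb₂ : b₂ ≠ 0) {θ : ℝ} (hF : F θ ≠ 0) (hs : θ ≠ s)
    (hr : r (θ + 1) = 0) : F (θ + 1) ≠ 0 := by
  intro h0
  have := h (θ + 1)
  rw [h0, hr, mul_zero, zero_sub, neg_eq_zero, add_sub_cancel_right] at this
  have hs' : (s : ℂ) + 1 - ((θ + 1 : ℝ) : ℂ) ≠ 0 := by
    intro h1
    apply hs
    have : ((s + 1 - (θ + 1) : ℝ) : ℂ) = 0 := by push_cast; push_cast at h1; exact h1
    have := Complex.ofReal_eq_zero.1 this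
    linarith
  exact mul_ne_zero (mul_ne_zero hb₂ hs') hF this

theorem Recur.step_down (h : Recur b₁ b₂ s F r) (hb₁ : b₁ ≠ 0) {θ : ℝ} (hF : F θ ≠ 0) (h0 : θ ≠ 0)
    (hr : r θ = 0) : F (θ - 1) ≠ 0 := by
  intro h1
  have := h θ
  rw [h1, hr, mul_zero, sub_zero] at this
  exact mul_ne_zero (mul_ne_zero hb₁ (Complex.ofReal_ne_zero.2 h0)) hF this

theorem Recur.below (h : Recur b₁ b₂ s F r) (hb₁ : b₁ ≠ 0) (hfin : {θ | F θ ≠ 0}.Finite)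
    (hr : ∀ θ < 0, r θ = 0) {θ : ℝ} (hθ : θ < 0) : F θ = 0 :=
  eq_zero_of_step_down hfin fun _ hx hFx =>
    h.step_down hb₁ hFx (by linarith) (hr _ (by linarith))

/-- For s = 0 both ends of the recursion are at 0, so a source at 0 and 1 can only sustain a value
at 0. -/
theorem Recur.resonant (h : Recur b₁ b₂ 0 F r) (hb₁ : b₁ ≠ 0) (hb₂ : b₂ ≠ 0)
    (hfin : {θ | F θ ≠ 0}.Finite) (hr : ∀ θ, θ ≠ 0 → θ ≠ 1 → r θ = 0) {θ : ℝ} (hθ : θ ≠ 0) :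
    F θ = 0 := by
  rcases lt_or_gt_of_ne hθ with h0 | h0
  · exact h.below hb₁ hfin (fun x hx => hr x (by linarith) (by linarith)) h0
  · exact eq_zero_of_step_up hfin fun x hx hFx =>
      h.step_up hb₂ hFx (by linarith) (hr _ (by linarith) (by linarith))

/-- Solutions of the homogeneous recursion live on `{0, …, k}` with `s = k`. -/
theorem Recur.homogeneous (h : Recur b₁ b₂ s F r) (hr : ∀ θ, r θ = 0) (hb₁ : b₁ ≠ 0) (hb₂ : b₂ ≠ 0)
    (hfin : {θ | F θ ≠ 0}.Finite) {θ : ℝ} (hθ : F θ ≠ 0) :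
    ∃ i j : ℕ, θ = i ∧ s = i + j ∧ F 0 ≠ 0 := by
  have hdown : ∃ i : ℕ, θ = i := by
    by_contra! hn
    refine hθ (?_ : F θ = 0)
    have hall : ∀ k : ℕ, F (θ - k) ≠ 0 := by
      intro k
      induction k with
      | zero => simpa using hθ
      | succ k ih =>
        have := h.step_down hb₁ ih (fun h0 => hn k (by linarith)) (hr _)
        rwa [Nat.cast_succ, ← sub_sub]
    exact absurd hfin (Set.infinite_of_injective_forall_mem (f := fun k : ℕ => θ - (k : ℝ))
      (fun a b hab => by simpa using hab) hall)
  have hup : ∃ j : ℕ, s = θ + j := by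
    by_contra! hn
    have hall : ∀ k : ℕ, F (θ + k) ≠ 0 := by
      intro k
      induction k with
      | zero => simpa using hθ
      | succ k ih =>
        have := h.step_up hb₂ ih (fun h0 => hn k h0.symm) (hr _)
        rwa [Nat.cast_succ, ← add_assoc]
    exact absurd hfin (Set.infinite_of_injective_forall_mem (f := fun k : ℕ => θ + (k : ℝ))
      (fun a b hab => by simpa using hab) hall)
  obtain ⟨i, rfl⟩ := hdown
  obtain ⟨j, hj⟩ := hup
  refine ⟨i, j, rfl, hj, ?_⟩
  clear hj
  induction i with
  | zero => simpa using hθ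
  | succ i ih =>
    have := h.step_down hb₁ hθ (by positivity) (hr _)
    exact ih (by simpa using this)

end

/-- An edge `[n₁, n₂]` of the support of `β`, exposed by the functional `ℓ`. -/
structure REdge (e : R3) (β : Trig) (ℓ n₁ n₂ : R3) : Prop where
  unit : e ⬝ᵥ e = 1
  planar : Trig.Planar e β
  perp : e ⬝ᵥ ℓ = 0
  mem₁ : β.coeff n₁ ≠ 0
  mem₂ : β.coeff n₂ ≠ 0
  level₁ : ℓ ⬝ᵥ n₁ = 1
  level₂ : ℓ ⬝ᵥ n₂ = 1
  levelLE : Trig.LevelLE ℓ β 1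
  top : ∀ m, β.coeff m ≠ 0 → ℓ ⬝ᵥ m = 1 → m = n₁ ∨ m = n₂
  det_pos : 0 < det e n₁ n₂

namespace REdge

/-- The points of level `s`. -/
def pt (n₁ n₂ : R3) (s θ : ℝ) : R3 := s • n₁ + θ • (n₂ - n₁)

theorem eq_pt_of_perp {e ℓ n₁ n₂ m : R3} (he : e ⬝ᵥ e = 1) (h₁ : e ⬝ᵥ n₁ = 0) (h₂ : e ⬝ᵥ n₂ = 0)
    (hl₁ : ℓ ⬝ᵥ n₁ = 1) (hl₂ : ℓ ⬝ᵥ n₂ = 1) (hD : 0 < det e n₁ n₂) (hm : e ⬝ᵥ m = 0) :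
    m = pt n₁ n₂ (ℓ ⬝ᵥ m) (det e n₁ m / det e n₁ n₂) := by
  have h := planar_expand he h₁ h₂ hm
  have hl := congrArg (ℓ ⬝ᵥ ·) h
  simp only [dotProduct_add, dotProduct_smul, hl₁, hl₂, smul_eq_mul, mul_one] at hl
  have hD := hD.ne'
  have hm' : m = (det e n₁ n₂)⁻¹ • (det e m n₂ • n₁ + det e n₁ m • n₂) := by
    rw [← h, smul_smul, inv_mul_cancel₀ hD, one_smul]
  have h3 : det e m n₂ = det e n₁ n₂ * (ℓ ⬝ᵥ m) - det e n₁ m := by linarith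
  have h4 : (det e n₁ n₂)⁻¹ * (det e m n₂) = (ℓ ⬝ᵥ m) - det e n₁ m / det e n₁ n₂ := by
    rw [h3]; field_simp
  rw [smul_add, smul_smul, smul_smul, h4] at hm'
  rw [pt]
  conv_lhs => rw [hm']
  rw [div_eq_inv_mul]
  module

variable {e : R3} {β : Trig} {ℓ n₁ n₂ : R3} (E : REdge e β ℓ n₁ n₂)
include E

theorem perp₁ : e ⬝ᵥ n₁ = 0 := E.planar _ E.mem₁

theorem perp₂ : e ⬝ᵥ n₂ = 0 := E.planar _ E.mem₂

theorem ne : n₁ ≠ n₂ := by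
  rintro rfl
  have := E.det_pos
  rw [det_self] at this
  exact lt_irrefl _ this

theorem level_pt (s θ : ℝ) : ℓ ⬝ᵥ pt n₁ n₂ s θ = s := by
  simp [pt, dotProduct_sub, E.level₁, E.level₂]

theorem exists_pt {m : R3} (hm : e ⬝ᵥ m = 0) : ∃ θ, m = pt n₁ n₂ (ℓ ⬝ᵥ m) θ :=
  ⟨_, eq_pt_of_perp E.unit E.perp₁ E.perp₂ E.level₁ E.level₂ E.det_pos hm⟩

theorem pt_injective (s : ℝ) : Function.Injective (pt n₁ n₂ s) := by
  intro a b hab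
  have : (a - b) • (n₂ - n₁) = 0 := by
    have := sub_eq_zero.2 hab
    rw [← this, pt, pt]; module
  rcases smul_eq_zero.1 this with h | h
  · linarith
  · exact absurd (sub_eq_zero.1 h).symm E.ne

theorem finite_line (g : Trig) (s : ℝ) : {θ | g.coeff (pt n₁ n₂ s θ) ≠ 0}.Finite := by
  refine (g.coeff.support.finite_toSet.preimage (E.pt_injective s).injOn).subset fun θ hθ => ?_
  simpa using hθ

/-- At level s + 1 only the top of `β`, that is the two ends of the edge, can meet the top of `g`.
-/
theorem br_coeff_pt {g : Trig} {s : ℝ} (hg : Trig.LevelLE ℓ g s) (θ : ℝ) :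
    (Trig.br e β g).coeff (pt n₁ n₂ (s + 1) θ) = det e n₁ n₂ *
      (β.coeff n₁ * θ * g.coeff (pt n₁ n₂ s θ) -
        β.coeff n₂ * (s + 1 - θ) * g.coeff (pt n₁ n₂ s (θ - 1))) := by
  classical
  rw [Trig.br_coeff]
  have hsub : ({n₁, n₂} : Finset R3) ⊆ β.coeff.support := by
    intro x hx
    rw [Finset.mem_insert, Finset.mem_singleton] at hx
    rcases hx with rfl | rfl
    · exact Finsupp.mem_support_iff.2 E.mem₁
    · exact Finsupp.mem_support_iff.2 E.mem₂
  rw [← Finset.sum_subset hsub]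
  · have h1 : pt n₁ n₂ (s + 1) θ - n₁ = pt n₁ n₂ s θ := by simp only [pt]; module
    have h2 : pt n₁ n₂ (s + 1) θ - n₂ = pt n₁ n₂ s (θ - 1) := by simp only [pt]; module
    rw [Finset.sum_pair E.ne, h1, h2]
    simp only [pt, det_add_right, det_smul_right, det_sub_right, det_self, det_swap e n₂ n₁]
    push_cast; ring
  · intro a ha hna
    rw [Finsupp.mem_support_iff] at ha
    by_cases h : g.coeff (pt n₁ n₂ (s + 1) θ - a) = 0
    · rw [h, mul_zero, zero_mul]
    · exfalso
      apply hna
      have h1 := hg _ h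
      have h2 := E.levelLE a ha
      rw [dotProduct_sub, E.level_pt] at h1
      have := E.top a ha (by linarith)
      simpa using this

theorem recur {g : Trig} {s : ℝ} (hg : Trig.LevelLE ℓ g s) :
    Recur (β.coeff n₁) (β.coeff n₂) s (fun θ => g.coeff (pt n₁ n₂ s θ))
      (fun θ => (Trig.br e β g).coeff (pt n₁ n₂ (s + 1) θ) / det e n₁ n₂) := by
  intro θ
  dsimp only
  rw [E.br_coeff_pt hg, mul_div_cancel_left₀ _ (Complex.ofReal_ne_zero.2 E.det_pos.ne')]

/-- A top part commuting with the edge has an integral level `k` and lives on `k + 1` points. -/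
theorem commuting {g : Trig} {s : ℝ} (hp : Trig.Planar e g) (hg : Trig.LevelLE ℓ g s)
    (hbr : ∀ p, ℓ ⬝ᵥ p = s + 1 → (Trig.br e β g).coeff p = 0) {m : R3} (hm : g.coeff m ≠ 0)
    (hs : ℓ ⬝ᵥ m = s) :
    ∃ i j : ℕ, m = pt n₁ n₂ s i ∧ s = i + j ∧ g.coeff (s • n₁) ≠ 0 := by
  obtain ⟨θ, hθ⟩ := E.exists_pt (hp m hm)
  rw [hs] at hθ
  obtain ⟨i, j, hi, hj, h0⟩ := (E.recur hg).homogeneous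
    (fun x => by rw [hbr _ (E.level_pt _ _), zero_div]) E.mem₁ E.mem₂ (E.finite_line g s)
    (θ := θ) (by rwa [← hθ])
  refine ⟨i, j, by rw [hθ, hi], hj, ?_⟩
  simpa [pt] using h0

end REdge

namespace REdge

variable {e : R3} {β : Trig} {ℓ n₁ n₂ : R3} (E : REdge e β ℓ n₁ n₂)

/-- The top part of `g` exists and does not commute with the edge. -/
def Noncommuting (e : R3) (β : Trig) (ℓ : R3) (g : Trig) (s : ℝ) : Prop :=
  Trig.Planar e g ∧ Trig.LevelLE ℓ g s ∧ ∃ p, ℓ ⬝ᵥ p = s + 1 ∧ (Trig.br e β g).coeff p ≠ 0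

include E

theorem pow_coeff_zero (k : ℕ) : (β ^ k).coeff ((k : ℝ) • n₁) = β.coeff n₁ ^ k := by
  classical
  induction k with
  | zero => simp [AddMonoidAlgebra.one_def]
  | succ k ih =>
    rw [pow_succ', Trig.coeff_mul_of_subset β _ subset_rfl, Finset.sum_eq_single n₁]
    · rw [Nat.cast_succ, add_smul, one_smul, add_sub_cancel_right, ih, pow_succ']
    · intro a ha hne
      rw [Finsupp.mem_support_iff] at ha
      by_contra h0
      have h := right_ne_zero_of_mul h0
      have h1 := (E.levelLE.pow k) _ h
      have h2 := E.levelLE a ha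
      rw [dotProduct_sub, dotProduct_smul, E.level₁] at h1
      push_cast at h1
      rcases E.top a ha (by simp at h1; linarith) with rfl | rfl
      · exact hne rfl
      · have h3 : ((k + 1 : ℕ) : ℝ) • n₁ - a = pt n₁ a k (-1) := by
          rw [pt]; push_cast; module
        rw [h3] at h
        obtain ⟨i, j, hi, -, -⟩ := E.commuting (E.planar.pow k) (E.levelLE.pow k)
          (fun p _ => by rw [Trig.br_pow_self]; rfl) h (E.level_pt _ _)
        have := E.pt_injective _ hi
        have hi0 : (0 : ℝ) ≤ i := by positivity
        linarith
    · intro h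
      exact absurd (Finsupp.mem_support_iff.2 E.mem₁) h

/-- Since `β ^ k` commutes with `β`, its top part solves the homogeneous recursion, whose solution
is binomial. -/
theorem pow_coeff (k j : ℕ) (hj : j ≤ k) : (β ^ k).coeff (pt n₁ n₂ k j) =
    k.choose j * β.coeff n₁ ^ (k - j) * β.coeff n₂ ^ j := by
  induction j with
  | zero => simpa [pt] using E.pow_coeff_zero k
  | succ j ih =>
    have h := E.recur (E.levelLE.pow k) ((j + 1 : ℕ) : ℝ)
    simp only [Trig.br_pow_self] at h
    have h1 : ((j + 1 : ℕ) : ℝ) - 1 = j := by push_cast; ring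
    rw [h1, ih (by omega)] at h
    simp only [AddMonoidAlgebra.coeff_zero, Finsupp.zero_apply, zero_div] at h
    have hc := congrArg (Nat.cast : ℕ → ℂ) (Nat.choose_succ_right_eq k j)
    rw [Nat.cast_mul, Nat.cast_mul, Nat.cast_sub (by omega : j ≤ k)] at hc
    obtain ⟨i, rfl⟩ := Nat.exists_eq_add_of_le hj
    have e1 : j + 1 + i - j = i + 1 := by omega
    have e2 : j + 1 + i - (j + 1) = i := by omega
    rw [e1] at h
    rw [e2]
    have hb := E.mem₁
    have hj1 : ((j : ℂ) + 1) ≠ 0 := by exact_mod_cast Nat.succ_ne_zero j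
    apply mul_left_cancel₀ (mul_ne_zero hb hj1)
    push_cast at h hc ⊢
    linear_combination h - β.coeff n₁ ^ (i + 1) * β.coeff n₂ ^ (j + 1) * hc

/-- Subtracting a multiple of a power of `β` lowers the level of a function with commuting top. -/
theorem sub_pow_level {f : Trig} (hp : Trig.Planar e f) {k : ℕ} (hf : Trig.LevelLE ℓ f k)
    (hbr : ∀ p, ℓ ⬝ᵥ p = k + 1 → (Trig.br e β f).coeff p = 0) {m : R3}
    (hm : (f - (f.coeff ((k : ℝ) • n₁) / β.coeff n₁ ^ k) • β ^ k).coeff m ≠ 0) : ℓ ⬝ᵥ m < k := by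
  set κ := f.coeff ((k : ℝ) • n₁) / β.coeff n₁ ^ k
  have hl : Trig.LevelLE ℓ (f - κ • β ^ k) k := hf.sub ((E.levelLE.pow k).smul κ)
  refine lt_of_le_of_ne (hl m hm) fun h => ?_
  obtain ⟨i, j, -, -, h0⟩ := E.commuting (hp.sub ((E.planar.pow k).smul κ)) hl
    (fun p hp => by rw [map_sub, Derivation.map_smul, Trig.br_pow_self, smul_zero, sub_zero, hbr p hp])
    hm h
  apply h0
  have hb : β.coeff n₁ ^ k ≠ 0 := pow_ne_zero _ E.mem₁
  simp only [AddMonoidAlgebra.coeff_sub, Finsupp.sub_apply, AddMonoidAlgebra.coeff_smul,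
    Finsupp.smul_apply, smul_eq_mul, E.pow_coeff_zero k]
  rw [div_mul_cancel₀ _ hb, sub_self]

/-- A commuting top part sits at an integral level k and is a multiple of that of `β ^ k`;
subtracting the multiple lowers the level. Since these levels are natural numbers, the process ends,
either at zero or at a top part that does not commute. -/
theorem exists_reduce (k : ℕ) (f : Trig) (hp : Trig.Planar e f)
    (hf : ∀ m, f.coeff m ≠ 0 → ℓ ⬝ᵥ m < k) : ∃ q : Polynomial ℂ,
      f - Polynomial.aeval β q = 0 ∨ ∃ s, Noncommuting e β ℓ (f - Polynomial.aeval β q) s := by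
  induction k using Nat.strong_induction_on generalizing f with
  | _ k ih =>
    by_cases h0 : f = 0
    · exact ⟨0, Or.inl (by simp [h0])⟩
    obtain ⟨m, hm, hl⟩ := Trig.exists_top (ℓ := ℓ) h0
    by_cases hbr : ∀ p, ℓ ⬝ᵥ p = ℓ ⬝ᵥ m + 1 → (Trig.br e β f).coeff p = 0
    · obtain ⟨i, j, -, hs, -⟩ := E.commuting hp hl hbr hm rfl
      have hs' : ℓ ⬝ᵥ m = ((i + j : ℕ) : ℝ) := by rw [hs]; push_cast; rfl
      have hlt : i + j < k := by
        have := hf m hm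
        rw [hs'] at this
        exact_mod_cast this
      rw [hs'] at hl hbr
      obtain ⟨q, hq⟩ := ih _ hlt _ (hp.sub ((E.planar.pow (i + j)).smul
        (f.coeff (((i + j : ℕ) : ℝ) • n₁) / β.coeff n₁ ^ (i + j))))
        (fun x hx => E.sub_pow_level hp hl hbr hx)
      refine ⟨Polynomial.C (f.coeff (((i + j : ℕ) : ℝ) • n₁) / β.coeff n₁ ^ (i + j)) *
        Polynomial.X ^ (i + j) + q, ?_⟩
      have : f - Polynomial.aeval β (Polynomial.C (f.coeff (((i + j : ℕ) : ℝ) • n₁) /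
          β.coeff n₁ ^ (i + j)) * Polynomial.X ^ (i + j) + q) =
          f - (f.coeff (((i + j : ℕ) : ℝ) • n₁) / β.coeff n₁ ^ (i + j)) • β ^ (i + j) -
            Polynomial.aeval β q := by
        rw [map_add, map_mul, Polynomial.aeval_C, map_pow, Polynomial.aeval_X, ← sub_sub,
          ← Algebra.smul_def]
      rw [this]
      exact hq
    · push Not at hbr
      refine ⟨0, Or.inr ⟨ℓ ⬝ᵥ m, ?_⟩⟩
      rw [map_zero, sub_zero]
      exact ⟨hp, hl, hbr⟩

/-- If the top of the bracket commuted, its coefficient at `(s + 1) • n₁` would be nonzero. At this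
end of the line, however, the recursion has the factor θ = 0 and a predecessor that vanishes by
`Recur.below`. -/
theorem noncommuting_br {g : Trig} {s : ℝ} (h : Noncommuting e β ℓ g s) :
    Noncommuting e β ℓ (Trig.br e β g) (s + 1) := by
  obtain ⟨hp, hl, p, hps, hpne⟩ := h
  have hl' : Trig.LevelLE ℓ (Trig.br e β g) (s + 1) := by
    rw [add_comm]; exact E.levelLE.br hl
  have hp' : Trig.Planar e (Trig.br e β g) := E.planar.br hp
  refine ⟨hp', hl', ?_⟩
  by_contra! hcon
  obtain ⟨i, j, -, hs, h0⟩ := E.commuting hp' hl' hcon hpne hps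
  apply h0
  have h1 : (s + 1) • n₁ = pt n₁ n₂ (s + 1) 0 := by simp [pt]
  rw [h1, E.br_coeff_pt hl]
  have hb : g.coeff (pt n₁ n₂ s (0 - 1)) = 0 := by
    refine (E.recur hl).below E.mem₁ (E.finite_line g s) (fun θ hθ => ?_) (by norm_num)
    by_cases hz : (Trig.br e β g).coeff (pt n₁ n₂ (s + 1) θ) = 0
    · rw [hz, zero_div]
    · obtain ⟨i', j', hi, -, -⟩ := E.commuting hp' hl' hcon hz (E.level_pt _ _)
      have := E.pt_injective _ hi
      have hi0 : (0 : ℝ) ≤ i' := by positivity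
      linarith
  rw [hb]
  simp

/-- A function whose iterated brackets with `β` have a common finite support commutes with `β`. -/
theorem br_eq_zero_of_bounded {f : Trig} (hp : Trig.Planar e f) (Z : Finset R3)
    (hZ : ∀ k : ℕ, ∀ p, ((Trig.br e β)^[k] f).coeff p ≠ 0 → p ∈ Z) : Trig.br e β f = 0 := by
  obtain ⟨M, hM⟩ : ∃ M : ℕ, ∀ m, f.coeff m ≠ 0 → ℓ ⬝ᵥ m < M := by
    by_cases h0 : f = 0
    · exact ⟨0, fun m hm => absurd (by rw [h0]; rfl) hm⟩
    obtain ⟨m, -, hl⟩ := Trig.exists_top (ℓ := ℓ) h0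
    obtain ⟨M, hM⟩ := exists_nat_gt (ℓ ⬝ᵥ m)
    exact ⟨M, fun x hx => (hl x hx).trans_lt hM⟩
  obtain ⟨q, h | ⟨s, h⟩⟩ := E.exists_reduce M f hp hM
  · rw [sub_eq_zero.1 h, Trig.br_aeval]
  · exfalso
    set g := f - Polynomial.aeval β q
    have hbr : Trig.br e β g = Trig.br e β f := by rw [map_sub, Trig.br_aeval, sub_zero]
    have hall : ∀ k : ℕ, Noncommuting e β ℓ ((Trig.br e β)^[k] g) (s + k) := by
      intro k
      induction k with
      | zero => simpa using h
      | succ k ih =>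
        rw [Function.iterate_succ_apply', Nat.cast_succ, ← add_assoc]
        exact E.noncommuting_br ih
    -- Iterated brackets climb one level at a time, which no finite set can accommodate.
    have hex : ∀ k : ℕ, ∃ p ∈ Z, ℓ ⬝ᵥ p = s + k + 1 := by
      intro k
      obtain ⟨-, -, p, hps, hpne⟩ := hall k
      refine ⟨p, hZ (k + 1) p ?_, hps⟩
      have h1 : Trig.br e β ((Trig.br e β)^[k] g) = (Trig.br e β)^[k + 1] f := by
        rw [Function.iterate_succ_apply (Trig.br e β) k f, ← hbr, ← Function.iterate_succ_apply,
          Function.iterate_succ_apply']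
      rwa [h1] at hpne
    obtain ⟨p₀, hp₀, -⟩ := hex 0
    obtain ⟨m, -, hmax⟩ := Finset.exists_max_image Z (fun x => ℓ ⬝ᵥ x) ⟨p₀, hp₀⟩
    obtain ⟨N, hN⟩ := exists_nat_gt (ℓ ⬝ᵥ m - s)
    obtain ⟨p, hpZ, hps⟩ := hex N
    have := hmax p hpZ
    linarith

/-- The centralizer of `β` consists of polynomials in `β`. -/
theorem exists_aeval {f : Trig} (hp : Trig.Planar e f) (hbr : Trig.br e β f = 0) :
    ∃ q : Polynomial ℂ, f = Polynomial.aeval β q := by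
  obtain ⟨M, hM⟩ : ∃ M : ℕ, ∀ m, f.coeff m ≠ 0 → ℓ ⬝ᵥ m < M := by
    by_cases h0 : f = 0
    · exact ⟨0, fun m hm => absurd (by rw [h0]; rfl) hm⟩
    obtain ⟨m, -, hl⟩ := Trig.exists_top (ℓ := ℓ) h0
    obtain ⟨M, hM⟩ := exists_nat_gt (ℓ ⬝ᵥ m)
    exact ⟨M, fun x hx => (hl x hx).trans_lt hM⟩
  obtain ⟨q, h | ⟨s, -, -, p, -, hne⟩⟩ := E.exists_reduce M f hp hM
  · exact ⟨q, sub_eq_zero.1 h⟩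
  · rw [map_sub, Trig.br_aeval, sub_zero, hbr] at hne
    exact absurd rfl hne

end REdge
-- Supports on circles and proportional components
namespace REdge

/-- A top level strictly between 0 and 1 is excluded because commuting levels are integral. At level
0 the only sources are the two ends of the edge, and the resonant recursion leaves only frequency 0,
where `f` vanishes. -/
theorem vanish_nonneg {e : R3} {β : Trig} {ℓ n₁ n₂ : R3} (E : REdge e β ℓ n₁ n₂) {f : Trig}
    (hp : Trig.Planar e f) (h0 : f.coeff 0 = 0) (hlt : ∀ m, f.coeff m ≠ 0 → ℓ ⬝ᵥ m < 1)
    (hbr : ∀ p, 1 < ℓ ⬝ᵥ p → (Trig.br e β f).coeff p = 0)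
    (hbr1 : ∀ p, ℓ ⬝ᵥ p = 1 → p ≠ n₁ → p ≠ n₂ → (Trig.br e β f).coeff p = 0) {m : R3}
    (hm : 0 ≤ ℓ ⬝ᵥ m) : f.coeff m = 0 := by
  by_contra hne
  obtain ⟨t, ht, hl⟩ := Trig.exists_top (ℓ := ℓ) (f := f) (by rintro rfl; exact hne rfl)
  have hs0 : 0 ≤ ℓ ⬝ᵥ t := hm.trans (hl m hne)
  have hs1 := hlt t ht
  rcases hs0.eq_or_lt with hs | hs
  · rw [← hs] at hl
    obtain ⟨θ, hθ⟩ := E.exists_pt (hp t ht)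
    rw [← hs] at hθ
    have hθ0 : θ ≠ 0 := by
      rintro rfl
      apply ht
      rw [hθ]
      simpa [pt] using h0
    apply ht
    rw [hθ]
    refine (E.recur hl).resonant E.mem₁ E.mem₂ (E.finite_line f 0) (fun x hx0 hx1 => ?_) hθ0
    rw [hbr1 _ (by rw [E.level_pt]; ring), zero_div]
    · intro h
      have : pt n₁ n₂ (0 + 1) 0 = n₁ := by simp [pt]
      exact hx0 (E.pt_injective _ (h.trans this.symm))
    · intro h
      have : pt n₁ n₂ (0 + 1) 1 = n₂ := by simp [pt]
      exact hx1 (E.pt_injective _ (h.trans this.symm))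
  · obtain ⟨i, j, -, hij, -⟩ := E.commuting hp hl (fun p hp => hbr p (by linarith)) ht rfl
    rw [hij] at hs hs1
    have h1 : 0 < i + j := by exact_mod_cast hs
    have h2 : i + j < 1 := by exact_mod_cast hs1
    omega

/-- Near an edge with end points of equal length, the whole support has that length. -/
theorem circle {e : R3} {β : Trig} {ℓ n₁ n₂ : R3} (E : REdge e β ℓ n₁ n₂)
    (hn : n₂ ⬝ᵥ n₂ = n₁ ⬝ᵥ n₁) (h0 : β.coeff 0 = 0) (hsym : ∀ n, β.coeff (-n) = -star (β.coeff n))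
    (hbr : ∀ p, 1 < ℓ ⬝ᵥ p → (Trig.br e β (Trig.lap β)).coeff p = 0)
    (hbr1 : ∀ p, ℓ ⬝ᵥ p = 1 → p ≠ n₁ → p ≠ n₂ → (Trig.br e β (Trig.lap β)).coeff p = 0)
    {m : R3} (hm : β.coeff m ≠ 0) : m ⬝ᵥ m = n₁ ⬝ᵥ n₁ := by
  -- `g` vanishes at both ends of the edge, so its level is below one and it vanishes on the half
  -- plane ℓ ≥ 0. The other half plane follows by symmetry.
  set g : Trig := Trig.lap β - ((n₁ ⬝ᵥ n₁ : ℝ) : ℂ) • β with hg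
  have hgc : ∀ x, g.coeff x = ((x ⬝ᵥ x - n₁ ⬝ᵥ n₁ : ℝ) : ℂ) * β.coeff x := by
    intro x
    simp only [hg, AddMonoidAlgebra.coeff_sub, Finsupp.sub_apply, AddMonoidAlgebra.coeff_smul,
      Finsupp.smul_apply, smul_eq_mul, Trig.weight_coeff]
    push_cast; ring
  have hbrg : Trig.br e β g = Trig.br e β (Trig.lap β) := by
    rw [hg, map_sub, Derivation.map_smul, Trig.br_self, smul_zero, sub_zero]
  have hgβ : ∀ x, g.coeff x ≠ 0 → β.coeff x ≠ 0 := fun x hx => by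
    rw [hgc] at hx; exact right_ne_zero_of_mul hx
  have hv : ∀ x, 0 ≤ ℓ ⬝ᵥ x → g.coeff x = 0 := fun x hx =>
    E.vanish_nonneg (f := g) (fun x hx => E.planar x (hgβ x hx)) (by rw [hgc, h0, mul_zero])
      (fun x hx => lt_of_le_of_ne (E.levelLE x (hgβ x hx)) fun h1 => by
        rcases E.top x (hgβ x hx) h1 with rfl | rfl
        · rw [hgc, sub_self] at hx; simp at hx
        · rw [hgc, hn, sub_self] at hx; simp at hx)
      (fun p hp => by rw [hbrg, hbr p hp]) (fun p hp h1 h2 => by rw [hbrg, hbr1 p hp h1 h2]) hx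
  have key : ∀ x, 0 ≤ ℓ ⬝ᵥ x → β.coeff x ≠ 0 → x ⬝ᵥ x = n₁ ⬝ᵥ n₁ := by
    intro x hx hβ
    have := hv x hx
    rw [hgc] at this
    have := Complex.ofReal_eq_zero.1 ((mul_eq_zero.1 this).resolve_right hβ)
    linarith
  rcases le_total 0 (ℓ ⬝ᵥ m) with h | h
  · exact key m h hm
  · have := key (-m) (by rw [dotProduct_neg]; linarith) (by rw [hsym]; simpa using hm)
    simpa using this

end REdge

theorem exists_det_pos {e : R3} {β : Trig} (he : e ⬝ᵥ e = 1) (hp : Trig.Planar e β)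
    (hsym : ∀ n, β.coeff n ≠ 0 → β.coeff (-n) ≠ 0)
    (hspan : ∃ a b, β.coeff a ≠ 0 ∧ β.coeff b ≠ 0 ∧ det e a b ≠ 0) {n : R3} (hn : e ⬝ᵥ n = 0)
    (hn0 : n ≠ 0) : ∃ x, β.coeff x ≠ 0 ∧ 0 < det e n x := by
  obtain ⟨a, b, ha, hb, hab⟩ := hspan
  have h := planar_expand he (hp a ha) (hp b hb) hn
  have hex : ∃ x, β.coeff x ≠ 0 ∧ det e n x ≠ 0 := by
    by_contra! hcon
    rw [hcon b hb, det_swap e a n, hcon a ha] at h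
    simp [hab, hn0] at h
  obtain ⟨x, hx, hd⟩ := hex
  rcases lt_or_gt_of_ne hd with h | h
  · exact ⟨-x, hsym x hx, by rw [det_neg_right]; linarith⟩
  · exact ⟨x, hx, h⟩

/-- Rotating the support line at a point of maximal length until it meets a second point. -/
theorem exists_supporting {e : R3} {β : Trig} (he : e ⬝ᵥ e = 1) (hp : Trig.Planar e β)
    (hsym : ∀ n, β.coeff n ≠ 0 → β.coeff (-n) ≠ 0) (h0 : β.coeff 0 = 0)
    (hspan : ∃ a b, β.coeff a ≠ 0 ∧ β.coeff b ≠ 0 ∧ det e a b ≠ 0) {n : R3} (hn : β.coeff n ≠ 0)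
    (hmax : ∀ x, β.coeff x ≠ 0 → x ⬝ᵥ x ≤ n ⬝ᵥ n) :
    ∃ ℓ n' : R3, e ⬝ᵥ ℓ = 0 ∧ Trig.LevelLE ℓ β 1 ∧ ℓ ⬝ᵥ n = 1 ∧ ℓ ⬝ᵥ n' = 1 ∧ β.coeff n' ≠ 0 ∧
      0 < det e n n' ∧ ∀ x, β.coeff x ≠ 0 → ℓ ⬝ᵥ x = 1 → x = n ∨ 0 < det e n x := by
  have hn0 : n ≠ 0 := by rintro rfl; exact hn h0
  have hnn : 0 < n ⬝ᵥ n := dot_self_pos hn0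
  have hsq : ∀ x, 0 ≤ (x - n) ⬝ᵥ (x - n) := fun x => by
    by_cases h : x - n = 0
    · simp [h]
    · exact (dot_self_pos h).le
  have hexp : ∀ x, (x - n) ⬝ᵥ (x - n) = x ⬝ᵥ x + n ⬝ᵥ n - 2 * (n ⬝ᵥ x) := fun x => by
    simp only [dotProduct_sub, sub_dotProduct, dotProduct_comm x n]; ring
  set ν : R3 := (n ⬝ᵥ n)⁻¹ • n
  have hνx : ∀ x, ν ⬝ᵥ x = (n ⬝ᵥ x) / (n ⬝ᵥ n) := fun x => by
    simp [ν, smul_dotProduct, div_eq_inv_mul]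
  have hle : ∀ x, β.coeff x ≠ 0 → ν ⬝ᵥ x ≤ 1 := by
    intro x hx
    rw [hνx, div_le_one hnn]
    have := hsq x; have := hexp x; have := hmax x hx
    linarith
  have heq : ∀ x, β.coeff x ≠ 0 → 1 ≤ ν ⬝ᵥ x → x = n := by
    intro x hx h1
    rw [hνx, one_le_div hnn] at h1
    by_contra hne
    have := dot_self_pos (sub_ne_zero.2 hne)
    have := hexp x; have := hmax x hx
    linarith
  have hqx : ∀ x, crossProduct e n ⬝ᵥ x = det e n x := fun x => by
    simp [det, dotProduct, Fin.sum_univ_three, cross_apply]; ring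
  obtain ⟨x₀, hx₀, hd₀⟩ := exists_det_pos he hp hsym hspan (hp n hn) hn0
  obtain ⟨τ, hτ, hle', n', hn', hq', hl'⟩ := exists_rotate (S := β.coeff.support) (ν := ν)
    (q := crossProduct e n) (fun x hx => hle x (Finsupp.mem_support_iff.1 hx))
    (fun x hx h1 => by rw [heq x (Finsupp.mem_support_iff.1 hx) h1.ge, hqx, det_self])
    ⟨x₀, Finsupp.mem_support_iff.2 hx₀, by rw [hqx]; exact hd₀⟩
  rw [hqx] at hq'
  refine ⟨ν + τ • crossProduct e n, n', ?_, fun x hx => hle' x (Finsupp.mem_support_iff.2 hx), ?_, hl',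
    Finsupp.mem_support_iff.1 hn', hq', ?_⟩
  · simp [ν, hp n hn]
  · rw [add_dotProduct, hνx, smul_dotProduct, hqx, det_self, div_self hnn.ne']; simp
  · intro x hx h1
    rw [add_dotProduct, smul_dotProduct τ, hqx, smul_eq_mul] at h1
    by_cases hxn : x = n
    · exact Or.inl hxn
    · right
      have : ν ⬝ᵥ x < 1 := lt_of_not_ge fun h => hxn (heq x hx h)
      have : 0 < τ * det e n x := by linarith
      exact (pos_iff_pos_of_mul_pos this).1 hτ

/-- On a circle, every point of the support has a successor. -/
theorem exists_edge_of_circle {e : R3} {β : Trig} (he : e ⬝ᵥ e = 1) (hp : Trig.Planar e β)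
    (hsym : ∀ n, β.coeff n ≠ 0 → β.coeff (-n) ≠ 0) (h0 : β.coeff 0 = 0)
    (hspan : ∃ a b, β.coeff a ≠ 0 ∧ β.coeff b ≠ 0 ∧ det e a b ≠ 0) {R : ℝ}
    (hR : ∀ x, β.coeff x ≠ 0 → x ⬝ᵥ x = R) {n : R3} (hn : β.coeff n ≠ 0) :
    ∃ ℓ n', REdge e β ℓ n n' := by
  obtain ⟨ℓ, n', hℓ, hle, h1, h2, hn', hD, -⟩ := exists_supporting he hp hsym h0 hspan hn
    (fun x hx => by rw [hR x hx, hR n hn])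
  refine ⟨ℓ, n', he, hp, hℓ, hn, hn', h1, h2, hle, fun m hm hlm => ?_, hD⟩
  have h := REdge.eq_pt_of_perp he (hp n hn) (hp n' hn') h1 h2 hD (hp m hm)
  set θ := det e n m / det e n n'
  rw [hlm] at h
  have hmm := hR m hm
  have hd : (n' - n) ⬝ᵥ (n' - n) ≠ 0 := by
    refine (dot_self_pos (sub_ne_zero.2 ?_)).ne'
    rintro rfl
    rw [det_self] at hD
    exact lt_irrefl _ hD
  have e1 := hR n hn
  have e2 := hR n' hn'
  have e3 : (n' - n) ⬝ᵥ (n' - n) = n' ⬝ᵥ n' + n ⬝ᵥ n - 2 * (n ⬝ᵥ n') := by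
    simp only [dotProduct_sub, sub_dotProduct, dotProduct_comm n' n]; ring
  have e4 : m ⬝ᵥ m = n ⬝ᵥ n + 2 * θ * (n ⬝ᵥ n' - n ⬝ᵥ n) + θ ^ 2 * ((n' - n) ⬝ᵥ (n' - n)) := by
    rw [h, REdge.pt]
    simp only [dotProduct_sub, sub_dotProduct, dotProduct_add, add_dotProduct, smul_dotProduct,
      dotProduct_smul, dotProduct_comm n' n, smul_eq_mul]
    ring
  have e5 : θ * (θ - 1) * ((n' - n) ⬝ᵥ (n' - n)) = 0 := by
    have : n ⬝ᵥ n' - n ⬝ᵥ n = - ((n' - n) ⬝ᵥ (n' - n)) / 2 := by rw [e3]; linarith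
    rw [this] at e4
    linarith
  rcases mul_eq_zero.1 ((mul_eq_zero.1 e5).resolve_right hd) with h3 | h3
  · left; rw [h, h3, REdge.pt]; simp
  · right; rw [h, sub_eq_zero.1 h3, REdge.pt]; simp

/-- At a point of maximal length, the edge has no further points and its ends have equal length. -/
theorem exists_edge_of_max {e : R3} {β : Trig} (he : e ⬝ᵥ e = 1) (hp : Trig.Planar e β) {ℓ n n' : R3}
    (hn : β.coeff n ≠ 0) (hmax : ∀ x, β.coeff x ≠ 0 → x ⬝ᵥ x ≤ n ⬝ᵥ n) (hℓ : e ⬝ᵥ ℓ = 0)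
    (hle : Trig.LevelLE ℓ β 1) (h1 : ℓ ⬝ᵥ n = 1) (h2 : ℓ ⬝ᵥ n' = 1) (hn' : β.coeff n' ≠ 0)
    (hD : 0 < det e n n') (hpos : ∀ x, β.coeff x ≠ 0 → ℓ ⬝ᵥ x = 1 → x = n ∨ 0 < det e n x)
    (hbr : ∀ p, ℓ ⬝ᵥ p = 2 → (Trig.br e β (Trig.lap β)).coeff p = 0) :
    ∃ n'', REdge e β ℓ n n'' ∧ n'' ⬝ᵥ n'' = n ⬝ᵥ n := by
  classical
  obtain ⟨z, hz, hmin⟩ := Finset.exists_min_image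
    (β.coeff.support.filter fun x => ℓ ⬝ᵥ x = 1 ∧ 0 < det e n x) (fun x => det e n x)
    ⟨n', by simp [hn', h2, hD]⟩
  simp only [Finset.mem_filter, Finsupp.mem_support_iff] at hz hmin
  obtain ⟨hz, hz1, hzD⟩ := hz
  have hnz : n ≠ z := by
    rintro rfl
    rw [det_self] at hzD
    exact lt_irrefl _ hzD
  -- `z` is the nearest neighbour of `n` on the support line, so `n + z` is an isolated sum. The
  -- bracket there is proportional to |z|² - |n|².
  have hnorm : z ⬝ᵥ z = n ⬝ᵥ n := by
    have h := hbr (n + z) (by rw [dotProduct_add, h1, hz1]; norm_num)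
    rw [Trig.br_coeff, ← Finset.sum_subset (s₁ := {n, z})] at h
    · rw [Finset.sum_pair hnz, Trig.weight_coeff, Trig.weight_coeff] at h
      simp only [add_sub_cancel_left, add_sub_cancel_right, det_add_right, det_self,
        det_swap e z n] at h
      have h' : β.coeff n * β.coeff z * ((det e n z : ℝ) : ℂ) *
          ((z ⬝ᵥ z - n ⬝ᵥ n : ℝ) : ℂ) = 0 := by
        push_cast at h ⊢; linear_combination h
      have := (mul_eq_zero.1 h').resolve_left (mul_ne_zero (mul_ne_zero hn hz)
        (Complex.ofReal_ne_zero.2 hzD.ne'))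
      have := Complex.ofReal_eq_zero.1 this
      linarith
    · intro x hx
      rw [Finset.mem_insert, Finset.mem_singleton] at hx
      rw [Finsupp.mem_support_iff]
      rcases hx with rfl | rfl <;> assumption
    · intro a ha hna
      rw [Finsupp.mem_support_iff] at ha
      by_contra h0
      have hb := right_ne_zero_of_mul (left_ne_zero_of_mul h0)
      rw [Trig.weight_coeff] at hb
      have hb := right_ne_zero_of_mul hb
      have ha1 := hle a ha
      have hb1 := hle _ hb
      rw [dotProduct_sub, dotProduct_add, h1, hz1] at hb1
      have ha2 : ℓ ⬝ᵥ a = 1 := by linarith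
      have hb2 : ℓ ⬝ᵥ (n + z - a) = 1 := by
        rw [dotProduct_sub, dotProduct_add, h1, hz1]; linarith
      apply hna
      rw [Finset.mem_insert, Finset.mem_singleton]
      rcases hpos a ha ha2 with h | h
      · exact Or.inl h
      · right
        have h3 := hmin a ⟨ha, ha2, h⟩
        rcases hpos _ hb hb2 with h4 | h4
        · have : z - a = 0 := by
            have h5 : n + z - a - n = 0 := by rw [h4, sub_self]
            rw [← h5]; abel
          exact (sub_eq_zero.1 this).symm
        · exfalso
          rw [det_sub_right, det_add_right, det_self] at h4
          linarith
  refine ⟨z, ⟨he, hp, hℓ, hn, hz, h1, hz1, hle, fun m hm hlm => ?_, hzD⟩, hnorm⟩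
  rcases hpos m hm hlm with h | h
  · exact Or.inl h
  · right
    have hmz := hmin m ⟨hm, hlm, h⟩
    have hpt := REdge.eq_pt_of_perp he (hp n hn) (hp z hz) h1 hz1 hzD (hp m hm)
    rw [hlm] at hpt
    set θ := det e n m / det e n z with hθ
    have hθ1 : 1 ≤ θ := by rw [hθ, one_le_div hzD]; exact hmz
    have hd := dot_self_pos (sub_ne_zero.2 hnz.symm)
    have e3 : (z - n) ⬝ᵥ (z - n) = z ⬝ᵥ z + n ⬝ᵥ n - 2 * (n ⬝ᵥ z) := by
      simp only [dotProduct_sub, sub_dotProduct, dotProduct_comm z n]; ring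
    have e4 : m ⬝ᵥ m = n ⬝ᵥ n + 2 * θ * (n ⬝ᵥ z - n ⬝ᵥ n) + θ ^ 2 * ((z - n) ⬝ᵥ (z - n)) := by
      rw [hpt, REdge.pt]
      simp only [dotProduct_sub, sub_dotProduct, dotProduct_add, add_dotProduct, smul_dotProduct,
        dotProduct_smul, dotProduct_comm z n, smul_eq_mul]
      ring
    -- A point of the line beyond `z` would be longer than `n`, against maximality.
    have e5 : θ * (θ - 1) * ((z - n) ⬝ᵥ (z - n)) ≤ 0 := by
      have h6 : n ⬝ᵥ z - n ⬝ᵥ n = - ((z - n) ⬝ᵥ (z - n)) / 2 := by rw [e3]; linarith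
      rw [h6] at e4
      have := hmax m hm
      linarith
    have hθ2 : θ - 1 = 0 := by
      by_contra hne
      have : 0 < θ - 1 := lt_of_le_of_ne (by linarith) (Ne.symm hne)
      have : 0 < θ * (θ - 1) * ((z - n) ⬝ᵥ (z - n)) := by positivity
      linarith
    rw [hpt, sub_eq_zero.1 hθ2, REdge.pt]
    simp

theorem REdge.pt_zero (n₁ n₂ : R3) (s : ℝ) : REdge.pt n₁ n₂ s 0 = s • n₁ := by simp [REdge.pt]

theorem REdge.pt_self (n₁ n₂ : R3) (s : ℝ) : REdge.pt n₁ n₂ s s = s • n₂ := by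
  rw [REdge.pt]; module

/-- The top part of a commuting function of level `k` is a multiple of `β ^ k`. -/
theorem REdge.top_coeff {e : R3} {β : Trig} {ℓ n₁ n₂ : R3} (E : REdge e β ℓ n₁ n₂) {f : Trig}
    (hp : Trig.Planar e f) {k : ℕ} (hf : Trig.LevelLE ℓ f k)
    (hbr : ∀ p, ℓ ⬝ᵥ p = k + 1 → (Trig.br e β f).coeff p = 0) {m : R3} (hm : ℓ ⬝ᵥ m = k) :
    f.coeff m = (f.coeff ((k : ℝ) • n₁) / β.coeff n₁ ^ k) * (β ^ k).coeff m := by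
  by_contra h
  refine (E.sub_pow_level hp hf hbr (m := m) ?_).ne hm
  simp only [AddMonoidAlgebra.coeff_sub, Finsupp.sub_apply, AddMonoidAlgebra.coeff_smul,
    Finsupp.smul_apply, smul_eq_mul]
  exact sub_ne_zero.2 h

/-- On the half plane ℓ ≥ 0 of each edge, α is a multiple of β by `vanish_nonneg`. The factor passes
from a vertex to the next along the edges, and reaches the opposite half plane, where the reality
conditions give the factor -star κ instead. -/
theorem eq_smul_of_edges {e : R3} {α β : Trig} (hα : Trig.Planar e α) (hα0 : α.coeff 0 = 0)
    (hβ0 : β.coeff 0 = 0)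
    (hαs : ∀ n, α.coeff (-n) = star (α.coeff n)) (hβs : ∀ n, β.coeff (-n) = -star (β.coeff n))
    (hne : ∃ n, β.coeff n ≠ 0)
    (hZ : ∀ p, α.coeff p = 0 → β.coeff p = 0 → (Trig.br e β α).coeff p = 0)
    (hE : ∀ n, β.coeff n ≠ 0 → ∃ ℓ n', REdge e β ℓ n n' ∧ Trig.LevelLE ℓ α 1) :
    ∃ κ : ℂ, (∀ m, α.coeff m = κ * β.coeff m) ∧ star κ = -κ := by
  have hloc : ∀ n, β.coeff n ≠ 0 → ∃ ℓ n', REdge e β ℓ n n' ∧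
      ∀ m, 0 ≤ ℓ ⬝ᵥ m → α.coeff m = α.coeff n / β.coeff n * β.coeff m := by
    intro n hn
    obtain ⟨ℓ, n', E, hl⟩ := hE n hn
    refine ⟨ℓ, n', E, fun m hm => ?_⟩
    have hl1 : Trig.LevelLE ℓ α (1 : ℕ) := by simpa using hl
    have hout : ∀ p, 1 < ℓ ⬝ᵥ p → (Trig.br e β α).coeff p = 0 := fun p hp =>
      hZ p (by by_contra h; linarith [hl p h]) (by by_contra h; linarith [E.levelLE p h])
    have hbr2 : ∀ p, ℓ ⬝ᵥ p = (1 : ℕ) + 1 → (Trig.br e β α).coeff p = 0 := fun p hp =>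
      hout p (by rw [hp]; norm_num)
    have hlt := fun m => E.sub_pow_level hα hl1 hbr2 (m := m)
    simp only [Nat.cast_one, one_smul, pow_one] at hlt
    set κ := α.coeff n / β.coeff n
    have hv : (α - κ • β).coeff m = 0 := by
      refine E.vanish_nonneg (hα.sub (E.planar.smul κ)) (by simp [hα0, hβ0]) hlt ?_ ?_ hm
      · intro p hp
        rw [map_sub, Derivation.map_smul, Trig.br_self, smul_zero, sub_zero, hout p hp]
      · intro p hp h1 h2
        rw [map_sub, Derivation.map_smul, Trig.br_self, smul_zero, sub_zero]
        have hβp : β.coeff p = 0 := by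
          by_contra h
          rcases E.top p h hp with h | h
          · exact h1 h
          · exact h2 h
        refine hZ p ?_ hβp
        rw [E.top_coeff hα hl1 hbr2 (by rw [hp]; simp), pow_one β, hβp, mul_zero]
    simpa [sub_eq_zero] using hv
  choose! L N hLN hval using hloc
  obtain ⟨n₀, hn₀⟩ := hne
  set κ := α.coeff n₀ / β.coeff n₀ with hκ
  have E₀ := hLN n₀ hn₀
  have hneg : ∀ m, L n₀ ⬝ᵥ m ≤ 0 → α.coeff m = -star κ * β.coeff m := by
    intro m hm
    have h := hval n₀ hn₀ (-m) (by rw [dotProduct_neg]; linarith)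
    rw [hαs, hβs] at h
    have := congrArg star h
    rw [star_star, star_mul', star_neg, star_star] at this
    rw [this]; ring
  -- If all vertices with factor κ stayed in the open half plane of `L n₀`, the one furthest around
  -- would have a successor with the same factor and a larger angle.
  have hM : ∃ m, β.coeff m ≠ 0 ∧ α.coeff m = κ * β.coeff m ∧ L n₀ ⬝ᵥ m ≤ 0 := by
    classical
    by_contra! hcon
    obtain ⟨m, hm, hmax⟩ := Finset.exists_max_image
      (β.coeff.support.filter fun m => α.coeff m = κ * β.coeff m)
      (fun m => det e (L n₀) m / (L n₀ ⬝ᵥ m)) ⟨n₀, by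
        rw [Finset.mem_filter, Finsupp.mem_support_iff]
        exact ⟨hn₀, by rw [hκ, div_mul_cancel₀ _ hn₀]⟩⟩
    simp only [Finset.mem_filter, Finsupp.mem_support_iff] at hm hmax
    have E := hLN m hm.1
    have hm' : α.coeff (N m) = κ * β.coeff (N m) := by
      rw [hval m hm.1 (N m) (by rw [E.level₂]; norm_num), hm.2, mul_div_cancel_right₀ _ hm.1]
    have h1 := hcon m hm.1 hm.2
    have h2 := hcon (N m) E.mem₂ hm'
    have h3 := hmax (N m) ⟨E.mem₂, hm'⟩
    rw [div_le_div_iff₀ h2 h1] at h3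
    have h4 := congrArg (L n₀ ⬝ᵥ ·) (planar_expand E.unit E.perp₁ E.perp₂ E₀.perp)
    simp only [dotProduct_add, dotProduct_smul, smul_eq_mul] at h4
    rw [det_swap e m (L n₀)] at h4
    have hL : 0 < L n₀ ⬝ᵥ L n₀ := dot_self_pos (by
      intro h; have := E₀.level₁; rw [h] at this; simp at this)
    have := mul_pos E.det_pos hL
    linarith
  obtain ⟨m, hm, h1, h2⟩ := hM
  have hκs : κ = -star κ := by
    rw [hneg m h2] at h1
    exact (mul_right_cancel₀ hm h1).symm
  refine ⟨κ, fun x => ?_, by rw [eq_neg_iff_add_eq_zero, add_comm, ← eq_neg_iff_add_eq_zero]; exact hκs⟩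
  rcases le_total 0 (L n₀ ⬝ᵥ x) with h | h
  · exact hval n₀ hn₀ x h
  · rw [hneg x h, ← hκs]

/-! ### Levels when the Coriolis term is effective -/

section
variable {e : R3} {α β : Trig} {ℓ : R3}

/-- The lowest top point `b` of α and the lowest point `n` of the edge form an isolated sum outside
both supports, so their area vanishes and b = s n. At `b` the Coriolis term then has nothing to
balance it unless `b` is horizontal. -/
theorem lowest_third_eq_zero (he : e ⬝ᵥ e = 1) (hα : Trig.Planar e α) (hβ : Trig.Planar e β)
    (hZ : ∀ p, α.coeff p = 0 → β.coeff p = 0 → (Trig.br e β α).coeff p = 0)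
    (hC : ∀ p, β.coeff p = 0 → α.coeff p ≠ 0 → (Trig.br e β (Trig.lap β)).coeff p = 0 → p 2 = 0)
    (hβl : Trig.LevelLE ℓ β 1) {s : ℝ} (hs : 2 ≤ s) (hαl : Trig.LevelLE ℓ α s)
    (hex : ∃ b, α.coeff b ≠ 0 ∧ ℓ ⬝ᵥ b = s) {w : R3}
    (hw : ∀ x, e ⬝ᵥ x = 0 → ℓ ⬝ᵥ x = 0 → w ⬝ᵥ x = 0 → x = 0) {n : R3} (hn : β.coeff n ≠ 0)
    (hn1 : ℓ ⬝ᵥ n = 1) (hmin : ∀ x, β.coeff x ≠ 0 → ℓ ⬝ᵥ x = 1 → w ⬝ᵥ n ≤ w ⬝ᵥ x) : n 2 = 0 := by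
  classical
  obtain ⟨b₀, hb₀, hb₀s⟩ := hex
  obtain ⟨b, hb, hbmin⟩ := Finset.exists_min_image (α.coeff.support.filter fun x => ℓ ⬝ᵥ x = s)
    (fun x => w ⬝ᵥ x) ⟨b₀, by simp [hb₀, hb₀s]⟩
  simp only [Finset.mem_filter, Finsupp.mem_support_iff] at hb hbmin
  obtain ⟨hb, hbs⟩ := hb
  have huniq : ∀ a, β.coeff a ≠ 0 → ℓ ⬝ᵥ a = 1 → w ⬝ᵥ a ≤ w ⬝ᵥ n → a = n := by
    intro a ha ha1 haw
    refine sub_eq_zero.1 (hw _ ?_ ?_ ?_)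
    · rw [dotProduct_sub, hβ a ha, hβ n hn, sub_zero]
    · rw [dotProduct_sub, ha1, hn1, sub_self]
    · rw [dotProduct_sub]; linarith [hmin a ha ha1]
  have hdet : det e n b = 0 := by
    have h := hZ (n + b) (by
        by_contra h; have := hαl _ h; rw [dotProduct_add, hn1, hbs] at this; linarith) (by
        by_contra h; have := hβl _ h; rw [dotProduct_add, hn1, hbs] at this; linarith)
    rw [Trig.br_coeff, Finset.sum_eq_single n] at h
    · rw [add_sub_cancel_left, det_add_right, det_self, zero_add] at h
      exact Complex.ofReal_eq_zero.1 ((mul_eq_zero.1 h).resolve_left (mul_ne_zero hn hb))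
    · intro a ha hne
      rw [Finsupp.mem_support_iff] at ha
      by_contra h0
      have hb' := right_ne_zero_of_mul (left_ne_zero_of_mul h0)
      have h1 := hβl a ha
      have h2 := hαl _ hb'
      rw [dotProduct_sub, dotProduct_add, hn1, hbs] at h2
      have ha1 : ℓ ⬝ᵥ a = 1 := by linarith
      have h3 := hbmin _ ⟨hb', by rw [dotProduct_sub, dotProduct_add, hn1, hbs]; linarith⟩
      rw [dotProduct_sub, dotProduct_add] at h3
      exact hne (huniq a ha ha1 (by linarith))
    · intro h
      exact absurd (Finsupp.mem_support_iff.2 hn) h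
  have hbn : b = s • n := by
    refine sub_eq_zero.1 (hw _ ?_ ?_ ?_)
    · rw [dotProduct_sub, dotProduct_smul, hα b hb, hβ n hn]; simp
    · rw [dotProduct_sub, dotProduct_smul, hbs, hn1]; simp
    · have hn0 : n ≠ 0 := by rintro rfl; simp at hn1
      have hq : e ⬝ᵥ crossProduct e n = 0 := by simp
      have h := planar_expand he (hβ n hn) hq (hα b hb)
      rw [hdet, zero_smul, add_zero] at h
      have h4 : det e n (crossProduct e n) = n ⬝ᵥ n := by
        have h5 : det e n (crossProduct e n) = (e ⬝ᵥ e) * (n ⬝ᵥ n) - (e ⬝ᵥ n) ^ 2 := by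
          simp [det, dotProduct, Fin.sum_univ_three, cross_apply]; ring
        rw [h5, he, hβ n hn]; ring
      rw [h4] at h
      have h6 := congrArg (ℓ ⬝ᵥ ·) h
      simp only [dotProduct_smul, hbs, hn1, smul_eq_mul, mul_one] at h6
      rw [← h6] at h
      have h7 : b = s • n := by
        have := smul_right_injective R3 (dot_self_pos hn0).ne' (h.trans (mul_smul _ _ _))
        exact this
      rw [h7, sub_self, dotProduct_zero]
  -- β vanishes at `b`, as its level is at most 1. In the bracket of β with its Laplacian a
  -- contribution at `b` would need s = 2 and both factors at `n`, where the area is zero.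
  have hb2 : b 2 = 0 := by
    refine hC b (by by_contra h; have := hβl _ h; linarith) hb ?_
    rw [Trig.br_coeff]
    refine Finset.sum_eq_zero fun a ha => ?_
    rw [Finsupp.mem_support_iff] at ha
    by_contra h0
    have hb' := right_ne_zero_of_mul (left_ne_zero_of_mul h0)
    rw [Trig.weight_coeff] at hb'
    have hb' := right_ne_zero_of_mul hb'
    have h1 := hβl a ha
    have h2 := hβl _ hb'
    rw [dotProduct_sub, hbs] at h2
    have ha1 : ℓ ⬝ᵥ a = 1 := by linarith
    have h3 := hmin _ hb' (by rw [dotProduct_sub, hbs]; linarith)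
    have hs2 : s = 2 := by linarith
    rw [dotProduct_sub, hbn, dotProduct_smul, hs2, smul_eq_mul] at h3
    have : a = n := huniq a ha ha1 (by linarith)
    rw [this, hbn, det_smul_right, det_self] at h0
    simp at h0
  rw [hbn, Pi.smul_apply, smul_eq_mul] at hb2
  rcases mul_eq_zero.1 hb2 with h | h
  · linarith
  · exact h

/-- Otherwise both ends of the contact segment would be horizontal, whereas in a plane other than
the horizontal one the horizontal vectors lie on a line. -/
theorem level_lt_two (he : e ⬝ᵥ e = 1) (hα : Trig.Planar e α) (hβ : Trig.Planar e β)
    (hZ : ∀ p, α.coeff p = 0 → β.coeff p = 0 → (Trig.br e β α).coeff p = 0)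
    (hC : ∀ p, β.coeff p = 0 → α.coeff p ≠ 0 → (Trig.br e β (Trig.lap β)).coeff p = 0 → p 2 = 0)
    (hH : ∀ x y : R3, e ⬝ᵥ x = 0 → e ⬝ᵥ y = 0 → x 2 = 0 → y 2 = 0 → det e x y = 0)
    (hβl : Trig.LevelLE ℓ β 1) {n n' : R3} (hn : β.coeff n ≠ 0) (hn' : β.coeff n' ≠ 0)
    (h1 : ℓ ⬝ᵥ n = 1) (h1' : ℓ ⬝ᵥ n' = 1) (hD : 0 < det e n n') {b : R3} (hb : α.coeff b ≠ 0) :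
    ℓ ⬝ᵥ b < 2 := by
  classical
  by_contra! hcon
  obtain ⟨t, ht, hl⟩ := Trig.exists_top (ℓ := ℓ) (f := α) (by rintro rfl; exact hb rfl)
  have hs : 2 ≤ ℓ ⬝ᵥ t := hcon.trans (hl b hb)
  set w := crossProduct e n
  have hqx : ∀ x, w ⬝ᵥ x = det e n x := fun x => by
    simp [w, det, dotProduct, Fin.sum_univ_three, cross_apply]; ring
  have hw : ∀ x, e ⬝ᵥ x = 0 → ℓ ⬝ᵥ x = 0 → w ⬝ᵥ x = 0 → x = 0 := by
    intro x hx hlx hwx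
    rw [hqx] at hwx
    have h := planar_expand he (hβ n hn) (hβ n' hn') hx
    rw [hwx, zero_smul, add_zero] at h
    have h2 := congrArg (ℓ ⬝ᵥ ·) h
    simp only [dotProduct_smul, hlx, h1, smul_eq_mul, mul_one, mul_zero] at h2
    rw [← h2, zero_smul] at h
    exact (smul_eq_zero.1 h).resolve_left hD.ne'
  have hne : (β.coeff.support.filter fun x => ℓ ⬝ᵥ x = 1).Nonempty := ⟨n, by simp [hn, h1]⟩
  obtain ⟨x, hx, hmin⟩ := Finset.exists_min_image _ (fun x => w ⬝ᵥ x) hne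
  obtain ⟨y, hy, hmax⟩ := Finset.exists_max_image _ (fun x => w ⬝ᵥ x) hne
  simp only [Finset.mem_filter, Finsupp.mem_support_iff] at hx hmin hy hmax
  have hx2 := lowest_third_eq_zero he hα hβ hZ hC hβl hs hl ⟨t, ht, rfl⟩ hw hx.1 hx.2
    (fun z hz hz1 => hmin z ⟨hz, hz1⟩)
  have hy2 := lowest_third_eq_zero he hα hβ hZ hC hβl hs hl ⟨t, ht, rfl⟩ (w := -w)
    (fun z h1 h2 h3 => hw z h1 h2 (by simpa using h3)) hy.1 hy.2
    (fun z hz hz1 => by simpa using hmax z ⟨hz, hz1⟩)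
  have hdet := hH x y (hβ x hx.1) (hβ y hy.1) hx2 hy2
  have h := planar_expand he (hβ x hx.1) (hβ y hy.1) (hβ n hn)
  rw [hdet, zero_smul] at h
  have h2 := congrArg (ℓ ⬝ᵥ ·) h
  simp only [dotProduct_add, dotProduct_smul, dotProduct_zero, hx.2, hy.2, smul_eq_mul, mul_one] at h2
  have h3 := hmin n ⟨hn, h1⟩
  have h4 := hmin n' ⟨hn', h1'⟩
  have h5 := hmax n ⟨hn, h1⟩
  have h6 := hmax n' ⟨hn', h1'⟩
  rw [det_swap e x n] at h2
  rw [hqx, hqx] at h3 h4 h5 h6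
  rw [det_self] at h3 h5
  linarith

theorem REdge.level_le_one {n n' : R3} (E : REdge e β ℓ n n') (hα : Trig.Planar e α)
    (hZ : ∀ p, α.coeff p = 0 → β.coeff p = 0 → (Trig.br e β α).coeff p = 0)
    (hlt : ∀ b, α.coeff b ≠ 0 → ℓ ⬝ᵥ b < 2) : Trig.LevelLE ℓ α 1 := by
  intro b hb
  by_contra! hcon
  obtain ⟨t, ht, hl⟩ := Trig.exists_top (ℓ := ℓ) (f := α) (by rintro rfl; exact hb rfl)
  have h1 : 1 < ℓ ⬝ᵥ t := hcon.trans_le (hl b hb)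
  have h2 := hlt t ht
  obtain ⟨i, j, -, hij, -⟩ := E.commuting hα hl (fun p hp => hZ p
    (by by_contra h; linarith [hl p h]) (by by_contra h; linarith [E.levelLE p h])) ht rfl
  rw [hij] at h1 h2
  have h3 : 1 < i + j := by exact_mod_cast h1
  have h4 : i + j < 2 := by exact_mod_cast h2
  omega

end

/-! ### The effect of viscosity around the circle -/

theorem REdge.natural_level {e : R3} {β : Trig} {ℓ n₁ n₂ : R3} (E : REdge e β ℓ n₁ n₂) {f : Trig}
    (hp : Trig.Planar e f) {k : ℕ} (hlt : ∀ m, f.coeff m ≠ 0 → ℓ ⬝ᵥ m < (k + 1 : ℕ))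
    (hbr : ∀ p, ((k + 1 : ℕ) : ℝ) < ℓ ⬝ᵥ p → (Trig.br e β f).coeff p = 0) :
    Trig.LevelLE ℓ f k := by
  intro b hb
  by_contra! hcon
  obtain ⟨t, ht, hl⟩ := Trig.exists_top (ℓ := ℓ) (f := f) (by rintro rfl; exact hb rfl)
  have h1 : (k : ℝ) < ℓ ⬝ᵥ t := hcon.trans_le (hl b hb)
  have h2 := hlt t ht
  obtain ⟨i, j, -, hij, -⟩ := E.commuting hp hl (fun p hp => hbr p (by push_cast; linarith)) ht rfl
  rw [hij] at h1 h2
  have h3 : k < i + j := by exact_mod_cast h1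
  have h4 : i + j < k + 1 := by exact_mod_cast h2
  omega

/-- How the second coefficient changes along an edge in the presence of viscosity. -/
theorem REdge.second_coeff {e : R3} {β : Trig} {ℓ n₁ n₂ : R3} (E : REdge e β ℓ n₁ n₂) {α : Trig}
    (hp : Trig.Planar e α) {k : ℕ} (hl : Trig.LevelLE ℓ α (k + 1 : ℕ))
    (hbr : ∀ p, ((k + 1 : ℕ) : ℝ) < ℓ ⬝ᵥ p → (Trig.br e β α).coeff p = 0) {C κ : ℂ}
    (hκ : κ = α.coeff (((k + 1 : ℕ) : ℝ) • n₁) / β.coeff n₁ ^ (k + 1))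
    (hres : ∀ j : ℕ, (Trig.br e β α).coeff (pt n₁ n₂ (k + 1 : ℕ) j) =
      C * j * ((k + 1 : ℕ) - j) * α.coeff (pt n₁ n₂ (k + 1 : ℕ) j)) :
    (α - κ • β ^ (k + 1)).coeff ((k : ℝ) • n₂) / β.coeff n₂ ^ k -
      (α - κ • β ^ (k + 1)).coeff ((k : ℝ) • n₁) / β.coeff n₁ ^ k =
        C * κ / det e n₁ n₂ * (k + 1) * k := by
  set f := α - κ • β ^ (k + 1)
  have hfp : Trig.Planar e f := hp.sub ((E.planar.pow _).smul κ)
  have hbrf : Trig.br e β f = Trig.br e β α := by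
    rw [map_sub, Derivation.map_smul, Trig.br_pow_self, smul_zero, sub_zero]
  have htop : ∀ p, ℓ ⬝ᵥ p = (k + 1 : ℕ) + 1 → (Trig.br e β α).coeff p = 0 := fun p hp =>
    hbr p (by rw [hp]; linarith)
  have hfl : Trig.LevelLE ℓ f k := by
    refine E.natural_level hfp (fun m hm => ?_) (fun p hp => by rw [hbrf, hbr p hp])
    simp only [f, hκ] at hm
    exact E.sub_pow_level hp hl htop hm
  have hD : (det e n₁ n₂ : ℂ) ≠ 0 := Complex.ofReal_ne_zero.2 E.det_pos.ne'
  set b₁ := β.coeff n₁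
  set b₂ := β.coeff n₂
  have hb₁ : b₁ ≠ 0 := E.mem₁
  have hb₂ : b₂ ≠ 0 := E.mem₂
  set F := fun θ => f.coeff (pt n₁ n₂ k θ)
  -- With the source `hres` the solution is the binomial one times a factor affine in j; the slope
  -- of this factor is the jump of the second coefficient.
  have key : ∀ j : ℕ, j ≤ k → F j = k.choose j * b₁ ^ (k - j) * b₂ ^ j *
      (F 0 / b₁ ^ k + C * κ / det e n₁ n₂ * (k + 1) * j) := by
    intro j hj
    induction j with
    | zero =>
      simp only [Nat.choose_zero_right, Nat.sub_zero, Nat.cast_zero, Nat.cast_one, pow_zero]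
      field_simp
      simp
    | succ j ih =>
      have h := E.recur hfl ((j + 1 : ℕ) : ℝ)
      dsimp only at h
      have hk1 : (k : ℝ) + 1 = ((k + 1 : ℕ) : ℝ) := by push_cast; rfl
      rw [hk1, hbrf, hres, E.top_coeff hp hl htop (E.level_pt _ _), ← hκ, E.pow_coeff _ _ (by omega)] at h
      have h1 : ((j + 1 : ℕ) : ℝ) - 1 = j := by push_cast; ring
      rw [h1] at h
      change b₁ * _ * F _ - b₂ * _ * F j = _ at h
      rw [ih (by omega)] at h
      obtain ⟨i, rfl⟩ := Nat.exists_eq_add_of_le hj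
      have e1 : j + 1 + i - j = i + 1 := by omega
      have e2 : j + 1 + i - (j + 1) = i := by omega
      have e3 : j + 1 + i + 1 - (j + 1) = i + 1 := by omega
      have hc := congrArg (Nat.cast : ℕ → ℂ) (Nat.choose_succ_right_eq (j + 1 + i) j)
      have hc1 := congrArg (Nat.cast : ℕ → ℂ) (Nat.add_one_mul_choose_eq (j + 1 + i) j)
      rw [e1] at h hc
      rw [e3] at h
      rw [e2]
      have hj1 : ((j : ℂ) + 1) ≠ 0 := by exact_mod_cast Nat.succ_ne_zero j
      apply mul_left_cancel₀ (mul_ne_zero hb₁ hj1)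
      push_cast at h hc hc1 ⊢
      set X := F 0 / b₁ ^ (j + 1 + i)
      set D : ℂ := ((det e n₁ n₂ : ℝ) : ℂ)
      generalize F ((j : ℝ) + 1) = F' at h ⊢
      generalize ((j + 1 + i).choose j : ℂ) = c at *
      generalize ((j + 1 + i).choose (j + 1) : ℂ) = c' at *
      generalize ((j + 1 + i + 1).choose (j + 1) : ℂ) = c1 at *
      have h' : b₁ * (↑j + 1) * F' - b₂ * (i + 1) * (c * b₁ ^ (i + 1) * b₂ ^ j *
          (X + C * κ / D * (↑j + 1 + ↑i + 1) * ↑j)) =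
          C * κ / D * (j + 1) * (i + 1) * c1 * b₁ ^ (i + 1) * b₂ ^ (j + 1) := by
        linear_combination h
      linear_combination h' - b₁ ^ (i + 1) * b₂ ^ (j + 1) *
        (X + C * κ / D * (↑j + 1 + ↑i + 1) * (↑j + 1)) * hc -
        C * κ / D * (i + 1) * b₁ ^ (i + 1) * b₂ ^ (j + 1) * hc1
  have h := key k le_rfl
  have e1 : F k = f.coeff ((k : ℝ) • n₂) := by simp only [F, pt_self]
  have e0 : F 0 = f.coeff ((k : ℝ) • n₁) := by simp only [F, pt_zero]
  rw [← e1, ← e0, h, Nat.choose_self, Nat.sub_self, pow_zero]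
  field_simp
  ring

/-- With viscosity, the level of `α` at every edge is at most one. -/
theorem exists_edge_level_le_one {e : R3} {α β : Trig} (hα : Trig.Planar e α)
    (hα0 : α ≠ 0) (hZ : ∀ p, α.coeff p = 0 → (Trig.br e β α).coeff p = 0)
    (hE : ∀ n, β.coeff n ≠ 0 → ∃ ℓ n', REdge e β ℓ n n') {ν : ℝ} (hν : ν ≠ 0)
    (hres : ∀ ℓ n n', REdge e β ℓ n n' → ∀ k : ℕ, Trig.LevelLE ℓ α k → ∀ j : ℕ,
      (Trig.br e β α).coeff (REdge.pt n n' k j) =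
        -Complex.I * ν * ((n' - n) ⬝ᵥ (n' - n) : ℝ) * j * (k - j) * α.coeff (REdge.pt n n' k j))
    {n : R3} (hn : β.coeff n ≠ 0) : ∃ ℓ n', REdge e β ℓ n n' ∧ Trig.LevelLE ℓ α 1 := by
  classical
  choose! L N hLN using hE
  have hlev : ∀ n, β.coeff n ≠ 0 → ∃ k : ℕ, Trig.LevelLE (L n) α k ∧ α.coeff ((k : ℝ) • n) ≠ 0 := by
    intro n hn
    obtain ⟨t, ht, hl⟩ := Trig.exists_top (ℓ := L n) hα0
    obtain ⟨i, j, -, hij, h0⟩ := (hLN n hn).commuting hα hl (fun p hp => hZ p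
      (by by_contra h; linarith [hl p h])) ht rfl
    refine ⟨i + j, ?_, ?_⟩
    · rw [Nat.cast_add, ← hij]; exact hl
    · rw [Nat.cast_add, ← hij]; exact h0
  choose! K hK hKne using hlev
  refine ⟨L n, N n, hLN n hn, ?_⟩
  -- A vertex where the level of α is maximal. The leading factor κ is constant along an edge, so
  -- the successor of a vertex of maximal level has the same level and the same κ.
  obtain ⟨n₀, hn₀, hmax⟩ := Finset.exists_max_image β.coeff.support K
    ⟨n, Finsupp.mem_support_iff.2 hn⟩
  simp only [Finsupp.mem_support_iff] at hn₀ hmax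
  rcases Nat.lt_or_ge (K n₀) 2 with h2 | h2
  · intro m hm
    refine (hK n hn m hm).trans ?_
    have := hmax n hn
    exact_mod_cast (by omega : K n ≤ 1)
  exfalso
  obtain ⟨k, hk⟩ : ∃ k, K n₀ = k + 1 := ⟨K n₀ - 1, by omega⟩
  have hk0 : 0 < k := by omega
  let κ : R3 → ℂ := fun n => α.coeff (((k + 1 : ℕ) : ℝ) • n) / β.coeff n ^ (k + 1)
  let φ : R3 → ℂ := fun n => (α - κ n • β ^ (k + 1)).coeff ((k : ℝ) • n) / β.coeff n ^ k
  -- Normalized by -iνκ, the second coefficient φ increases by a positive real along every such edge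
  -- when the level is at least 2. This is impossible at a vertex where its real part is maximal.
  obtain ⟨m, hm, hmmax⟩ := Finset.exists_max_image (β.coeff.support.filter fun n => K n = k + 1)
    (fun n => (φ n / (-Complex.I * ν * κ n)).re) ⟨n₀, by simp [hn₀, hk]⟩
  simp only [Finset.mem_filter, Finsupp.mem_support_iff] at hm hmmax
  obtain ⟨hm, hmk⟩ := hm
  have E := hLN m hm
  have hl := hK m hm
  have hne := hKne m hm
  rw [hmk] at hl hne
  have hbr : ∀ p, ((k + 1 : ℕ) : ℝ) < L m ⬝ᵥ p → (Trig.br e β α).coeff p = 0 := fun p hp =>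
    hZ p (by by_contra h; linarith [hl p h])
  have htop := E.top_coeff hα hl (fun p hp => hbr p (by linarith)) (m := ((k + 1 : ℕ) : ℝ) • N m)
    (by rw [dotProduct_smul, E.level₂, smul_eq_mul, mul_one])
  have hpow : (β ^ (k + 1)).coeff (((k + 1 : ℕ) : ℝ) • N m) = β.coeff (N m) ^ (k + 1) := by
    rw [← REdge.pt_self m, E.pow_coeff _ _ le_rfl]; simp
  rw [hpow] at htop
  have hκm : κ m ≠ 0 := div_ne_zero hne (pow_ne_zero _ hm)
  have hκ' : κ (N m) = κ m := by
    simp only [κ]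
    rw [htop, mul_div_cancel_right₀ _ (pow_ne_zero _ E.mem₂)]
  have hKN : K (N m) = k + 1 := by
    have h1 := hmax _ E.mem₂
    have h2 := hK _ E.mem₂ (((k + 1 : ℕ) : ℝ) • N m)
      (by rw [htop]; exact mul_ne_zero hκm (pow_ne_zero _ E.mem₂))
    rw [dotProduct_smul, (hLN _ E.mem₂).level₁, smul_eq_mul, mul_one] at h2
    have h3 : k + 1 ≤ K (N m) := by exact_mod_cast h2
    omega
  have hstep := E.second_coeff hα hl hbr (κ := κ m)
    (C := -Complex.I * ν * ((N m - m) ⬝ᵥ (N m - m) : ℝ)) rfl (hres _ _ _ E _ hl)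
  have hle := hmmax (N m) ⟨E.mem₂, hKN⟩
  have hφ : φ (N m) - φ m = -Complex.I * ν * ((N m - m) ⬝ᵥ (N m - m) : ℝ) * κ m / det e m (N m) *
      (k + 1) * k := by
    simp only [φ]; rw [hκ']; exact hstep
  have hdiff : φ (N m) / (-Complex.I * ν * κ (N m)) - φ m / (-Complex.I * ν * κ m) =
      (((N m - m) ⬝ᵥ (N m - m) / det e m (N m) * (k + 1) * k : ℝ) : ℂ) := by
    have hI : -Complex.I * ν * κ m ≠ 0 :=
      mul_ne_zero (mul_ne_zero (neg_ne_zero.2 Complex.I_ne_zero) (Complex.ofReal_ne_zero.2 hν)) hκm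
    rw [hκ', ← sub_div, hφ, div_eq_iff hI]
    push_cast; ring
  have hpos : 0 < (N m - m) ⬝ᵥ (N m - m) / det e m (N m) * (k + 1) * k := by
    have h1 := dot_self_pos (sub_ne_zero.2 E.ne.symm)
    have h2 := E.det_pos
    have h3 : (0 : ℝ) < k := by exact_mod_cast hk0
    positivity
  have := congrArg Complex.re hdiff
  rw [Complex.sub_re, Complex.ofReal_re] at this
  linarith

/-! ### Degenerate stream functions, circles, and the Coriolis case -/

theorem smul_eq_of_det_eq_zero {e n x : R3} (he : e ⬝ᵥ e = 1) (hn : e ⬝ᵥ n = 0) (hx : e ⬝ᵥ x = 0)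
    (hn0 : n ≠ 0) (h : det e n x = 0) : (n ⬝ᵥ n) • x = (n ⬝ᵥ x) • n := by
  have hx' := planar_expand he hn (by simp : e ⬝ᵥ crossProduct e n = 0) hx
  rw [h, zero_smul, add_zero] at hx'
  have h4 : det e n (crossProduct e n) = n ⬝ᵥ n := by
    have h5 : det e n (crossProduct e n) = (e ⬝ᵥ e) * (n ⬝ᵥ n) - (e ⬝ᵥ n) ^ 2 := by
      simp [det, dotProduct, Fin.sum_univ_three, cross_apply]; ring
    rw [h5, he, hn]; ring
  rw [h4] at hx'
  have h6 := congrArg (n ⬝ᵥ ·) hx'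
  simp only [dotProduct_smul, smul_eq_mul] at h6
  have h7 : n ⬝ᵥ x = det e x (crossProduct e n) :=
    mul_left_cancel₀ (dot_self_pos hn0).ne' (by rw [h6]; ring)
  rw [hx', h7]

theorem det_eq_zero_of_parallel {e n x y : R3} (he : e ⬝ᵥ e = 1) (hn : e ⬝ᵥ n = 0) (hx : e ⬝ᵥ x = 0)
    (hy : e ⬝ᵥ y = 0) (hn0 : n ≠ 0) (h : det e n x = 0) (h' : det e n y = 0) : det e x y = 0 := by
  have h1 := smul_eq_of_det_eq_zero he hn hx hn0 h
  have h2 := smul_eq_of_det_eq_zero he hn hy hn0 h'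
  have hp := (dot_self_pos hn0).ne'
  have h3 : det e ((n ⬝ᵥ n) • x) ((n ⬝ᵥ n) • y) = 0 := by
    rw [h1, h2, det_smul_left, det_smul_right, det_self]; simp
  rw [det_smul_left, det_smul_right] at h3
  simpa [hp] using h3

theorem Trig.Planar.br_eq_zero {e : R3} {f g : Trig} (hf : Trig.Planar e f) (hg : Trig.Planar e g)
    {p : R3} (hp : e ⬝ᵥ p ≠ 0) : (Trig.br e f g).coeff p = 0 := by
  by_contra h
  exact hp (hf.br hg p h)

section
variable {e : R3} {α β : Trig}

/-- If the in-plane part is supported on a line, so is the whole field. -/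
theorem det_eq_zero_of_line (he : e ⬝ᵥ e = 1) (hα : Trig.Planar e α) (hβ : Trig.Planar e β)
    (hβ0 : β.coeff 0 = 0) (hαs : ∀ n, α.coeff n ≠ 0 → α.coeff (-n) ≠ 0)
    (hZ : ∀ p, α.coeff p = 0 → β.coeff p = 0 → (Trig.br e β α).coeff p = 0)
    (hline : ∀ x y, β.coeff x ≠ 0 → β.coeff y ≠ 0 → det e x y = 0) {b₀ : R3} (hb₀ : β.coeff b₀ ≠ 0)
    {n : R3} (hn : α.coeff n ≠ 0) : det e b₀ n = 0 := by
  classical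
  by_contra hne
  have hb₀0 : b₀ ≠ 0 := by rintro rfl; exact hb₀ hβ0
  have hex : ∃ n, α.coeff n ≠ 0 ∧ 0 < det e b₀ n := by
    rcases lt_or_gt_of_ne hne with h | h
    · exact ⟨-n, hαs n hn, by rw [det_neg_right]; linarith⟩
    · exact ⟨n, hn, h⟩
  obtain ⟨n₁, hn₁, hpos⟩ := hex
  obtain ⟨n₂, hn₂, hmax⟩ := Finset.exists_max_image α.coeff.support (fun x => det e b₀ x)
    ⟨n₁, Finsupp.mem_support_iff.2 hn₁⟩
  -- A mode of α farthest from the line and, among those, most extreme along it, is paired with the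
  -- extreme mode `b` of β. Their sum is isolated and outside both supports.
  obtain ⟨n₃, hn₃, hmax₃⟩ := Finset.exists_max_image
    (α.coeff.support.filter fun x => det e b₀ x = det e b₀ n₂) (fun x => b₀ ⬝ᵥ x) ⟨n₂, by simp_all⟩
  obtain ⟨b, hb, hbmax⟩ := Finset.exists_max_image β.coeff.support (fun x => b₀ ⬝ᵥ x)
    ⟨b₀, Finsupp.mem_support_iff.2 hb₀⟩
  simp only [Finset.mem_filter, Finsupp.mem_support_iff] at hn₂ hmax hn₃ hmax₃ hb hbmax
  have hM : 0 < det e b₀ n₂ := hpos.trans_le (hmax n₁ hn₁)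
  have hbb := hbmax b₀ hb₀
  have hb₀p := dot_self_pos hb₀0
  have hdetp : det e b₀ (n₃ + b) = det e b₀ n₂ := by
    rw [det_add_right, hn₃.2, hline _ _ hb₀ hb, add_zero]
  have h := hZ (n₃ + b) (by
      by_contra h
      have := hmax₃ _ ⟨h, hdetp⟩
      rw [dotProduct_add] at this
      linarith) (by
      by_contra h
      have := hline _ _ hb₀ h
      linarith)
  rw [Trig.br_coeff, Finset.sum_eq_single b] at h
  · rw [add_sub_cancel_right, det_add_right, det_self, add_zero] at h
    have h1 := Complex.ofReal_eq_zero.1 ((mul_eq_zero.1 h).resolve_left (mul_ne_zero hb hn₃.1))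
    have hbne : b ≠ 0 := by rintro rfl; exact hb hβ0
    have := det_eq_zero_of_parallel he (hβ b hb) (hβ b₀ hb₀) (hα n₃ hn₃.1) hbne
      (hline _ _ hb hb₀) h1
    linarith [hn₃.2]
  · intro a ha hab
    rw [Finsupp.mem_support_iff] at ha
    by_contra h0
    have hc := right_ne_zero_of_mul (left_ne_zero_of_mul h0)
    have h1 := hmax₃ _ ⟨hc, by rw [det_sub_right, hdetp, hline _ _ hb₀ ha, sub_zero]⟩
    rw [dotProduct_sub, dotProduct_add] at h1
    have h2 := hbmax a ha
    have h3 : b₀ ⬝ᵥ a = b₀ ⬝ᵥ b := by linarith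
    have h4 := smul_eq_of_det_eq_zero he (hβ _ hb₀) (hβ _ ha) hb₀0 (hline _ _ hb₀ ha)
    have h5 := smul_eq_of_det_eq_zero he (hβ _ hb₀) (hβ _ hb) hb₀0 (hline _ _ hb₀ hb)
    rw [h3, ← h5] at h4
    exact hab (smul_right_injective R3 hb₀p.ne' h4)
  · intro h
    exact absurd (Finsupp.mem_support_iff.2 hb) h

theorem exists_max_norm {β : Trig} (h : ∃ n, β.coeff n ≠ 0) :
    ∃ n, β.coeff n ≠ 0 ∧ ∀ x, β.coeff x ≠ 0 → x ⬝ᵥ x ≤ n ⬝ᵥ n := by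
  obtain ⟨n, hn⟩ := h
  obtain ⟨m, hm, hmax⟩ := Finset.exists_max_image β.coeff.support (fun x => x ⬝ᵥ x)
    ⟨n, Finsupp.mem_support_iff.2 hn⟩
  exact ⟨m, Finsupp.mem_support_iff.1 hm, fun x hx => hmax x (Finsupp.mem_support_iff.2 hx)⟩

/-- Without Coriolis effect, the in-plane part lives on a circle. -/
theorem exists_circle (he : e ⬝ᵥ e = 1) (hβ : Trig.Planar e β) (hβ0 : β.coeff 0 = 0)
    (hβs : ∀ n, β.coeff (-n) = -star (β.coeff n))
    (hspan : ∃ a b, β.coeff a ≠ 0 ∧ β.coeff b ≠ 0 ∧ det e a b ≠ 0)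
    (hZ : ∀ p, β.coeff p = 0 → (Trig.br e β (Trig.lap β)).coeff p = 0) :
    ∃ R : ℝ, ∀ n, β.coeff n ≠ 0 → n ⬝ᵥ n = R := by
  have hsym : ∀ n, β.coeff n ≠ 0 → β.coeff (-n) ≠ 0 := fun n hn => by rw [hβs]; simpa using hn
  obtain ⟨n, hn, hmax⟩ := exists_max_norm ⟨_, hspan.choose_spec.choose_spec.1⟩
  obtain ⟨ℓ, n', hℓ, hle, h1, h2, hn', hD, hpos⟩ := exists_supporting he hβ hsym hβ0 hspan hn hmax
  obtain ⟨n'', E, hnn⟩ := exists_edge_of_max he hβ hn hmax hℓ hle h1 h2 hn' hD hpos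
    (fun p hp => hZ p (by by_contra h; have := hle p h; linarith))
  refine ⟨n ⬝ᵥ n, fun m hm => E.circle hnn hβ0 hβs
    (fun p hp => hZ p (by by_contra h; have := hle p h; linarith))
    (fun p hp hne hne' => hZ p ?_) hm⟩
  by_contra h
  rcases E.top p h hp with h | h
  · exact hne h
  · exact hne' h

/-- With Coriolis effect, the field is proportional to its in-plane part, which lives on a circle. -/
theorem exists_circle_of_coriolis (he : e ⬝ᵥ e = 1) (hα : Trig.Planar e α) (hβ : Trig.Planar e β)
    (hα0 : α.coeff 0 = 0) (hβ0 : β.coeff 0 = 0) (hαs : ∀ n, α.coeff (-n) = star (α.coeff n))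
    (hβs : ∀ n, β.coeff (-n) = -star (β.coeff n))
    (hspan : ∃ a b, β.coeff a ≠ 0 ∧ β.coeff b ≠ 0 ∧ det e a b ≠ 0)
    (hZ : ∀ p, α.coeff p = 0 → β.coeff p = 0 → (Trig.br e β α).coeff p = 0)
    (hZ' : ∀ p, α.coeff p = 0 → β.coeff p = 0 → (Trig.br e β (Trig.lap β)).coeff p = 0)
    (hC : ∀ p, β.coeff p = 0 → α.coeff p ≠ 0 → (Trig.br e β (Trig.lap β)).coeff p = 0 → p 2 = 0)
    (hH : ∀ x y : R3, e ⬝ᵥ x = 0 → e ⬝ᵥ y = 0 → x 2 = 0 → y 2 = 0 → det e x y = 0) :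
    ∃ (R : ℝ) (κ : ℂ), (∀ n, β.coeff n ≠ 0 → n ⬝ᵥ n = R) ∧ (∀ n, α.coeff n = κ * β.coeff n) ∧
      star κ = -κ := by
  have hsym : ∀ n, β.coeff n ≠ 0 → β.coeff (-n) ≠ 0 := fun n hn => by rw [hβs]; simpa using hn
  have hneβ : ∃ n, β.coeff n ≠ 0 := ⟨_, hspan.choose_spec.choose_spec.1⟩
  obtain ⟨n, hn, hmax⟩ := exists_max_norm hneβ
  obtain ⟨ℓ, n', hℓ, hle, h1, h2, hn', hD, hpos⟩ := exists_supporting he hβ hsym hβ0 hspan hn hmax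
  have hlt : ∀ b, α.coeff b ≠ 0 → ℓ ⬝ᵥ b < 2 := fun b hb =>
    level_lt_two he hα hβ hZ hC hH hle hn hn' h1 h2 hD hb
  obtain ⟨n'', E, hnn⟩ := exists_edge_of_max he hβ hn hmax hℓ hle h1 h2 hn' hD hpos
    (fun p hp => hZ' p (by by_contra h; have := hlt p h; linarith)
      (by by_contra h; have := hle p h; linarith))
  have hl1 := E.level_le_one hα hZ hlt
  have hcirc : ∀ m, β.coeff m ≠ 0 → m ⬝ᵥ m = n ⬝ᵥ n := by
    refine fun m hm => E.circle hnn hβ0 hβs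
      (fun p hp => hZ' p (by by_contra h; linarith [hl1 p h]) (by by_contra h; linarith [hle p h]))
      (fun p hp hne hne' => ?_) hm
    have hβp : β.coeff p = 0 := by
      by_contra h
      rcases E.top p h hp with h | h
      · exact hne h
      · exact hne' h
    refine hZ' p ?_ hβp
    rw [E.top_coeff hα (k := 1) (by simpa using hl1) (fun q hq => hZ q
      (by by_contra h; have := hl1 q h; rw [hq] at this; norm_num at this)
      (by by_contra h; have := hle q h; rw [hq] at this; norm_num at this)) (by rw [hp]; simp),
      pow_one β, hβp, mul_zero]
  obtain ⟨κ, h, h'⟩ := eq_smul_of_edges hα hα0 hβ0 hαs hβs hneβ hZ fun m hm => by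
    obtain ⟨ℓ', m', E'⟩ := exists_edge_of_circle he hβ hsym hβ0 hspan hcirc hm
    exact ⟨ℓ', m', E', E'.level_le_one hα hZ fun b hb => level_lt_two he hα hβ hZ hC hH E'.levelLE
      E'.mem₁ E'.mem₂ E'.level₁ E'.level₂ E'.det_pos hb⟩
  exact ⟨_, κ, hcirc, h, h'⟩

/-- On a circle, `β` commutes with its Laplacian. -/
theorem br_lap_eq_zero {R : ℝ} (hR : ∀ n, β.coeff n ≠ 0 → n ⬝ᵥ n = R) :
    Trig.br e β (Trig.lap β) = 0 := by
  have : Trig.lap β = (R : ℂ) • β := by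
    ext n
    rw [Trig.weight_coeff]
    by_cases h : β.coeff n = 0
    · simp [h]
    · simp [hR n h]
  rw [this, Derivation.map_smul, Trig.br_self, smul_zero]

end

/-! ### Planar solutions with constant supports -/

/-- A planar solution on a time interval, written in terms of the coefficients `A` (orthogonal to the
plane) and `B` (stream function of the in-plane part), with constant Fourier supports. -/
structure PlanarEvolution (ν Ω : ℝ) (e : R3) (U : Set ℝ) (A B : ℝ → Trig) (SA SB : Finset R3) :
    Prop where
  unit : e ⬝ᵥ e = 1
  planarA : ∀ t ∈ U, Trig.Planar e (A t)
  planarB : ∀ t ∈ U, Trig.Planar e (B t)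
  zeroA : ∀ t ∈ U, (A t).coeff 0 = 0
  zeroB : ∀ t ∈ U, (B t).coeff 0 = 0
  symA : ∀ t ∈ U, ∀ n, (A t).coeff (-n) = star ((A t).coeff n)
  symB : ∀ t ∈ U, ∀ n, (B t).coeff (-n) = -star ((B t).coeff n)
  memA : ∀ t ∈ U, ∀ n, (A t).coeff n ≠ 0 ↔ n ∈ SA
  memB : ∀ t ∈ U, ∀ n, (B t).coeff n ≠ 0 ↔ n ∈ SB
  derivA : ∀ t ∈ U, ∀ n, n ≠ 0 → HasDerivAt (fun s => (A s).coeff n)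
    (-(ν * (n ⬝ᵥ n) : ℝ) * (A t).coeff n - (Ω * n 2 : ℝ) * (B t).coeff n
      - Complex.I * (Trig.br e (B t) (A t)).coeff n) t
  derivB : ∀ t ∈ U, ∀ n, n ≠ 0 → HasDerivAt (fun s => (B s).coeff n)
    (-(ν * (n ⬝ᵥ n) : ℝ) * (B t).coeff n + (Ω * n 2 / (n ⬝ᵥ n) : ℝ) * (A t).coeff n
      - Complex.I / ((n ⬝ᵥ n : ℝ) : ℂ) * (Trig.br e (B t) (Trig.lap (B t))).coeff n) t

theorem Trig.br_coeff_zero (e : R3) (f g : Trig) : (Trig.br e f g).coeff 0 = 0 := by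
  rw [Trig.br_coeff]
  refine Finset.sum_eq_zero fun a _ => ?_
  simp [det]

theorem Trig.eq_sum_single {f : Trig} {Z : Finset R3} (h : ∀ n, f.coeff n ≠ 0 → n ∈ Z) :
    f = ∑ n ∈ Z, f.coeff n • (AddMonoidAlgebra.single n 1 : Trig) := by
  classical
  ext m
  rw [AddMonoidAlgebra.coeff_sum, Finsupp.finsetSum_apply]
  simp only [AddMonoidAlgebra.coeff_smul, Finsupp.smul_apply, AddMonoidAlgebra.coeff_single,
    Finsupp.single_apply, smul_eq_mul, mul_ite, mul_one, mul_zero]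
  rw [Finset.sum_ite_eq']
  split_ifs with hm
  · rfl
  · by_contra h0; exact hm (h m h0)

theorem Trig.hasDerivAt_linear (φ : Trig →ₗ[ℂ] ℂ) {A : ℝ → Trig} {G : Trig} {Z : Finset R3} {t : ℝ}
    {U : Set ℝ} (hU : U ∈ nhds t) (hA : ∀ s ∈ U, ∀ n, (A s).coeff n ≠ 0 → n ∈ Z)
    (hG : ∀ n, G.coeff n ≠ 0 → n ∈ Z)
    (hd : ∀ n ∈ Z, HasDerivAt (fun s => (A s).coeff n) (G.coeff n) t) :
    HasDerivAt (fun s => φ (A s)) (φ G) t := by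
  have h1 : HasDerivAt (fun s => ∑ n ∈ Z, (A s).coeff n * φ (AddMonoidAlgebra.single n 1))
      (∑ n ∈ Z, G.coeff n * φ (AddMonoidAlgebra.single n 1)) t :=
    HasDerivAt.fun_sum fun n hn => (hd n hn).mul_const _
  have e : ∀ f : Trig, (∀ n, f.coeff n ≠ 0 → n ∈ Z) →
      φ f = ∑ n ∈ Z, f.coeff n * φ (AddMonoidAlgebra.single n 1) := by
    intro f hf
    conv_lhs => rw [Trig.eq_sum_single hf]
    rw [map_sum]
    simp only [map_smul, smul_eq_mul]
  rw [e G hG]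
  exact h1.congr_of_eventuallyEq (Filter.eventually_of_mem hU fun s hs => e _ (hA s hs))

theorem hasDerivAt_eq_zero_of_eventually {f : ℝ → ℂ} {f' : ℂ} {t : ℝ} {U : Set ℝ} (hU : U ∈ nhds t)
    (hf : ∀ s ∈ U, f s = 0) (h : HasDerivAt f f' t) : f' = 0 :=
  h.unique ((hasDerivAt_const t (0 : ℂ)).congr_of_eventuallyEq (Filter.eventually_of_mem hU hf))

namespace PlanarEvolution

variable {ν Ω : ℝ} {e : R3} {U : Set ℝ} {A B : ℝ → Trig} {SA SB : Finset R3}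
  (H : PlanarEvolution ν Ω e U A B SA SB) (hU : IsOpen U)
include H hU

/-- A mode that vanishes at one time of `U` vanishes throughout, so its derivative is zero and its
evolution equation turns into an algebraic one. -/
theorem relA {t : ℝ} (ht : t ∈ U) {p : R3} (hp : (A t).coeff p = 0) :
    ((Ω * p 2 : ℝ) : ℂ) * (B t).coeff p = -Complex.I * (Trig.br e (B t) (A t)).coeff p := by
  by_cases hp0 : p = 0
  · rw [hp0, Trig.br_coeff_zero]; simp
  have hpA : p ∉ SA := fun h => (H.memA t ht p).2 h hp
  have hz := hasDerivAt_eq_zero_of_eventually (hU.mem_nhds ht) (fun s hs => by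
    by_contra h; exact hpA ((H.memA s hs p).1 h)) (H.derivA t ht p hp0)
  rw [hp] at hz
  linear_combination -hz

theorem relB {t : ℝ} (ht : t ∈ U) {p : R3} (hp : (B t).coeff p = 0) :
    ((Ω * p 2 : ℝ) : ℂ) * (A t).coeff p = Complex.I * (Trig.br e (B t) (Trig.lap (B t))).coeff p := by
  by_cases hp0 : p = 0
  · rw [hp0, Trig.br_coeff_zero]; simp
  have hpB : p ∉ SB := fun h => (H.memB t ht p).2 h hp
  have hz := hasDerivAt_eq_zero_of_eventually (hU.mem_nhds ht) (fun s hs => by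
    by_contra h; exact hpB ((H.memB s hs p).1 h)) (H.derivB t ht p hp0)
  rw [hp] at hz
  have hpp : ((p ⬝ᵥ p : ℝ) : ℂ) ≠ 0 := Complex.ofReal_ne_zero.2 (dot_self_pos hp0).ne'
  rw [Complex.ofReal_div] at hz
  field_simp at hz
  linear_combination hz

theorem outA {t : ℝ} (ht : t ∈ U) {p : R3} (hp : (A t).coeff p = 0) (hp' : (B t).coeff p = 0) :
    (Trig.br e (B t) (A t)).coeff p = 0 := by
  have := H.relA hU ht hp
  rw [hp', mul_zero] at this
  simpa using this.symm

theorem outB {t : ℝ} (ht : t ∈ U) {p : R3} (hp : (A t).coeff p = 0) (hp' : (B t).coeff p = 0) :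
    (Trig.br e (B t) (Trig.lap (B t))).coeff p = 0 := by
  have := H.relB hU ht hp'
  rw [hp, mul_zero] at this
  simpa using this.symm

section NoCoriolis
variable (hA0 : ∀ n, e ⬝ᵥ n = 0 → Ω * n 2 = 0)
include hA0

theorem outA' {t : ℝ} (ht : t ∈ U) {p : R3} (hp : (A t).coeff p = 0) :
    (Trig.br e (B t) (A t)).coeff p = 0 := by
  by_cases h : e ⬝ᵥ p = 0
  · have := H.relA hU ht hp
    rw [hA0 p h] at this
    simpa using this.symm
  · exact (H.planarB t ht).br_eq_zero (H.planarA t ht) h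

theorem outB' {t : ℝ} (ht : t ∈ U) {p : R3} (hp : (B t).coeff p = 0) :
    (Trig.br e (B t) (Trig.lap (B t))).coeff p = 0 := by
  by_cases h : e ⬝ᵥ p = 0
  · have := H.relB hU ht hp
    rw [hA0 p h] at this
    simpa using this.symm
  · refine (H.planarB t ht).br_eq_zero (fun m hm => H.planarB t ht m ?_) h
    rw [Trig.weight_coeff] at hm
    exact right_ne_zero_of_mul hm

omit hU in
theorem derivA' {t : ℝ} (ht : t ∈ U) {n : R3} (hn : n ∈ SA) : HasDerivAt (fun s => (A s).coeff n)
    (-(ν * (n ⬝ᵥ n) : ℝ) * (A t).coeff n - Complex.I * (Trig.br e (B t) (A t)).coeff n) t := by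
  have hne := (H.memA t ht n).2 hn
  have h := H.derivA t ht n (by rintro rfl; exact hne (H.zeroA t ht))
  rwa [hA0 n (H.planarA t ht n hne), Complex.ofReal_zero, zero_mul, sub_zero] at h

omit hU in
theorem derivB' {R : ℝ} {t : ℝ} (ht : t ∈ U) (hR : ∀ n, (B t).coeff n ≠ 0 → n ⬝ᵥ n = R) {n : R3}
    (hn : n ∈ SB) : HasDerivAt (fun s => (B s).coeff n) (-(ν * R : ℝ) * (B t).coeff n) t := by
  have hne := (H.memB t ht n).2 hn
  have h := H.derivB t ht n (by rintro rfl; exact hne (H.zeroB t ht))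
  rwa [hA0 n (H.planarB t ht n hne), zero_div, Complex.ofReal_zero, zero_mul, add_zero, br_lap_eq_zero hR,
    AddMonoidAlgebra.coeff_zero, Finsupp.zero_apply, mul_zero, sub_zero, hR n hne] at h

/-- On the top level α is binomial in the edge coefficients of β at every time. Differentiating this
relation determines the bracket from the mismatch of viscous decay rates. -/
theorem br_top {R : ℝ} (hR : ∀ n, n ∈ SB → n ⬝ᵥ n = R) {t : ℝ} (ht : t ∈ U) {ℓ n n' : R3}
    (E : REdge e (B t) ℓ n n') {k : ℕ} (hl : Trig.LevelLE ℓ (A t) k) (j : ℕ) :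
    (Trig.br e (B t) (A t)).coeff (REdge.pt n n' k j) =
      -Complex.I * ν * ((n' - n) ⬝ᵥ (n' - n) : ℝ) * j * (k - j) * (A t).coeff (REdge.pt n n' k j) := by
  by_cases hpt : (A t).coeff (REdge.pt n n' k j) = 0
  · rw [hpt, H.outA' hU hA0 ht hpt, mul_zero]
  have hmem := (H.memA t ht _).1 hpt
  have hRt : ∀ s ∈ U, ∀ m, (B s).coeff m ≠ 0 → m ⬝ᵥ m = R := fun s hs m hm =>
    hR m ((H.memB s hs m).1 hm)
  have hEs : ∀ s ∈ U, REdge e (B s) ℓ n n' := fun s hs =>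
    { unit := E.unit
      planar := H.planarB s hs
      perp := E.perp
      mem₁ := (H.memB s hs n).2 ((H.memB t ht n).1 E.mem₁)
      mem₂ := (H.memB s hs n').2 ((H.memB t ht n').1 E.mem₂)
      level₁ := E.level₁
      level₂ := E.level₂
      levelLE := fun m hm => E.levelLE m ((H.memB t ht m).2 ((H.memB s hs m).1 hm))
      top := fun m hm => E.top m ((H.memB t ht m).2 ((H.memB s hs m).1 hm))
      det_pos := E.det_pos }
  have hls : ∀ s ∈ U, Trig.LevelLE ℓ (A s) k := fun s hs m hm =>
    hl m ((H.memA t ht m).2 ((H.memA s hs m).1 hm))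
  have hout : ∀ s ∈ U, ∀ p, (k : ℝ) < ℓ ⬝ᵥ p → (Trig.br e (B s) (A s)).coeff p = 0 := fun s hs p hp =>
    H.outA' hU hA0 hs (by by_contra h; linarith [hls s hs p h])
  have hcomm : ∀ s ∈ U, ∀ p, ℓ ⬝ᵥ p = k + 1 → (Trig.br e (B s) (A s)).coeff p = 0 := fun s hs p hp =>
    hout s hs p (by linarith)
  obtain ⟨i, j', hi, hij, hK0⟩ := E.commuting (H.planarA t ht) hl (hcomm t ht) hpt (E.level_pt _ _)
  have hjk : j ≤ k := by
    have h1 : j = i := by exact_mod_cast E.pt_injective _ hi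
    have h2 : k = i + j' := by exact_mod_cast hij
    omega
  have hK0mem := (H.memA t ht _).1 hK0
  have hn := (H.memB t ht n).1 E.mem₁
  have hn' := (H.memB t ht n').1 E.mem₂
  -- The binomial relation with the denominator cleared, valid at all times because the supports are
  -- constant.
  have hid : ∀ s ∈ U, (A s).coeff (REdge.pt n n' k j) * (B s).coeff n ^ j -
      k.choose j * ((A s).coeff ((k : ℝ) • n) * (B s).coeff n' ^ j) = 0 := by
    intro s hs
    rw [(hEs s hs).top_coeff (H.planarA s hs) (hls s hs) (hcomm s hs) (E.level_pt _ _),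
      (hEs s hs).pow_coeff k j hjk]
    obtain ⟨i, rfl⟩ := Nat.exists_eq_add_of_le hjk
    rw [Nat.add_sub_cancel_left]
    have := (hEs s hs).mem₁
    field_simp
    ring
  -- At the end `k • n` the bracket vanishes: subtracting the multiple of the power lowers the level
  -- without changing the bracket, and the recursion at θ = 0 has no predecessor.
  have hbr0 : (Trig.br e (B t) (A t)).coeff ((k : ℝ) • n) = 0 := by
    obtain - | k := k
    · simp only [Nat.cast_zero, zero_smul]
      exact Trig.br_coeff_zero _ _ _
    set κ := (A t).coeff (((k + 1 : ℕ) : ℝ) • n) / (B t).coeff n ^ (k + 1) with hκ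
    set f := A t - κ • B t ^ (k + 1)
    have hbrf : Trig.br e (B t) f = Trig.br e (B t) (A t) := by
      rw [map_sub, Derivation.map_smul, Trig.br_pow_self, smul_zero, sub_zero]
    have hfl : Trig.LevelLE ℓ f k := by
      refine E.natural_level ((H.planarA t ht).sub ((E.planar.pow _).smul κ)) (fun m hm => ?_)
        (fun p hp => by rw [hbrf, hout t ht p hp])
      exact E.sub_pow_level (H.planarA t ht) hl (hcomm t ht) hm
    have hk1 : (k : ℝ) + 1 = ((k + 1 : ℕ) : ℝ) := by push_cast; rfl
    have hb := (E.recur hfl).below E.mem₁ (E.finite_line f k) (fun θ hθ => by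
      rw [hbrf, hk1, H.outA' hU hA0 ht, zero_div]
      by_contra h
      obtain ⟨i, j', hi, -, -⟩ := E.commuting (H.planarA t ht) hl (hcomm t ht) h (E.level_pt _ _)
      have := E.pt_injective _ hi
      have hi0 : (0 : ℝ) ≤ i := by positivity
      linarith) (θ := 0 - 1) (by norm_num)
    have h := E.br_coeff_pt hfl 0
    rw [hb, hbrf, hk1, REdge.pt_zero] at h
    rw [h]; simp
  have hd := (((H.derivA' hA0 ht hmem).mul ((H.derivB' hA0 ht (hRt t ht) hn).pow j)).sub
    ((((H.derivA' hA0 ht hK0mem).mul ((H.derivB' hA0 ht (hRt t ht) hn').pow j))).const_mul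
      (k.choose j : ℂ)))
  have hz := hasDerivAt_eq_zero_of_eventually (hU.mem_nhds ht) hid hd
  have h0 := hid t ht
  rw [hbr0] at hz
  -- The defect j (k - j) |n' - n|² against k²R is the difference of decay rates that survives.
  have hnorm : (REdge.pt n n' k j) ⬝ᵥ (REdge.pt n n' k j) =
      (k : ℝ) ^ 2 * R - j * (k - j) * ((n' - n) ⬝ᵥ (n' - n)) := by
    have e3 : (n' - n) ⬝ᵥ (n' - n) = n' ⬝ᵥ n' + n ⬝ᵥ n - 2 * (n ⬝ᵥ n') := by
      simp only [dotProduct_sub, sub_dotProduct, dotProduct_comm n' n]; ring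
    rw [hR n hn, hR n' hn'] at e3
    have e4 : n ⬝ᵥ n' = R - ((n' - n) ⬝ᵥ (n' - n)) / 2 := by rw [e3]; ring
    rw [REdge.pt]
    have e5 : ((k : ℝ) • n + (j : ℝ) • (n' - n)) ⬝ᵥ ((k : ℝ) • n + (j : ℝ) • (n' - n)) =
        k ^ 2 * (n ⬝ᵥ n) + 2 * k * j * (n ⬝ᵥ n' - n ⬝ᵥ n) + j ^ 2 * ((n' - n) ⬝ᵥ (n' - n)) := by
      simp only [dotProduct_sub, sub_dotProduct, dotProduct_add, add_dotProduct, smul_dotProduct,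
        dotProduct_smul, dotProduct_comm n' n, smul_eq_mul]
      ring
    rw [e5, e4, hR n hn]; ring
  have hnorm0 : ((k : ℝ) • n) ⬝ᵥ ((k : ℝ) • n) = (k : ℝ) ^ 2 * R := by
    rw [smul_dotProduct, dotProduct_smul, hR n hn]; simp only [smul_eq_mul]; ring
  rw [hnorm, hnorm0] at hz
  have hbn : (B t).coeff n ≠ 0 := E.mem₁
  have hpow : ∀ x : ℂ, (j : ℂ) * x ^ (j - 1) * (-((ν * R : ℝ) : ℂ) * x) = -((ν * R : ℝ) : ℂ) * j * x ^ j := by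
    intro x
    rcases Nat.eq_zero_or_pos j with rfl | hj
    · simp
    · obtain ⟨i, rfl⟩ : ∃ i, j = i + 1 := ⟨j - 1, by omega⟩
      rw [Nat.add_sub_cancel, pow_succ]; ring
  rw [hpow, hpow] at hz
  simp only [Pi.pow_apply] at hz
  push_cast at hz
  apply mul_left_cancel₀ (pow_ne_zero j hbn)
  linear_combination (Complex.I) * hz + Complex.I * ν * R * (k ^ 2 + j) * h0 +
    (Trig.br e (B t) (A t)).coeff (REdge.pt n n' k j) * (B t).coeff n ^ j * Complex.I_mul_I

end NoCoriolis

end PlanarEvolution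

/-- What the dynamics forces on a planar field, in terms of coefficients. -/
def PlanarAdmissible (ν Ω : ℝ) (e : R3) (α β : Trig) : Prop :=
  (β = 0 ∧ ∀ n, e ⬝ᵥ n = 0 → Ω * n 2 = 0) ∨
  ∃ R : ℝ, (∀ n, β.coeff n ≠ 0 → n ⬝ᵥ n = R) ∧
    (∃ a b, β.coeff a ≠ 0 ∧ β.coeff b ≠ 0 ∧ det e a b ≠ 0) ∧
    ∃ q : Polynomial ℂ, α = Polynomial.aeval β q ∧
      ((∀ n, e ⬝ᵥ n = 0 → Ω * n 2 = 0) → ν ≠ 0 →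
        ∃ κ : ℂ, star κ = -κ ∧ q = Polynomial.C κ * Polynomial.X) ∧
      ((¬∀ n, e ⬝ᵥ n = 0 → Ω * n 2 = 0) →
        ∃ κ : ℂ, star κ = -κ ∧ κ ^ 2 = -R ∧ q = Polynomial.C κ * Polynomial.X)

theorem PlanarAdmissible.br_eq_zero {ν Ω : ℝ} {e : R3} {α β : Trig}
    (h : PlanarAdmissible ν Ω e α β) : Trig.br e β α = 0 ∧ Trig.br e β (Trig.lap β) = 0 := by
  rcases h with ⟨rfl, -⟩ | ⟨R, hR, -, q, rfl, -⟩
  · constructor <;> rw [Trig.br_apply] <;> simp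
  · exact ⟨Trig.br_aeval _ _ _, br_lap_eq_zero hR⟩

theorem aeval_C_mul_X_eq {α β : Trig} {κ : ℂ} (h : ∀ n, α.coeff n = κ * β.coeff n) :
    α = Polynomial.aeval β (Polynomial.C κ * Polynomial.X) := by
  rw [map_mul, Polynomial.aeval_C, Polynomial.aeval_X, ← Algebra.smul_def]
  ext n
  rw [h]
  simp

/-- A nonzero β spans the plane, since otherwise α would lie on the same line. Without Coriolis
effect β lives on a circle; for ν = 0 boundedness of the iterated brackets gives commutation, and
for ν ≠ 0 the level bound gives proportionality. With Coriolis effect proportionality is algebraic,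
and its persistence in time fixes the factor. -/
theorem PlanarEvolution.admissible {ν Ω : ℝ} {e : R3} {t₀ ε : ℝ} {A B : ℝ → Trig} {SA SB : Finset R3}
    (H : PlanarEvolution ν Ω e (Metric.ball t₀ ε) A B SA SB) {t : ℝ} (ht : t ∈ Metric.ball t₀ ε)
    (hspan : ∃ x y, (x ∈ SA ∨ x ∈ SB) ∧ (y ∈ SA ∨ y ∈ SB) ∧ det e x y ≠ 0) :
    PlanarAdmissible ν Ω e (A t) (B t) := by
  have hU : IsOpen (Metric.ball t₀ ε) := Metric.isOpen_ball
  have he := H.unit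
  have hα := H.planarA t ht
  have hβ := H.planarB t ht
  have hα0 := H.zeroA t ht
  have hβ0 := H.zeroB t ht
  have hαs := H.symA t ht
  have hβs := H.symB t ht
  have hsymA : ∀ n, (A t).coeff n ≠ 0 → (A t).coeff (-n) ≠ 0 := fun n hn => by rw [hαs]; simpa using hn
  have hsymB : ∀ n, (B t).coeff n ≠ 0 → (B t).coeff (-n) ≠ 0 := fun n hn => by rw [hβs]; simpa using hn
  have hZ : ∀ p, (A t).coeff p = 0 → (B t).coeff p = 0 → (Trig.br e (B t) (A t)).coeff p = 0 :=
    fun p h h' => H.outA hU ht h h'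
  have hspan' : ∃ x y, ((A t).coeff x ≠ 0 ∨ (B t).coeff x ≠ 0) ∧
      ((A t).coeff y ≠ 0 ∨ (B t).coeff y ≠ 0) ∧ det e x y ≠ 0 := by
    simpa only [H.memA t ht, H.memB t ht] using hspan
  obtain ⟨x₀, y₀, hx₀, hy₀, hxy₀⟩ := hspan'
  have hpl : ∀ x, ((A t).coeff x ≠ 0 ∨ (B t).coeff x ≠ 0) → e ⬝ᵥ x = 0 := fun x hx =>
    hx.elim (hα x) (hβ x)
  have hH : (¬∀ n, e ⬝ᵥ n = 0 → Ω * n 2 = 0) →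
      Ω ≠ 0 ∧ ∀ x y : R3, e ⬝ᵥ x = 0 → e ⬝ᵥ y = 0 → x 2 = 0 → y 2 = 0 → det e x y = 0 := by
    intro h
    push Not at h
    obtain ⟨n, hn, hne⟩ := h
    refine ⟨left_ne_zero_of_mul hne, fun x y hx hy hx2 hy2 => ?_⟩
    have := congrFun (planar_expand he hx hy hn) 2
    simp only [Pi.smul_apply, Pi.add_apply, hx2, hy2, smul_eq_mul, mul_zero, add_zero] at this
    exact (mul_eq_zero.1 this).resolve_right (right_ne_zero_of_mul hne)
  by_cases hB0 : ∃ b, (B t).coeff b ≠ 0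
  swap
  · push Not at hB0
    have hB : B t = 0 := by ext n; simp [hB0]
    left
    refine ⟨hB, ?_⟩
    by_contra hcor
    obtain ⟨hΩ, hH⟩ := hH hcor
    -- With β = 0 the Coriolis term would create in-plane motion at every mode that is not
    -- horizontal, and the horizontal modes cannot span this plane.
    have hz : ∀ x, ((A t).coeff x ≠ 0 ∨ (B t).coeff x ≠ 0) → x 2 = 0 := by
      intro x hx
      have hx' := hx.resolve_right fun h => h (hB0 x)
      have := H.relB hU ht (hB0 x)
      rw [hB] at this
      have h0 : (Trig.br e 0 (Trig.lap 0)).coeff x = 0 := by rw [map_zero, map_zero]; rfl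
      rw [h0, mul_zero] at this
      have := (mul_eq_zero.1 this).resolve_right hx'
      exact (mul_eq_zero.1 (Complex.ofReal_eq_zero.1 this)).resolve_left hΩ
    exact hxy₀ (hH _ _ (hpl _ hx₀) (hpl _ hy₀) (hz _ hx₀) (hz _ hy₀))
  obtain ⟨b₀, hb₀⟩ := hB0
  have hb₀0 : b₀ ≠ 0 := by rintro rfl; exact hb₀ hβ0
  have hspanB : ∃ a b, (B t).coeff a ≠ 0 ∧ (B t).coeff b ≠ 0 ∧ det e a b ≠ 0 := by
    by_contra! hline
    have hall : ∀ x, ((A t).coeff x ≠ 0 ∨ (B t).coeff x ≠ 0) → det e b₀ x = 0 := by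
      rintro x (hx | hx)
      · exact det_eq_zero_of_line he hα hβ hβ0 hsymA hZ (fun x y hx hy => hline x y hx hy) hb₀ hx
      · exact hline _ _ hb₀ hx
    exact hxy₀ (det_eq_zero_of_parallel he (hβ _ hb₀) (hpl _ hx₀) (hpl _ hy₀) hb₀0 (hall _ hx₀)
      (hall _ hy₀))
  right
  by_cases hcor : ∀ n, e ⬝ᵥ n = 0 → Ω * n 2 = 0
  · obtain ⟨R, hR⟩ := exists_circle he hβ hβ0 hβs hspanB (fun p hp => H.outB' hU hcor ht hp)
    have hRS : ∀ n, n ∈ SB → n ⬝ᵥ n = R := fun n hn => hR n ((H.memB t ht n).2 hn)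
    have hE : ∀ n, (B t).coeff n ≠ 0 → ∃ ℓ n', REdge e (B t) ℓ n n' := fun n hn =>
      exists_edge_of_circle he hβ hsymB hβ0 hspanB hR hn
    by_cases hν : ν = 0
    · have hBconst : ∀ s ∈ Metric.ball t₀ ε, B s = B t := by
        intro s hs
        ext n
        by_cases hn : n ∈ SB
        · have hd : ∀ x ∈ Metric.ball t₀ ε, HasDerivWithinAt (fun s => (B s).coeff n) 0
              (Metric.ball t₀ ε) x := by
            intro x hx
            have := H.derivB' hcor hx (fun m hm => hRS m ((H.memB x hx m).1 hm)) hn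
            rw [hν, zero_mul, Complex.ofReal_zero, neg_zero, zero_mul] at this
            exact this.hasDerivWithinAt
          exact (convex_ball t₀ ε).is_const_of_fderivWithin_eq_zero (𝕜 := ℝ)
            (fun x hx => (hd x hx).differentiableWithinAt)
            (fun x hx => by
              have h0 := (hd x hx).hasFDerivWithinAt.fderivWithin (hU.uniqueDiffWithinAt hx)
              rw [h0]; ext; simp) hs ht
        · rw [not_not.1 (mt (H.memB s hs n).1 hn), not_not.1 (mt (H.memB t ht n).1 hn)]
      set L : Trig →ₗ[ℂ] Trig := (Trig.br e (B t) : Trig →ₗ[ℂ] Trig) with hL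
      -- Now α evolves by the constant operator `-i L`. Differentiating the vanishing of `L ^ k` of
      -- α at `p` gives the same for k + 1.
      have hiter : ∀ k : ℕ, ∀ s ∈ Metric.ball t₀ ε, ∀ p, p ∉ SA → ((L ^ k) (A s)).coeff p = 0 := by
        intro k
        induction k with
        | zero =>
          intro s hs p hp
          exact not_not.1 (mt (H.memA s hs p).1 hp)
        | succ k ih =>
          intro s hs p hp
          let φ : Trig →ₗ[ℂ] ℂ :=
            (Finsupp.lapply p ∘ₗ (AddMonoidAlgebra.coeffLinearEquiv ℂ : Trig ≃ₗ[ℂ] (R3 →₀ ℂ)).toLinearMap)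
              ∘ₗ (L ^ k)
          have hφ : ∀ f, φ f = ((L ^ k) f).coeff p := fun f => rfl
          have hd := Trig.hasDerivAt_linear φ (A := A) (G := -Complex.I • L (A s)) (Z := SA)
            (hU.mem_nhds hs) (fun x hx n hn => (H.memA x hx n).1 hn) (fun n hn => by
              by_contra h
              apply hn
              have h1 := not_not.1 (mt (H.memA s hs n).1 h)
              have h2 := H.outA' hU hcor hs h1
              rw [hBconst s hs] at h2
              change (-Complex.I • Trig.br e (B t) (A s)).coeff n = 0
              simp [h2]) (fun n hn => by
              have := H.derivA' hcor hs hn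
              rw [hν, zero_mul, Complex.ofReal_zero, neg_zero, zero_mul, zero_sub, hBconst s hs] at this
              convert this using 1
              change (-Complex.I • Trig.br e (B t) (A s)).coeff n = _
              simp)
          have hz := hasDerivAt_eq_zero_of_eventually (hU.mem_nhds hs)
            (fun x hx => by rw [hφ]; exact ih x hx p hp) hd
          rw [hφ, map_smul] at hz
          rw [pow_succ, Module.End.mul_apply]
          simpa using hz
      have hbr : Trig.br e (B t) (A t) = 0 := by
        obtain ⟨ℓ, n', E⟩ := hE b₀ hb₀
        refine E.br_eq_zero_of_bounded hα SA fun k p hp => ?_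
        by_contra h
        apply hp
        have := hiter k t ht p h
        rwa [Module.End.pow_apply] at this
      obtain ⟨ℓ, n', E⟩ := hE b₀ hb₀
      obtain ⟨q, hq⟩ := E.exists_aeval hα hbr
      exact ⟨R, hR, hspanB, q, hq, fun _ h => absurd hν h, fun h => absurd hcor h⟩
    · have hlev : ∀ n, (B t).coeff n ≠ 0 → ∃ ℓ n', REdge e (B t) ℓ n n' ∧ Trig.LevelLE ℓ (A t) 1 := by
        intro n hn
        by_cases hA : A t = 0
        · obtain ⟨ℓ, n', E⟩ := hE n hn
          exact ⟨ℓ, n', E, fun m hm => absurd (by rw [hA]; rfl) hm⟩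
        · exact exists_edge_level_le_one hα hA (fun p hp => H.outA' hU hcor ht hp) hE hν
            (fun ℓ n n' E k hk j => H.br_top hU hcor hRS ht E hk j) hn
      obtain ⟨κ, h, hκ⟩ := eq_smul_of_edges hα hα0 hβ0 hαs hβs ⟨b₀, hb₀⟩ hZ hlev
      exact ⟨R, hR, hspanB, _, aeval_C_mul_X_eq h, fun _ _ => ⟨κ, hκ, rfl⟩, fun h => absurd hcor h⟩
  · obtain ⟨hΩ, hH⟩ := hH hcor
    have hC : ∀ s ∈ Metric.ball t₀ ε, ∀ p, (B s).coeff p = 0 → (A s).coeff p ≠ 0 →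
        (Trig.br e (B s) (Trig.lap (B s))).coeff p = 0 → p 2 = 0 := by
      intro s hs p hp hp' hbr
      have := H.relB hU hs hp
      rw [hbr, mul_zero] at this
      have := (mul_eq_zero.1 this).resolve_right hp'
      exact (mul_eq_zero.1 (Complex.ofReal_eq_zero.1 this)).resolve_left hΩ
    have hall : ∀ s ∈ Metric.ball t₀ ε, ∃ (R : ℝ) (κ : ℂ), (∀ n, (B s).coeff n ≠ 0 → n ⬝ᵥ n = R) ∧
        (∀ n, (A s).coeff n = κ * (B s).coeff n) ∧ star κ = -κ := by
      intro s hs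
      refine exists_circle_of_coriolis he (H.planarA s hs) (H.planarB s hs) (H.zeroA s hs) (H.zeroB s hs)
        (H.symA s hs) (H.symB s hs) ?_ (fun p h h' => H.outA hU hs h h')
        (fun p h h' => H.outB hU hs h h') (hC s hs) hH
      obtain ⟨a, b, ha, hb, hab⟩ := hspanB
      exact ⟨a, b, (H.memB s hs a).2 ((H.memB t ht a).1 ha), (H.memB s hs b).2 ((H.memB t ht b).1 hb), hab⟩
    obtain ⟨R, κ, hR, hκ, hκs⟩ := hall t ht
    have hRpos : R ≠ 0 := by rw [← hR _ hb₀]; exact (dot_self_pos hb₀0).ne'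
    obtain ⟨n, hn, hn2⟩ : ∃ n, (B t).coeff n ≠ 0 ∧ n 2 ≠ 0 := by
      by_contra! hcon
      obtain ⟨a, b, ha, hb, hab⟩ := hspanB
      exact hab (hH a b (hβ a ha) (hβ b hb) (hcon a ha) (hcon b hb))
    have hn0 : n ≠ 0 := by rintro rfl; exact hn hβ0
    have hbr : Trig.br e (B t) (A t) = 0 := by rw [aeval_C_mul_X_eq hκ, Trig.br_aeval]
    have hAn := H.derivA t ht n hn0
    have hAn' := H.derivA t ht (-n) (neg_ne_zero.2 hn0)
    have hBn := H.derivB t ht n hn0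
    have hBn' := H.derivB t ht (-n) (neg_ne_zero.2 hn0)
    rw [hbr] at hAn hAn'
    rw [br_lap_eq_zero hR] at hBn hBn'
    -- Proportionality with a time dependent factor makes this 2 × 2 determinant vanish. Its
    -- derivative is a nonzero multiple of κ² + R, because the third coordinate changes sign from
    -- `n` to `-n`.
    have hz := hasDerivAt_eq_zero_of_eventually (hU.mem_nhds ht) (fun s hs => by
      obtain ⟨-, κ', -, h, -⟩ := hall s hs
      change (A s).coeff n * (B s).coeff (-n) - (A s).coeff (-n) * (B s).coeff n = 0
      rw [h n, h (-n)]; ring) ((hAn.mul hBn').sub (hAn'.mul hBn))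
    have hκ2 : κ ^ 2 = -(R : ℂ) := by
      have hb' := hsymB n hn
      rw [hκ n, hκ (-n)] at hz
      simp only [AddMonoidAlgebra.coeff_zero, Finsupp.zero_apply, Pi.neg_apply, neg_dotProduct,
        dotProduct_neg, neg_neg, hR n hn] at hz
      have hRc : (R : ℂ) ≠ 0 := Complex.ofReal_ne_zero.2 hRpos
      push_cast at hz
      field_simp at hz
      have hfac : (Ω : ℂ) * (n 2 : ℂ) * (B t).coeff n * (B t).coeff (-n) * (κ ^ 2 + R) = 0 := by
        linear_combination (-1 / 2 : ℂ) * hz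
      have hne : (Ω : ℂ) * (n 2 : ℂ) * (B t).coeff n * (B t).coeff (-n) ≠ 0 :=
        mul_ne_zero (mul_ne_zero (mul_ne_zero (Complex.ofReal_ne_zero.2 hΩ)
          (Complex.ofReal_ne_zero.2 hn2)) hn) hb'
      linear_combination (mul_eq_zero.1 hfac).resolve_left hne
    exact ⟨R, hR, hspanB, _, aeval_C_mul_X_eq hκ, fun h => absurd h hcor,
      fun _ => ⟨κ, hκs, hκ2, rfl⟩⟩

/-! ### From vector modes to normal component and stream function -/

theorem coriolis_mulVec (n : R3) (v : C3) :
    coriolis n *ᵥ v = ((n 2 / (n ⬝ᵥ n) : ℝ) : ℂ) • crossProduct (toC n) v := by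
  simp only [cross_apply]
  ext i
  fin_cases i <;>
    simp [coriolis, Matrix.mulVec, dotProduct, Fin.sum_univ_three, toC] <;> ring

/-- Both summands contribute equally after exchanging the two frequencies, and c a · b = c a · (a +
b) by incompressibility. -/
theorem interaction_eq {S : Finset R3} {c : R3 →₀ C3} (hS : c.support ⊆ S)
    (hdiv : ∀ n, c n ⬝ᵥ toC n = 0) (n : R3) : interaction S c n = (2 : ℂ) • nl c n := by
  classical
  have h0 : ∀ a, a ∉ S → c a = 0 := fun a ha => Finsupp.notMem_support_iff.1 fun h => ha (hS h)
  have key : ∑ a ∈ S, ∑ b ∈ S, (if a + b = n then (c a ⬝ᵥ toC b) • c b else 0) = nl c n := by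
    rw [nl]
    rw [Finset.sum_subset hS (fun a _ ha => by rw [Finsupp.notMem_support_iff.1 ha]; simp)]
    refine Finset.sum_congr rfl fun a _ => ?_
    rw [Finset.sum_eq_single (n - a)]
    · rw [if_pos (by abel), toC_sub, dotProduct_sub, hdiv, sub_zero]
    · intro b _ hb
      rw [if_neg]
      rintro rfl
      exact hb (by abel)
    · intro h
      rw [h0 _ h]; simp
  rw [interaction, Finset.sum_filter, Finset.sum_product]
  have : ∀ a b : R3, (if (a, b).1 + (a, b).2 = n then
      (c (a, b).1 ⬝ᵥ toC (a, b).2) • c (a, b).2 + (c (a, b).2 ⬝ᵥ toC (a, b).1) • c (a, b).1 else 0) =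
      (if a + b = n then (c a ⬝ᵥ toC b) • c b else 0) +
        (if b + a = n then (c b ⬝ᵥ toC a) • c a else 0) := by
    intro a b
    rw [add_comm b a]
    split_ifs <;> simp
  simp only [this, Finset.sum_add_distrib]
  rw [key, Finset.sum_comm, key, two_smul]

theorem proj_smul (n : R3) (r : ℂ) (v : C3) : proj n (r • v) = r • proj n v := by
  rw [proj, proj, dotProduct_smul, smul_sub, smul_eq_mul, mul_div_assoc, mul_smul]

theorem proj_eq_zero_iff {n : R3} (hn : n ≠ 0) {v : C3} :
    proj n v = 0 ↔ ∃ γ : ℂ, v = γ • toC n := by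
  constructor
  · exact fun h => ⟨_, sub_eq_zero.1 h⟩
  · rintro ⟨γ, rfl⟩
    have h0 : ((n ⬝ᵥ n : ℝ) : ℂ) ≠ 0 := Complex.ofReal_ne_zero.2 (dot_self_pos hn).ne'
    rw [proj_smul, proj, toC_dot, div_self h0, one_smul, sub_self, smul_zero]

theorem proj_dot {n w : R3} (h : n ⬝ᵥ w = 0) (v : C3) : proj n v ⬝ᵥ toC w = v ⬝ᵥ toC w := by
  rw [proj, sub_dotProduct, smul_dotProduct, toC_dot, h]
  simp

theorem hasDerivAt_dot {f : ℝ → C3} {f' : C3} {t : ℝ} (h : HasDerivAt f f' t) (w : C3) :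
    HasDerivAt (fun s => f s ⬝ᵥ w) (f' ⬝ᵥ w) t := by
  simp only [dotProduct]
  exact HasDerivAt.fun_sum fun i _ => ((hasDerivAt_pi.1 h) i).mul_const _

/-- The coefficient functions of the component along `e`. -/
def perpT (e : R3) (c : R3 →₀ C3) : Trig :=
  .ofCoeff (Finsupp.onFinset c.support (perpCoeff e c) fun a h => by
    rw [Finsupp.mem_support_iff]; intro h0; apply h; rw [perpCoeff, h0, zero_dotProduct])

/-- The stream function of the component in the plane orthogonal to `e`. -/
def parT (e : R3) (c : R3 →₀ C3) : Trig :=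
  .ofCoeff (Finsupp.onFinset c.support (parCoeff e c) fun a h => by
    rw [Finsupp.mem_support_iff]; intro h0; apply h; rw [parCoeff, h0, zero_dotProduct, zero_div])

theorem perpT_coeff (e : R3) (c : R3 →₀ C3) (n : R3) : (perpT e c).coeff n = c n ⬝ᵥ toC e := rfl

theorem parT_coeff (e : R3) (c : R3 →₀ C3) (n : R3) :
    (parT e c).coeff n = (c n ⬝ᵥ toC (crossProduct e n)) / ((n ⬝ᵥ n : ℝ) : ℂ) := rfl

theorem mem_support_of_perpT {e : R3} {c : R3 →₀ C3} {n : R3} (h : (perpT e c).coeff n ≠ 0) :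
    n ∈ c.support := by
  rw [Finsupp.mem_support_iff]; rintro h0; apply h; rw [perpT_coeff, h0, zero_dotProduct]

theorem mem_support_of_parT {e : R3} {c : R3 →₀ C3} {n : R3} (h : (parT e c).coeff n ≠ 0) :
    n ∈ c.support := by
  rw [Finsupp.mem_support_iff]; rintro h0; apply h; rw [parT_coeff, h0, zero_dotProduct, zero_div]

section Planar
variable {e : R3} {c : R3 →₀ C3} (he : e ⬝ᵥ e = 1) (hdiv : ∀ n, c n ⬝ᵥ toC n = 0)
  (hpl : ∀ n ∈ c.support, e ⬝ᵥ n = 0)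

include hpl in
theorem perpT_planar : Trig.Planar e (perpT e c) := fun _ hn => hpl _ (mem_support_of_perpT hn)

include hpl in
theorem parT_planar : Trig.Planar e (parT e c) := fun _ hn => hpl _ (mem_support_of_parT hn)

include he hdiv hpl in
theorem mode_eq (n : R3) (hn : n ≠ 0) : c n = (perpT e c).coeff n • toC e +
    (parT e c).coeff n • toC (crossProduct e n) := by
  by_cases h : n ∈ c.support
  · exact mode_expand he (hpl n h) hn (hdiv n)
  · rw [perpT_coeff, parT_coeff, Finsupp.notMem_support_iff.1 h]; simp

theorem mem_support_iff_perpT_parT (he : e ⬝ᵥ e = 1) (hdiv : ∀ n, c n ⬝ᵥ toC n = 0)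
    (hpl : ∀ n ∈ c.support, e ⬝ᵥ n = 0) (hc0 : c 0 = 0) (n : R3) :
    n ∈ c.support ↔ (perpT e c).coeff n ≠ 0 ∨ (parT e c).coeff n ≠ 0 := by
  constructor
  · intro h
    by_contra! hcon
    rw [Finsupp.mem_support_iff] at h
    refine h ?_
    by_cases hn : n = 0
    · rw [hn, hc0]
    · rw [mode_eq he hdiv hpl n hn, hcon.1, hcon.2]; simp
  · rintro (h | h)
    · exact mem_support_of_perpT h
    · exact mem_support_of_parT h

/-- For the second component, (p - a) · p = (|p|² + |p - a|² - |a|²) / 2. The |p|² term is a bracket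
of the stream function with itself, and the remaining two terms agree by antisymmetry. -/
theorem nl_eq_br (he : e ⬝ᵥ e = 1) (hdiv : ∀ n, c n ⬝ᵥ toC n = 0)
    (hpl : ∀ n ∈ c.support, e ⬝ᵥ n = 0) (hc0 : c 0 = 0) {p : R3} (hp : e ⬝ᵥ p = 0) :
    nl c p ⬝ᵥ toC e = (Trig.br e (parT e c) (perpT e c)).coeff p ∧
      nl c p ⬝ᵥ toC (crossProduct e p) =
        (Trig.br e (parT e c) (Trig.lap (parT e c))).coeff p := by
  obtain ⟨h1, h2⟩ := nl_planar he hp hc0 hdiv (fun a ha _ => hpl a ha)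
  have hsub : (parT e c).coeff.support ⊆ c.support := fun a ha =>
    mem_support_of_parT (Finsupp.mem_support_iff.1 ha)
  have hsub' : (Trig.lap (parT e c)).coeff.support ⊆ c.support := fun a ha =>
    hsub (Trig.weight_support _ _ ha)
  refine ⟨by rw [h1, Trig.br_coeff_of_subset _ _ hsub]; rfl, ?_⟩
  have e1 := Trig.br_coeff_of_subset e (parT e c) hsub p
  have e2 := Trig.br_coeff_of_subset e (Trig.lap (parT e c)) hsub p
  have e3 := Trig.br_coeff_of_subset e (parT e c) hsub' p
  rw [Trig.br_self] at e1
  rw [Trig.br_swap] at e3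
  have e4 : nl c p ⬝ᵥ toC (crossProduct e p) = (1 / 2 : ℂ) * (((p ⬝ᵥ p : ℝ) : ℂ) *
      (∑ a ∈ c.support, (parT e c).coeff a * (parT e c).coeff (p - a) * (det e a p : ℂ)) +
      (∑ a ∈ c.support, (parT e c).coeff a * (Trig.lap (parT e c)).coeff (p - a) * (det e a p : ℂ)) -
      ∑ a ∈ c.support, (Trig.lap (parT e c)).coeff a * (parT e c).coeff (p - a) * (det e a p : ℂ)) := by
    rw [h2, Finset.mul_sum, ← Finset.sum_add_distrib, ← Finset.sum_sub_distrib, Finset.mul_sum]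
    refine Finset.sum_congr rfl fun a _ => ?_
    have : (p - a) ⬝ᵥ p = (p ⬝ᵥ p + (p - a) ⬝ᵥ (p - a) - a ⬝ᵥ a) / 2 := by
      simp only [dotProduct_sub, sub_dotProduct, dotProduct_comm a p]; ring
    rw [this, Trig.weight_coeff, Trig.weight_coeff]
    change (parT e c).coeff a * (parT e c).coeff (p - a) * _ * _ = _
    push_cast
    ring
  rw [e4, ← e1, ← e2, ← e3]
  simp only [AddMonoidAlgebra.coeff_zero, Finsupp.zero_apply, AddMonoidAlgebra.coeff_neg,
    Finsupp.neg_apply]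
  ring

end Planar

/-- A vector orthogonal to `e` and `e × p` is parallel to `p`. -/
theorem exists_smul_of_dot_eq_zero {e p : R3} {v : C3} (he : e ⬝ᵥ e = 1) (hp : e ⬝ᵥ p = 0)
    (hp0 : p ≠ 0) (h1 : v ⬝ᵥ toC e = 0) (h2 : v ⬝ᵥ toC (crossProduct e p) = 0) :
    ∃ γ : ℂ, v = γ • toC p := by
  rw [← proj_eq_zero_iff hp0]
  have hpp : ((p ⬝ᵥ p : ℝ) : ℂ) ≠ 0 := Complex.ofReal_ne_zero.2 (dot_self_pos hp0).ne'
  have hd : proj p v ⬝ᵥ toC p = 0 := by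
    rw [proj, sub_dotProduct, smul_dotProduct, toC_dot, smul_eq_mul, div_mul_cancel₀ _ hpp,
      dotProduct_comm, sub_self]
  rw [mode_expand he hp hp0 hd, proj_dot (by rw [dotProduct_comm, hp]), h1,
    proj_dot (by simp), h2]
  simp

/-- The field with modes `c t` solves the projected system in a neighbourhood of `t` (at nonzero
frequencies). -/
def ModeODE (ν Ω : ℝ) (c : ℝ → R3 →₀ C3) (t : ℝ) : Prop :=
  ∀ n, n ≠ 0 → HasDerivAt (fun s => c s n) (-((ν * (n ⬝ᵥ n)) • c t n) -
    Ω • (coriolis n *ᵥ c t n) - Complex.I • proj n (nl (c t) n)) t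

theorem IsField.div' {v : R3 → R3} {c : R3 →₀ C3} (h : IsField v c) (n : R3) : c n ⬝ᵥ toC n = 0 := by
  rw [dotProduct_comm]; exact h.divFree n

/-- At frequencies outside `S` and `S + S`, where nothing is required, both the mode and the
interaction vanish. -/
theorem Solves.modeODE {ν Ω : ℝ} {I : Set ℝ} (hI : IsOpen I) {u : ℝ → R3 → R3} {S : Finset R3}
    {c : ℝ → R3 →₀ C3} (hu : IsFieldOn I u S c) (h : Solves ν Ω I S c) {t : ℝ} (ht : t ∈ I) :
    ModeODE ν Ω c t := by
  intro n hn
  have hint := interaction_eq (hu.support_subset t ht) (hu.field t ht).div' n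
  by_cases hS : n ∈ S ∨ (n ≠ 0 ∧ ∃ n₁ ∈ S, ∃ n₂ ∈ S, n₁ + n₂ = n)
  · obtain ⟨-, hd, heq⟩ := h n hS t ht
    rw [hint, proj_smul, smul_smul, div_mul_cancel₀ _ two_ne_zero] at heq
    refine hd.hasDerivAt.congr_deriv ?_
    rw [← sub_eq_zero, ← heq]
    abel
  · push Not at hS
    have hz : ∀ s ∈ I, c s n = 0 := fun s hs => Finsupp.notMem_support_iff.1 fun h =>
      hS.1 (hu.support_subset s hs h)
    have hnl : nl (c t) n = 0 := by
      have : interaction S (c t) n = 0 := by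
        rw [interaction]
        refine Finset.sum_eq_zero fun p hp => ?_
        rw [Finset.mem_filter, Finset.mem_product] at hp
        exact absurd hp.2 (hS.2 hn p.1 hp.1.1 p.2 hp.1.2)
      rw [hint] at this
      exact (smul_eq_zero.1 this).resolve_left two_ne_zero
    rw [hz t ht, hnl]
    have : proj n 0 = 0 := by simp [proj]
    rw [this, Matrix.mulVec_zero, smul_zero, smul_zero, smul_zero, neg_zero, sub_zero, sub_zero]
    exact (hasDerivAt_const t (0 : C3)).congr_of_eventuallyEq
      (Filter.eventually_of_mem (hI.mem_nhds ht) hz)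

theorem ModeODE.perp {ν Ω : ℝ} {c : ℝ → R3 →₀ C3} {t : ℝ} (h : ModeODE ν Ω c t) {e : R3}
    (he : e ⬝ᵥ e = 1) (hc0 : c t 0 = 0) (hdiv : ∀ n, c t n ⬝ᵥ toC n = 0)
    (hpl : ∀ n ∈ (c t).support, e ⬝ᵥ n = 0) {n : R3} (hn : n ≠ 0) (hen : e ⬝ᵥ n = 0) :
    HasDerivAt (fun s => (perpT e (c s)).coeff n)
      (-(ν * (n ⬝ᵥ n) : ℝ) * (perpT e (c t)).coeff n - (Ω * n 2 : ℝ) * (parT e (c t)).coeff n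
        - Complex.I * (Trig.br e (parT e (c t)) (perpT e (c t))).coeff n) t := by
  refine (hasDerivAt_dot (h n hn) (toC e)).congr_deriv ?_
  have hnn : ((n ⬝ᵥ n : ℝ) : ℂ) ≠ 0 := Complex.ofReal_ne_zero.2 (dot_self_pos hn).ne'
  have hne : n ⬝ᵥ e = 0 := by rw [dotProduct_comm, hen]
  have hcr : crossProduct (toC n) (c t n) ⬝ᵥ toC e = c t n ⬝ᵥ toC (crossProduct e n) := by
    rw [toC_cross, dotProduct_comm, triple_product_permutation, triple_product_permutation]
  rw [sub_dotProduct, sub_dotProduct, neg_dotProduct, smul_dotProduct, smul_dotProduct Ω,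
    smul_dotProduct, coriolis_mulVec, smul_dotProduct, hcr, proj_dot hne,
    (nl_eq_br he hdiv hpl hc0 hen).1, perpT_coeff, parT_coeff]
  simp only [Complex.real_smul, smul_eq_mul]
  push_cast
  field_simp

theorem ModeODE.par {ν Ω : ℝ} {c : ℝ → R3 →₀ C3} {t : ℝ} (h : ModeODE ν Ω c t) {e : R3}
    (he : e ⬝ᵥ e = 1) (hc0 : c t 0 = 0) (hdiv : ∀ n, c t n ⬝ᵥ toC n = 0)
    (hpl : ∀ n ∈ (c t).support, e ⬝ᵥ n = 0) {n : R3} (hn : n ≠ 0) (hen : e ⬝ᵥ n = 0) :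
    HasDerivAt (fun s => (parT e (c s)).coeff n)
      (-(ν * (n ⬝ᵥ n) : ℝ) * (parT e (c t)).coeff n +
        (Ω * n 2 / (n ⬝ᵥ n) : ℝ) * (perpT e (c t)).coeff n
        - Complex.I / ((n ⬝ᵥ n : ℝ) : ℂ) *
          (Trig.br e (parT e (c t)) (Trig.lap (parT e (c t)))).coeff n) t := by
  refine ((hasDerivAt_dot (h n hn) (toC (crossProduct e n))).div_const _).congr_deriv ?_
  have hnn : ((n ⬝ᵥ n : ℝ) : ℂ) ≠ 0 := Complex.ofReal_ne_zero.2 (dot_self_pos hn).ne'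
  have hcr : crossProduct (toC n) (c t n) ⬝ᵥ toC (crossProduct e n) =
      -((n ⬝ᵥ n : ℝ) : ℂ) * (c t n ⬝ᵥ toC e) := by
    rw [toC_cross, cross_dot_cross, hdiv, toC_dot, toC_dot, dotProduct_comm n e, hen]
    push_cast; ring
  rw [sub_dotProduct, sub_dotProduct, neg_dotProduct, smul_dotProduct, smul_dotProduct Ω,
    smul_dotProduct, coriolis_mulVec, smul_dotProduct, hcr, proj_dot (by simp),
    (nl_eq_br he hdiv hpl hc0 hen).2, perpT_coeff, parT_coeff]
  simp only [Complex.real_smul, smul_eq_mul]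
  push_cast
  field_simp
  ring

theorem star_dot_toC (v : C3) (a : R3) : star (v ⬝ᵥ toC a) = star v ⬝ᵥ toC a := by
  simp [dotProduct, toC]

theorem perpT_neg {c : R3 →₀ C3} (hconj : ∀ n, c (-n) = star (c n)) (e n : R3) :
    (perpT e c).coeff (-n) = star ((perpT e c).coeff n) := by
  rw [perpT_coeff, perpT_coeff, hconj, star_dot_toC]

theorem parT_neg {c : R3 →₀ C3} (hconj : ∀ n, c (-n) = star (c n)) (e n : R3) :
    (parT e c).coeff (-n) = -star ((parT e c).coeff n) := by
  rw [parT_coeff, parT_coeff, hconj, star_div₀, star_dot_toC, map_neg, toC_neg, neg_dotProduct,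
    dotProduct_neg, dotProduct_neg, neg_neg, neg_div]
  simp

/-- Treating one function at a time: if it is nonzero somewhere on the current open set, the set is
shrunk to where it is nonzero; otherwise it vanishes there. -/
theorem exists_constant_pattern {ι E : Type*} [TopologicalSpace E] [T1Space E] [Zero E] (F : Finset ι)
    (f : ι → ℝ → E) {U : Set ℝ} (hU : IsOpen U) (hne : U.Nonempty)
    (hf : ∀ i ∈ F, ContinuousOn (f i) U) :
    ∃ V ⊆ U, IsOpen V ∧ V.Nonempty ∧ ∀ i ∈ F, (∀ t ∈ V, f i t = 0) ∨ (∀ t ∈ V, f i t ≠ 0) := by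
  classical
  induction F using Finset.induction_on with
  | empty => exact ⟨U, subset_rfl, hU, hne, by simp⟩
  | insert i F _ ih =>
    obtain ⟨V, hVU, hV, hVne, hpat⟩ := ih fun j hj => hf j (Finset.mem_insert_of_mem hj)
    by_cases h : ∃ t ∈ V, f i t ≠ 0
    · obtain ⟨t, ht, hti⟩ := h
      refine ⟨V ∩ f i ⁻¹' {0}ᶜ, Set.inter_subset_left.trans hVU,
        ((hf i (Finset.mem_insert_self _ _)).mono hVU).isOpen_inter_preimage hV isOpen_compl_singleton,
        ⟨t, ht, hti⟩, fun j hj => ?_⟩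
      rcases Finset.mem_insert.1 hj with rfl | hj
      · exact Or.inr fun s hs => hs.2
      · exact (hpat j hj).imp (fun h s hs => h s hs.1) fun h s hs => h s hs.1
    · push Not at h
      refine ⟨V, hVU, hV, hVne, fun j hj => ?_⟩
      rcases Finset.mem_insert.1 hj with rfl | hj
      · exact Or.inl h
      · exact hpat j hj

/-! ### The classification for coefficients -/

/-- The three types of solutions, in terms of Fourier coefficients. -/
def CoeffAdmissible (ν Ω : ℝ) (c : R3 →₀ C3) : Prop :=
  TypeI c ∨
  ((∃ a ∈ c.support, ∃ b ∈ c.support, crossProduct a b ≠ 0) ∧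
    ∃ e : R3, e ⬝ᵥ e = 1 ∧ (∀ n ∈ c.support, e ⬝ᵥ n = 0) ∧
      PlanarAdmissible ν Ω e (perpT e c) (parT e c)) ∨
  ((∃ a ∈ c.support, ∃ b ∈ c.support, crossProduct a b ≠ 0) ∧
    (∀ e : R3, e ≠ 0 → ∃ x ∈ c.support, x ⬝ᵥ e ≠ 0) ∧ ∃ μ : ℝ, μ ≠ 0 ∧ ∀ n, HelicalAt μ c n)

/-- Frequencies that interact are parallel, so every transport factor c a · p vanishes by
incompressibility. -/
theorem TypeI.nl_eq_zero {c : R3 →₀ C3} (hc0 : c 0 = 0) (hdiv : ∀ n, c n ⬝ᵥ toC n = 0) (h : TypeI c)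
    (p : R3) : nl c p = 0 := by
  obtain ⟨L, hL, hmem⟩ := h
  obtain ⟨v, -, hv⟩ := finrank_eq_one_iff'.1 hL
  rw [nl]
  refine Finset.sum_eq_zero fun a ha => ?_
  by_cases hb : p - a ∈ c.support
  · obtain ⟨s, hs⟩ := hv ⟨a, hmem a ha⟩
    obtain ⟨r, hr⟩ := hv ⟨p - a, hmem _ hb⟩
    have hs' : s • (v : R3) = a := congrArg Subtype.val hs
    have hr' : r • (v : R3) = p - a := congrArg Subtype.val hr
    have hs0 : s ≠ 0 := by
      rintro rfl
      rw [zero_smul] at hs'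
      rw [← hs', Finsupp.mem_support_iff] at ha
      exact ha hc0
    have hp : p = ((s + r) / s) • a := by
      rw [← hs', smul_smul, div_mul_cancel₀ _ hs0, add_smul, hs', hr']; abel
    conv_lhs => rw [hp, toC_smul, dotProduct_smul, hdiv, smul_zero, zero_smul]
  · rw [Finsupp.notMem_support_iff.1 hb, smul_zero]

theorem CoeffAdmissible.nl_parallel {ν Ω : ℝ} {c : R3 →₀ C3} (hc0 : c 0 = 0)
    (hdiv : ∀ n, c n ⬝ᵥ toC n = 0) (h : CoeffAdmissible ν Ω c) {p : R3} (hp : p ≠ 0) :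
    ∃ γ : ℂ, nl c p = γ • toC p := by
  rcases h with h | ⟨-, e, he, hpl, h⟩ | ⟨-, -, μ, -, h⟩
  · exact ⟨0, by rw [h.nl_eq_zero hc0 hdiv, zero_smul]⟩
  · by_cases hep : e ⬝ᵥ p = 0
    · obtain ⟨h1, h2⟩ := h.br_eq_zero
      obtain ⟨h3, h4⟩ := nl_eq_br he hdiv hpl hc0 hep
      exact exists_smul_of_dot_eq_zero he hep hp (by rw [h3, h1]; rfl) (by rw [h4, h2]; rfl)
    · refine ⟨0, ?_⟩
      rw [zero_smul, nl]
      refine Finset.sum_eq_zero fun a ha => ?_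
      by_cases hb : p - a ∈ c.support
      · have h1 := hpl a ha
        have h2 := hpl _ hb
        rw [dotProduct_sub, h1, sub_zero] at h2
        exact absurd h2 hep
      · rw [Finsupp.notMem_support_iff.1 hb, smul_zero]
  · exact nl_of_helical hdiv h p

theorem typeI_of_cross_eq_zero {c : R3 →₀ C3} (hc0 : c 0 = 0)
    (h : ∀ a ∈ c.support, ∀ b ∈ c.support, crossProduct a b = 0) : TypeI c := by
  by_cases hne : c.support.Nonempty
  · obtain ⟨a, ha⟩ := hne
    have ha0 : a ≠ 0 := by
      rintro rfl; rw [Finsupp.mem_support_iff] at ha; exact ha hc0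
    refine ⟨Submodule.span ℝ {a}, finrank_span_singleton ha0, fun b hb => ?_⟩
    have h1 := parallel_of_cross_eq_zero (h a ha b hb)
    rw [Submodule.mem_span_singleton]
    refine ⟨(a ⬝ᵥ a)⁻¹ * (a ⬝ᵥ b), ?_⟩
    rw [mul_smul, ← h1, smul_smul, inv_mul_cancel₀ (dot_self_pos ha0).ne', one_smul]
  · have h1 : (Pi.single 0 1 : R3) ≠ 0 := by
      intro h; have := congrFun h 0; simp at this
    refine ⟨Submodule.span ℝ {Pi.single 0 1}, finrank_span_singleton h1, fun b hb => ?_⟩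
    exact absurd ⟨b, hb⟩ hne

/-- In every time interval a solution is of one of the three types at some time. -/
theorem exists_coeffAdmissible {ν Ω : ℝ} {U : Set ℝ} (hU : IsOpen U) (hne : U.Nonempty) {S : Finset R3}
    {c : ℝ → R3 →₀ C3} (hc0 : ∀ t ∈ U, c t 0 = 0) (hconj : ∀ t ∈ U, ∀ n, c t (-n) = star (c t n))
    (hdiv : ∀ t ∈ U, ∀ n, c t n ⬝ᵥ toC n = 0) (hS : ∀ t ∈ U, (c t).support ⊆ S)
    (hode : ∀ t ∈ U, ModeODE ν Ω c t) : ∃ t ∈ U, CoeffAdmissible ν Ω (c t) := by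
  classical
  have hcont : ∀ n, ContinuousOn (fun t => c t n) U := by
    intro n
    by_cases hn : n = 0
    · rw [hn]
      exact (continuousOn_const (c := (0 : C3))).congr hc0
    · exact fun t ht => (hode t ht n hn).continuousAt.continuousWithinAt
  -- On `V` the Fourier support no longer changes. In the planar case the set is shrunk twice more,
  -- for the supports of the two scalar components.
  obtain ⟨V, hVU, hV, ⟨t₁, ht₁⟩, hpat⟩ := exists_constant_pattern S (fun n t => c t n) hU hne
    fun n _ => hcont n
  have hconst : ∀ t ∈ V, ∀ s ∈ V, ∀ n, n ∈ (c t).support → n ∈ (c s).support := by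
    intro t ht s hs n hn
    rw [Finsupp.mem_support_iff] at hn ⊢
    rcases hpat n (hS t (hVU ht) (Finsupp.mem_support_iff.2 hn)) with h | h
    · exact absurd (h t ht) hn
    · exact h s hs
  by_cases hspan : ∃ a ∈ (c t₁).support, ∃ b ∈ (c t₁).support, crossProduct a b ≠ 0
  swap
  · push Not at hspan
    exact ⟨t₁, hVU ht₁, Or.inl (typeI_of_cross_eq_zero (hc0 t₁ (hVU ht₁)) hspan)⟩
  obtain ⟨w, hw, z, hz, hwz⟩ := hspan
  obtain ⟨e, he, hew, hez, hcr, hdet⟩ := exists_unit_normal hwz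
  by_cases hpl : ∀ n ∈ (c t₁).support, e ⬝ᵥ n = 0
  · have hplV : ∀ t ∈ V, ∀ n ∈ (c t).support, e ⬝ᵥ n = 0 := fun t ht n hn =>
      hpl n (hconst t ht t₁ ht₁ n hn)
    obtain ⟨W, hWV, hW, hWne, hpatW⟩ := exists_constant_pattern S
      (fun n t => (perpT e (c t)).coeff n) hV ⟨t₁, ht₁⟩ fun n _ => by
        have : Continuous fun v : C3 => v ⬝ᵥ toC e := by simp only [dotProduct]; fun_prop
        exact this.comp_continuousOn ((hcont n).mono hVU)
    obtain ⟨X, hXW, hX, ⟨t₀, ht₀⟩, hpatX⟩ := exists_constant_pattern S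
      (fun n t => (parT e (c t)).coeff n) hW hWne fun n _ => by
        have : Continuous fun v : C3 => (v ⬝ᵥ toC (crossProduct e n)) / ((n ⬝ᵥ n : ℝ) : ℂ) := by
          simp only [dotProduct]; fun_prop
        exact this.comp_continuousOn ((hcont n).mono (hWV.trans hVU))
    obtain ⟨ε, hε, hball⟩ := Metric.isOpen_iff.1 hX t₀ ht₀
    have hBV : Metric.ball t₀ ε ⊆ V := hball.trans (hXW.trans hWV)
    have hBU : Metric.ball t₀ ε ⊆ U := hBV.trans hVU
    have ht₀B := Metric.mem_ball_self hε (x := t₀)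
    have H : PlanarEvolution ν Ω e (Metric.ball t₀ ε) (fun t => perpT e (c t)) (fun t => parT e (c t))
        (perpT e (c t₀)).coeff.support (parT e (c t₀)).coeff.support :=
      { unit := he
        planarA := fun t ht => perpT_planar (hplV t (hBV ht))
        planarB := fun t ht => parT_planar (hplV t (hBV ht))
        zeroA := fun t ht => by rw [perpT_coeff, hc0 t (hBU ht), zero_dotProduct]
        zeroB := fun t ht => by rw [parT_coeff, hc0 t (hBU ht), zero_dotProduct, zero_div]
        symA := fun t ht => perpT_neg (hconj t (hBU ht)) e
        symB := fun t ht => parT_neg (hconj t (hBU ht)) e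
        memA := fun t ht n => by
          rw [Finsupp.mem_support_iff]
          by_cases hn : n ∈ S
          · rcases hpatW n hn with h | h
            · simp [h t (hXW (hball ht)), h t₀ (hXW ht₀)]
            · simp [h t (hXW (hball ht)), h t₀ (hXW ht₀)]
          · have h0 : ∀ s ∈ Metric.ball t₀ ε, (perpT e (c s)).coeff n = 0 := fun s hs => by
              by_contra h
              exact hn (hS s (hBU hs) (mem_support_of_perpT h))
            simp [h0 t ht, h0 t₀ ht₀B]
        memB := fun t ht n => by
          rw [Finsupp.mem_support_iff]
          by_cases hn : n ∈ S
          · rcases hpatX n hn with h | h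
            · simp [h t (hball ht), h t₀ ht₀]
            · simp [h t (hball ht), h t₀ ht₀]
          · have h0 : ∀ s ∈ Metric.ball t₀ ε, (parT e (c s)).coeff n = 0 := fun s hs => by
              by_contra h
              exact hn (hS s (hBU hs) (mem_support_of_parT h))
            simp [h0 t ht, h0 t₀ ht₀B]
        derivA := fun t ht n hn => by
          by_cases hen : e ⬝ᵥ n = 0
          · exact (hode t (hBU ht)).perp he (hc0 t (hBU ht)) (hdiv t (hBU ht)) (hplV t (hBV ht)) hn hen
          · have hA := fun s (hs : s ∈ Metric.ball t₀ ε) =>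
              not_not.1 (mt (perpT_planar (hplV s (hBV hs)) n) hen)
            have hB := fun s (hs : s ∈ Metric.ball t₀ ε) =>
              not_not.1 (mt (parT_planar (hplV s (hBV hs)) n) hen)
            rw [hA t ht, hB t ht, Trig.Planar.br_eq_zero (parT_planar (hplV t (hBV ht)))
              (perpT_planar (hplV t (hBV ht))) hen, mul_zero, mul_zero, mul_zero, sub_zero, sub_zero]
            exact (hasDerivAt_const t (0 : ℂ)).congr_of_eventuallyEq
              (Filter.eventually_of_mem (Metric.isOpen_ball.mem_nhds ht) hA)
        derivB := fun t ht n hn => by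
          by_cases hen : e ⬝ᵥ n = 0
          · exact (hode t (hBU ht)).par he (hc0 t (hBU ht)) (hdiv t (hBU ht)) (hplV t (hBV ht)) hn hen
          · have hA := fun s (hs : s ∈ Metric.ball t₀ ε) =>
              not_not.1 (mt (perpT_planar (hplV s (hBV hs)) n) hen)
            have hB := fun s (hs : s ∈ Metric.ball t₀ ε) =>
              not_not.1 (mt (parT_planar (hplV s (hBV hs)) n) hen)
            have hlap : Trig.Planar e (Trig.lap (parT e (c t))) := fun m hm => by
              rw [Trig.weight_coeff] at hm
              exact parT_planar (hplV t (hBV ht)) m (right_ne_zero_of_mul hm)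
            rw [hA t ht, hB t ht, Trig.Planar.br_eq_zero (parT_planar (hplV t (hBV ht)))
              hlap hen, mul_zero, mul_zero, mul_zero, add_zero, sub_zero]
            exact (hasDerivAt_const t (0 : ℂ)).congr_of_eventuallyEq
              (Filter.eventually_of_mem (Metric.isOpen_ball.mem_nhds ht) hB) }
    have hw0 := hconst t₁ ht₁ t₀ (hBV ht₀B) w hw
    have hz0 := hconst t₁ ht₁ t₀ (hBV ht₀B) z hz
    have hmem := mem_support_iff_perpT_parT he (hdiv t₀ (hBU ht₀B)) (hplV t₀ (hBV ht₀B))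
      (hc0 t₀ (hBU ht₀B))
    refine ⟨t₀, hBU ht₀B, Or.inr (Or.inl ⟨⟨w, hw0, z, hz0, hwz⟩, e, he, hplV t₀ (hBV ht₀B),
      H.admissible ht₀B ⟨w, z, ?_, ?_, hdet.ne'⟩⟩)⟩
    · simpa only [Finsupp.mem_support_iff] using (hmem w).1 hw0
    · simpa only [Finsupp.mem_support_iff] using (hmem z).1 hz0
  · push Not at hpl
    obtain ⟨x, hx, hex⟩ := hpl
    -- A frequency outside the constant support has zero derivative, so the projected interaction
    -- vanishes there.
    have hcl : ClosedModes (c t₁) := by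
      intro p hp hps
      rw [← proj_eq_zero_iff hp]
      have hz : ∀ s ∈ V, c s p = 0 := fun s hs => Finsupp.notMem_support_iff.1 fun h =>
        hps (hconst s hs t₁ ht₁ p h)
      have h1 := (hode t₁ (hVU ht₁) p hp).unique
        ((hasDerivAt_const t₁ (0 : C3)).congr_of_eventuallyEq
          (Filter.eventually_of_mem (hV.mem_nhds ht₁) hz))
      rw [hz t₁ ht₁, Matrix.mulVec_zero, smul_zero, smul_zero, neg_zero, sub_zero, zero_sub,
        neg_eq_zero] at h1
      exact (smul_eq_zero.1 h1).resolve_left Complex.I_ne_zero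
    have hspan3 : ∀ e' : R3, e' ≠ 0 → ∃ x ∈ (c t₁).support, x ⬝ᵥ e' ≠ 0 := by
      intro e' he'
      by_contra! hcon
      have h1 : crossProduct (crossProduct w z) e' = 0 := by
        rw [cross_cross_eq_smul_sub_smul, hcon w hw, hcon z hz, zero_smul, zero_smul, sub_zero]
      rw [hcr, map_smul, LinearMap.smul_apply] at h1
      have h2 := parallel_of_cross_eq_zero ((smul_eq_zero.1 h1).resolve_left hdet.ne')
      have h3 := hcon x hx
      rw [he, one_smul] at h2
      rw [h2, dotProduct_smul, smul_eq_mul, dotProduct_comm x e] at h3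
      rcases mul_eq_zero.1 h3 with h4 | h4
      · rw [h4, zero_smul] at h2; exact he' h2
      · exact hex h4
    refine ⟨t₁, hVU ht₁, Or.inr (Or.inr ⟨⟨w, hw, z, hz, hwz⟩, hspan3, ?_⟩)⟩
    exact helical_of_closed (hc0 t₁ (hVU ht₁)) (hconj t₁ (hVU ht₁)) (hdiv t₁ (hVU ht₁)) hcl
      ⟨w, hw, z, hz, hwz⟩ hspan3

theorem Solves.exists_coeffAdmissible {ν Ω : ℝ} {I : Set ℝ} (hI : IsOpen I) {u : ℝ → R3 → R3}
    {S : Finset R3} {c : ℝ → R3 →₀ C3} (hu : IsFieldOn I u S c) (h : Solves ν Ω I S c) {U : Set ℝ}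
    (hU : IsOpen U) (hUI : U ⊆ I) (hne : U.Nonempty) : ∃ t ∈ U, CoeffAdmissible ν Ω (c t) :=
  FiniteMode.exists_coeffAdmissible hU hne (fun t ht => (hu.field t (hUI ht)).meanZero)
    (fun t ht => (hu.field t (hUI ht)).conj) (fun t ht => (hu.field t (hUI ht)).div')
    (fun t ht => hu.support_subset t (hUI ht)) (fun _ ht => h.modeODE hI hu (hUI ht))

/-- If the projected interaction were nonzero at some time, it would be so on an open set of times
by continuity. That set contains an admissible time, at which the interaction is a gradient. -/
theorem Solves.evolvesLinearly {ν Ω : ℝ} {I : Set ℝ} (hI : IsOpen I) {u : ℝ → R3 → R3}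
    {S : Finset R3} {c : ℝ → R3 →₀ C3} (hu : IsFieldOn I u S c) (h : Solves ν Ω I S c) :
    EvolvesLinearly ν Ω I S c := by
  intro n hn t ht
  obtain ⟨-, hd, heq⟩ := h n (Or.inl hn) t ht
  refine ⟨hd, ?_⟩
  have hn0 : n ≠ 0 := by
    rintro rfl
    obtain ⟨s, hs, hne⟩ := hu.ne_zero 0 hn
    exact hne (hu.field s hs).meanZero
  have hz : proj n (interaction S (c t) n) = 0 := by
    by_contra hne
    have hcont : ContinuousOn (fun s => proj n (interaction S (c s) n)) I := by
      have hc : ∀ m ∈ S, ContinuousOn (fun s => c s m) I := fun m hm s hs =>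
        (h m (Or.inl hm) s hs).2.1.continuousAt.continuousWithinAt
      have hi : ContinuousOn (fun s => interaction S (c s) n) I := by
        simp only [interaction]
        refine continuousOn_finsetSum _ fun p hp => ?_
        rw [Finset.mem_filter, Finset.mem_product] at hp
        have hd : ∀ w : C3, Continuous fun v : C3 => v ⬝ᵥ w := fun w => by
          simp only [dotProduct]; fun_prop
        exact (((hd _).comp_continuousOn (hc _ hp.1.1)).smul (hc _ hp.1.2)).add
          (((hd _).comp_continuousOn (hc _ hp.1.2)).smul (hc _ hp.1.1))
      have hp : Continuous (proj n) := by
        unfold proj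
        simp only [dotProduct]
        fun_prop
      exact hp.comp_continuousOn hi
    obtain ⟨s, hs, hadm⟩ := h.exists_coeffAdmissible hI hu
      (hcont.isOpen_inter_preimage hI isOpen_compl_singleton) Set.inter_subset_left ⟨t, ht, hne⟩
    apply hs.2
    obtain ⟨γ, hγ⟩ := hadm.nl_parallel (hu.field s hs.1).meanZero (hu.field s hs.1).div' hn0
    change proj n (interaction S (c s) n) = 0
    rw [interaction_eq (hu.support_subset s hs.1) (hu.field s hs.1).div', proj_smul,
      (proj_eq_zero_iff hn0).2 ⟨γ, hγ⟩, smul_zero]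
  rwa [hz, smul_zero, add_zero] at heq

/-! ### Persistence of the types under the linear flow -/

theorem eq_exp_smul {E : Type*} [NormedAddCommGroup E] [NormedSpace ℂ E] {I : Set ℝ} (hIo : IsOpen I)
    (hIc : I.OrdConnected) {y : ℝ → E} {l : ℂ} (h : ∀ t ∈ I, HasDerivAt y (l • y t) t) {t₀ t : ℝ}
    (ht₀ : t₀ ∈ I) (ht : t ∈ I) : y t = Complex.exp (l * (t - t₀ : ℝ)) • y t₀ := by
  have hd : ∀ s ∈ I, HasDerivAt (fun s : ℝ => Complex.exp (-l * (s - t₀ : ℝ)) • y s) 0 s := by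
    intro s hs
    have h1 : HasDerivAt (fun s : ℝ => Complex.exp (-l * (s - t₀ : ℝ)))
        (Complex.exp (-l * (s - t₀ : ℝ)) * -l) s := by
      have h2 : HasDerivAt (fun s : ℝ => -l * ((s - t₀ : ℝ) : ℂ)) (-l) s := by
        have := (((hasDerivAt_id s).sub_const t₀).ofReal_comp).const_mul (-l)
        simpa using this
      exact h2.cexp
    refine (h1.smul (h s hs)).congr_deriv ?_
    rw [smul_smul, ← add_smul]
    simp
  have hc := hIc.convex.is_const_of_fderivWithin_eq_zero (𝕜 := ℝ)
    (fun x hx => (hd x hx).hasDerivWithinAt.differentiableWithinAt)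
    (fun x hx => by
      rw [(hd x hx).hasDerivWithinAt.hasFDerivWithinAt.fderivWithin (hIo.uniqueDiffWithinAt hx)]
      ext; simp) ht ht₀
  simp only [sub_self, Complex.ofReal_zero, mul_zero, Complex.exp_zero, one_smul] at hc
  rw [← hc, smul_smul, ← Complex.exp_add]
  simp

theorem hasDerivAt_cross {f : ℝ → C3} {f' : C3} {t : ℝ} (h : HasDerivAt f f' t) (w : C3) :
    HasDerivAt (fun s => crossProduct w (f s)) (crossProduct w f') t :=
  (((crossProduct w).restrictScalars ℝ).toContinuousLinearMap.hasFDerivAt).comp_hasDerivAt t h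

theorem sq_eq_of_curl {μ : ℂ} {v : C3} {n : R3} (hdiv : v ⬝ᵥ toC n = 0) (hne : v ≠ 0)
    (h : Complex.I • crossProduct (toC n) v = μ • v) : μ ^ 2 = ((n ⬝ᵥ n : ℝ) : ℂ) := by
  have h1 : Complex.I • crossProduct (toC n) (Complex.I • crossProduct (toC n) v) =
      ((n ⬝ᵥ n : ℝ) : ℂ) • v := by
    rw [map_smul, smul_smul, Complex.I_mul_I, cross_cross_eq_smul_sub_smul', dotProduct_comm (toC n),
      hdiv, toC_dot, zero_smul, zero_sub, smul_neg, neg_smul, one_smul, neg_neg]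
  rw [h, map_smul, smul_comm, h, smul_smul] at h1
  rw [pow_two]
  exact smul_left_injective ℂ hne h1

theorem sq_eq_of_helical {μ : ℝ} {c : R3 →₀ C3} {n : R3} (hdiv : c n ⬝ᵥ toC n = 0) (hne : c n ≠ 0)
    (h : HelicalAt μ c n) : μ ^ 2 = n ⬝ᵥ n :=
  Complex.ofReal_injective (by rw [Complex.ofReal_pow]; exact sq_eq_of_curl hdiv hne h)

theorem helicalAt_of_eq_zero {μ : ℝ} {c : R3 →₀ C3} {n : R3} (h : c n = 0) : HelicalAt μ c n := by
  rw [HelicalAt, h, map_zero, smul_zero, smul_zero]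

/-- Planar helical modes. -/
theorem perpT_eq_of_helical {e n : R3} {c : R3 →₀ C3} {μ : ℝ} (hen : e ⬝ᵥ n = 0) (hn : n ≠ 0)
    (hdiv : c n ⬝ᵥ toC n = 0) (h : HelicalAt μ c n) :
    (perpT e c).coeff n = Complex.I * μ * (parT e c).coeff n := by
  have hnn : ((n ⬝ᵥ n : ℝ) : ℂ) ≠ 0 := Complex.ofReal_ne_zero.2 (dot_self_pos hn).ne'
  have hcr : crossProduct (toC n) (c n) ⬝ᵥ toC (crossProduct e n) =
      -((n ⬝ᵥ n : ℝ) : ℂ) * (c n ⬝ᵥ toC e) := by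
    rw [toC_cross, cross_dot_cross, hdiv, toC_dot, toC_dot, dotProduct_comm n e, hen]
    push_cast; ring
  have h1 := congrArg (· ⬝ᵥ toC (crossProduct e n)) h
  simp only [smul_dotProduct, hcr, smul_eq_mul] at h1
  rw [perpT_coeff, parT_coeff]
  field_simp
  linear_combination Complex.I * h1 + ((n ⬝ᵥ n : ℝ) : ℂ) * (c n ⬝ᵥ toC e) * Complex.I_mul_I

section
variable {ν Ω : ℝ} {I : Set ℝ} {u : ℝ → R3 → R3} {S : Finset R3} {c : ℝ → R3 →₀ C3}
  (hIo : IsOpen I) (hIc : I.OrdConnected) (hu : IsFieldOn I u S c) (h : EvolvesLinearly ν Ω I S c)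
include hIo hIc hu h

omit hIo hIc hu in
theorem EvolvesLinearly.hasDerivAt {n : R3} (hn : n ∈ S) {t : ℝ} (ht : t ∈ I) :
    HasDerivAt (fun s => c s n)
      (-((ν * (n ⬝ᵥ n) : ℝ) : ℂ) • c t n -
        ((Ω * (n 2 / (n ⬝ᵥ n)) : ℝ) : ℂ) • crossProduct (toC n) (c t n)) t := by
  obtain ⟨hd, heq⟩ := h n hn t ht
  refine hd.hasDerivAt.congr_deriv ?_
  rw [coriolis_mulVec] at heq
  have e1 : (ν * (n ⬝ᵥ n)) • c t n = ((ν * (n ⬝ᵥ n) : ℝ) : ℂ) • c t n := by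
    ext i; simp
  have e2 : Ω • ((n 2 / (n ⬝ᵥ n) : ℝ) : ℂ) • crossProduct (toC n) (c t n) =
      ((Ω * (n 2 / (n ⬝ᵥ n)) : ℝ) : ℂ) • crossProduct (toC n) (c t n) := by
    ext i; simp [mul_assoc]
  rw [e1, e2] at heq
  rw [← sub_eq_zero, ← heq]
  module

/-- The linear flow commutes with the curl and is diagonal in the helical basis, so the defect at a
mode satisfies a scalar linear equation and stays zero. -/
theorem EvolvesLinearly.helicalAt {n : R3} (hn : n ∈ S) {μ : ℝ} (hμ : μ ^ 2 = n ⬝ᵥ n) {t₀ t : ℝ}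
    (ht₀ : t₀ ∈ I) (ht : t ∈ I) (h₀ : HelicalAt μ (c t₀) n) : HelicalAt μ (c t) n := by
  rw [← helDefect_eq_zero] at h₀ ⊢
  have hd : ∀ s ∈ I, HasDerivAt (fun s => helDefect μ (c s) n)
      ((-((ν * (n ⬝ᵥ n) : ℝ) : ℂ) - ((Ω * (n 2 / (n ⬝ᵥ n)) : ℝ) : ℂ) * (Complex.I * μ)) •
        helDefect μ (c s) n) s := by
    intro s hs
    have h1 := h.hasDerivAt hn hs
    refine (((hasDerivAt_cross h1 (toC n)).const_smul Complex.I).sub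
      (h1.const_smul (μ : ℂ))).congr_deriv ?_
    have hcc : crossProduct (toC n) (crossProduct (toC n) (c s n)) = -((μ : ℂ) ^ 2) • c s n := by
      rw [cross_cross_eq_smul_sub_smul', dotProduct_comm (toC n), (hu.field s hs).div', toC_dot, ← hμ]
      push_cast
      rw [zero_smul, zero_sub, neg_smul]
    rw [helDefect, map_sub, map_smul, map_smul, hcc]
    have hI := Complex.I_mul_I
    ext i
    simp only [Pi.sub_apply, Pi.smul_apply, smul_eq_mul]
    linear_combination -((Ω * (n 2 / (n ⬝ᵥ n)) : ℝ) : ℂ) * μ *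
      (crossProduct (toC n) (c s n)) i * (-hI)
  rw [eq_exp_smul hIo hIc hd ht₀ ht, h₀, smul_zero]

/-- The zero vector is helical for both signs of the eigenvalue. Both properties persist, and only
zero has both. -/
theorem EvolvesLinearly.eq_zero {n : R3} {t₀ t : ℝ} (ht₀ : t₀ ∈ I) (ht : t ∈ I) (h₀ : c t₀ n = 0) :
    c t n = 0 := by
  by_cases hn : n ∈ S
  · by_cases hn0 : n = 0
    · rw [hn0]; exact (hu.field t ht).meanZero
    have hpos := dot_self_pos hn0
    have hsq : √(n ⬝ᵥ n) ^ 2 = n ⬝ᵥ n := Real.sq_sqrt hpos.le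
    have h1 := h.helicalAt hIo hIc hu hn hsq ht₀ ht (helicalAt_of_eq_zero h₀)
    have h2 := h.helicalAt hIo hIc hu hn (μ := -√(n ⬝ᵥ n)) (by rw [neg_sq, hsq]) ht₀ ht
      (helicalAt_of_eq_zero h₀)
    rw [HelicalAt] at h1 h2
    rw [h1, Complex.ofReal_neg, neg_smul, self_eq_neg] at h2
    exact (smul_eq_zero.1 h2).resolve_left (Complex.ofReal_ne_zero.2 (Real.sqrt_pos.2 hpos).ne')
  · exact Finsupp.notMem_support_iff.1 fun hs => hn (hu.support_subset t ht hs)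

theorem EvolvesLinearly.support_eq {t₀ t : ℝ} (ht₀ : t₀ ∈ I) (ht : t ∈ I) :
    (c t).support = (c t₀).support := by
  ext n
  rw [Finsupp.mem_support_iff, Finsupp.mem_support_iff]
  exact not_congr ⟨h.eq_zero hIo hIc hu ht ht₀, h.eq_zero hIo hIc hu ht₀ ht⟩

omit hu in
theorem EvolvesLinearly.eq_exp {n : R3} (hn : n ∈ S) (hΩ : Ω * n 2 = 0) {t₀ t : ℝ} (ht₀ : t₀ ∈ I)
    (ht : t ∈ I) : c t n = Complex.exp (-((ν * (n ⬝ᵥ n) : ℝ) : ℂ) * (t - t₀ : ℝ)) • c t₀ n := by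
  refine eq_exp_smul (y := fun s => c s n) hIo hIc (fun s hs => ?_) ht₀ ht
  refine (h.hasDerivAt hn hs).congr_deriv ?_
  rw [← mul_div_assoc, hΩ, zero_div, Complex.ofReal_zero, zero_smul, sub_zero]

/-- Without Coriolis effect each mode only decays by its own factor: nothing moves for ν = 0, and a
linear relation between the two scalar components survives for ν ≠ 0. With Coriolis effect the
condition κ² = -R makes every mode helical, with eigenvalue the imaginary part of κ. -/
theorem EvolvesLinearly.planarAdmissible {t₀ t : ℝ} (ht₀ : t₀ ∈ I) (ht : t ∈ I) {e : R3}
    (he : e ⬝ᵥ e = 1) (hpl : ∀ n ∈ (c t₀).support, e ⬝ᵥ n = 0)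
    (h₀ : PlanarAdmissible ν Ω e (perpT e (c t₀)) (parT e (c t₀))) :
    PlanarAdmissible ν Ω e (perpT e (c t)) (parT e (c t)) := by
  have hsupp := h.support_eq hIo hIc hu ht₀ ht
  have hS : ∀ n, n ∈ (c t₀).support → n ∈ S := fun n hn => hu.support_subset t₀ ht₀ hn
  have hpl' : ∀ n ∈ (c t).support, e ⬝ᵥ n = 0 := by rw [hsupp]; exact hpl
  have hmem := mem_support_iff_perpT_parT he (hu.field t ht).div' hpl' (hu.field t ht).meanZero
  have hmem₀ := mem_support_iff_perpT_parT he (hu.field t₀ ht₀).div' hpl (hu.field t₀ ht₀).meanZero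
  have hscale : (∀ n, e ⬝ᵥ n = 0 → Ω * n 2 = 0) → ∀ n, c t n =
      Complex.exp (-((ν * (n ⬝ᵥ n) : ℝ) : ℂ) * (t - t₀ : ℝ)) • c t₀ n := by
    intro hA n
    by_cases hn : n ∈ (c t₀).support
    · exact h.eq_exp hIo hIc (hS n hn) (hA n (hpl n hn)) ht₀ ht
    · have h1 := Finsupp.notMem_support_iff.1 hn
      rw [h1, h.eq_zero hIo hIc hu ht₀ ht h1, smul_zero]

  have hmult : ∀ κ : ℂ, perpT e (c t) =
      Polynomial.aeval (parT e (c t)) (Polynomial.C κ * Polynomial.X) →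
      perpT e (c t₀) = Polynomial.aeval (parT e (c t₀)) (Polynomial.C κ * Polynomial.X) →
      ∀ n, (parT e (c t)).coeff n ≠ 0 ↔ (parT e (c t₀)).coeff n ≠ 0 := by
    intro κ h1 h2 n
    have aux : ∀ f g : Trig, f = Polynomial.aeval g (Polynomial.C κ * Polynomial.X) →
        ((f.coeff n ≠ 0 ∨ g.coeff n ≠ 0) ↔ g.coeff n ≠ 0) := by
      intro f g hfg
      rw [map_mul, Polynomial.aeval_C, Polynomial.aeval_X, ← Algebra.smul_def] at hfg
      constructor
      · rintro (h | h) h0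
        · apply h; rw [hfg]; simp [h0]
        · exact h h0
      · exact Or.inr
    rw [← aux _ _ h1, ← aux _ _ h2, ← hmem, ← hmem₀, hsupp]
  rcases h₀ with ⟨hβ, hA⟩ | ⟨R, hR, ⟨a, b, ha, hb, hab⟩, q, hq, hqA, hqB⟩
  · left
    refine ⟨?_, hA⟩
    ext n
    have : (parT e (c t₀)).coeff n = 0 := by rw [hβ]; rfl
    rw [parT_coeff] at this
    rw [parT_coeff, hscale hA, smul_dotProduct, smul_eq_mul, mul_div_assoc, this, mul_zero]
    rfl
  · right
    by_cases hA : ∀ n, e ⬝ᵥ n = 0 → Ω * n 2 = 0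
    · by_cases hν : ν = 0
      · have hc : c t = c t₀ := by
          ext1 n
          rw [hscale hA n, hν]
          simp
        rw [hc]
        exact ⟨R, hR, ⟨a, b, ha, hb, hab⟩, q, hq, hqA, hqB⟩
      · obtain ⟨κ, hκ, rfl⟩ := hqA hA hν
        have hq₀ := hq
        rw [map_mul, Polynomial.aeval_C, Polynomial.aeval_X, ← Algebra.smul_def] at hq
        have hq' : perpT e (c t) =
            Polynomial.aeval (parT e (c t)) (Polynomial.C κ * Polynomial.X) := by
          refine aeval_C_mul_X_eq fun n => ?_
          have h1 : (perpT e (c t₀)).coeff n = κ * (parT e (c t₀)).coeff n := by rw [hq]; simp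
          rw [perpT_coeff, parT_coeff] at h1
          rw [perpT_coeff, parT_coeff, hscale hA n, smul_dotProduct, smul_dotProduct, smul_eq_mul,
            smul_eq_mul, h1]
          ring
        have hiff := hmult κ hq' hq₀
        exact ⟨R, fun n hn => hR n ((hiff n).1 hn), ⟨a, b, (hiff a).2 ha, (hiff b).2 hb, hab⟩, _, hq',
          fun _ _ => ⟨κ, hκ, rfl⟩, fun h => absurd hA h⟩
    · obtain ⟨κ, hκ, hκ2, rfl⟩ := hqB hA
      have hq₀ := hq
      rw [map_mul, Polynomial.aeval_C, Polynomial.aeval_X, ← Algebra.smul_def] at hq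
      have h1 : ∀ n, (perpT e (c t₀)).coeff n = κ * (parT e (c t₀)).coeff n := fun n => by
        rw [hq]; simp
      have hκI : κ = Complex.I * (κ.im : ℂ) := by
        have hre : κ.re = 0 := by
          have := congrArg Complex.re hκ
          simp at this
          linarith
        apply Complex.ext <;> simp [hre]
      have hhel₀ : ∀ n ∈ (c t₀).support, HelicalAt κ.im (c t₀) n := by
        intro n hn
        have hβn : (parT e (c t₀)).coeff n ≠ 0 := by
          rcases (hmem₀ n).1 hn with h2 | h2
          · rw [h1] at h2; exact right_ne_zero_of_mul h2
          · exact h2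
        have hn0 : n ≠ 0 := by
          rintro rfl
          exact (Finsupp.mem_support_iff.1 hn) (hu.field t₀ ht₀).meanZero
        refine helical_of_coeff he (hpl n hn) hn0 ((hu.field t₀ ht₀).div' n) ?_ ?_
        · have h3 := h1 n
          change (κ.im : ℂ) * (parT e (c t₀)).coeff n = -(Complex.I * (perpT e (c t₀)).coeff n)
          rw [h3]
          conv_rhs => rw [hκI]
          linear_combination (κ.im : ℂ) * (parT e (c t₀)).coeff n * Complex.I_mul_I
        · have h3 := h1 n
          change (κ.im : ℂ) * (perpT e (c t₀)).coeff n =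
            Complex.I * (parT e (c t₀)).coeff n * ((n ⬝ᵥ n : ℝ) : ℂ)
          rw [h3, hR n hβn]
          linear_combination -(Complex.I * (parT e (c t₀)).coeff n) * hκ2 +
            (Complex.I * κ * (parT e (c t₀)).coeff n) * hκI +
            ((κ.im : ℂ) * κ * (parT e (c t₀)).coeff n) * Complex.I_mul_I
      have hq' : perpT e (c t) =
          Polynomial.aeval (parT e (c t)) (Polynomial.C κ * Polynomial.X) := by
        refine aeval_C_mul_X_eq fun n => ?_
        by_cases hn : n ∈ (c t₀).support
        · have hn0 : n ≠ 0 := by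
            rintro rfl
            exact (Finsupp.mem_support_iff.1 hn) (hu.field t₀ ht₀).meanZero
          have hsq := sq_eq_of_helical ((hu.field t₀ ht₀).div' n) (Finsupp.mem_support_iff.1 hn)
            (hhel₀ n hn)
          rw [perpT_eq_of_helical (hpl n hn) hn0 ((hu.field t ht).div' n)
            (h.helicalAt hIo hIc hu (hS n hn) hsq ht₀ ht (hhel₀ n hn)), ← hκI]
        · have h2 := h.eq_zero hIo hIc hu ht₀ ht (Finsupp.notMem_support_iff.1 hn)
          rw [perpT_coeff, parT_coeff, h2]
          simp
      have hiff := hmult κ hq' hq₀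
      exact ⟨R, fun n hn => hR n ((hiff n).1 hn), ⟨a, b, (hiff a).2 ha, (hiff b).2 hb, hab⟩, _, hq',
        fun h => absurd h hA, fun _ => ⟨κ, hκ, hκ2, rfl⟩⟩

theorem EvolvesLinearly.coeffAdmissible {t₀ t : ℝ} (ht₀ : t₀ ∈ I) (ht : t ∈ I)
    (h₀ : CoeffAdmissible ν Ω (c t₀)) : CoeffAdmissible ν Ω (c t) := by
  have hsupp := h.support_eq hIo hIc hu ht₀ ht
  rcases h₀ with h₀ | ⟨hs, e, he, hpl, h₀⟩ | ⟨hs, hs3, μ, hμ, h₀⟩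
  · left
    rw [TypeI, hsupp]; exact h₀
  · right; left
    rw [hsupp]
    exact ⟨hs, e, he, hpl, h.planarAdmissible hIo hIc hu ht₀ ht he hpl h₀⟩
  · right; right
    rw [hsupp]
    refine ⟨hs, hs3, μ, hμ, fun n => ?_⟩
    by_cases hn : c t₀ n = 0
    · exact helicalAt_of_eq_zero (h.eq_zero hIo hIc hu ht₀ ht hn)
    · exact h.helicalAt hIo hIc hu (hu.support_subset t₀ ht₀ (Finsupp.mem_support_iff.2 hn))
        (sq_eq_of_helical ((hu.field t₀ ht₀).div' n) hn (h₀ n)) ht₀ ht (h₀ n)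

omit hIc in
theorem EvolvesLinearly.solves (hadm : ∀ t ∈ I, CoeffAdmissible ν Ω (c t)) : Solves ν Ω I S c := by
  intro n hn t ht
  have hn0 : n ≠ 0 := by
    rcases hn with hn | hn
    · rintro rfl
      obtain ⟨s, hs, hne⟩ := hu.ne_zero 0 hn
      exact hne (hu.field s hs).meanZero
    · exact hn.1
  have hz : proj n (interaction S (c t) n) = 0 := by
    rw [interaction_eq (hu.support_subset t ht) (hu.field t ht).div', proj_smul,
      (proj_eq_zero_iff hn0).2 ((hadm t ht).nl_parallel (hu.field t ht).meanZero (hu.field t ht).div'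
        hn0), smul_zero]
  refine ⟨(hu.field t ht).divFree n, ?_⟩
  rw [hz, smul_zero, add_zero]
  by_cases hnS : n ∈ S
  · exact h n hnS t ht
  · have hc0 : ∀ s ∈ I, c s n = 0 := fun s hs => Finsupp.notMem_support_iff.1 fun hs' =>
      hnS (hu.support_subset s hs hs')
    have hd : HasDerivAt (fun s => c s n) 0 t :=
      (hasDerivAt_const t (0 : C3)).congr_of_eventuallyEq
        (Filter.eventually_of_mem (hIo.mem_nhds ht) hc0)
    refine ⟨hd.differentiableAt, ?_⟩
    rw [hd.deriv, hc0 t ht, Matrix.mulVec_zero, smul_zero, smul_zero, add_zero, add_zero]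

end

/-! ### Fields in physical space and their coefficients -/

theorem wave_zero (x : R3) : wave 0 x = 1 := by simp [wave]

theorem wave_add (a b x : R3) : wave (a + b) x = wave a x * wave b x := by
  rw [wave, wave, wave, ← Complex.exp_add, add_dotProduct]; push_cast; ring_nf

namespace Trig

/-- Evaluation of trigonometric polynomials at a point. -/
def ev (x : R3) : Trig →ₐ[ℂ] ℂ :=
  AddMonoidAlgebra.lift ℂ ℂ R3
    { toFun := fun n => wave n.toAdd x
      map_one' := wave_zero x
      map_mul' := fun _ _ => wave_add _ _ x }

theorem ev_eq_sum (x : R3) {f : Trig} {s : Finset R3} (hs : f.coeff.support ⊆ s) :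
    ev x f = ∑ n ∈ s, f.coeff n * wave n x := by
  rw [ev, AddMonoidAlgebra.lift_apply, Finsupp.sum]
  rw [← Finset.sum_subset hs (fun n _ hn => by rw [Finsupp.notMem_support_iff.1 hn, zero_mul])]
  rfl

/-- The character `x ↦ exp (i n · x)`. -/
def waveHom (n : R3) : Multiplicative R3 →* ℂ where
  toFun x := wave n x.toAdd
  map_one' := by simp [wave]
  map_mul' a b := by
    simp only [wave, toAdd_mul, ← Complex.exp_add, dotProduct_add]; push_cast; ring_nf

theorem waveHom_injective : Function.Injective waveHom := by
  intro n m h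
  by_contra hne
  have hk := dot_self_pos (sub_ne_zero.2 hne)
  set k := n - m with hkdef
  have h1 : ∀ x : R3, wave n x = wave m x := fun x => DFunLike.congr_fun h (Multiplicative.ofAdd x)
  -- At the point π k / |k|² the wave of frequency `k` equals -1, so distinct frequencies give
  -- distinct characters.
  have h2 : wave k ((Real.pi / (k ⬝ᵥ k)) • k) = 1 := by
    have h3 := h1 ((Real.pi / (k ⬝ᵥ k)) • k)
    have h4 : n = k + m := by rw [hkdef]; abel
    rw [h4, wave_add] at h3
    exact mul_right_cancel₀ (Complex.exp_ne_zero _) (h3.trans (one_mul _).symm)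
  rw [wave, dotProduct_smul, smul_eq_mul, div_mul_cancel₀ _ hk.ne', mul_comm, Complex.exp_pi_mul_I] at h2
  norm_num at h2

/-- Uniqueness of Fourier coefficients. -/
theorem ev_injective {f g : Trig} (h : ∀ x, ev x f = ev x g) : f = g := by
  rw [← sub_eq_zero]
  -- Dedekind's independence of characters gives uniqueness of Fourier coefficients.
  have hli := (linearIndependent_monoidHom (Multiplicative R3) ℂ).comp waveHom waveHom_injective
  rw [linearIndependent_iff] at hli
  have h0 := hli (f - g).coeff (by
    funext x
    rw [Finsupp.linearCombination_apply, Finsupp.sum, Finset.sum_apply]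
    have h1 : ev x.toAdd (f - g) = 0 := by rw [map_sub, h, sub_self]
    rw [ev_eq_sum _ subset_rfl] at h1
    exact h1)
  exact AddMonoidAlgebra.coeff_eq_zero.1 h0

/-- The trigonometric polynomial `w · v`. -/
def dotT (c : R3 →₀ C3) (w : R3 → C3) : Trig :=
  .ofCoeff (Finsupp.onFinset c.support (fun n => c n ⬝ᵥ w n) fun a h => by
    rw [Finsupp.mem_support_iff]; intro h0; apply h; rw [h0, zero_dotProduct])

theorem dotT_coeff (c : R3 →₀ C3) (w : R3 → C3) (n : R3) : (dotT c w).coeff n = c n ⬝ᵥ w n := rfl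

theorem ev_dotT (x : R3) (c : R3 →₀ C3) (w : R3 → C3) :
    ev x (dotT c w) = ∑ n ∈ c.support, (c n ⬝ᵥ w n) * wave n x :=
  ev_eq_sum x fun _ ha => by
    rw [Finsupp.mem_support_iff] at ha ⊢
    intro h0; apply ha; rw [dotT_coeff, h0, zero_dotProduct]

end Trig

section
variable {v : R3 → R3} {c : R3 →₀ C3} (h : IsField v c)
include h

theorem IsField.dot (x w : R3) : ((v x ⬝ᵥ w : ℝ) : ℂ) = Trig.ev x (Trig.dotT c fun _ => toC w) := by
  rw [← toC_dot, h.expansion, sum_dotProduct, Trig.ev_dotT]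
  exact Finset.sum_congr rfl fun n _ => by rw [smul_dotProduct, smul_eq_mul, mul_comm]

theorem IsField.differentiable : Differentiable ℝ v := by
  rw [differentiable_pi]
  intro i
  have h1 : (fun x => v x i) = fun x => Complex.reCLM (∑ n ∈ c.support, wave n x * c n i) := by
    funext x
    have := congrFun (h.expansion x) i
    rw [Finset.sum_apply] at this
    simp only [Pi.smul_apply, smul_eq_mul] at this
    rw [← this]
    simp [toC]
  rw [h1]
  have h2 (n : R3) : Differentiable ℝ fun x : R3 => n ⬝ᵥ x := by
    have : (fun x : R3 => n ⬝ᵥ x) = fun x => n 0 * x 0 + n 1 * x 1 + n 2 * x 2 := by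
      funext x; simp [dotProduct, Fin.sum_univ_three]
    rw [this]
    fun_prop
  refine Complex.reCLM.differentiable.comp (Differentiable.fun_sum fun n _ => ?_)
  exact ((Complex.ofRealCLM.differentiable.comp (h2 n)).const_mul _).cexp.mul_const _

theorem IsField.partialDeriv_eq (j i : Fin 3) (x : R3) : (partialDeriv v j i x : ℂ) =
    ∑ n ∈ c.support, Complex.I * n j * wave n x * c n i := by
  set d : R3 := Pi.single j 1
  have hline : HasDerivAt (fun s : ℝ => x + s • d) d 0 := by
    have := ((hasDerivAt_id (0 : ℝ)).smul_const d).const_add x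
    simpa using this
  have h1 : HasDerivAt (fun s : ℝ => v (x + s • d) i) (partialDeriv v j i x) 0 := by
    have h2 : HasFDerivAt v (fderiv ℝ v x) (x + (0 : ℝ) • d) := by
      rw [zero_smul, add_zero]; exact (h.differentiable x).hasFDerivAt
    exact (hasDerivAt_pi.1 (h2.comp_hasDerivAt (0 : ℝ) hline)) i
  have h3 := h1.ofReal_comp
  refine h3.unique ?_
  have h4 : (fun s : ℝ => ((v (x + s • d) i : ℝ) : ℂ)) =
      fun s : ℝ => ∑ n ∈ c.support, wave n (x + s • d) * c n i := by
    funext s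
    have := congrFun (h.expansion (x + s • d)) i
    rw [Finset.sum_apply] at this
    exact this
  rw [h4]
  refine HasDerivAt.fun_sum fun n _ => HasDerivAt.mul_const ?_ _
  have h5 : HasDerivAt (fun s : ℝ => Complex.I * ((n ⬝ᵥ (x + s • d) : ℝ) : ℂ))
      (Complex.I * n j) 0 := by
    have h6 : HasDerivAt (fun s : ℝ => n ⬝ᵥ (x + s • d)) (n j) 0 := by
      have h7 : (fun s : ℝ => n ⬝ᵥ (x + s • d)) = fun s => n ⬝ᵥ x + s * n j := by
        funext s
        rw [dotProduct_add, dotProduct_smul, dotProduct_single, mul_one, smul_eq_mul]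
      rw [h7]
      simpa using ((hasDerivAt_id (0 : ℝ)).mul_const (n j)).const_add (n ⬝ᵥ x)
    exact h6.ofReal_comp.const_mul _
  have h8 := h5.cexp
  simp only [zero_smul, add_zero] at h8
  refine h8.congr_deriv ?_
  rw [wave]; ring

theorem IsField.curl_eq (x : R3) :
    toC (curl v x) = ∑ n ∈ c.support, wave n x • (Complex.I • crossProduct (toC n) (c n)) := by
  ext i
  rw [Finset.sum_apply]
  simp only [cross_apply]
  fin_cases i <;>
  · simp only [toC, curl, Pi.smul_apply, Fin.zero_eta, Fin.mk_one, Fin.reduceFinMk, Matrix.cons_val,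
      Complex.ofReal_sub, h.partialDeriv_eq, ← Finset.sum_sub_distrib, smul_eq_mul]
    refine Finset.sum_congr rfl fun n _ => ?_
    ring

theorem IsField.curl_dot (x w : R3) : ((curl v x ⬝ᵥ w : ℝ) : ℂ) =
    Trig.ev x (Trig.dotT c fun n => Complex.I • toC (crossProduct w n)) := by
  rw [← toC_dot, h.curl_eq, sum_dotProduct, Trig.ev_dotT]
  refine Finset.sum_congr rfl fun n _ => ?_
  have : crossProduct (toC n) (c n) ⬝ᵥ toC w = c n ⬝ᵥ toC (crossProduct w n) := by
    rw [toC_cross, dotProduct_comm, triple_product_permutation, triple_product_permutation]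
  rw [smul_dotProduct, smul_dotProduct, this, dotProduct_smul, smul_eq_mul, mul_comm]

end

theorem linearIndependent_pair_iff_cross {a b : R3} :
    LinearIndependent ℝ ![a, b] ↔ crossProduct a b ≠ 0 := by
  rw [LinearIndependent.pair_iff]
  constructor
  · intro h h0
    have h1 := parallel_of_cross_eq_zero h0
    have h2 := h (-(a ⬝ᵥ b)) (a ⬝ᵥ a) (by rw [h1, neg_smul, neg_add_cancel])
    have ha : a = 0 := by
      by_contra ha
      exact (dot_self_pos ha).ne' h2.2
    have h3 := h 1 0 (by rw [ha]; simp)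
    exact one_ne_zero h3.1
  · intro h s t hst
    constructor
    · have h1 := congrArg (fun v => crossProduct v b) hst
      simp only [map_add, map_smul, LinearMap.add_apply, LinearMap.smul_apply, cross_self, smul_zero,
        add_zero, map_zero, LinearMap.zero_apply] at h1
      exact (smul_eq_zero.1 h1).resolve_right h
    · have h1 := congrArg (fun v => crossProduct a v) hst
      simp only [map_add, map_smul, cross_self, smul_zero, zero_add, map_zero] at h1
      exact (smul_eq_zero.1 h1).resolve_right h

theorem cross_eq_det_smul {e a b : R3} (he : e ⬝ᵥ e = 1) (ha : e ⬝ᵥ a = 0) (hb : e ⬝ᵥ b = 0) :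
    crossProduct a b = det e a b • e := by
  have h1 : crossProduct e (crossProduct a b) = 0 := by
    rw [cross_cross_eq_smul_sub_smul', hb, dotProduct_comm a, ha]; simp
  have h2 := parallel_of_cross_eq_zero h1
  rwa [he, one_smul] at h2

theorem det_ne_zero_of_cross {e a b : R3} (he : e ⬝ᵥ e = 1) (ha : e ⬝ᵥ a = 0) (hb : e ⬝ᵥ b = 0)
    (hab : crossProduct a b ≠ 0) : det e a b ≠ 0 := by
  intro h
  rw [cross_eq_det_smul he ha hb, h, zero_smul] at hab
  exact hab rfl

theorem mem_plane_iff {e a b : R3} {P : Submodule ℝ R3} (he : e ⬝ᵥ e = 1) (ha : e ⬝ᵥ a = 0)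
    (hb : e ⬝ᵥ b = 0) (hab : crossProduct a b ≠ 0) (haP : a ∈ P) (hbP : b ∈ P)
    (hP : Module.finrank ℝ P = 2) (p : R3) : p ∈ P ↔ e ⬝ᵥ p = 0 := by
  have hle : Submodule.span ℝ (Set.range ![a, b]) ≤ P := by
    rw [Submodule.span_le]
    rintro _ ⟨i, rfl⟩
    fin_cases i
    · exact haP
    · exact hbP
  have heq := Submodule.eq_of_le_of_finrank_eq hle (by
    rw [finrank_span_eq_card (linearIndependent_pair_iff_cross.2 hab), hP]; rfl)
  constructor
  · intro hp
    rw [← heq] at hp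
    induction hp using Submodule.span_induction with
    | mem x hx =>
      obtain ⟨i, rfl⟩ := hx
      fin_cases i
      · exact ha
      · exact hb
    | zero => exact dotProduct_zero _
    | add x y _ _ hx hy => rw [dotProduct_add, hx, hy, add_zero]
    | smul r x _ hx => rw [dotProduct_smul, hx, smul_zero]
  · intro hp
    have h1 := planar_expand he ha hb hp
    rw [← Submodule.smul_mem_iff _ (det_ne_zero_of_cross he ha hb hab), h1]
    exact P.add_mem (P.smul_mem _ haP) (P.smul_mem _ hbP)

theorem coriolis_trivial_iff {Ω : ℝ} {e : R3} {P : Submodule ℝ R3} (he : e ⬝ᵥ e = 1)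
    (hP : ∀ p, p ∈ P ↔ e ⬝ᵥ p = 0) :
    (∀ n : R3, e ⬝ᵥ n = 0 → Ω * n 2 = 0) ↔ Ω = 0 ∨ P = horizontalPlane := by
  constructor
  · intro h
    by_cases hΩ : Ω = 0
    · exact Or.inl hΩ
    right
    have h1 : ∀ x : R3, crossProduct e x 2 = 0 := fun x =>
      (mul_eq_zero.1 (h _ (dot_self_cross _ _))).resolve_left hΩ
    have e0 : e 0 = 0 := by simpa [cross_apply] using h1 (Pi.single 1 1)
    have e1 : e 1 = 0 := by simpa [cross_apply] using h1 (Pi.single 0 1)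
    have e2 : e 2 ≠ 0 := by
      intro e2
      simp [dotProduct, Fin.sum_univ_three, e0, e1, e2] at he
    ext p
    rw [hP, horizontalPlane, LinearMap.mem_ker, LinearMap.proj_apply, dotProduct, Fin.sum_univ_three,
      e0, e1, zero_mul, zero_mul, zero_add, zero_add, mul_eq_zero, or_iff_right e2]
  · rintro (rfl | rfl) n hn
    · exact zero_mul _
    · have h1 := (hP n).2 hn
      rw [horizontalPlane, LinearMap.mem_ker, LinearMap.proj_apply] at h1
      rw [h1, mul_zero]

theorem linearIndependent_triple_of_dot_cross {a b x : R3} (h : x ⬝ᵥ crossProduct a b ≠ 0) :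
    LinearIndependent ℝ ![a, b, x] := by
  rw [Fintype.linearIndependent_iff]
  intro g hg
  simp only [Fin.sum_univ_three, Matrix.cons_val] at hg
  have h2 : g 2 = 0 := by
    have h1 := congrArg (fun v => v ⬝ᵥ crossProduct a b) hg
    simpa [add_dotProduct, smul_dotProduct, h] using h1
  have h0 : g 0 = 0 := by
    have h1 := congrArg (fun v => v ⬝ᵥ crossProduct b x) hg
    have h3 : a ⬝ᵥ crossProduct b x = x ⬝ᵥ crossProduct a b := by
      rw [triple_product_permutation, triple_product_permutation]
    simpa [add_dotProduct, smul_dotProduct, h3, h] using h1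
  have h1 : g 1 = 0 := by
    have h1 := congrArg (fun v => v ⬝ᵥ crossProduct x a) hg
    have h3 : b ⬝ᵥ crossProduct x a = x ⬝ᵥ crossProduct a b := triple_product_permutation _ _ _
    simpa [add_dotProduct, smul_dotProduct, h3, h] using h1
  intro i
  fin_cases i
  exacts [h0, h1, h2]

theorem dot_cross_ne_zero_of_linearIndependent {a b x : R3} (h : LinearIndependent ℝ ![a, b, x]) :
    crossProduct a b ≠ 0 ∧ ∀ e : R3, e ≠ 0 → a ⬝ᵥ e ≠ 0 ∨ b ⬝ᵥ e ≠ 0 ∨ x ⬝ᵥ e ≠ 0 := by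
  constructor
  · rw [← linearIndependent_pair_iff_cross, LinearIndependent.pair_iff]
    intro s t hst
    rw [Fintype.linearIndependent_iff] at h
    have h1 := h ![s, t, 0] (by simpa [Fin.sum_univ_three] using hst)
    exact ⟨h1 0, h1 1⟩
  · intro e he
    by_contra! hcon
    have htop := h.span_eq_top_of_card_eq_finrank' (by simp)
    have hz : ∀ y ∈ Submodule.span ℝ (Set.range ![a, b, x]), y ⬝ᵥ e = 0 := fun y hy => by
      induction hy using Submodule.span_induction with
      | mem y hy =>
        obtain ⟨i, rfl⟩ := hy
        fin_cases i
        exacts [hcon.1, hcon.2.1, hcon.2.2]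
      | zero => exact zero_dotProduct _
      | add x y _ _ hx hy => rw [add_dotProduct, hx, hy, add_zero]
      | smul r x _ hx => rw [smul_dotProduct, hx, smul_zero]
    exact (dot_self_pos he).ne' (hz e (htop ▸ Submodule.mem_top))

/-- The polynomial in the stream function is complex, while ω and the normal component are real;
real parts of coefficients suffice at real arguments. -/
theorem exists_real_polynomial (q : Polynomial ℂ) :
    ∃ Q : Polynomial ℝ, ∀ y : ℝ, Q.eval y = (q.eval (y : ℂ)).re := by
  induction q using Polynomial.induction_on' with
  | add p q hp hq =>
    obtain ⟨P, hP⟩ := hp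
    obtain ⟨Q, hQ⟩ := hq
    exact ⟨P + Q, fun y => by rw [Polynomial.eval_add, Polynomial.eval_add, hP, hQ, Complex.add_re]⟩
  | monomial n a =>
    refine ⟨Polynomial.monomial n a.re, fun y => ?_⟩
    rw [Polynomial.eval_monomial, Polynomial.eval_monomial, ← Complex.ofReal_pow,
      Complex.re_mul_ofReal]

theorem eq_smul_of_dot_eq_zero {e w : R3} (he : e ⬝ᵥ e = 1) (h : ∀ p, e ⬝ᵥ p = 0 → w ⬝ᵥ p = 0) :
    w = (w ⬝ᵥ e) • e := by
  have h1 : e ⬝ᵥ (w - (w ⬝ᵥ e) • e) = 0 := by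
    rw [dotProduct_sub, dotProduct_smul, he, dotProduct_comm]; simp
  have h2 : (w - (w ⬝ᵥ e) • e) ⬝ᵥ (w - (w ⬝ᵥ e) • e) = 0 := by
    rw [sub_dotProduct, smul_dotProduct, h1, h _ h1]; simp
  by_contra hne
  exact (dot_self_pos (sub_ne_zero.2 hne)).ne' h2

section
variable {v : R3 → R3} {c : R3 →₀ C3} (h : IsField v c)
include h

theorem IsField.dot_normal (x e : R3) : ((v x ⬝ᵥ e : ℝ) : ℂ) = Trig.ev x (perpT e c) := h.dot x e

/-- On a circle the Laplacian acts as a scalar, so the vorticity is a multiple of the stream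
function. -/
theorem IsField.curl_dot_normal {R : ℝ} (hR : ∀ n ∈ c.support, n ⬝ᵥ n = R) (x e : R3) :
    ((curl v x ⬝ᵥ e : ℝ) : ℂ) = Complex.I * R * Trig.ev x (parT e c) := by
  rw [h.curl_dot, ← smul_eq_mul, ← map_smul]
  congr 1
  ext n
  rw [Trig.dotT_coeff, AddMonoidAlgebra.coeff_smul, Finsupp.smul_apply, parT_coeff, dotProduct_smul,
    smul_eq_mul, smul_eq_mul]
  by_cases hn : n ∈ c.support
  · have hn0 : n ≠ 0 := by
      rintro rfl; exact (Finsupp.mem_support_iff.1 hn) h.meanZero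
    have hRn : (R : ℂ) ≠ 0 := by rw [← hR n hn]; exact Complex.ofReal_ne_zero.2 (dot_self_pos hn0).ne'
    rw [hR n hn]
    field_simp
  · rw [Finsupp.notMem_support_iff.1 hn]; simp

theorem IsField.curl_eq_smul {e : R3} (he : e ⬝ᵥ e = 1) (hpl : ∀ n ∈ c.support, e ⬝ᵥ n = 0)
    (hperp : ∀ n, c n ⬝ᵥ toC e = 0) (x : R3) : curl v x = (curl v x ⬝ᵥ e) • e := by
  refine eq_smul_of_dot_eq_zero he fun p hp => ?_
  have h0 := h.curl_dot x p
  rw [Trig.ev_dotT, Finset.sum_eq_zero, Complex.ofReal_eq_zero] at h0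
  · exact h0
  intro n hn
  rw [cross_eq_det_smul he hp (hpl n hn), toC_smul, dotProduct_smul, dotProduct_smul, hperp]
  simp

/-- The coefficients of the component of a field orthogonal to `e`. -/
def parCoeffs (e : R3) (c : R3 →₀ C3) : R3 →₀ C3 :=
  c.mapRange (fun w => w - (w ⬝ᵥ toC e) • toC e) (by simp)

omit h in
theorem parCoeffs_apply (e n : R3) : parCoeffs e c n = c n - (c n ⬝ᵥ toC e) • toC e := rfl

omit h in
theorem parCoeffs_dot {e p : R3} (hp : e ⬝ᵥ p = 0) (n : R3) :
    parCoeffs e c n ⬝ᵥ toC p = c n ⬝ᵥ toC p := by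
  rw [parCoeffs_apply, sub_dotProduct, smul_dotProduct, toC_dot, hp]; simp

omit h in
theorem parCoeffs_dot_self {e : R3} (he : e ⬝ᵥ e = 1) (n : R3) : parCoeffs e c n ⬝ᵥ toC e = 0 := by
  rw [parCoeffs_apply, sub_dotProduct, smul_dotProduct, toC_dot, he]; simp

omit h in
theorem parT_parCoeffs (e : R3) : parT e (parCoeffs e c) = parT e c := by
  ext n
  rw [parT_coeff, parT_coeff, parCoeffs_dot (dot_self_cross _ _)]

theorem IsField.parallel {e : R3} (hpl : ∀ n ∈ c.support, e ⬝ᵥ n = 0) :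
    IsField (fun x => v x - (v x ⬝ᵥ e) • e) (parCoeffs e c) where
  meanZero := by rw [parCoeffs_apply, h.meanZero]; simp
  conj n := by
    rw [parCoeffs_apply, parCoeffs_apply, h.conj, star_sub, star_smul, star_dot_toC, star_toC]
  divFree n := by
    by_cases hn : n ∈ c.support
    · rw [dotProduct_comm, parCoeffs_dot (hpl n hn), h.div']
    · rw [parCoeffs_apply, Finsupp.notMem_support_iff.1 hn]; simp
  expansion x := by
    rw [toC_sub, toC_smul, ← toC_dot, h.expansion, sum_dotProduct, Finset.sum_smul,
      ← Finset.sum_sub_distrib]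
    rw [Finset.sum_subset (s₁ := (parCoeffs e c).support) Finsupp.support_mapRange]
    · refine Finset.sum_congr rfl fun n _ => ?_
      rw [parCoeffs_apply, smul_sub, smul_dotProduct, smul_eq_mul, mul_smul]
    · intro n _ hn
      rw [Finsupp.notMem_support_iff.1 hn, smul_zero]

theorem IsField.typeIIa {Ω : ℝ} {e : R3} {P : Submodule ℝ R3} (he : e ⬝ᵥ e = 1)
    (hP : ∀ p, p ∈ P ↔ e ⬝ᵥ p = 0) (hpl : ∀ n ∈ c.support, e ⬝ᵥ n = 0) (hβ : parT e c = 0)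
    (hΩ : ∀ n, e ⬝ᵥ n = 0 → Ω * n 2 = 0) : TypeIIa Ω P v := by
  refine ⟨(coriolis_trivial_iff he hP).1 hΩ, fun x p hp => ?_⟩
  have h0 := h.dot x p
  rw [Trig.ev_dotT, Finset.sum_eq_zero, Complex.ofReal_eq_zero] at h0
  · exact h0
  intro n hn
  have hn0 : n ≠ 0 := by
    rintro rfl; exact (Finsupp.mem_support_iff.1 hn) h.meanZero
  rw [mode_eq he h.div' hpl n hn0, hβ, add_dotProduct, smul_dotProduct, smul_dotProduct, toC_dot,
    (hP p).1 hp]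
  simp

/-- On the circle of radius r the stream function equals ω / (i r), so substituting this in `q` and
taking real parts gives `Q`. A factor κ on the imaginary axis becomes the real factor κ.im / r,
which is ±1 when κ² = -R. -/
theorem IsField.typeIIb {ν Ω : ℝ} {e : R3} {P : Submodule ℝ R3} (he : e ⬝ᵥ e = 1)
    (hP : ∀ p, p ∈ P ↔ e ⬝ᵥ p = 0) (hpl : ∀ n ∈ c.support, e ⬝ᵥ n = 0) {R : ℝ}
    (hR : ∀ n, (parT e c).coeff n ≠ 0 → n ⬝ᵥ n = R)
    (hsp : ∃ a b, (parT e c).coeff a ≠ 0 ∧ (parT e c).coeff b ≠ 0 ∧ det e a b ≠ 0)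
    {q : Polynomial ℂ} (hq : perpT e c = Polynomial.aeval (parT e c) q)
    (hν : (∀ n, e ⬝ᵥ n = 0 → Ω * n 2 = 0) → ν ≠ 0 →
        ∃ κ : ℂ, star κ = -κ ∧ q = Polynomial.C κ * Polynomial.X)
    (hΩ : (¬∀ n, e ⬝ᵥ n = 0 → Ω * n 2 = 0) →
        ∃ κ : ℂ, star κ = -κ ∧ κ ^ 2 = -R ∧ q = Polynomial.C κ * Polynomial.X) :
    TypeIIb ν Ω P v := by
  classical
  obtain ⟨a, b, ha, hb, hab⟩ := hsp
  have hR0 : 0 < R := by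
    rw [← hR a ha]
    refine dot_self_pos ?_
    rintro rfl
    simp [det] at hab
  have hpar := h.parallel hpl
  have hbe := parCoeffs_dot_self (c := c) he
  have hsupp : ∀ n ∈ (parCoeffs e c).support, e ⬝ᵥ n = 0 := fun n hn =>
    hpl n (Finsupp.support_mapRange hn)
  have hmem : ∀ n, n ∈ (parCoeffs e c).support ↔ (parT e c).coeff n ≠ 0 := fun n => by
    rw [mem_support_iff_perpT_parT he hpar.div' hsupp hpar.meanZero, parT_parCoeffs, perpT_coeff,
      hbe n]
    simp
  have hneg : ∀ n, (parT e c).coeff n ≠ 0 → (parT e c).coeff (-n) ≠ 0 := fun n hn => by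
    rw [parT_neg h.conj]
    simpa using hn
  have hRs : ∀ n ∈ (parCoeffs e c).support, n ⬝ᵥ n = R := fun n hn => hR n ((hmem n).1 hn)
  set r := √R with hr
  have hr0 : 0 < r := Real.sqrt_pos.2 hR0
  have hrr : r ^ 2 = R := Real.sq_sqrt hR0.le
  set w : R3 → R3 := fun x => v x - (v x ⬝ᵥ e) • e with hw
  set ω : R3 → ℝ := fun x => (curl w x ⬝ᵥ e) / r with hω
  have hev : ∀ x, Trig.ev x (parT e c) = ω x / (Complex.I * r) := fun x => by
    have h1 := hpar.curl_dot_normal hRs x e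
    rw [parT_parCoeffs, ← hrr] at h1
    have h2 : (r : ℂ) ≠ 0 := Complex.ofReal_ne_zero.2 hr0.ne'
    simp only [hω, Complex.ofReal_div]
    rw [h1]
    push_cast
    field_simp
  have hval : ∀ x, ((v x ⬝ᵥ e : ℝ) : ℂ) = q.eval ((ω x : ℂ) / (Complex.I * r)) := fun x => by
    rw [h.dot_normal, hq, ← Polynomial.aeval_algHom_apply, hev, Polynomial.coe_aeval_eq_eval]
  have hlin : ∀ κ : ℂ, star κ = -κ → q = Polynomial.C κ * Polynomial.X →
      ∀ x, (Polynomial.C (κ.im / r) * Polynomial.X : Polynomial ℝ).eval (ω x) = v x ⬝ᵥ e := by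
    intro κ hκ hqκ x
    have h1 := hval x
    have h3 : κ = Complex.I * κ.im := by
      have := congrArg Complex.re hκ
      simp at this
      apply Complex.ext <;> simp
      linarith
    have h2 : (r : ℂ) ≠ 0 := Complex.ofReal_ne_zero.2 hr0.ne'
    rw [hqκ, Polynomial.eval_mul, Polynomial.eval_C, Polynomial.eval_X, h3] at h1
    apply Complex.ofReal_injective
    rw [h1, Polynomial.eval_mul, Polynomial.eval_C, Polynomial.eval_X]
    push_cast
    have hI := Complex.I_ne_zero
    field_simp
  obtain ⟨Q, hQ, hQ1, hQ2⟩ : ∃ Q : Polynomial ℝ, (∀ x, Q.eval (ω x) = v x ⬝ᵥ e) ∧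
      ((∀ n, e ⬝ᵥ n = 0 → Ω * n 2 = 0) → ν ≠ 0 → ∃ κ : ℝ, Q = Polynomial.C κ * Polynomial.X) ∧
      ((¬∀ n, e ⬝ᵥ n = 0 → Ω * n 2 = 0) → Q = Polynomial.X ∨ Q = -Polynomial.X) := by
    by_cases hA : ∀ n, e ⬝ᵥ n = 0 → Ω * n 2 = 0
    · by_cases hν0 : ν = 0
      · obtain ⟨Q, hQ⟩ := exists_real_polynomial
          (q.comp (Polynomial.C (1 / (Complex.I * r)) * Polynomial.X))
        refine ⟨Q, fun x => ?_, fun _ hn => absurd hν0 hn, fun hn => absurd hA hn⟩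
        rw [hQ, Polynomial.eval_comp, Polynomial.eval_mul, Polynomial.eval_C, Polynomial.eval_X,
          one_div_mul_eq_div, ← hval, Complex.ofReal_re]
      · obtain ⟨κ, hκ, hqκ⟩ := hν hA hν0
        exact ⟨_, hlin κ hκ hqκ, fun _ _ => ⟨_, rfl⟩, fun hn => absurd hA hn⟩
    · obtain ⟨κ, hκ, hκ2, hqκ⟩ := hΩ hA
      refine ⟨_, hlin κ hκ hqκ, fun hn => absurd hn hA, fun _ => ?_⟩
      have h1 : κ.im ^ 2 = r ^ 2 := by
        have h3 : κ.re = 0 := by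
          have := congrArg Complex.re hκ
          simp at this
          linarith
        have := congrArg Complex.re hκ2
        rw [pow_two] at this
        simp [h3] at this
        rw [hrr, ← this, pow_two]
      rcases sq_eq_sq_iff_eq_or_eq_neg.1 h1 with h1 | h1
      · left; rw [h1, div_self hr0.ne']; simp
      · right; rw [h1, neg_div, div_self hr0.ne']; simp
  -- The mean `m` is 0, since `Q` is chosen to reproduce the normal component exactly and this
  -- component has no zero mode.
  refine ⟨e, w, fun x => v x ⬝ᵥ e, ⟨he, fun p hp => (hP p).1 hp⟩, fun x => by simp [hw],
    fun x => ?_, parCoeffs e c, r, ω, Q, 0, hpar, hr0, fun n hn => ⟨(hP n).2 (hsupp n hn), ?_⟩, ?_,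
    fun x => ?_, ⟨(perpT e c).coeff, fun x => ?_, ?_⟩, fun x => by rw [hQ, sub_zero], ?_, ?_⟩
  · rw [hP, dotProduct_sub, dotProduct_smul, he, dotProduct_comm]; simp
  · rw [hrr, hRs n hn]
  -- Four distinct points of the support: two independent frequencies and their opposites.
  · have hsub : ({a, -a, b, -b} : Finset R3) ⊆ (parCoeffs e c).support := by
      intro n hn
      rw [hmem]
      simp only [Finset.mem_insert, Finset.mem_singleton] at hn
      rcases hn with rfl | rfl | rfl | rfl
      exacts [ha, hneg _ ha, hb, hneg _ hb]
    refine le_trans (le_of_eq ?_) (Finset.card_le_card hsub)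
    have hne : ∀ n : R3, (parT e c).coeff n ≠ 0 → n ≠ -n := fun n hn h0 => by
      have h1 : n ⬝ᵥ n = -(n ⬝ᵥ n) := by conv_lhs => rw [h0]; rw [neg_dotProduct, ← h0]
      rw [hR n hn] at h1
      linarith
    have h1 : a ≠ b := by rintro rfl; exact hab (det_self _ _)
    have h2 : a ≠ -b := by rintro rfl; rw [det_neg_left, det_self, neg_zero] at hab; exact hab rfl
    have h3 : -a ≠ b := fun h => h2 (by rw [← h, neg_neg])
    have h4 : -a ≠ -b := fun h => h1 (neg_injective h)
    rw [Finset.card_insert_of_notMem (by simp [hne a ha, h1, h2]),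
      Finset.card_insert_of_notMem (by simp [h3, h4]),
      Finset.card_insert_of_notMem (by simpa using hne b hb), Finset.card_singleton]
  · rw [hpar.curl_eq_smul he hsupp hbe x]
    simp only [hω]
    rw [mul_div_cancel₀ _ hr0.ne']
  · simp only [hQ]
    rw [h.dot_normal, Trig.ev_eq_sum x subset_rfl]
  · rw [perpT_coeff, h.meanZero]; simp
  · rw [← coriolis_trivial_iff he hP]; exact hQ1
  · intro h1 h2
    refine hQ2 fun hA => ?_
    rcases (coriolis_trivial_iff he hP).1 hA with h3 | h3
    exacts [h1 h3, h2 h3]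

theorem IsField.typeIII (hs : ∃ a ∈ c.support, ∃ b ∈ c.support, crossProduct a b ≠ 0)
    (hs3 : ∀ e : R3, e ≠ 0 → ∃ x ∈ c.support, x ⬝ᵥ e ≠ 0) {μ : ℝ} (hμ : μ ≠ 0)
    (hel : ∀ n, HelicalAt μ c n) : TypeIII v c := by
  obtain ⟨a, ha, b, hb, hab⟩ := hs
  obtain ⟨x, hx, hxe⟩ := hs3 _ hab
  refine ⟨⟨a, ha, b, hb, x, hx, linearIndependent_triple_of_dot_cross hxe⟩,
    ⟨|μ|, abs_pos.2 hμ, fun n hn => ?_⟩, μ, fun y => ?_⟩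
  · rw [sq_abs, sq_eq_of_helical (h.div' n) (Finsupp.mem_support_iff.1 hn) (hel n)]
  · rw [h.curl_eq, h.expansion, Finset.smul_sum]
    refine Finset.sum_congr rfl fun n _ => ?_
    rw [hel n, smul_comm]

theorem IsField.isAdmissible {ν Ω : ℝ} (hadm : CoeffAdmissible ν Ω c) : IsAdmissible ν Ω v c := by
  rcases hadm with h1 | ⟨⟨a, ha, b, hb, hab⟩, e, he, hpl, hadm⟩ | ⟨hs, hs3, μ, hμ, hel⟩
  · exact Or.inl h1
  · refine Or.inr (Or.inl ⟨⟨a, ha, b, hb, linearIndependent_pair_iff_cross.2 hab⟩, ?_⟩)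
    set P := Submodule.span ℝ (Set.range ![a, b])
    have hfin : Module.finrank ℝ P = 2 := by
      rw [finrank_span_eq_card (linearIndependent_pair_iff_cross.2 hab)]; rfl
    have hP := mem_plane_iff he (hpl a ha) (hpl b hb) hab
      (P := P)
      (Submodule.subset_span (Set.mem_range_self 0)) (Submodule.subset_span (Set.mem_range_self 1)) hfin
    refine ⟨P, hfin, fun n hn => (hP n).2 (hpl n hn), ?_⟩
    rcases hadm with ⟨hβ, hΩ⟩ | ⟨R, hR, hsp, q, hq, hν, hΩ⟩
    · exact Or.inl (h.typeIIa he hP hpl hβ hΩ)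
    · exact Or.inr (h.typeIIb he hP hpl hR hsp hq hν hΩ)
  · exact Or.inr (Or.inr (h.typeIII hs hs3 hμ hel))

end

theorem eq_of_dot_toC {a b : C3} (h : ∀ w : R3, a ⬝ᵥ toC w = b ⬝ᵥ toC w) : a = b := by
  ext i
  have h1 : toC (Pi.single i 1) = Pi.single i 1 := by
    ext j
    by_cases hj : j = i
    · subst hj; simp [toC]
    · simp [toC, hj]
  simpa [h1] using h (Pi.single i 1)

theorem exists_det_ne_zero_of_circle {e : R3} {s : Finset R3} {R : ℝ} (he : e ⬝ᵥ e = 1)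
    (hpl : ∀ n ∈ s, e ⬝ᵥ n = 0) (hR : 0 < R) (hs : ∀ n ∈ s, n ⬝ᵥ n = R) (hcard : 2 < s.card) :
    ∃ a ∈ s, ∃ b ∈ s, det e a b ≠ 0 := by
  classical
  obtain ⟨a, ha⟩ := Finset.card_pos.1 (by omega : 0 < s.card)
  by_contra! hcon
  have hsub : s ⊆ {a, -a} := fun x hx => by
    have h1 := parallel_of_cross_eq_zero (w := a) (z := x) (by
      rw [cross_eq_det_smul he (hpl a ha) (hpl x hx), hcon a ha x hx, zero_smul])
    rw [hs a ha] at h1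
    have h2 : x = ((a ⬝ᵥ x) / R) • a := by
      rw [div_eq_inv_mul, mul_smul, ← h1, smul_smul, inv_mul_cancel₀ hR.ne', one_smul]
    generalize (a ⬝ᵥ x) / R = t at h2
    have h3 := hs x hx
    rw [h2, smul_dotProduct, dotProduct_smul, hs a ha, smul_eq_mul, smul_eq_mul, ← mul_assoc] at h3
    have h4 : t * t = 1 := by
      apply mul_right_cancel₀ hR.ne'
      rw [h3, one_mul]
    rw [Finset.mem_insert, Finset.mem_singleton, h2]
    rcases mul_self_eq_one_iff.1 h4 with rfl | rfl <;> simp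
  have := (Finset.card_le_card hsub).trans Finset.card_le_two
  omega

section
variable {v : R3 → R3} {c : R3 →₀ C3} (h : IsField v c)
include h

theorem IsField.coeff_dot_eq {w : R3 → R3} {b : R3 →₀ C3} (hb : IsField w b) {p : R3}
    (hp : ∀ x, v x ⬝ᵥ p = w x ⬝ᵥ p) (n : R3) : c n ⬝ᵥ toC p = b n ⬝ᵥ toC p := by
  have h1 : Trig.dotT c (fun _ => toC p) = Trig.dotT b fun _ => toC p :=
    Trig.ev_injective fun x => by rw [← h.dot, ← hb.dot, hp]
  exact congrArg (fun f : Trig => f.coeff n) h1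

theorem IsField.coeff_dot_eq_zero {p : R3} (hp : ∀ x, v x ⬝ᵥ p = 0) (n : R3) :
    c n ⬝ᵥ toC p = 0 := by
  have h1 : Trig.dotT c (fun _ => toC p) = 0 :=
    Trig.ev_injective fun x => by rw [← h.dot, hp, map_zero, Complex.ofReal_zero]
  exact congrArg (fun f : Trig => f.coeff n) h1

theorem IsField.curl_coeff {μ : ℂ} (hμ : ∀ x, toC (curl v x) = μ • toC (v x)) (n : R3) :
    Complex.I • crossProduct (toC n) (c n) = μ • c n := by
  refine eq_of_dot_toC fun w => ?_
  have h1 : Trig.dotT c (fun n => Complex.I • toC (crossProduct w n)) =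
      μ • Trig.dotT c fun _ => toC w :=
    Trig.ev_injective fun x => by
      rw [map_smul, ← h.dot, ← h.curl_dot, ← toC_dot, hμ, smul_dotProduct, toC_dot]
  have h2 := congrArg (fun f : Trig => f.coeff n) h1
  have h3 : crossProduct (toC n) (c n) ⬝ᵥ toC w = c n ⬝ᵥ toC (crossProduct w n) := by
    rw [toC_cross, dotProduct_comm, triple_product_permutation, triple_product_permutation]
  rw [smul_dotProduct, smul_dotProduct, h3]
  simpa [Trig.dotT_coeff] using h2

/-- Applying the curl twice to a mode multiplies it by |n|², so μ² is positive and μ is real. -/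
theorem IsField.exists_helical {n : R3} (hn : n ∈ c.support) (hcurl : IsCurlEigenfield v) :
    ∃ μ : ℝ, μ ≠ 0 ∧ ∀ n, HelicalAt μ c n := by
  obtain ⟨μ, hμ⟩ := hcurl
  have hn0 : n ≠ 0 := by
    rintro rfl; exact (Finsupp.mem_support_iff.1 hn) h.meanZero
  have hpos := dot_self_pos hn0
  have hcoeff := h.curl_coeff hμ
  have hsq := sq_eq_of_curl (h.div' n) (Finsupp.mem_support_iff.1 hn) (hcoeff n)
  have h1 := congrArg Complex.re hsq
  have h2 := congrArg Complex.im hsq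
  rw [pow_two] at h1 h2
  simp only [Complex.mul_re, Complex.mul_im, Complex.ofReal_re, Complex.ofReal_im] at h1 h2
  have h3 : μ.re ≠ 0 := by
    intro h3
    rw [h3] at h1
    nlinarith [mul_self_nonneg μ.im]
  have h4 : μ.im = 0 := by
    have : μ.re * μ.im = 0 := by linarith
    exact (mul_eq_zero.1 this).resolve_left h3
  have h5 : μ = (μ.re : ℂ) := by apply Complex.ext <;> simp [h4]
  refine ⟨μ.re, h3, fun m => ?_⟩
  rw [HelicalAt, ← h5]
  exact hcoeff m

theorem IsField.planarAdmissible_of_typeIIa {ν Ω : ℝ} {e : R3} {P : Submodule ℝ R3} (he : e ⬝ᵥ e = 1)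
    (hP : ∀ p, p ∈ P ↔ e ⬝ᵥ p = 0) (ht : TypeIIa Ω P v) :
    PlanarAdmissible ν Ω e (perpT e c) (parT e c) := by
  refine Or.inl ⟨?_, (coriolis_trivial_iff he hP).2 ht.1⟩
  ext n
  rw [parT_coeff, h.coeff_dot_eq_zero (fun x => ht.2 x _ ((hP _).2 (dot_self_cross _ _))), zero_div]
  rfl

/-- Since ω is i r times the stream function, composing `Q` with this scaling and subtracting the
mean gives the polynomial `q`. For linear `Q` the mean must be zero, because neither scalar
component has a zero mode. -/
theorem IsField.planarAdmissible_of_typeIIb {ν Ω : ℝ} {P : Submodule ℝ R3} {a b : R3} (ha : a ∈ P)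
    (hb : b ∈ P) (hab : crossProduct a b ≠ 0) (hfin : Module.finrank ℝ P = 2)
    (hcP : ∀ n ∈ c.support, n ∈ P) (ht : TypeIIb ν Ω P v) :
    ∃ e : R3, e ⬝ᵥ e = 1 ∧ (∀ n ∈ c.support, e ⬝ᵥ n = 0) ∧
      PlanarAdmissible ν Ω e (perpT e c) (parT e c) := by
  obtain ⟨e, w, vperp, ⟨he, heP⟩, hdec, hwP, d, r, ω, Q, m, hd, hr, hdP, hcard, hcurl, -, hQ, hν,
    hΩ⟩ := ht
  have hP := mem_plane_iff he (heP a ha) (heP b hb) hab ha hb hfin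
  refine ⟨e, he, fun n hn => heP n (hcP n hn), ?_⟩
  have hwe : ∀ x, w x ⬝ᵥ e = 0 := fun x => by rw [dotProduct_comm]; exact heP _ (hwP x)
  have hβ : parT e c = parT e d := by
    ext n
    rw [parT_coeff, parT_coeff, h.coeff_dot_eq hd (p := crossProduct e n) fun x => ?_]
    rw [hdec, add_dotProduct, smul_dotProduct, dot_self_cross, smul_zero, add_zero]
  have hde := hd.coeff_dot_eq_zero hwe
  have hmem : ∀ n, n ∈ d.support ↔ (parT e c).coeff n ≠ 0 := fun n => by
    rw [mem_support_iff_perpT_parT he hd.div' (fun n hn => heP n (hdP n hn).1) hd.meanZero, hβ,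
      perpT_coeff, hde n]
    simp
  have hr' : (r : ℂ) ≠ 0 := Complex.ofReal_ne_zero.2 hr.ne'
  have hω : ∀ x, (ω x : ℂ) = Complex.I * r * Trig.ev x (parT e c) := fun x => by
    have h1 := hd.curl_dot_normal (fun n hn => (hdP n hn).2) x e
    rw [hcurl, smul_dotProduct, he, smul_eq_mul, mul_one, ← hβ] at h1
    push_cast at h1
    apply mul_left_cancel₀ hr'
    rw [h1]; ring
  set q : Polynomial ℂ := (Q.map Complex.ofRealHom).comp (Polynomial.C (Complex.I * r) * Polynomial.X) -
    Polynomial.C (m : ℂ) with hq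
  have hα : perpT e c = Polynomial.aeval (parT e c) q := Trig.ev_injective fun x => by
    rw [← h.dot_normal, ← Polynomial.aeval_algHom_apply, Polynomial.coe_aeval_eq_eval, hq,
      Polynomial.eval_sub, Polynomial.eval_comp, Polynomial.eval_mul, Polynomial.eval_C,
      Polynomial.eval_C, Polynomial.eval_X, ← hω, hdec, add_dotProduct, hwe, smul_dotProduct, he, hQ,
      zero_add, smul_eq_mul, mul_one, Complex.ofReal_sub]
    congr 1
    exact (Polynomial.eval_map_apply (f := Complex.ofRealHom) (p := Q) (ω x)).symm
  have hlin : ∀ κ : ℝ, Q = Polynomial.C κ * Polynomial.X →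
      q = Polynomial.C (κ * (Complex.I * r)) * Polynomial.X := by
    intro κ hκ
    have h1 : q = Polynomial.C (κ * (Complex.I * r)) * Polynomial.X - Polynomial.C (m : ℂ) := by
      rw [hq, hκ, Polynomial.map_mul, Polynomial.map_C, Polynomial.map_X, Polynomial.mul_comp,
        Polynomial.C_comp, Polynomial.X_comp, ← mul_assoc, ← Polynomial.C_mul]
      rfl
    -- Comparing zero modes shows m = 0.
    have h2 := congrArg (fun f : Trig => f.coeff 0) hα
    have h3 : (parT e c).coeff 0 = 0 := by rw [parT_coeff, h.meanZero]; simp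
    have h4 : (perpT e c).coeff 0 = 0 := by rw [perpT_coeff, h.meanZero]; simp
    rw [h1, map_sub, map_mul, Polynomial.aeval_C, Polynomial.aeval_C, Polynomial.aeval_X,
      ← Algebra.smul_def, Algebra.algebraMap_eq_smul_one] at h2
    simp [h3, h4, AddMonoidAlgebra.one_def] at h2
    rw [h1, h2]; simp
  obtain ⟨x, hx, y, hy, hxy⟩ := exists_det_ne_zero_of_circle he (fun n hn => heP n (hdP n hn).1)
    (pow_pos hr 2) (fun n hn => (hdP n hn).2) (by omega)
  refine Or.inr ⟨r ^ 2, fun n hn => (hdP n ((hmem n).2 hn)).2, ⟨x, y, (hmem x).1 hx, (hmem y).1 hy, hxy⟩,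
    q, hα, fun hA hν0 => ?_, fun hA => ?_⟩
  · obtain ⟨κ, hκ⟩ := hν ((coriolis_trivial_iff he hP).1 hA) hν0
    exact ⟨_, by simp, hlin κ hκ⟩
  · have hcond : ¬(Ω = 0 ∨ P = horizontalPlane) := fun h => hA ((coriolis_trivial_iff he hP).2 h)
    push Not at hcond
    have hI : (Complex.I * r) ^ 2 = -(r ^ 2 : ℝ) := by
      rw [mul_pow, Complex.I_sq]; push_cast; ring
    rcases hΩ hcond.1 hcond.2 with h1 | h1
    · exact ⟨_, by simp, by rw [mul_pow, hI]; simp, hlin 1 (by rw [h1]; simp)⟩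
    · exact ⟨_, by simp, by rw [mul_pow, hI]; simp, hlin (-1) (by rw [h1]; simp)⟩

theorem IsField.coeffAdmissible {ν Ω : ℝ} (hadm : IsAdmissible ν Ω v c) : CoeffAdmissible ν Ω c := by
  rcases hadm with h1 | ⟨⟨a, ha, b, hb, hab⟩, P, hfin, hcP, hadm⟩ |
    ⟨⟨a, ha, b, hb, d, hd, hli⟩, -, hcurl⟩
  · exact Or.inl h1
  · rw [linearIndependent_pair_iff_cross] at hab
    refine Or.inr (Or.inl ⟨⟨a, ha, b, hb, hab⟩, ?_⟩)
    rcases hadm with hadm | hadm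
    · obtain ⟨e, he, hea, heb, -⟩ := exists_unit_normal hab
      have hP := mem_plane_iff he hea heb hab (hcP a ha) (hcP b hb) hfin
      exact ⟨e, he, fun n hn => (hP n).1 (hcP n hn), h.planarAdmissible_of_typeIIa he hP hadm⟩
    · exact h.planarAdmissible_of_typeIIb (hcP a ha) (hcP b hb) hab hfin hcP hadm
  · obtain ⟨hab, hsp⟩ := dot_cross_ne_zero_of_linearIndependent hli
    refine Or.inr (Or.inr ⟨⟨a, ha, b, hb, hab⟩, fun e he => ?_, h.exists_helical ha hcurl⟩)
    rcases hsp e he with h1 | h1 | h1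
    exacts [⟨a, ha, h1⟩, ⟨b, hb, h1⟩, ⟨d, hd, h1⟩]

end

end FiniteMode
end

/-! ### The characterization of finite-mode solutions -/

theorem theorem5p1 (ν Ω : ℝ) (I : Set ℝ) (hIo : IsOpen I) (hIc : I.OrdConnected)
    (hIn : I.Nonempty)
    (u : ℝ → FiniteMode.R3 → FiniteMode.R3) (S : Finset FiniteMode.R3)
    (c : ℝ → FiniteMode.R3 →₀ FiniteMode.C3) (hu : FiniteMode.IsFieldOn I u S c) :
    (FiniteMode.Solves ν Ω I S c ↔
      FiniteMode.EvolvesLinearly ν Ω I S c ∧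
        ∃ t ∈ I, FiniteMode.IsAdmissible ν Ω (u t) (c t)) ∧
    (FiniteMode.Solves ν Ω I S c ↔
      FiniteMode.EvolvesLinearly ν Ω I S c ∧
        ∀ t ∈ I, FiniteMode.IsAdmissible ν Ω (u t) (c t)) := by
  have hforward : FiniteMode.Solves ν Ω I S c → FiniteMode.EvolvesLinearly ν Ω I S c ∧
      ∀ t ∈ I, FiniteMode.IsAdmissible ν Ω (u t) (c t) := fun h => by
    have hlin := h.evolvesLinearly hIo hu
    obtain ⟨t₀, ht₀, h₀⟩ := h.exists_coeffAdmissible hIo hu hIo subset_rfl hIn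
    exact ⟨hlin, fun t ht => (hu.field t ht).isAdmissible
      (hlin.coeffAdmissible hIo hIc hu ht₀ ht h₀)⟩
  have hback : FiniteMode.EvolvesLinearly ν Ω I S c →
      (∃ t ∈ I, FiniteMode.IsAdmissible ν Ω (u t) (c t)) → FiniteMode.Solves ν Ω I S c := by
    rintro hlin ⟨t₀, ht₀, h₀⟩
    exact hlin.solves hIo hu fun t ht =>
      hlin.coeffAdmissible hIo hIc hu ht₀ ht ((hu.field t₀ ht₀).coeffAdmissible h₀)
  obtain ⟨t₀, ht₀⟩ := hIn
  exact ⟨⟨fun h => ⟨(hforward h).1, t₀, ht₀, (hforward h).2 t₀ ht₀⟩, fun h => hback h.1 h.2⟩,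
    ⟨hforward, fun h => hback h.1 ⟨t₀, ht₀, h.2 t₀ ht₀⟩⟩⟩
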